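/- **Model.** Let $r\ge 1$ be an integer. For $\theta=(d_1,a_1,b_1,d_2,a_2,b_2)\in(0,\infty)^6$ a sequence of counts $(Y_t)_{t\in\mathbb Z}$ follows the self-excited threshold Poisson autoregression with threshold $r$ and parameter $\theta$ if the conditional law of $Y_t$ given $\mathcal F_{t-1}=\sigma(Y_s,\ s\le t-1)$ is Poisson$(\lambda_t)$, where $$\lambda_t=\begin{cases}d_1+a_1\lambda_{t-1}+b_1Y_{t-1},& Y_{t-1}\le r,\\ d_2+a_2\lambda_{t-1}+b_2Y_{t-1},& Y_{t-1}>r.\end{cases}$$ Write $d_t,a_t,b_t$ for $d_i,a_i,b_i$ with $i=1$ if $Y_t\le r$ and $i=2$ if $Y_t>r$, and let $$\lambda_t(\theta)=\sum_{k\ge1}\Big(\prod_{j=1}^{k-1}a_{t-j}\Big)\big(d_{t-k}+b_{t-k}Y_{t-k}\big)$$ be the stationary solution of the recursion, given $(Y_t)$ and $\theta$. **Estimator.** Let $\mathbf\Theta=\{\theta\in(0,\infty)^6:\ a_1<1,\ b_1<1,\ a_2+b_2<1\}$ and let $\mathcal D\subset\mathbf\Theta$ be compact. Fix an initial value $\tilde\lambda_1>0$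 and let $\tilde\lambda_t=\tilde\lambda_t(\theta)$, $t\ge2$, be computed from $\tilde\lambda_1$ and the observations $Y_1,\dots,Y_n$ by the recursion with parameter $\theta$. Let $\hat\theta=\hat\theta_n$ be a maximum likelihood estimator with known threshold $r$, that is, a measurable maximizer over $\theta\in\mathcal D$ of $$\tilde\ell(\theta)=\sum_{t=1}^n\big(-\tilde\lambda_t(\theta)+Y_t\log\tilde\lambda_t(\theta)\big).$$ **Theorem.** Assume that $Y_1,\dots,Y_n$ are generated from the model with threshold $r$ and true parameter $\theta_0$ in the interior of $\mathcal D$. Let $$G=E\Big[\frac1{\lambda_t(\theta_0)}\Big(\frac{\partial\lambda_t(\theta_0)}{\partial\theta}\Big)\Big(\frac{\partial\lambda_t(\theta_0)}{\partial\theta}\Big)^{\mathsf T}\Big],$$ where the expectation is taken under the stationary law of the model with parameter $\theta_0$. Then the series for $\lambda_t(\theta)$ converges for all $\theta\in\mathbf\Theta$ and is differentiable in $\theta$ at $\theta_0$, almost surely under the stationary law; $G$ is finite and positive definite; and $$\sqrt n\,(\hat\theta_n-\theta_0)\xrightarrow{d}N(0,G^{-1}).$$ Furthermore $G$ is estimated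 consistently (in probability, entrywise) by $$\widehat G=\frac1n\sum_{t=1}^n\frac1{\tilde\lambda_t}\Big(\frac{\partial\tilde\lambda_t}{\partial\theta}\Big)\Big(\frac{\partial\tilde\lambda_t}{\partial\theta}\Big)^{\mathsf T},$$ evaluated at $\theta=\hat\theta_n$, and also when it is evaluated at $\theta=\theta_0$. -/

import Mathlib

open MeasureTheory ProbabilityTheory Filter Topology
open scoped NNReal

noncomputable section

namespace SETPAR

/-- Parameter vectors `θ = (d₁, a₁, b₁, d₂, a₂, b₂)`, with coordinates numbered `0, …, 5`. -/
abbrev Param : Type := EuclideanSpace ℝ (Fin 6)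

/-- The parameter space `Θ`: all six coordinates positive, `a₁ < 1`, `b₁ < 1`, `a₂ + b₂ < 1`. -/
def paramSpace : Set Param :=
  {θ | (∀ i, 0 < θ i) ∧ θ 1 < 1 ∧ θ 2 < 1 ∧ θ 4 + θ 5 < 1}

/-- The intercept `d` of the regime selected by the last count `y`
(lower regime if `y ≤ r`, upper regime if `y > r`). -/
def dCoef (r : ℕ) (θ : Param) (y : ℕ) : ℝ := if y ≤ r then θ 0 else θ 3

/-- The coefficient `a` of the last intensity, in the regime selected by the last count `y`. -/
def aCoef (r : ℕ) (θ : Param) (y : ℕ) : ℝ := if y ≤ r then θ 1 else θ 4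

/-- The coefficient `b` of the last count, in the regime selected by the last count `y`. -/
def bCoef (r : ℕ) (θ : Param) (y : ℕ) : ℝ := if y ≤ r then θ 2 else θ 5

/-- The next intensity, given the last count `y` and the last intensity `l`. -/
def nextIntensity (r : ℕ) (θ : Param) (y : ℕ) (l : ℝ) : ℝ :=
  dCoef r θ y + aCoef r θ y * l + bCoef r θ y * y

/-- The σ-algebra `ℱ_t` generated by the counts `Y_s`, `s ≤ t`. -/
abbrev past {Ω : Type*} (Y : ℤ → Ω → ℕ) (t : ℤ) : MeasurableSpace Ω :=
  ⨆ s : ℤ, ⨆ _ : s ≤ t, MeasurableSpace.comap (Y s) ⊤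

/-- `Y` follows the self-excited threshold Poisson autoregression with threshold `r`, parameter `θ`
and intensity process `lam`: the conditional law of `Y_t` given `ℱ_{t-1}` is Poisson with mean
`lam t`, and `lam` satisfies the two-regime recursion. (By the first property for `k = 0`, `lam t` is
almost surely equal to an `ℱ_{t-1}`-measurable variable.) Stationarity is not part of the
definition. -/
structure IsSETPAR {Ω : Type*} [MeasurableSpace Ω] (P : Measure Ω) (r : ℕ) (θ : Param)
    (Y : ℤ → Ω → ℕ) (lam : ℤ → Ω → ℝ≥0) : Prop where
  measurable : ∀ t, Measurable (Y t)
  condLaw : ∀ (t : ℤ) (k : ℕ),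
    P[(Y t ⁻¹' {k}).indicator (fun _ => (1 : ℝ)) | past Y (t - 1)]
      =ᵐ[P] fun ω => (poissonMeasure (lam t ω)).real {k}
  recursion : ∀ t : ℤ, ∀ᵐ ω ∂P,
    (lam t ω : ℝ) = nextIntensity r θ (Y (t - 1) ω) (lam (t - 1) ω)

/-- `π`, a probability measure on the space of two-sided count paths, is a stationary law of the
model: it is shift invariant, and under `π` the coordinate process follows the model. -/
structure IsStationaryLaw (r : ℕ) (θ : Param) (π : Measure (ℤ → ℕ)) : Prop where
  isProbabilityMeasure : IsProbabilityMeasure π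
  shiftInvariant : MeasurePreserving (fun (y : ℤ → ℕ) (t : ℤ) => y (t + 1)) π π
  model : ∃ lam : ℤ → (ℤ → ℕ) → ℝ≥0, IsSETPAR π r θ (fun t y => y t) lam

/-- The `k`-th summand (`k = 0, 1, …`) of the stationary solution `λ_t(θ)` of the recursion driven
by the path `y`: `(∏_{j=1}^{k} a_{t-j}) (d_{t-k-1} + b_{t-k-1} y_{t-k-1})`. -/
def statTerm (r : ℕ) (θ : Param) (y : ℤ → ℕ) (t : ℤ) (k : ℕ) : ℝ :=
  (∏ j ∈ Finset.range k, aCoef r θ (y (t - 1 - j))) *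
    (dCoef r θ (y (t - 1 - k)) + bCoef r θ (y (t - 1 - k)) * y (t - 1 - k))

/-- The stationary solution `λ_t(θ)` of the recursion driven by the path `y`. -/
def statIntensity (r : ℕ) (θ : Param) (y : ℤ → ℕ) (t : ℤ) : ℝ :=
  ∑' k : ℕ, statTerm r θ y t k

/-- The vector of partial derivatives `∂f/∂θ` at `θ`. -/
def partials (f : Param → ℝ) (θ : Param) : Fin 6 → ℝ :=
  fun i => fderiv ℝ f θ (EuclideanSpace.single i 1)

/-- The matrix `λ_t⁻¹ (∂λ_t/∂θ) (∂λ_t/∂θ)ᵀ` at `θ`, for the stationary solution along `y`. -/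
def infoMatrix (r : ℕ) (θ : Param) (y : ℤ → ℕ) (t : ℤ) : Matrix (Fin 6) (Fin 6) ℝ :=
  (statIntensity r θ y t)⁻¹ •
    Matrix.vecMulVec (partials (fun ϑ => statIntensity r ϑ y t) θ)
      (partials (fun ϑ => statIntensity r ϑ y t) θ)

/-- `G = E[λ_t⁻¹ (∂λ_t/∂θ) (∂λ_t/∂θ)ᵀ]` (entrywise), the expectation being that of the stationary
law `π`. -/
def fisherMatrix (π : Measure (ℤ → ℕ)) (r : ℕ) (θ : Param) (t : ℤ) :
    Matrix (Fin 6) (Fin 6) ℝ :=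
  Matrix.of fun i j => ∫ y, infoMatrix r θ y t i j ∂π

/-- The observable intensities, computed by the recursion from the data `y_1, y_2, …` and the fixed
initial value `x`: `approxIntensity r x θ y k` is `λ̃_{k+1}`, so `λ̃_1 = x`, and `λ̃_{k+2}` is
obtained from `y_{k+1}` and `λ̃_{k+1}`. -/
def approxIntensity (r : ℕ) (x : ℝ) (θ : Param) (y : ℤ → ℕ) : ℕ → ℝ
  | 0 => x
  | k + 1 => nextIntensity r θ (y ((k : ℤ) + 1)) (approxIntensity r x θ y k)

/-- The log-likelihood (up to an additive constant) of the data `y_1, …, y_n`: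
`∑_{t=1}^n (-λ̃_t + y_t log λ̃_t)`, where `t = k + 1`. -/
def logLik (r : ℕ) (x : ℝ) (y : ℤ → ℕ) (n : ℕ) (θ : Param) : ℝ :=
  ∑ k ∈ Finset.range n,
    (-approxIntensity r x θ y k + (y ((k : ℤ) + 1) : ℝ) * Real.log (approxIntensity r x θ y k))

/-- The empirical matrix `Ĝ = n⁻¹ ∑_{t=1}^n λ̃_t⁻¹ (∂λ̃_t/∂θ) (∂λ̃_t/∂θ)ᵀ` at `θ`. -/
def empiricalMatrix (r : ℕ) (x : ℝ) (y : ℤ → ℕ) (n : ℕ) (θ : Param) :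
    Matrix (Fin 6) (Fin 6) ℝ :=
  (n : ℝ)⁻¹ • ∑ k ∈ Finset.range n,
    (approxIntensity r x θ y k)⁻¹ •
      Matrix.vecMulVec (partials (fun ϑ => approxIntensity r x ϑ y k) θ)
        (partials (fun ϑ => approxIntensity r x ϑ y k) θ)

end SETPAR

end

/-! ### Poisson integrals -/

/-! Once the parameter is fixed at the truth, three quantities evolve together under the counts: the
true intensity, the intensity computed from the observations, and the derivative of the latter in
the parameter. They form a Markov chain driven by Poisson draws. For a given count all states are in
the same regime, so the discontinuity at the threshold is invisible, and after rescaling the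
derivative the update is a contraction of the state (`lipschitzWith_stateStep`). An exponential
moment of the intensity is a Lyapunov function: in the lower regime the count is at most `r`, in the
upper regime `a₂ + b₂ < 1` (`exists_drift`).

The counts being discrete, the laws of the chain from two starting points may be mutually singular,
so minorization is replaced by a weak form of Harris' theorem (`exists_contraction`). Two
independent copies started in a bounded region draw only zeros for a while with positive
probability, and the contraction then brings them close. The iterates of the transition operator on
a Lipschitz function are Lipschitz uniformly in time, so closeness of the states suffices.
Forgetting of the starting point makes correlations decay, hence laws of large numbers, extended
from bounded Lipschitz functions to polynomial growth by cutoffs and moments.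

The observed process is not assumed stationary, and its initial intensity need not have any moment.
The argument therefore runs conditionally on the event that the initial intensity is at most `K`.
This event lies in the past of the sample, so the conditional Poisson laws survive
(`exists_boundedSample`). The limits do not depend on `K`, which finally tends to infinity.

The recursion is bilinear in the parameter and the intensity. Increments of the observable intensity
in the parameter thus expand to third order with errors controlled by exponential smoothings of the
counts, which have all moments. This gives a quadratic expansion of the likelihood
(`UniformBounds.abs_pathLik_sub_le`). The score is a martingale up to a geometrically small error,
and its central limit theorem comes from an explicit exponential martingale
(`PoissonCounts.tendsto_integral_exp`).

Consistency follows from a basic inequality (`UniformBounds.norm_sq_le_of_pathLik_le`). A parameter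
at least as likely as the truth has a Poisson divergence from it bounded by a martingale average,
which vanishes uniformly over the compact set. The divergence controls the squared differences of
intensities, hence of regressors, hence of parameters. Normality follows by comparing the likelihood
at the estimator with that at the maximizer of the quadratic approximation
(`norm_sq_le_of_quadratic_expansion`), without the score equation.

On the stationary side, shift invariance forces the intensity to be the convergent series
(`IsStationaryLaw.ae_rate_eq`). Stationary expectations are the ergodic limits of the chain, which
provides the moments that the definition of a stationary law does not include. Degeneracy of `G`
would give a linear relation between the regressors for every value of the count. Two counts in each
regime, and an intensity that is not constant, exclude it. -/

lemma poissonMeasure_singleton_zero (a : ℝ≥0) :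
    poissonMeasure a {0} = ENNReal.ofReal (Real.exp (-a)) := by
  simp [poissonMeasure_singleton]

lemma integrable_poissonMeasure_of_bounded {a : ℝ≥0} {u : ℕ → ℝ} {B : ℝ} (hu : ∀ k, |u k| ≤ B) :
    Integrable u (poissonMeasure a) :=
  Integrable.of_bound (by fun_prop) B (.of_forall fun k => by simpa using hu k)

lemma abs_integral_poissonMeasure_le {a : ℝ≥0} {u : ℕ → ℝ} {B : ℝ} (hu : ∀ k, |u k| ≤ B) :
    |∫ k, u k ∂poissonMeasure a| ≤ B := by
  have := norm_integral_le_of_norm_le_const (μ := poissonMeasure a) (f := u) (C := B)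
    (.of_forall fun k => by simpa using hu k)
  simpa using this

/-- Coupling by infinite divisibility: a count with mean `b` is a count with mean `a` plus an
independent one with mean `b - a`. The latter is nonzero with probability at most `b - a`, and only
then does `u` change, by at most `2 * B`. -/
lemma abs_integral_poissonMeasure_sub_le_of_le {a b : ℝ≥0} (hab : a ≤ b) {u : ℕ → ℝ} {B : ℝ}
    (hu : ∀ k, |u k| ≤ B) :
    |∫ k, u k ∂poissonMeasure b - ∫ k, u k ∂poissonMeasure a| ≤ 2 * B * (b - a) := by
  have hB : 0 ≤ B := (abs_nonneg _).trans (hu 0)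
  obtain ⟨c, rfl⟩ := exists_add_of_le hab
  have hbd : ∀ i, ∫ j, u (i + j) ∂poissonMeasure c - u i
      = ∫ j, (u (i + j) - u i) ∂poissonMeasure c := by
    intro i
    rw [integral_sub (integrable_poissonMeasure_of_bounded fun k => hu _) (integrable_const _)]
    simp
  have h1 : ∀ i, |∫ j, u (i + j) ∂poissonMeasure c - u i| ≤ 2 * B * c := by
    intro i
    rw [hbd]
    have h2 : |∫ j, (u (i + j) - u i) ∂poissonMeasure c|
        ≤ ∫ j, 2 * B * (({0}ᶜ : Set ℕ).indicator 1 j) ∂poissonMeasure c := by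
      rw [← Real.norm_eq_abs]
      refine norm_integral_le_of_norm_le ?_ (.of_forall fun j => ?_)
      · exact (integrable_poissonMeasure_of_bounded (B := 1) (fun k => by
          by_cases hk : k = 0 <;> simp [hk])).const_mul _
      · by_cases hj : j = 0
        · simp [hj]
        · simp only [Set.mem_compl_iff, Set.mem_singleton_iff, hj, not_false_eq_true,
            Set.indicator_of_mem, Pi.one_apply, mul_one, Real.norm_eq_abs]
          have := abs_sub (u (i + j)) (u i)
          linarith [hu (i + j), hu i]
    refine h2.trans ?_
    rw [integral_const_mul, integral_indicator_one (by measurability),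
      probReal_compl_eq_one_sub (by measurability), measureReal_def, poissonMeasure_singleton_zero,
      ENNReal.toReal_ofReal (Real.exp_pos _).le]
    gcongr
    linarith [Real.add_one_le_exp (-(c : ℝ))]
  have h3 : ∫ k, u k ∂poissonMeasure (a + c)
      = ∫ i, ∫ j, u (i + j) ∂poissonMeasure c ∂poissonMeasure a := by
    rw [← poissonMeasure_conv_poissonMeasure, integral_conv]
    exact Integrable.of_bound (by fun_prop) B (.of_forall fun k => by simpa using hu k)
  rw [h3, ← integral_sub]
  · push_cast
    simpa using abs_integral_poissonMeasure_le h1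
  · exact integrable_poissonMeasure_of_bounded fun i => abs_integral_poissonMeasure_le fun j => hu _
  · exact integrable_poissonMeasure_of_bounded hu

/-- Poisson integrals of bounded functions are Lipschitz in the rate. -/
lemma abs_integral_poissonMeasure_sub_le {a b : ℝ≥0} {u w : ℕ → ℝ} {B ε : ℝ}
    (hu : ∀ k, |u k| ≤ B) (hw : ∀ k, |w k| ≤ B) (huw : ∀ k, |u k - w k| ≤ ε) :
    |∫ k, u k ∂poissonMeasure a - ∫ k, w k ∂poissonMeasure b| ≤ ε + 2 * B * dist a b := by
  have h1 : |∫ k, u k ∂poissonMeasure a - ∫ k, w k ∂poissonMeasure a| ≤ ε := by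
    rw [← integral_sub (integrable_poissonMeasure_of_bounded hu)
      (integrable_poissonMeasure_of_bounded hw)]
    exact abs_integral_poissonMeasure_le huw
  have h2 : |∫ k, w k ∂poissonMeasure a - ∫ k, w k ∂poissonMeasure b| ≤ 2 * B * dist a b := by
    rw [NNReal.dist_eq]
    rcases le_total a b with h | h
    · have := abs_integral_poissonMeasure_sub_le_of_le h hw
      rw [abs_sub_comm] at this
      rwa [abs_sub_comm (a : ℝ), abs_of_nonneg (a := (b : ℝ) - a) (sub_nonneg.2 (by exact_mod_cast h))]
    · have := abs_integral_poissonMeasure_sub_le_of_le h hw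
      rwa [abs_of_nonneg (a := (a : ℝ) - b) (sub_nonneg.2 (by exact_mod_cast h))]
  calc _ ≤ _ := abs_sub_le _ (∫ k, w k ∂poissonMeasure a) _
    _ ≤ _ := add_le_add h1 h2

/-! ### Contractive chains driven by Poisson counts -/

/-- A chain on `S` driven by Poisson counts: in the state `s`, a count with mean `rate s` is drawn,
and the state is updated by the contraction `step` of that count. The function `V` is a Lyapunov
function. -/
structure PoissonChain (S : Type*) [NormedAddCommGroup S] where
  step : ℕ → S → S
  rate : S → ℝ≥0
  ρ : ℝ≥0
  ρ_lt_one : ρ < 1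
  lipschitz_step : ∀ k, LipschitzWith ρ (step k)
  lipschitz_rate : LipschitzWith 1 rate
  V : S → ℝ≥0
  continuous_V : Continuous V
  γ : ℝ≥0
  γ_lt_one : γ < 1
  C : ℝ≥0
  drift : ∀ s, ∫⁻ k, V (step k s) ∂poissonMeasure (rate s) ≤ γ * V s + C
  norm_le_V : ∀ s, ‖s‖₊ ≤ V s

namespace PoissonChain

variable {S : Type*} [NormedAddCommGroup S] (c : PoissonChain S)

/-- The transition operator. -/
noncomputable def op (f : S → ℝ) (s : S) : ℝ := ∫ k, f (c.step k s) ∂poissonMeasure (c.rate s)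

/-- The transition operator of two independent copies of the chain. -/
noncomputable def pairOp (F : S → S → ENNReal) (x y : S) : ENNReal :=
  ∫⁻ p, F (c.step p.1 x) (c.step p.2 y) ∂((poissonMeasure (c.rate x)).prod
    (poissonMeasure (c.rate y)))

lemma abs_op_le {f : S → ℝ} {B : ℝ} (hf : ∀ s, |f s| ≤ B) (s : S) : |c.op f s| ≤ B :=
  abs_integral_poissonMeasure_le fun _ => hf _

lemma abs_op_iterate_le {f : S → ℝ} {B : ℝ} (hf : ∀ s, |f s| ≤ B) (n : ℕ) (s : S) :
    |c.op^[n] f s| ≤ B := by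
  induction n generalizing s with
  | zero => exact hf s
  | succ n ih => rw [Function.iterate_succ_apply']; exact c.abs_op_le ih s

/-- The contraction of the step damps the old constant by `ρ`, while the dependence of the rate on
the state costs `2 * B`. -/
lemma lipschitzWith_op {f : S → ℝ} {B L : ℝ≥0} (hf : ∀ s, |f s| ≤ B) (hL : LipschitzWith L f) :
    LipschitzWith (c.ρ * L + 2 * B) (c.op f) := by
  refine LipschitzWith.of_dist_le_mul fun x y => ?_
  have h : ∀ k, |f (c.step k x) - f (c.step k y)| ≤ L * (c.ρ * dist x y) := fun k => by
    rw [← Real.dist_eq]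
    exact (hL.dist_le_mul _ _).trans (by gcongr; exact (c.lipschitz_step k).dist_le_mul _ _)
  have h2 := abs_integral_poissonMeasure_sub_le (a := c.rate x) (b := c.rate y)
    (fun k => hf (c.step k x)) (fun k => hf (c.step k y)) h
  rw [Real.dist_eq]
  refine h2.trans ?_
  have h3 := c.lipschitz_rate.dist_le_mul x y
  simp only [NNReal.coe_one, one_mul] at h3
  have : 2 * (B : ℝ) * dist (c.rate x) (c.rate y) ≤ 2 * B * dist x y := by gcongr
  push_cast
  linarith

/-- Equicontinuity of the iterates. It takes the place of a strong Feller property: two copies need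
only come close, not meet. -/
lemma lipschitzWith_op_iterate {f : S → ℝ} {B L : ℝ≥0} (hf : ∀ s, |f s| ≤ B)
    (hL : LipschitzWith L f) : ∃ L' : ℝ≥0, ∀ n, LipschitzWith L' (c.op^[n] f) := by
  -- The map `L ↦ ρ L + 2 B` has the fixed point `2 B / (1 - ρ)`, so no constant above it increases.
  refine ⟨max L (2 * B / (1 - c.ρ)), fun n => ?_⟩
  induction n with
  | zero => exact hL.weaken (le_max_left _ _)
  | succ n ih =>
    rw [Function.iterate_succ_apply']
    refine (c.lipschitzWith_op (c.abs_op_iterate_le hf n) ih).weaken ?_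
    set M := max L (2 * B / (1 - c.ρ)) with hM
    have h1 : (0 : ℝ) < 1 - c.ρ := by have := c.ρ_lt_one; rw [sub_pos]; exact_mod_cast this
    have h2 : (2 * B / (1 - c.ρ) : ℝ) ≤ M := by
      have : (2 * B / (1 - c.ρ) : ℝ≥0) ≤ M := le_max_right _ _
      have h := NNReal.coe_le_coe.2 this
      rwa [NNReal.coe_div, NNReal.coe_sub c.ρ_lt_one.le] at h
    rw [div_le_iff₀ h1] at h2
    rw [← NNReal.coe_le_coe]
    push_cast
    linarith

lemma pairOp_mono {F G : S → S → ENNReal} (h : ∀ x y, F x y ≤ G x y) (x y : S) :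
    c.pairOp F x y ≤ c.pairOp G x y := lintegral_mono fun _ => h _ _

/-- Independent coupling: the difference of the two expectations is one expectation over the product
measure. -/
lemma edist_op_le {f : S → ℝ} {B : ℝ} (hf : ∀ s, |f s| ≤ B) (x y : S) :
    edist (c.op f x) (c.op f y) ≤ c.pairOp (fun x y => edist (f x) (f y)) x y := by
  have h : c.op f x - c.op f y = ∫ p : ℕ × ℕ, (f (c.step p.1 x) - f (c.step p.2 y))
      ∂((poissonMeasure (c.rate x)).prod (poissonMeasure (c.rate y))) := by
    have i1 : Integrable (fun p : ℕ × ℕ => f (c.step p.1 x))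
        ((poissonMeasure (c.rate x)).prod (poissonMeasure (c.rate y))) :=
      Integrable.of_bound Measurable.of_discrete.aestronglyMeasurable B (.of_forall fun k => by simpa using hf _)
    have i2 : Integrable (fun p : ℕ × ℕ => f (c.step p.2 y))
        ((poissonMeasure (c.rate x)).prod (poissonMeasure (c.rate y))) :=
      Integrable.of_bound Measurable.of_discrete.aestronglyMeasurable B (.of_forall fun k => by simpa using hf _)
    rw [integral_sub i1 i2, integral_prod _ i1, integral_prod _ i2]
    simp [op]
  rw [edist_eq_enorm_sub, h]
  refine (enorm_integral_le_lintegral_enorm _).trans (le_of_eq ?_)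
  simp [pairOp, edist_eq_enorm_sub]

lemma edist_op_iterate_le {f : S → ℝ} {B : ℝ} (hf : ∀ s, |f s| ≤ B) (n m : ℕ) (x y : S) :
    edist (c.op^[m + n] f x) (c.op^[m + n] f y)
      ≤ c.pairOp^[m] (fun x y => edist (c.op^[n] f x) (c.op^[n] f y)) x y := by
  induction m generalizing x y with
  | zero => simp
  | succ m ih =>
    rw [Nat.succ_add_eq_add_succ, Nat.add_succ, Function.iterate_succ_apply',
      Function.iterate_succ_apply']
    exact (c.edist_op_le (c.abs_op_iterate_le hf _) x y).trans (c.pairOp_mono ih x y)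

lemma pairOp_V_le (b : ℝ≥0) (x y : S) :
    c.pairOp (fun x y => b * (c.V x + c.V y)) x y ≤ b * (c.γ * (c.V x + c.V y) + 2 * c.C) := by
  unfold pairOp
  rw [lintegral_const_mul _ .of_discrete, lintegral_prod _ Measurable.of_discrete.aemeasurable]
  gcongr
  calc _ = ∫⁻ j, (c.V (c.step j x) : ENNReal) + ∫⁻ k, c.V (c.step k y) ∂poissonMeasure (c.rate y)
        ∂poissonMeasure (c.rate x) := by
        refine lintegral_congr fun j => ?_
        rw [lintegral_add_left .of_discrete]; simp
    _ = ∫⁻ j, (c.V (c.step j x) : ENNReal) ∂poissonMeasure (c.rate x)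
        + ∫⁻ k, c.V (c.step k y) ∂poissonMeasure (c.rate y) := by
        rw [lintegral_add_left .of_discrete]; simp
    _ ≤ (c.γ * c.V x + c.C) + (c.γ * c.V y + c.C) := add_le_add (c.drift x) (c.drift y)
    _ = _ := by ring

/-- The accumulated constant in the drift of two independent copies. -/
noncomputable def driftConst : ℝ≥0 := 2 * c.C / (1 - c.γ)

lemma driftConst_eq : c.γ * c.driftConst + 2 * c.C = c.driftConst := by
  have h1 : (0 : ℝ) < 1 - c.γ := by have := c.γ_lt_one; rw [sub_pos]; exact_mod_cast this
  rw [driftConst, ← NNReal.coe_inj]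
  push_cast [NNReal.coe_sub c.γ_lt_one.le]
  field_simp
  ring

/-- At least one step is taken, so the factor of `V` is `γ` and not `1`. This strict decrease is
what handles states with large `V` in `exists_contraction`. -/
lemma pairOp_iterate_V_le (b : ℝ≥0) (m : ℕ) (x y : S) :
    c.pairOp^[m + 1] (fun x y => b * (c.V x + c.V y)) x y
      ≤ b * (c.γ * (c.V x + c.V y) + c.driftConst) := by
  have key : ∀ (b d : ℝ≥0) (x y : S),
      c.pairOp (fun x y => b * (c.V x + c.V y) + d) x y
        ≤ b * (c.γ * (c.V x + c.V y) + 2 * c.C) + d := by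
    intro b d x y
    refine le_trans (le_of_eq ?_) (add_le_add_left (c.pairOp_V_le b x y) _)
    simp [pairOp, lintegral_add_right]
  have aux : ∀ (m : ℕ) (x y : S), c.pairOp^[m] (fun x y => b * (c.V x + c.V y)) x y
      ≤ ((b * c.γ ^ m : ℝ≥0) : ENNReal) * (c.V x + c.V y)
        + ((b * 2 * c.C * ∑ i ∈ Finset.range m, c.γ ^ i : ℝ≥0) : ENNReal) := by
    intro m
    induction m with
    | zero => intro x y; simp
    | succ m ih =>
      intro x y
      rw [Function.iterate_succ_apply']
      refine (c.pairOp_mono ih x y).trans ((key _ _ x y).trans (le_of_eq ?_))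
      rw [Finset.sum_range_succ]
      push_cast
      ring
  refine (aux _ _ _).trans ?_
  have h2 : 2 * c.C * ∑ i ∈ Finset.range (m + 1), c.γ ^ i ≤ c.driftConst := by
    have h1 : (0 : ℝ) < 1 - c.γ := by have := c.γ_lt_one; rw [sub_pos]; exact_mod_cast this
    rw [driftConst, ← NNReal.coe_le_coe]
    push_cast [NNReal.coe_sub c.γ_lt_one.le]
    rw [le_div_iff₀ h1, mul_assoc, mul_comm (Finset.sum _ _), mul_neg_geom_sum]
    have : (0 : ℝ) ≤ c.γ ^ (m + 1) := by positivity
    nlinarith [c.C.2, mul_nonneg c.C.2 this]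
  have h3 : c.γ ^ (m + 1) ≤ c.γ := by
    rw [pow_succ]; exact mul_le_of_le_one_left' (pow_le_one' c.γ_lt_one.le m)
  have e : (b : ENNReal) * (c.γ * (c.V x + c.V y) + c.driftConst)
      = ((b * c.γ : ℝ≥0) : ENNReal) * (c.V x + c.V y) + ((b * c.driftConst : ℝ≥0) : ENNReal) := by
    push_cast; ring
  rw [e]
  · rw [mul_assoc b, mul_assoc b]
    gcongr

/-- Both counts vanish with probability `exp (-a) * exp (-b)`, and there the better bound `e` holds.
As `e ≤ w`, a lower bound `η` for this probability is enough. -/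
lemma lintegral_prod_poissonMeasure_le_of_zero {a b : ℝ≥0} {G h : ℕ × ℕ → ENNReal}
    {e w η : ℝ≥0} (hew : e ≤ w) (hη : (η : ℝ) ≤ Real.exp (-a) * Real.exp (-b))
    (hG : ∀ p, G p ≤ w + h p) (hG0 : G (0, 0) ≤ e + h (0, 0)) :
    ∫⁻ p, G p ∂((poissonMeasure a).prod (poissonMeasure b))
      ≤ ((η * e + (1 - η) * w : ℝ≥0) : ENNReal)
        + ∫⁻ p, h p ∂((poissonMeasure a).prod (poissonMeasure b)) := by
  set μ := (poissonMeasure a).prod (poissonMeasure b) with hμ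
  have hμ0 : μ.real {(0, 0)} = Real.exp (-a) * Real.exp (-b) := by
    rw [← Set.singleton_prod_singleton, measureReal_def, hμ, Measure.prod_prod,
      poissonMeasure_singleton_zero, poissonMeasure_singleton_zero, ENNReal.toReal_mul,
      ENNReal.toReal_ofReal (Real.exp_pos _).le, ENNReal.toReal_ofReal (Real.exp_pos _).le]
  have hle1 : μ.real {(0, 0)} ≤ 1 := measureReal_le_one
  calc ∫⁻ p, G p ∂μ ≤ ∫⁻ p, ((({(0, 0)} : Set (ℕ × ℕ)).indicator (fun _ => (e : ENNReal)) p
        + (({(0, 0)} : Set (ℕ × ℕ))ᶜ).indicator (fun _ => (w : ENNReal)) p) + h p) ∂μ := by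
        refine lintegral_mono fun p => ?_
        by_cases hp : p = (0, 0)
        · subst hp; simpa using hG0
        · simpa [hp] using hG p
    _ = (e * μ {(0, 0)} + w * μ {(0, 0)}ᶜ) + ∫⁻ p, h p ∂μ := by
        rw [lintegral_add_left (by fun_prop), lintegral_add_left (by fun_prop),
          lintegral_indicator (by measurability), lintegral_indicator (by measurability)]
        simp
    _ ≤ _ := by
        gcongr
        rw [← ENNReal.ofReal_toReal (measure_ne_top μ {(0, 0)}),
          ← ENNReal.ofReal_toReal (measure_ne_top μ {(0, 0)}ᶜ), ← measureReal_def,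
          ← measureReal_def, probReal_compl_eq_one_sub (by measurability),
          ← ENNReal.ofReal_coe_nnreal, ← ENNReal.ofReal_coe_nnreal, ← ENNReal.ofReal_coe_nnreal,
          ← ENNReal.ofReal_mul (by positivity), ← ENNReal.ofReal_mul (by positivity),
          ← ENNReal.ofReal_add (mul_nonneg e.coe_nonneg measureReal_nonneg)
            (mul_nonneg w.coe_nonneg (sub_nonneg.2 hle1))]
        refine ENNReal.ofReal_le_ofReal ?_
        have h1 : η ≤ 1 := by
          rw [← NNReal.coe_le_coe]; push_cast; linarith
        push_cast [NNReal.coe_sub h1]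
        rw [hμ0]
        have : (e : ℝ) ≤ w := by exact_mod_cast hew
        nlinarith

/-- Along a word of zeros both copies follow the deterministic orbits of `step 0`. If the rates stay
below `R` on them, the word has probability at least `η ^ m`, so this share of the mass enjoys the
bound `e` at the endpoints. -/
lemma pairOp_iterate_le_of_zero_word {F H : S → S → ENNReal} {e w η R : ℝ≥0} (hew : e ≤ w)
    (hη : (η : ℝ) ≤ Real.exp (-R) * Real.exp (-R)) (hF : ∀ x y, F x y ≤ w + H x y) (m : ℕ)
    (x y : S) (hx : ∀ i < m, c.rate ((c.step 0)^[i] x) ≤ R)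
    (hy : ∀ i < m, c.rate ((c.step 0)^[i] y) ≤ R)
    (hxy : F ((c.step 0)^[m] x) ((c.step 0)^[m] y) ≤ e) :
    c.pairOp^[m] F x y
      ≤ ((η ^ m * e + (1 - η ^ m) * w : ℝ≥0) : ENNReal) + c.pairOp^[m] H x y := by
  have hη1 : η ≤ 1 := by
    rw [← NNReal.coe_le_coe]
    refine hη.trans ?_
    have : Real.exp (-R) ≤ 1 := Real.exp_le_one_iff.2 (by simp)
    push_cast
    exact mul_le_one₀ this (Real.exp_pos _).le this
  have hall : ∀ (m : ℕ) (x y : S), c.pairOp^[m] F x y ≤ w + c.pairOp^[m] H x y := by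
    intro m
    induction m with
    | zero => exact hF
    | succ m ih =>
      intro x y
      simp only [Function.iterate_succ_apply']
      refine (c.pairOp_mono ih x y).trans (le_of_eq ?_)
      simp [pairOp, lintegral_add_left]
  induction m generalizing x y with
  | zero => simpa using hxy.trans le_self_add
  | succ m ih =>
    have h0 := ih (c.step 0 x) (c.step 0 y) (fun i hi => by simpa using hx (i + 1) (by omega))
      (fun i hi => by simpa using hy (i + 1) (by omega)) hxy
    have hm1 : η ^ m ≤ 1 := pow_le_one' hη1 m
    simp only [Function.iterate_succ_apply']
    refine (lintegral_prod_poissonMeasure_le_of_zero (e := η ^ m * e + (1 - η ^ m) * w) (w := w)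
      (η := η) (h := fun p => c.pairOp^[m] H (c.step p.1 x) (c.step p.2 y)) ?_ ?_
      (fun p => hall m _ _) h0).trans ?_
    · calc η ^ m * e + (1 - η ^ m) * w ≤ η ^ m * w + (1 - η ^ m) * w := by gcongr
        _ = w := by rw [← add_mul, add_tsub_cancel_of_le hm1, one_mul]
    · refine hη.trans ?_
      gcongr
      · simpa using hx 0 (by omega)
      · simpa using hy 0 (by omega)
    · refine add_le_add_left (ENNReal.coe_le_coe.2 ?_) _
      rw [← NNReal.coe_le_coe]
      push_cast [NNReal.coe_sub hm1, NNReal.coe_sub hη1, NNReal.coe_sub (pow_le_one' hη1 (m + 1))]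
      apply le_of_eq
      ring

lemma norm_step_zero_iterate_le (x : S) (i : ℕ) :
    ‖(c.step 0)^[i] x‖ ≤ ‖x‖ + i * ‖c.step 0 0‖ := by
  induction i with
  | zero => simp
  | succ i ih =>
    rw [Function.iterate_succ_apply']
    have h := (c.lipschitz_step 0).dist_le_mul ((c.step 0)^[i] x) 0
    have h1 : ‖c.step 0 ((c.step 0)^[i] x)‖
        ≤ dist (c.step 0 ((c.step 0)^[i] x)) (c.step 0 0) + ‖c.step 0 0‖ := by
      rw [dist_eq_norm]
      exact norm_le_norm_sub_add _ _
    have h2 : (c.ρ : ℝ) * dist ((c.step 0)^[i] x) 0 ≤ ‖(c.step 0)^[i] x‖ := by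
      rw [dist_zero_right]
      exact mul_le_of_le_one_left (norm_nonneg _) (by exact_mod_cast c.ρ_lt_one.le)
    push_cast
    linarith

lemma rate_le (x : S) : (c.rate x : ℝ) ≤ c.rate 0 + ‖x‖ := by
  have h := c.lipschitz_rate.dist_le_mul x 0
  rw [NNReal.dist_eq, dist_zero_right] at h
  have := le_abs_self ((c.rate x : ℝ) - c.rate 0)
  simp only [NNReal.coe_one, one_mul] at h
  linarith

lemma dist_step_zero_iterate_le (x y : S) (m : ℕ) :
    dist ((c.step 0)^[m] x) ((c.step 0)^[m] y) ≤ c.ρ ^ m * dist x y := by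
  have := ((c.lipschitz_step 0).iterate m).dist_le_mul x y
  simpa using this

set_option maxHeartbeats 1000000 in
-- Differences are weighted by `1 + β (V x + V y)`, and the excess of the weighted bound over `2 *
-- e` shrinks by `α`. If `V x + V y` is small, a word of zeros brings the copies so close that the
-- Lipschitz bound gives `e`. If it is large, the drift of `V` reduces the weight itself.
lemma exists_contraction {f : S → ℝ} {B L : ℝ≥0} (hf : ∀ s, |f s| ≤ B) (hL : LipschitzWith L f)
    {e : ℝ} (he : 0 < e) : ∃ (m : ℕ) (β α : ℝ), 0 < β ∧ β ≤ 1 ∧ 0 ≤ α ∧ α < 1 ∧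
      ∀ (N : ℕ) (w : ℝ), 2 * e ≤ w →
        (∀ n ≥ N, ∀ x y, |c.op^[n] f x - c.op^[n] f y| ≤ w * (1 + β * (c.V x + c.V y))) →
        ∀ n ≥ N + m, ∀ x y, |c.op^[n] f x - c.op^[n] f y|
          ≤ (2 * e + α * (w - 2 * e)) * (1 + β * (c.V x + c.V y)) := by
  obtain ⟨L', hL'⟩ := c.lipschitzWith_op_iterate hf hL
  have hγ : (c.γ : ℝ) < 1 := by exact_mod_cast c.γ_lt_one
  have hγ0 : (0 : ℝ) ≤ c.γ := c.γ.2
  set K : ℝ := (c.driftConst : ℝ) with hK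
  have hK0 : 0 ≤ K := c.driftConst.coe_nonneg
  -- Beyond this level the constant of the drift is at most half of the decrease: `K ≤ s (1 - γ) /
  -- 2` for `s > R`.
  set R : ℝ := 2 * K / (1 - c.γ) + 1 with hR
  have hR1 : 1 ≤ R := by
    have : 0 ≤ 2 * K / (1 - c.γ) := div_nonneg (by linarith) (by linarith)
    linarith
  obtain ⟨m, hm⟩ : ∃ m : ℕ, L' * (c.ρ ^ (m + 1) * R) ≤ e := by
    have h1 : Tendsto (fun m : ℕ => (L' : ℝ) * ((c.ρ : ℝ) ^ (m + 1) * R)) atTop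
        (𝓝 (L' * (0 * R))) := by
      refine Tendsto.const_mul _ (Tendsto.mul_const _ ?_)
      exact (tendsto_pow_atTop_nhds_zero_of_lt_one c.ρ.2 (by exact_mod_cast c.ρ_lt_one)).comp
        (tendsto_add_atTop_nat 1)
    simp only [zero_mul, mul_zero] at h1
    obtain ⟨m, hm⟩ := (h1.eventually (ge_mem_nhds he)).exists
    exact ⟨m, hm⟩
  -- Bound for the rates met along a word of zeros started in the ball of radius `R`.
  set R' : ℝ≥0 := c.rate 0 + (R.toNNReal + (m + 1) * ‖c.step 0 0‖₊) with hR'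
  set η : ℝ≥0 := (Real.exp (-R') * Real.exp (-R')).toNNReal with hη
  have hηr : (η : ℝ) = Real.exp (-R') * Real.exp (-R') := by
    rw [hη, Real.coe_toNNReal _ (by positivity)]
  have hη1 : η ≤ 1 := by
    rw [← NNReal.coe_le_coe, hηr]
    have : Real.exp (-R') ≤ 1 := Real.exp_le_one_iff.2 (by simp)
    push_cast
    exact mul_le_one₀ this (Real.exp_pos _).le this
  set p : ℝ := (η : ℝ) ^ (m + 1) with hp
  have hp0 : 0 < p := by rw [hp, hηr]; positivity
  have hp1 : p ≤ 1 := pow_le_one₀ η.2 (by exact_mod_cast hη1)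
  -- So small that, for small `V`, the weight term after `m + 1` steps costs at most half of the
  -- gain `p`.
  set β : ℝ := min 1 (p / 2 / (R + K)) with hβ
  have hRK : 0 < R + K := by linarith
  have hβ0 : 0 < β := lt_min one_pos (by positivity)
  have hβp : β * (c.γ * R + K) ≤ p / 2 := by
    have h1 : β ≤ p / 2 / (R + K) := min_le_right _ _
    rw [le_div_iff₀ hRK] at h1
    refine le_trans ?_ h1
    gcongr
    exact mul_le_of_le_one_left (by linarith) hγ.le
  -- The least share of `β s` in the weight `1 + β s` for `s ≥ R`. Only this share benefits from the
  -- drift.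
  set θ : ℝ := β * R / (1 + β * R) with hθ
  have hβR : 0 < β * R := by positivity
  have hθ0 : 0 < θ := by positivity
  have hθ1 : θ < 1 := by rw [hθ, div_lt_one (by positivity)]; linarith
  set α : ℝ := max (1 - p / 2) (1 - θ * (1 - c.γ) / 2) with hα
  have hα0 : 0 ≤ α := le_max_of_le_left (by linarith)
  have hα1 : α < 1 := by
    refine max_lt (by linarith) ?_
    have : 0 < θ * (1 - c.γ) := mul_pos hθ0 (by linarith)
    linarith
  refine ⟨m + 1, β, α, hβ0, min_le_left _ _, hα0, hα1, fun N w hw hN n hn x y => ?_⟩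
  obtain ⟨k, rfl⟩ : ∃ k, n = (m + 1) + k := ⟨n - (m + 1), by omega⟩
  have hw0 : 0 ≤ w := by linarith
  set s : ℝ := (c.V x : ℝ) + c.V y with hs
  have hs0 : 0 ≤ s := by positivity
  lift w to ℝ≥0 using hw0
  set b : ℝ≥0 := w * β.toNNReal with hb
  have hbr : (b : ℝ) = w * β := by rw [hb]; push_cast [Real.coe_toNNReal _ hβ0.le]; rfl
  have hD : ∀ x y, edist (c.op^[k] f x) (c.op^[k] f y)
      ≤ w + (b : ENNReal) * (c.V x + c.V y) := by
    intro x y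
    have h1 := hN k (by omega) x y
    rw [edist_dist, Real.dist_eq]
    have e1 : (w : ENNReal) + (b : ENNReal) * (c.V x + c.V y)
        = ENNReal.ofReal (w * (1 + β * (c.V x + c.V y))) := by
      have : (w * (1 + β * (c.V x + c.V y)) : ℝ) = ((w + b * (c.V x + c.V y) : ℝ≥0) : ℝ) := by
        push_cast; rw [hbr]; ring
      rw [this, ENNReal.ofReal_coe_nnreal]; push_cast; rfl
    rw [e1]
    exact ENNReal.ofReal_le_ofReal h1
  have hV := c.pairOp_iterate_V_le b m x y
  have hstep := c.edist_op_iterate_le hf k (m + 1) x y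
  have toReal : ∀ d : ℝ≥0, edist (c.op^[m + 1 + k] f x) (c.op^[m + 1 + k] f y)
      ≤ d + (b : ENNReal) * (c.γ * (c.V x + c.V y) + c.driftConst) →
      |c.op^[m + 1 + k] f x - c.op^[m + 1 + k] f y| ≤ d + w * β * (c.γ * s + K) := by
    intro d hd
    have e1 : (d : ENNReal) + (b : ENNReal) * (c.γ * (c.V x + c.V y) + c.driftConst)
        = ENNReal.ofReal (d + w * β * (c.γ * s + K)) := by
      have : (d + w * β * (c.γ * s + K) : ℝ)
          = ((d + b * (c.γ * (c.V x + c.V y) + c.driftConst) : ℝ≥0) : ℝ) := by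
        push_cast; rw [hbr]
      rw [this, ENNReal.ofReal_coe_nnreal]; push_cast; rfl
    rw [e1, edist_dist, Real.dist_eq] at hd
    exact (ENNReal.ofReal_le_ofReal_iff (by positivity)).1 hd
  have hαle1 : 1 - p / 2 ≤ α := le_max_left _ _
  have hαle2 : 1 - θ * (1 - c.γ) / 2 ≤ α := le_max_right _ _
  rcases le_or_gt s R with hsR | hsR
  · have hx : ‖x‖ ≤ R := by
      have : (‖x‖ : ℝ) ≤ c.V x := by exact_mod_cast c.norm_le_V x
      have : (0 : ℝ) ≤ c.V y := (c.V y).2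
      linarith
    have hy : ‖y‖ ≤ R := by
      have : (‖y‖ : ℝ) ≤ c.V y := by exact_mod_cast c.norm_le_V y
      have : (0 : ℝ) ≤ c.V x := (c.V x).2
      linarith
    have hrate : ∀ z : S, ‖z‖ ≤ R → ∀ i < m + 1, c.rate ((c.step 0)^[i] z) ≤ R' := by
      intro z hz i hi
      have h1 := c.rate_le ((c.step 0)^[i] z)
      have h2 := c.norm_step_zero_iterate_le z i
      have h3 : (i : ℝ) * ‖c.step 0 0‖ ≤ (m + 1) * ‖c.step 0 0‖ := by
        gcongr; exact_mod_cast hi.le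
      rw [← NNReal.coe_le_coe, hR']
      push_cast [Real.coe_toNNReal R (by linarith)]
      linarith
    have hmeet : edist (c.op^[k] f ((c.step 0)^[m + 1] x)) (c.op^[k] f ((c.step 0)^[m + 1] y))
        ≤ (e.toNNReal : ENNReal) := by
      rw [edist_dist, ENNReal.ofReal]
      refine ENNReal.coe_le_coe.2 (Real.toNNReal_le_toNNReal ?_)
      refine ((hL' k).dist_le_mul _ _).trans (le_trans ?_ hm)
      have h1 := c.dist_step_zero_iterate_le x y (m + 1)
      have h2 : dist x y ≤ R := by
        have h3 : (‖x‖ : ℝ) ≤ c.V x := by exact_mod_cast c.norm_le_V x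
        have h4 : (‖y‖ : ℝ) ≤ c.V y := by exact_mod_cast c.norm_le_V y
        have := dist_le_norm_add_norm x y
        linarith
      have h5 : (c.ρ : ℝ) ^ (m + 1) * dist x y ≤ c.ρ ^ (m + 1) * R := by gcongr
      gcongr
      exact h1.trans h5
    have hew : e.toNNReal ≤ w := by
      rw [← NNReal.coe_le_coe, Real.coe_toNNReal _ he.le]; linarith
    have h0 := c.pairOp_iterate_le_of_zero_word (H := fun x y => (b : ENNReal) * (c.V x + c.V y))
      hew hηr.le hD (m + 1) x y (hrate x hx) (hrate y hy) hmeet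
    have h1 := toReal _ (hstep.trans (h0.trans (add_le_add_right hV _)))
    have h2 : ((η ^ (m + 1) * e.toNNReal + (1 - η ^ (m + 1)) * w : ℝ≥0) : ℝ)
        = p * e + (1 - p) * w := by
      push_cast [NNReal.coe_sub (pow_le_one' hη1 (m + 1)), Real.coe_toNNReal _ he.le]
      rfl
    rw [h2] at h1
    refine h1.trans ?_
    have h3 : w * β * (c.γ * s + K) ≤ w * (p / 2) := by
      rw [mul_assoc]
      refine mul_le_mul_of_nonneg_left (le_trans ?_ hβp) w.2
      gcongr
    have h4 : (1 - p / 2) * (w - 2 * e) ≤ α * (w - 2 * e) :=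
      mul_le_mul_of_nonneg_right hαle1 (by linarith)
    have h5 : 0 ≤ (2 * e + α * (w - 2 * e)) * (β * s) := by
      have : 0 ≤ α * (w - 2 * e) := mul_nonneg hα0 (by linarith)
      positivity
    -- The map `w ↦ p e + (1 - p / 2) w` has the fixed point `2 e`, whence the form of the
    -- statement.
    calc _ ≤ p * e + (1 - p) * w + w * (p / 2) := by linarith
      _ = 2 * e + (1 - p / 2) * (w - 2 * e) := by ring
      _ ≤ 2 * e + α * (w - 2 * e) := by linarith
      _ ≤ (2 * e + α * (w - 2 * e)) * (1 + β * s) := by linarith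
  · have h0 : c.pairOp^[m + 1] (fun x y => edist (c.op^[k] f x) (c.op^[k] f y)) x y
        ≤ w + c.pairOp^[m + 1] (fun x y => (b : ENNReal) * (c.V x + c.V y)) x y := by
      have : ∀ (m : ℕ) (x y : S), c.pairOp^[m] (fun x y => edist (c.op^[k] f x) (c.op^[k] f y)) x y
          ≤ w + c.pairOp^[m] (fun x y => (b : ENNReal) * (c.V x + c.V y)) x y := by
        intro m
        induction m with
        | zero => exact hD
        | succ m ih =>
          intro x y
          simp only [Function.iterate_succ_apply']
          refine (c.pairOp_mono ih x y).trans (le_of_eq ?_)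
          simp [pairOp, lintegral_add_left]
      exact this _ x y
    have h1 := toReal _ (hstep.trans (h0.trans (add_le_add_right hV _)))
    refine h1.trans ?_
    have hKs : K ≤ s * (1 - c.γ) / 2 := by
      have h2 : 2 * K / (1 - c.γ) ≤ s := by linarith
      rw [div_le_iff₀ (by linarith)] at h2
      linarith
    have hθs : θ * (1 + β * s) ≤ β * s := by
      rw [hθ, div_mul_eq_mul_div, div_le_iff₀ (by positivity)]
      have : β * R ≤ β * s := by gcongr
      linarith
    have h3 : 1 + β * (c.γ * s + K) ≤ α * (1 + β * s) := by
      have h4 : (1 - θ * (1 - c.γ) / 2) * (1 + β * s) ≤ α * (1 + β * s) := by gcongr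
      refine le_trans ?_ h4
      have h5 : β * K ≤ β * (s * (1 - c.γ) / 2) := by gcongr
      have h6 : θ * (1 + β * s) * (1 - c.γ) ≤ β * s * (1 - c.γ) :=
        mul_le_mul_of_nonneg_right hθs (by linarith)
      calc 1 + β * (c.γ * s + K) = 1 + β * (c.γ * s) + β * K := by ring
        _ ≤ 1 + β * (c.γ * s) + β * (s * (1 - c.γ) / 2) := by gcongr
        _ = 1 + β * s - β * s * (1 - c.γ) / 2 := by ring
        _ ≤ 1 + β * s - θ * (1 + β * s) * (1 - c.γ) / 2 := by linarith
        _ = _ := by ring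
    have h4 : w * (1 + β * (c.γ * s + K)) ≤ w * (α * (1 + β * s)) := by gcongr
    have h5 : α * w ≤ 2 * e + α * (w - 2 * e) := by
      have : e * α ≤ e * 1 := by gcongr
      linarith
    have h6 : α * w * (1 + β * s) ≤ (2 * e + α * (w - 2 * e)) * (1 + β * s) := by gcongr
    calc _ = w * (1 + β * (c.γ * s + K)) := by ring
      _ ≤ _ := h4
      _ = α * w * (1 + β * s) := by ring
      _ ≤ _ := h6

/-- The chain forgets its starting point. -/
theorem exists_abs_op_iterate_sub_le {f : S → ℝ} {B L : ℝ≥0} (hf : ∀ s, |f s| ≤ B)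
    (hL : LipschitzWith L f) {ε : ℝ} (hε : 0 < ε) :
    ∃ N, ∀ n ≥ N, ∀ x y, |c.op^[n] f x - c.op^[n] f y| ≤ ε * (1 + c.V x + c.V y) := by
  obtain ⟨m, β, α, hβ, hβ1, hα, hα1, h⟩ := c.exists_contraction hf hL (e := ε / 4) (by positivity)
  set e := ε / 4 with he
  set W : ℝ := 2 * B with hW
  have hW0 : 0 ≤ W := by positivity
  -- Start from the trivial bound `2 * B` and contract its excess over `2 * e = ε / 2` once every
  -- `m` steps.
  have key : ∀ j : ℕ, ∀ n ≥ j * m, ∀ x y, |c.op^[n] f x - c.op^[n] f y|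
      ≤ (2 * e + α ^ j * W) * (1 + β * (c.V x + c.V y)) := by
    intro j
    induction j with
    | zero =>
      intro n _ x y
      have h1 := abs_sub (c.op^[n] f x) (c.op^[n] f y)
      have h2 := c.abs_op_iterate_le hf n x
      have h3 := c.abs_op_iterate_le hf n y
      have h4 : 0 ≤ β * ((c.V x : ℝ) + c.V y) := by positivity
      have h5 : 0 ≤ e := by positivity
      have h6 : 0 ≤ W * (β * ((c.V x : ℝ) + c.V y)) := by positivity
      have h7 : 0 ≤ e * (β * ((c.V x : ℝ) + c.V y)) := by positivity
      rw [pow_zero]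
      nlinarith
    | succ j ih =>
      intro n hn x y
      have h1 := h (j * m) (2 * e + α ^ j * W) (by have : 0 ≤ α ^ j * W := by positivity
                                                   linarith) ih n (by linarith) x y
      refine h1.trans (le_of_eq ?_)
      ring
  have h2 : Tendsto (fun j : ℕ => 2 * e + α ^ j * W) atTop (𝓝 (2 * e + 0 * W)) :=
    ((tendsto_pow_atTop_nhds_zero_of_lt_one hα hα1).mul_const W).const_add _
  obtain ⟨j, hj⟩ := (h2.eventually_le_const (u := ε) (by linarith)).exists
  refine ⟨j * m, fun n hn x y => (key j n hn x y).trans ?_⟩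
  have h3 : 0 ≤ (c.V x : ℝ) + c.V y := by positivity
  rw [add_assoc]
  gcongr
  exact mul_le_of_le_one_left h3 hβ1

end PoissonChain

section Stochastic

variable {Ω : Type*} [MeasurableSpace Ω] {P : Measure Ω}

/-! ### Stochastic orders -/

/-- `U n` tends to `0` in probability. -/
def NegligibleInProb (P : Measure Ω) (U : ℕ → Ω → ℝ) : Prop :=
  ∀ ε > 0, Tendsto (fun n => P {ω | ε ≤ |U n ω|}) atTop (𝓝 0)

/-- `U n` is bounded in probability. -/
def BoundedInProb (P : Measure Ω) (U : ℕ → Ω → ℝ) : Prop :=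
  ∀ ε : ENNReal, 0 < ε → ∃ K > 0, ∀ᶠ n in atTop, P {ω | K ≤ |U n ω|} ≤ ε

/-- Only the outer measure of the events enters, so no measurability of `U` is needed. This matters
for likelihood quantities evaluated at the estimator. -/
lemma NegligibleInProb.mono_ae {U W : ℕ → Ω → ℝ} (hW : NegligibleInProb P W)
    (h : ∀ᶠ n in atTop, ∀ᵐ ω ∂P, |U n ω| ≤ |W n ω|) : NegligibleInProb P U := by
  intro ε hε
  refine tendsto_of_tendsto_of_tendsto_of_le_of_le' tendsto_const_nhds (hW ε hε)
    (.of_forall fun _ => zero_le) ?_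
  filter_upwards [h] with n hn
  refine measure_mono_ae ?_
  filter_upwards [hn] with ω h1 h2
  exact le_trans (h2 : ε ≤ |U n ω|) h1

lemma NegligibleInProb.mono {U W : ℕ → Ω → ℝ} (hW : NegligibleInProb P W)
    (h : ∀ n ω, |U n ω| ≤ |W n ω|) : NegligibleInProb P U :=
  hW.mono_ae (.of_forall fun n => .of_forall fun ω => h n ω)

lemma BoundedInProb.mono_ae {U W : ℕ → Ω → ℝ} (hW : BoundedInProb P W)
    (h : ∀ᶠ n in atTop, ∀ᵐ ω ∂P, |U n ω| ≤ |W n ω|) : BoundedInProb P U := by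
  intro ε hε
  obtain ⟨K, hK, hn⟩ := hW ε hε
  refine ⟨K, hK, ?_⟩
  filter_upwards [hn, h] with n h1 h2
  refine (measure_mono_ae ?_).trans h1
  filter_upwards [h2] with ω h3 h4
  exact le_trans (h4 : K ≤ |U n ω|) h3

lemma NegligibleInProb.add {U W : ℕ → Ω → ℝ} (hU : NegligibleInProb P U)
    (hW : NegligibleInProb P W) : NegligibleInProb P (fun n ω => U n ω + W n ω) := by
  intro ε hε
  have h := (hU (ε / 2) (by positivity)).add (hW (ε / 2) (by positivity))
  rw [add_zero] at h
  refine tendsto_of_tendsto_of_tendsto_of_le_of_le tendsto_const_nhds h (fun _ => zero_le) ?_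
  intro n
  refine (measure_mono ?_).trans (measure_union_le _ _)
  intro ω hω
  by_contra hc
  simp only [Set.mem_union, Set.mem_ofPred_eq, not_or, not_le] at hc hω
  have := abs_add_le (U n ω) (W n ω)
  linarith [hc.1, hc.2]

lemma NegligibleInProb.abs {U : ℕ → Ω → ℝ} (hU : NegligibleInProb P U) :
    NegligibleInProb P (fun n ω => |U n ω|) :=
  hU.mono fun _ _ => (abs_abs _).le

lemma NegligibleInProb.zero : NegligibleInProb P (fun _ _ => 0) := by
  intro ε hε
  simp [hε.not_ge]

lemma NegligibleInProb.sum {ι : Type*} {s : Finset ι} {U : ι → ℕ → Ω → ℝ}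
    (hU : ∀ i ∈ s, NegligibleInProb P (U i)) :
    NegligibleInProb P (fun n ω => ∑ i ∈ s, U i n ω) := by
  classical
  induction s using Finset.induction_on with
  | empty => simpa using NegligibleInProb.zero
  | insert i s hi ih =>
    simp_rw [Finset.sum_insert hi]
    exact (hU i (by simp)).add (ih fun j hj => hU j (by simp [hj]))

lemma BoundedInProb.mul_negligible {U W : ℕ → Ω → ℝ} (hU : BoundedInProb P U)
    (hW : NegligibleInProb P W) : NegligibleInProb P (fun n ω => U n ω * W n ω) := by
  intro ε hε
  rw [ENNReal.tendsto_nhds_zero]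
  intro δ hδ
  obtain ⟨K, hK, hn⟩ := hU (δ / 2) (ENNReal.half_pos hδ.ne')
  have h2 := (ENNReal.tendsto_nhds_zero.1 (hW (ε / K) (by positivity))) (δ / 2)
    (ENNReal.half_pos hδ.ne')
  filter_upwards [hn, h2] with n h3 h4
  calc P {ω | ε ≤ |U n ω * W n ω|}
      ≤ P ({ω | K ≤ |U n ω|} ∪ {ω | ε / K ≤ |W n ω|}) := by
        refine measure_mono fun ω hω => ?_
        by_contra hc
        simp only [Set.mem_union, Set.mem_ofPred_eq, not_or, not_le] at hc hω
        rw [abs_mul] at hω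
        have : |U n ω| * |W n ω| < K * (ε / K) :=
          mul_lt_mul'' hc.1 hc.2 (abs_nonneg _) (abs_nonneg _)
        rw [mul_div_cancel₀ _ hK.ne'] at this
        linarith
    _ ≤ _ := (measure_union_le _ _).trans (add_le_add h3 h4)
    _ = δ := ENNReal.add_halves δ

lemma BoundedInProb.const [IsFiniteMeasure P] (a : ℝ) : BoundedInProb P (fun _ _ => a) := by
  intro ε hε
  refine ⟨|a| + 1, by positivity, .of_forall fun n => ?_⟩
  have : ¬ (|a| + 1 ≤ |a|) := by linarith
  simp [this]

lemma NegligibleInProb.const_mul [IsFiniteMeasure P] {U : ℕ → Ω → ℝ}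
    (hU : NegligibleInProb P U) (a : ℝ) : NegligibleInProb P (fun n ω => a * U n ω) :=
  (BoundedInProb.const a).mul_negligible hU

lemma NegligibleInProb.boundedInProb {U : ℕ → Ω → ℝ} (hU : NegligibleInProb P U) :
    BoundedInProb P U := fun ε hε =>
  ⟨1, one_pos, (ENNReal.tendsto_nhds_zero.1 (hU 1 one_pos)) ε hε⟩

lemma BoundedInProb.add {U W : ℕ → Ω → ℝ} (hU : BoundedInProb P U) (hW : BoundedInProb P W) :
    BoundedInProb P (fun n ω => U n ω + W n ω) := by
  intro ε hε
  obtain ⟨K, hK, hn⟩ := hU (ε / 2) (ENNReal.half_pos hε.ne')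
  obtain ⟨M, hM, hm⟩ := hW (ε / 2) (ENNReal.half_pos hε.ne')
  refine ⟨K + M, by positivity, ?_⟩
  filter_upwards [hn, hm] with n h3 h4
  calc P {ω | K + M ≤ |U n ω + W n ω|}
      ≤ P ({ω | K ≤ |U n ω|} ∪ {ω | M ≤ |W n ω|}) := by
        refine measure_mono fun ω hω => ?_
        by_contra hc
        simp only [Set.mem_union, Set.mem_ofPred_eq, not_or, not_le] at hc hω
        have := abs_add_le (U n ω) (W n ω)
        linarith [hc.1, hc.2]
    _ ≤ _ := (measure_union_le _ _).trans (add_le_add h3 h4)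
    _ = ε := ENNReal.add_halves ε

lemma BoundedInProb.mul {U W : ℕ → Ω → ℝ} (hU : BoundedInProb P U) (hW : BoundedInProb P W) :
    BoundedInProb P (fun n ω => U n ω * W n ω) := by
  intro ε hε
  obtain ⟨K, hK, hn⟩ := hU (ε / 2) (ENNReal.half_pos hε.ne')
  obtain ⟨M, hM, hm⟩ := hW (ε / 2) (ENNReal.half_pos hε.ne')
  refine ⟨K * M, by positivity, ?_⟩
  filter_upwards [hn, hm] with n h3 h4
  calc P {ω | K * M ≤ |U n ω * W n ω|}
      ≤ P ({ω | K ≤ |U n ω|} ∪ {ω | M ≤ |W n ω|}) := by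
        refine measure_mono fun ω hω => ?_
        by_contra hc
        simp only [Set.mem_union, Set.mem_ofPred_eq, not_or, not_le] at hc hω
        rw [abs_mul] at hω
        exact absurd hω (not_le.2 (mul_lt_mul'' hc.1 hc.2 (abs_nonneg _) (abs_nonneg _)))
    _ ≤ _ := (measure_union_le _ _).trans (add_le_add h3 h4)
    _ = ε := ENNReal.add_halves ε

lemma measure_abs_ge_le_lintegral {U : Ω → ℝ} (hU : AEMeasurable U P) {ε : ℝ} (hε : 0 < ε) :
    P {ω | ε ≤ |U ω|} ≤ (∫⁻ ω, ‖U ω‖ₑ ∂P) / ENNReal.ofReal ε := by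
  refine le_trans (measure_mono fun ω hω => ?_) (meas_ge_le_lintegral_div (f := fun ω => ‖U ω‖ₑ)
    hU.enorm (ENNReal.ofReal_pos.2 hε).ne' ENNReal.ofReal_ne_top)
  simp only [Set.mem_ofPred_eq] at hω ⊢
  rw [← ofReal_norm]
  exact ENNReal.ofReal_le_ofReal hω

lemma NegligibleInProb.of_lintegral {U : ℕ → Ω → ℝ} (hU : ∀ n, AEMeasurable (U n) P)
    (h : Tendsto (fun n => ∫⁻ ω, ‖U n ω‖ₑ ∂P) atTop (𝓝 0)) : NegligibleInProb P U := by
  intro ε hε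
  refine tendsto_of_tendsto_of_tendsto_of_le_of_le tendsto_const_nhds ?_ (fun _ => zero_le)
    (fun n => measure_abs_ge_le_lintegral (hU n) hε)
  have := ENNReal.Tendsto.div_const h (b := ENNReal.ofReal ε)
    (Or.inr (ENNReal.ofReal_pos.2 hε).ne')
  simpa using this

lemma BoundedInProb.of_lintegral {U : ℕ → Ω → ℝ} (hU : ∀ n, AEMeasurable (U n) P) {C : ℝ≥0}
    (h : ∀ n, ∫⁻ ω, ‖U n ω‖ₑ ∂P ≤ C) : BoundedInProb P U := by
  intro ε hε
  rcases eq_or_ne ε ⊤ with rfl | hε'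
  · exact ⟨1, one_pos, by simp⟩
  have he : 0 < ε.toReal := ENNReal.toReal_pos hε.ne' hε'
  refine ⟨(C + 1) / ε.toReal, by positivity, .of_forall fun n => ?_⟩
  refine (measure_abs_ge_le_lintegral (hU n) (by positivity)).trans ?_
  refine ENNReal.div_le_of_le_mul ((h n).trans ?_)
  rw [← ENNReal.ofReal_coe_nnreal, ← ENNReal.ofReal_toReal hε', ← ENNReal.ofReal_mul he.le]
  refine ENNReal.ofReal_le_ofReal ?_
  rw [ENNReal.toReal_ofReal he.le, mul_div_cancel₀ _ he.ne']
  linarith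

lemma NegligibleInProb.of_sq {U : ℕ → Ω → ℝ} (h : NegligibleInProb P (fun n ω => U n ω ^ 2)) :
    NegligibleInProb P U := by
  intro ε hε
  refine tendsto_of_tendsto_of_tendsto_of_le_of_le tendsto_const_nhds (h (ε ^ 2) (by positivity))
    (fun _ => zero_le) (fun n => measure_mono fun ω hω => ?_)
  simp only [Set.mem_ofPred_eq, abs_pow] at hω ⊢
  gcongr

/-- It suffices to bound on events of probability tending to one. -/
lemma NegligibleInProb.of_event {U W E : ℕ → Ω → ℝ} (hW : NegligibleInProb P W)
    (hE : NegligibleInProb P E) {δ : ℝ} (hδ : 0 < δ)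
    (h : ∀ᶠ n in atTop, ∀ᵐ ω ∂P, |E n ω| < δ → |U n ω| ≤ |W n ω|) : NegligibleInProb P U := by
  intro ε hε
  have h0 := (hW ε hε).add (hE δ hδ)
  rw [add_zero] at h0
  refine tendsto_of_tendsto_of_tendsto_of_le_of_le' tendsto_const_nhds h0
    (.of_forall fun _ => zero_le) ?_
  filter_upwards [h] with n hn
  refine (measure_mono_ae ?_).trans (measure_union_le _ _)
  filter_upwards [hn] with ω h1 h2
  by_cases h3 : |E n ω| < δ
  · exact Or.inl (le_trans (h2 : ε ≤ |U n ω|) (h1 h3))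
  · exact Or.inr (not_lt.1 h3)

/-! ### Uniformly bounded moments -/

/-- All moments of the variables `U k` are bounded uniformly in `k`. -/
structure HasUniformMoments (P : Measure Ω) (U : ℕ → Ω → ℝ) : Prop where
  aemeasurable : ∀ k, AEMeasurable (U k) P
  bound : ∀ p : ℕ, ∃ C : ℝ≥0, ∀ k, ∫⁻ ω, ‖U k ω‖ₑ ^ p ∂P ≤ C

namespace HasUniformMoments

variable {U W : ℕ → Ω → ℝ}

lemma mono (hW : HasUniformMoments P W) (hU : ∀ k, AEMeasurable (U k) P)
    (h : ∀ k, ∀ᵐ ω ∂P, |U k ω| ≤ |W k ω|) : HasUniformMoments P U := by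
  refine ⟨hU, fun p => ?_⟩
  obtain ⟨C, hC⟩ := hW.bound p
  refine ⟨C, fun k => (lintegral_mono_ae ?_).trans (hC k)⟩
  filter_upwards [h k] with ω hω
  gcongr
  rw [← ofReal_norm, ← ofReal_norm]
  exact ENNReal.ofReal_le_ofReal hω

lemma const [IsFiniteMeasure P] (a : ℝ) : HasUniformMoments P (fun _ _ => a) := by
  refine ⟨fun _ => aemeasurable_const, fun p => ⟨(‖a‖₊ ^ p * (P Set.univ).toNNReal), fun k => ?_⟩⟩
  simp only [lintegral_const]
  push_cast
  rw [ENNReal.coe_toNNReal (measure_ne_top _ _)]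
  rfl

lemma add (hU : HasUniformMoments P U) (hW : HasUniformMoments P W) :
    HasUniformMoments P (fun k ω => U k ω + W k ω) := by
  refine ⟨fun k => (hU.aemeasurable k).add (hW.aemeasurable k), fun p => ?_⟩
  obtain ⟨C, hC⟩ := hU.bound p
  obtain ⟨D, hD⟩ := hW.bound p
  refine ⟨2 ^ p * (C + D), fun k => ?_⟩
  calc ∫⁻ ω, ‖U k ω + W k ω‖ₑ ^ p ∂P ≤ ∫⁻ ω, 2 ^ p * (‖U k ω‖ₑ ^ p + ‖W k ω‖ₑ ^ p) ∂P := by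
        refine lintegral_mono fun ω => ?_
        calc ‖U k ω + W k ω‖ₑ ^ p ≤ (2 * max ‖U k ω‖ₑ ‖W k ω‖ₑ) ^ p := by
              gcongr
              refine (enorm_add_le _ _).trans ?_
              rw [two_mul]
              exact add_le_add (le_max_left _ _) (le_max_right _ _)
          _ = 2 ^ p * max ‖U k ω‖ₑ ‖W k ω‖ₑ ^ p := mul_pow _ _ _
          _ ≤ _ := by
              gcongr
              rcases le_total ‖U k ω‖ₑ ‖W k ω‖ₑ with h | h
              · rw [max_eq_right h]; exact le_add_self
              · rw [max_eq_left h]; exact le_self_add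
    _ = 2 ^ p * (∫⁻ ω, ‖U k ω‖ₑ ^ p ∂P + ∫⁻ ω, ‖W k ω‖ₑ ^ p ∂P) := by
        rw [lintegral_const_mul' _ _ (by simp), lintegral_add_left'
          ((hU.aemeasurable k).enorm.pow_const p)]
    _ ≤ 2 ^ p * (C + D) := by gcongr; exacts [hC k, hD k]
    _ = _ := by push_cast; rfl

lemma mul (hU : HasUniformMoments P U) (hW : HasUniformMoments P W) :
    HasUniformMoments P (fun k ω => U k ω * W k ω) := by
  refine ⟨fun k => (hU.aemeasurable k).mul (hW.aemeasurable k), fun p => ?_⟩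
  obtain ⟨C, hC⟩ := hU.bound (2 * p)
  obtain ⟨D, hD⟩ := hW.bound (2 * p)
  refine ⟨C + D, fun k => ?_⟩
  calc ∫⁻ ω, ‖U k ω * W k ω‖ₑ ^ p ∂P ≤ ∫⁻ ω, (‖U k ω‖ₑ ^ (2 * p) + ‖W k ω‖ₑ ^ (2 * p)) ∂P := by
        refine lintegral_mono fun ω => ?_
        rw [enorm_mul, mul_pow, two_mul, pow_add, pow_add]
        rcases le_total (‖U k ω‖ₑ ^ p) (‖W k ω‖ₑ ^ p) with h | h
        · exact le_trans (mul_le_mul_left h _) le_add_self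
        · exact le_trans (mul_le_mul_right h _) le_self_add
    _ = ∫⁻ ω, ‖U k ω‖ₑ ^ (2 * p) ∂P + ∫⁻ ω, ‖W k ω‖ₑ ^ (2 * p) ∂P :=
        lintegral_add_left' ((hU.aemeasurable k).enorm.pow_const _) _
    _ ≤ C + D := add_le_add (hC k) (hD k)
    _ = _ := by push_cast; rfl

lemma const_mul [IsFiniteMeasure P] (hU : HasUniformMoments P U) (a : ℝ) :
    HasUniformMoments P (fun k ω => a * U k ω) := (const a).mul hU

lemma neg (hU : HasUniformMoments P U) : HasUniformMoments P (fun k ω => - U k ω) :=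
  hU.mono (fun k => (hU.aemeasurable k).neg) (fun k => .of_forall fun ω => by simp)

lemma sub (hU : HasUniformMoments P U) (hW : HasUniformMoments P W) :
    HasUniformMoments P (fun k ω => U k ω - W k ω) := by
  simpa [sub_eq_add_neg] using hU.add hW.neg

lemma abs (hU : HasUniformMoments P U) : HasUniformMoments P (fun k ω => |U k ω|) :=
  hU.mono (fun k => by simpa using (hU.aemeasurable k).norm) (fun k => .of_forall fun ω => by simp)

lemma pow [IsFiniteMeasure P] (hU : HasUniformMoments P U) (q : ℕ) :
    HasUniformMoments P (fun k ω => U k ω ^ q) := by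
  induction q with
  | zero => simpa using const 1
  | succ q ih => simpa [pow_succ] using ih.mul hU

lemma sum [IsFiniteMeasure P] {ι : Type*} {s : Finset ι} {U : ι → ℕ → Ω → ℝ}
    (hU : ∀ i ∈ s, HasUniformMoments P (U i)) :
    HasUniformMoments P (fun k ω => ∑ i ∈ s, U i k ω) := by
  classical
  induction s using Finset.induction_on with
  | empty => simpa using const 0
  | insert i s hi ih =>
    simp_rw [Finset.sum_insert hi]
    exact (hU i (by simp)).add (ih fun j hj => hU j (by simp [hj]))

/-- A process obtained by exponential smoothing from a process with uniformly bounded moments. -/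
lemma of_recursion [IsFiniteMeasure P] (hU : HasUniformMoments P U) {a x : ℝ} (ha : 0 ≤ a)
    (ha1 : a < 1) {B : ℕ → Ω → ℝ} (h0 : ∀ ω, B 0 ω = x)
    (hB : ∀ k ω, B (k + 1) ω = a * B k ω + U k ω) : HasUniformMoments P B := by
  have hm : ∀ k, AEMeasurable (B k) P := by
    intro k
    induction k with
    | zero => rw [show B 0 = fun _ => x from funext h0]; exact aemeasurable_const
    | succ k ih =>
      rw [show B (k + 1) = fun ω => a * B k ω + U k ω from funext (hB k)]
      exact (ih.const_mul a).add (hU.aemeasurable k)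
  refine ⟨hm, fun p => ?_⟩
  -- Writing `a B + U` as the convex combination of `B` and `(1 - a)⁻¹ U` with weights `a` and `1 -
  -- a` lets the convexity of the power `p` propagate the bound.
  obtain ⟨D, hD⟩ := (hU.const_mul (1 - a)⁻¹).bound p
  lift a to ℝ≥0 using ha
  have ha1' : (a : ℝ≥0) ≤ 1 := by exact_mod_cast ha1.le
  have hsub : ((1 - a : ℝ≥0) : ℝ) = 1 - a := NNReal.coe_sub ha1'
  obtain ⟨D0, hD0⟩ := (const (P := P) x).bound p
  refine ⟨D0 + D, fun k => ?_⟩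
  induction k with
  | zero => simp only [h0]; exact (hD0 0).trans (by simp)
  | succ k ih =>
    have hpt : ∀ ω, ‖B (k + 1) ω‖ₑ ^ p ≤ a * ‖B k ω‖ₑ ^ p
        + (1 - a : ℝ≥0) * ‖(1 - (a : ℝ))⁻¹ * U k ω‖ₑ ^ p := by
      intro ω
      have h1 : ‖B (k + 1) ω‖₊ ≤ a * ‖B k ω‖₊ + (1 - a) * ‖(1 - (a : ℝ))⁻¹ * U k ω‖₊ := by
        rw [← NNReal.coe_le_coe]
        push_cast
        rw [hsub, hB, norm_mul, norm_inv, Real.norm_of_nonneg (by linarith : 0 ≤ 1 - (a : ℝ)),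
          mul_inv_cancel_left₀ (by linarith)]
        refine (norm_add_le _ _).trans ?_
        rw [norm_mul, Real.norm_of_nonneg a.coe_nonneg]
      have h2 : ‖B (k + 1) ω‖₊ ^ p ≤ a * ‖B k ω‖₊ ^ p
          + (1 - a) * ‖(1 - (a : ℝ))⁻¹ * U k ω‖₊ ^ p := by
        refine (pow_le_pow_left' h1 p).trans ?_
        have hc : (a : ℝ) + ((1 - a : ℝ≥0) : ℝ) = 1 := by rw [hsub]; ring
        have := (convexOn_pow p).2 (Set.mem_Ici.2 (NNReal.coe_nonneg ‖B k ω‖₊))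
          (Set.mem_Ici.2 (NNReal.coe_nonneg ‖(1 - (a : ℝ))⁻¹ * U k ω‖₊)) a.coe_nonneg
          (NNReal.coe_nonneg _) hc
        rw [← NNReal.coe_le_coe]
        simpa only [smul_eq_mul, NNReal.coe_add, NNReal.coe_mul, NNReal.coe_pow] using this
      have h3 := ENNReal.coe_le_coe.2 h2
      push_cast at h3
      simpa [enorm_eq_nnnorm] using h3
    calc ∫⁻ ω, ‖B (k + 1) ω‖ₑ ^ p ∂P
        ≤ ∫⁻ ω, (a * ‖B k ω‖ₑ ^ p + (1 - a : ℝ≥0) * ‖(1 - (a : ℝ))⁻¹ * U k ω‖ₑ ^ p) ∂P :=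
          lintegral_mono hpt
      _ = a * ∫⁻ ω, ‖B k ω‖ₑ ^ p ∂P + (1 - a : ℝ≥0) * ∫⁻ ω, ‖(1 - (a : ℝ))⁻¹ * U k ω‖ₑ ^ p ∂P := by
          rw [lintegral_add_left' (((hm k).enorm.pow_const p).const_mul _),
            lintegral_const_mul' _ _ (by simp), lintegral_const_mul' _ _ (by simp)]
      _ ≤ a * ((D0 + D : ℝ≥0) : ENNReal) + (1 - a : ℝ≥0) * D := by
          gcongr
          exact hD k
      _ ≤ ((D0 + D : ℝ≥0) : ENNReal) := by
          rw [← ENNReal.coe_mul, ← ENNReal.coe_mul, ← ENNReal.coe_add, ENNReal.coe_le_coe,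
            ← NNReal.coe_le_coe]
          push_cast
          rw [hsub]
          nlinarith [mul_nonneg (sub_nonneg.2 ha1.le) D0.2]

lemma exists_lintegral_le (hU : HasUniformMoments P U) :
    ∃ C : ℝ≥0, ∀ k, ∫⁻ ω, ‖U k ω‖ₑ ∂P ≤ C := by simpa using hU.bound 1

lemma memLp_two (hU : HasUniformMoments P U) (k : ℕ) : MemLp (U k) 2 P := by
  refine ⟨(hU.aemeasurable k).aestronglyMeasurable, ?_⟩
  rw [eLpNorm_lt_top_iff_lintegral_rpow_enorm_lt_top (by norm_num) (by norm_num)]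
  obtain ⟨C, hC⟩ := hU.bound 2
  refine lt_of_le_of_lt (le_of_eq ?_) ((hC k).trans_lt ENNReal.coe_lt_top)
  refine lintegral_congr fun ω => ?_
  rw [← ENNReal.rpow_natCast]
  simp

lemma integrable (hU : HasUniformMoments P U) (k : ℕ) : Integrable (U k) P := by
  obtain ⟨C, hC⟩ := hU.exists_lintegral_le
  exact ⟨(hU.aemeasurable k).aestronglyMeasurable, (hC k).trans_lt ENNReal.coe_lt_top⟩

lemma exists_integral_sq_le (hU : HasUniformMoments P U) :
    ∃ C : ℝ, 0 ≤ C ∧ ∀ k, ∫ ω, U k ω ^ 2 ∂P ≤ C := by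
  obtain ⟨C, hC⟩ := hU.bound 2
  refine ⟨C, C.2, fun k => ?_⟩
  rw [integral_eq_lintegral_of_nonneg_ae (.of_forall fun ω => sq_nonneg _)
    ((hU.aemeasurable k).pow_const 2).aestronglyMeasurable]
  refine ENNReal.toReal_le_of_le_ofReal C.2 ?_
  rw [ENNReal.ofReal_coe_nnreal]
  refine le_trans (le_of_eq (lintegral_congr fun ω => ?_)) (hC k)
  rw [← enorm_pow, Real.enorm_eq_ofReal (sq_nonneg _)]

lemma lintegral_average_le {C : ℝ≥0} (hU : ∀ k, AEMeasurable (U k) P)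
    (hC : ∀ k, ∫⁻ ω, ‖U k ω‖ₑ ∂P ≤ C) (n : ℕ) :
    ∫⁻ ω, ‖(n : ℝ)⁻¹ * ∑ k ∈ Finset.range n, U k ω‖ₑ ∂P ≤ C := by
  calc ∫⁻ ω, ‖(n : ℝ)⁻¹ * ∑ k ∈ Finset.range n, U k ω‖ₑ ∂P
      ≤ ∫⁻ ω, ‖(n : ℝ)⁻¹‖ₑ * ∑ k ∈ Finset.range n, ‖U k ω‖ₑ ∂P := by
        refine lintegral_mono fun ω => ?_
        rw [enorm_mul]
        gcongr
        exact enorm_sum_le _ _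
    _ = ‖(n : ℝ)⁻¹‖ₑ * ∑ k ∈ Finset.range n, ∫⁻ ω, ‖U k ω‖ₑ ∂P := by
        rw [lintegral_const_mul' _ _ (by simp), lintegral_finsetSum' _ fun k _ => (hU k).enorm]
    _ ≤ ‖(n : ℝ)⁻¹‖ₑ * ∑ k ∈ Finset.range n, (C : ENNReal) := by gcongr; exact hC _
    _ ≤ C := by
        rw [Finset.sum_const, Finset.card_range, nsmul_eq_mul, ← mul_assoc]
        refine mul_le_of_le_one_left' ?_
        rcases eq_or_ne n 0 with rfl | hn
        · simp
        · rw [enorm_inv (by simpa using hn), Real.enorm_natCast]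
          exact ENNReal.inv_mul_le_one _

lemma average (hU : HasUniformMoments P U) :
    BoundedInProb P (fun n ω => (n : ℝ)⁻¹ * ∑ k ∈ Finset.range n, U k ω) := by
  obtain ⟨C, hC⟩ := hU.exists_lintegral_le
  refine BoundedInProb.of_lintegral (fun n => ?_) (fun n => lintegral_average_le hU.aemeasurable hC n)
  exact (Finset.aemeasurable_fun_sum _ fun k _ => hU.aemeasurable k).const_mul _

lemma boundedInProb (hU : HasUniformMoments P U) : BoundedInProb P U := by
  obtain ⟨C, hC⟩ := hU.exists_lintegral_le
  exact BoundedInProb.of_lintegral hU.aemeasurable hC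

end HasUniformMoments

end Stochastic

/-! ### Counts with conditional Poisson laws -/

section Model

variable {Ω : Type*} [mΩ : MeasurableSpace Ω] {P : Measure Ω}

/-- One-sided sequence of counts `Y k` whose conditional law given `ℱ k` is Poisson with
mean `lam k`. -/
structure PoissonCounts (P : Measure Ω) (ℱ : Filtration ℕ mΩ) (Y : ℕ → Ω → ℕ)
    (lam : ℕ → Ω → ℝ≥0) : Prop where
  measurable_count : ∀ k, Measurable[ℱ (k + 1)] (Y k)
  measurable_rate : ∀ k, Measurable[ℱ k] (lam k)
  law : ∀ k j (B : Set Ω), MeasurableSet[ℱ k] B →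
    P (B ∩ Y k ⁻¹' {j}) = ∫⁻ ω in B, poissonMeasure (lam k ω) {j} ∂P

namespace PoissonCounts

variable {ℱ : Filtration ℕ mΩ} {Y : ℕ → Ω → ℕ} {lam : ℕ → Ω → ℝ≥0}

lemma measurable_count' (h : PoissonCounts P ℱ Y lam) (k : ℕ) : Measurable (Y k) :=
  (h.measurable_count k).mono (ℱ.le _) le_rfl

lemma measurable_rate' (h : PoissonCounts P ℱ Y lam) (k : ℕ) : Measurable (lam k) :=
  (h.measurable_rate k).mono (ℱ.le _) le_rfl

lemma measurable_singleton_mass (h : PoissonCounts P ℱ Y lam) (k j : ℕ) :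
    Measurable[ℱ k] (fun ω => poissonMeasure (lam k ω) {j}) := by
  have h1 : Measurable (fun a : ℝ≥0 => poissonMeasure a {j}) := by
    simp_rw [poissonMeasure_singleton]
    fun_prop
  exact h1.comp (h.measurable_rate k)

/-- The conditional law as an equality of measures on the past: restricting to one value of the
count amounts to weighting by its Poisson mass. Integrals of functions of the past follow. -/
lemma trim_restrict_eq (h : PoissonCounts P ℱ Y lam) (k j : ℕ) :
    (P.restrict (Y k ⁻¹' {j})).trim (ℱ.le k)
      = (P.withDensity fun ω => poissonMeasure (lam k ω) {j}).trim (ℱ.le k) := by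
  refine @Measure.ext _ (ℱ k) _ _ fun B hB => ?_
  have hY : MeasurableSet (Y k ⁻¹' {j}) := h.measurable_count' k (measurableSet_singleton j)
  rw [trim_measurableSet_eq _ hB, trim_measurableSet_eq _ hB, Measure.restrict_apply' hY,
    withDensity_apply _ (ℱ.le k _ hB), h.law k j B hB]

lemma setLIntegral_fiber (h : PoissonCounts P ℱ Y lam) (k j : ℕ) {g : Ω → ENNReal}
    (hg : Measurable[ℱ k] g) :
    ∫⁻ ω in Y k ⁻¹' {j}, g ω ∂P = ∫⁻ ω, poissonMeasure (lam k ω) {j} * g ω ∂P := by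
  rw [← lintegral_trim (ℱ.le k) hg, h.trim_restrict_eq, lintegral_trim (ℱ.le k) hg,
    lintegral_withDensity_eq_lintegral_mul _
      ((h.measurable_singleton_mass k j).mono (ℱ.le k) le_rfl) (hg.mono (ℱ.le k) le_rfl)]
  rfl

variable {E : Type*} [NormedAddCommGroup E] [NormedSpace ℝ E]

lemma setIntegral_fiber (h : PoissonCounts P ℱ Y lam) (k j : ℕ) {g : Ω → E}
    (hg : StronglyMeasurable[ℱ k] g) :
    ∫ ω in Y k ⁻¹' {j}, g ω ∂P = ∫ ω, (poissonMeasure (lam k ω)).real {j} • g ω ∂P := by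
  rw [integral_trim (ℱ.le k) hg, h.trim_restrict_eq, ← integral_trim (ℱ.le k) hg,
    integral_withDensity_eq_integral_toReal_smul
      ((h.measurable_singleton_mass k j).mono (ℱ.le k) le_rfl)
      (.of_forall fun ω => measure_lt_top _ _)]
  rfl

/-- Disintegration of the joint law of the past and the next count. -/
lemma lintegral_count (h : PoissonCounts P ℱ Y lam) (k : ℕ) {g : Ω → ℕ → ENNReal}
    (hg : ∀ j, Measurable[ℱ k] fun ω => g ω j) :
    ∫⁻ ω, g ω (Y k ω) ∂P = ∫⁻ ω, ∫⁻ j, g ω j ∂poissonMeasure (lam k ω) ∂P := by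
  have h1 : ∀ ω, g ω (Y k ω) = ∑' j, (Y k ⁻¹' {j}).indicator (fun ω => g ω j) ω := by
    intro ω
    rw [tsum_eq_single (Y k ω)]
    · simp
    · intro j hj
      simp [hj.symm]
  have hY : ∀ j, MeasurableSet (Y k ⁻¹' {j}) := fun j =>
    h.measurable_count' k (measurableSet_singleton j)
  simp_rw [h1]
  rw [lintegral_tsum fun j =>
    (((hg j).mono (ℱ.le k) le_rfl).indicator (hY j)).aemeasurable]
  simp_rw [lintegral_countable']
  rw [lintegral_tsum (f := fun j ω => g ω j * poissonMeasure (lam k ω) {j})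
    fun j => (((hg j).mono (ℱ.le k) le_rfl).mul
    ((h.measurable_singleton_mass k j).mono (ℱ.le k) le_rfl)).aemeasurable]
  congr with j
  rw [lintegral_indicator (hY j), h.setLIntegral_fiber k j (hg j)]
  simp_rw [mul_comm]

lemma setIntegral_fiber_congr (h : PoissonCounts P ℱ Y lam) (k j : ℕ) (g : Ω → ℕ → E) :
    ∫ ω in Y k ⁻¹' {j}, g ω (Y k ω) ∂P = ∫ ω in Y k ⁻¹' {j}, g ω j ∂P := by
  refine setIntegral_congr_fun (h.measurable_count' k (measurableSet_singleton j)) fun ω hω => ?_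
  simp only [Set.mem_preimage, Set.mem_singleton_iff] at hω
  simp [hω]

/-- The integral is split over the value of the count. The same splitting applied to the norm gives
the summability that allows sum and integral to be exchanged. -/
lemma integral_count [FiniteDimensional ℝ E] (h : PoissonCounts P ℱ Y lam) (k : ℕ) {g : Ω → ℕ → E}
    (hg : ∀ j, StronglyMeasurable[ℱ k] fun ω => g ω j)
    (hi : Integrable (fun ω => g ω (Y k ω)) P) :
    ∫ ω, g ω (Y k ω) ∂P = ∫ ω, ∫ j, g ω j ∂poissonMeasure (lam k ω) ∂P := by
  have hY : ∀ j, MeasurableSet (Y k ⁻¹' {j}) := fun j =>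
    h.measurable_count' k (measurableSet_singleton j)
  have hdisj : Pairwise (Function.onFun Disjoint fun j => Y k ⁻¹' {j}) := by
    intro i j hij
    exact Disjoint.preimage _ (by simpa using hij)
  have hun : (⋃ j, Y k ⁻¹' {j}) = Set.univ := by
    ext ω; simp
  have s1 : HasSum (fun j => ∫ ω, (poissonMeasure (lam k ω)).real {j} • g ω j ∂P)
      (∫ ω, g ω (Y k ω) ∂P) := by
    have := hasSum_integral_iUnion hY hdisj (f := fun ω => g ω (Y k ω)) (μ := P)
      hi.integrableOn
    rw [hun, setIntegral_univ] at this
    simp_rw [h.setIntegral_fiber_congr k _ g, h.setIntegral_fiber k _ (hg _)] at this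
    exact this
  have s2 : Summable (fun j => ∫ ω, ‖(poissonMeasure (lam k ω)).real {j} • g ω j‖ ∂P) := by
    have := (hasSum_integral_iUnion hY hdisj (f := fun ω => ‖g ω (Y k ω)‖) (μ := P)
      hi.norm.integrableOn).summable
    simp_rw [h.setIntegral_fiber_congr k _ (fun ω j => ‖g ω j‖), h.setIntegral_fiber k _ (hg _).norm] at this
    simpa [norm_smul, abs_of_nonneg measureReal_nonneg] using this
  have hmeas : ∀ j, StronglyMeasurable[ℱ k]
      (fun ω => (poissonMeasure (lam k ω)).real {j} • g ω j) := fun j =>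
    ((h.measurable_singleton_mass k j).ennreal_toReal.stronglyMeasurable).smul (hg j)
  have s3 : ∀ j, Integrable (fun ω => (poissonMeasure (lam k ω)).real {j} • g ω j) P := by
    intro j
    have h1 : ∫⁻ ω, ‖(poissonMeasure (lam k ω)).real {j} • g ω j‖ₑ ∂P
        = ∫⁻ ω in Y k ⁻¹' {j}, ‖g ω j‖ₑ ∂P := by
      rw [h.setLIntegral_fiber k j (hg j).enorm]
      refine lintegral_congr fun ω => ?_
      rw [enorm_smul, measureReal_def, Real.enorm_eq_ofReal ENNReal.toReal_nonneg,
        ENNReal.ofReal_toReal (measure_ne_top _ _)]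
    refine ⟨((hmeas j).mono (ℱ.le k)).aestronglyMeasurable, ?_⟩
    rw [HasFiniteIntegral, h1]
    have h2 : ∫⁻ ω in Y k ⁻¹' {j}, ‖g ω j‖ₑ ∂P = ∫⁻ ω in Y k ⁻¹' {j}, ‖g ω (Y k ω)‖ₑ ∂P := by
      refine setLIntegral_congr_fun (hY j) fun ω hω => ?_
      simp only [Set.mem_preimage, Set.mem_singleton_iff] at hω
      simp [hω]
    rw [h2]
    exact (setLIntegral_le_lintegral _ _).trans_lt hi.2
  rw [← s1.tsum_eq, (hasSum_integral_of_summable_integral_norm s3 s2).tsum_eq]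
  refine integral_congr_ae (.of_forall fun ω => ?_)
  simp only [integral_poissonMeasure, poissonMeasure_real_singleton]

/-- A count minus its conditional mean, and more generally a function of the count with zero
conditional mean, is orthogonal to the past. -/
lemma integral_eq_zero_of_past (h : PoissonCounts P ℱ Y lam) (k : ℕ) {G : Ω → ℝ} {e : ℕ → ℝ≥0 → ℝ}
    (hG : Measurable[ℱ k] G) (he : ∀ j, Measurable (e j))
    (hz : ∀ l, ∫ j, e j l ∂poissonMeasure l = 0)
    (hi : Integrable (fun ω => G ω * e (Y k ω) (lam k ω)) P) :
    ∫ ω, G ω * e (Y k ω) (lam k ω) ∂P = 0 := by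
  rw [h.integral_count k (g := fun ω j => G ω * e j (lam k ω)) ?_ hi]
  · simp [integral_const_mul, hz]
  · intro j
    exact (hG.mul ((he j).comp (h.measurable_rate k))).stronglyMeasurable

end PoissonCounts

/-! ### Weak laws of large numbers -/

/-- Adding one variable creates cross terms with the preceding ones. At most `N` of these are close
enough to be bounded only by `A`, and each of the others is at most `ε`. -/
lemma integral_sq_sum_le [IsProbabilityMeasure P] {u : ℕ → Ω → ℝ} (hu : ∀ k, MemLp (u k) 2 P)
    {A ε : ℝ} (hA : ∀ k, ∫ ω, u k ω ^ 2 ∂P ≤ A) (hε : 0 ≤ ε) {N : ℕ}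
    (h : ∀ k l, k + N ≤ l → k < l → |∫ ω, u k ω * u l ω ∂P| ≤ ε) (n : ℕ) :
    ∫ ω, (∑ k ∈ Finset.range n, u k ω) ^ 2 ∂P ≤ n * ((2 * N + 1) * A) + ε * n ^ 2 := by
  have hA0 : 0 ≤ A := (integral_nonneg fun ω => sq_nonneg _).trans (hA 0)
  have hmul : ∀ k l, Integrable (fun ω => u k ω * u l ω) P := fun k l =>
    MemLp.integrable_mul (hu k) (hu l)
  have hkl : ∀ k l, |∫ ω, u k ω * u l ω ∂P| ≤ A := by
    intro k l
    have h1 : ∫ ω, |u k ω * u l ω| ∂P ≤ ∫ ω, (u k ω ^ 2 + u l ω ^ 2) / 2 ∂P := by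
      refine integral_mono (hmul k l).abs
        (((hu k).integrable_sq.add (hu l).integrable_sq).div_const 2) fun ω => ?_
      rw [abs_mul]
      nlinarith [sq_nonneg (|u k ω| - |u l ω|), sq_abs (u k ω), sq_abs (u l ω)]
    rw [integral_div, integral_add (hu k).integrable_sq (hu l).integrable_sq] at h1
    refine (abs_integral_le_integral_abs).trans (h1.trans ?_)
    linarith [hA k, hA l]
  induction n with
  | zero => simp
  | succ n ih =>
    have hS : MemLp (fun ω => ∑ k ∈ Finset.range n, u k ω) 2 P :=
      memLp_finsetSum _ fun k _ => hu k
    have hcross : |∫ ω, (∑ k ∈ Finset.range n, u k ω) * u n ω ∂P| ≤ N * A + n * ε := by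
      simp_rw [Finset.sum_mul]
      rw [integral_finsetSum _ fun k _ => hmul k n]
      refine (Finset.abs_sum_le_sum_abs _ _).trans ?_
      calc ∑ k ∈ Finset.range n, |∫ ω, u k ω * u n ω ∂P|
          ≤ ∑ k ∈ Finset.range n, ((if n < k + N then A else 0) + ε) := by
            refine Finset.sum_le_sum fun k hk => ?_
            split_ifs with hkn
            · linarith [hkl k n]
            · simpa using h k n (by omega) (Finset.mem_range.1 hk)
        _ = ((Finset.range n).filter (fun k => n < k + N)).card * A + n * ε := by
            rw [Finset.sum_add_distrib, ← Finset.sum_filter]; simp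
        _ ≤ N * A + n * ε := by
            gcongr
            calc ((Finset.range n).filter (fun k => n < k + N)).card
                ≤ (Finset.Ico (n + 1 - N) n).card := by
                  refine Finset.card_le_card fun k hk => ?_
                  simp only [Finset.mem_filter, Finset.mem_range, Finset.mem_Ico] at hk ⊢
                  omega
              _ ≤ N := by simp; omega
    simp_rw [Finset.sum_range_succ, add_sq]
    have i1 := hS.integrable_sq
    have i2 : Integrable (fun ω => 2 * (∑ k ∈ Finset.range n, u k ω) * u n ω) P := by
      simpa [mul_assoc] using (MemLp.integrable_mul hS (hu n)).const_mul 2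
    have i3 : Integrable (fun ω => (∑ k ∈ Finset.range n, u k ω) ^ 2
        + 2 * (∑ k ∈ Finset.range n, u k ω) * u n ω) P := i1.add i2
    rw [integral_add i3 (hu n).integrable_sq, integral_add i1 i2]
    simp_rw [mul_assoc]
    rw [integral_const_mul]
    have := (abs_le.1 hcross).2
    have := hA n
    push_cast
    nlinarith

lemma lintegral_enorm_le_of_integral_sq_le [IsProbabilityMeasure P] {U : Ω → ℝ} (hU : MemLp U 2 P)
    {C : ℝ} (hC : ∫ ω, U ω ^ 2 ∂P ≤ C) : ∫⁻ ω, ‖U ω‖ₑ ∂P ≤ ENNReal.ofReal (√C) := by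
  rw [← ofReal_integral_norm_eq_lintegral_enorm (hU.integrable one_le_two)]
  refine ENNReal.ofReal_le_ofReal (Real.le_sqrt_of_sq_le (le_trans ?_ hC))
  have h1 : ∫ ω, (‖U ω‖ - ∫ ω, ‖U ω‖ ∂P) ^ 2 ∂P
      = ∫ ω, U ω ^ 2 ∂P - (∫ ω, ‖U ω‖ ∂P) ^ 2 := by
    have e : ∀ ω, (‖U ω‖ - ∫ ω, ‖U ω‖ ∂P) ^ 2
        = U ω ^ 2 - 2 * (∫ ω, ‖U ω‖ ∂P) * ‖U ω‖ + (∫ ω, ‖U ω‖ ∂P) ^ 2 := by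
      intro ω
      rw [sub_sq, Real.norm_eq_abs, sq_abs]; ring
    have i1 := (hU.integrable one_le_two).norm
    simp_rw [e]
    have i2 : Integrable (fun ω => U ω ^ 2 - 2 * (∫ ω, ‖U ω‖ ∂P) * ‖U ω‖) P :=
      hU.integrable_sq.sub (i1.const_mul _)
    rw [integral_add i2 (integrable_const _),
      integral_sub hU.integrable_sq (i1.const_mul _), integral_const_mul]
    simp
    ring
  have h2 : 0 ≤ ∫ ω, (‖U ω‖ - ∫ ω, ‖U ω‖ ∂P) ^ 2 ∂P := integral_nonneg fun ω => sq_nonneg _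
  linarith

/-- Averages of a weakly correlated sequence tend to zero in `L¹`. -/
lemma tendsto_lintegral_average_of_correlation [IsProbabilityMeasure P] {u : ℕ → Ω → ℝ}
    (hu : ∀ k, MemLp (u k) 2 P) {A : ℝ} (hA : ∀ k, ∫ ω, u k ω ^ 2 ∂P ≤ A)
    (h : ∀ ε > 0, ∃ N : ℕ, ∀ k l, k + N ≤ l → k < l → |∫ ω, u k ω * u l ω ∂P| ≤ ε) :
    Tendsto (fun n : ℕ => ∫⁻ ω, ‖(n : ℝ)⁻¹ * ∑ k ∈ Finset.range n, u k ω‖ₑ ∂P) atTop (𝓝 0) := by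
  have hS : ∀ n : ℕ, MemLp (fun ω => (n : ℝ)⁻¹ * ∑ k ∈ Finset.range n, u k ω) 2 P := fun n =>
    (memLp_finsetSum _ fun k _ => hu k).const_mul _
  have key : Tendsto (fun n : ℕ => ∫ ω, ((n : ℝ)⁻¹ * ∑ k ∈ Finset.range n, u k ω) ^ 2 ∂P) atTop
      (𝓝 0) := by
    rw [Metric.tendsto_atTop]
    intro ε hε
    obtain ⟨N, hN⟩ := h (ε / 2) (by positivity)
    have h1 : Tendsto (fun n : ℕ => (n : ℝ)⁻¹ * ((2 * N + 1) * A)) atTop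
        (𝓝 (0 * ((2 * N + 1) * A))) := tendsto_inv_atTop_nhds_zero_nat.mul_const _
    rw [zero_mul] at h1
    obtain ⟨M, hM⟩ := eventually_atTop.1 (h1.eventually_lt_const (u := ε / 2) (by positivity))
    refine ⟨max M 1, fun n hn => ?_⟩
    have hn1 : 0 < (n : ℝ) := by
      have : 1 ≤ n := le_trans (le_max_right _ _) hn
      positivity
    rw [Real.dist_eq, sub_zero, abs_of_nonneg (integral_nonneg fun ω => sq_nonneg _)]
    simp_rw [mul_pow]
    rw [integral_const_mul]
    have h2 := integral_sq_sum_le hu hA (by positivity) hN n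
    calc ((n : ℝ)⁻¹) ^ 2 * ∫ ω, (∑ k ∈ Finset.range n, u k ω) ^ 2 ∂P
        ≤ ((n : ℝ)⁻¹) ^ 2 * (n * ((2 * N + 1) * A) + ε / 2 * n ^ 2) := by gcongr
      _ = (n : ℝ)⁻¹ * ((2 * N + 1) * A) + ε / 2 := by field_simp
      _ < ε := by linarith [hM n (le_trans (le_max_left _ _) hn)]
  have h2 : Tendsto (fun n : ℕ => ENNReal.ofReal
      (√(∫ ω, ((n : ℝ)⁻¹ * ∑ k ∈ Finset.range n, u k ω) ^ 2 ∂P))) atTop (𝓝 0) := by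
    have := ENNReal.tendsto_ofReal (key.sqrt)
    simpa using this
  exact tendsto_of_tendsto_of_tendsto_of_le_of_le tendsto_const_nhds h2 (fun _ => zero_le)
    (fun n => lintegral_enorm_le_of_integral_sq_le (hS n) le_rfl)

end Model

/-! ### Ergodic limits and laws of large numbers for the chain -/

namespace PoissonChain

variable {S : Type*} [NormedAddCommGroup S] (c : PoissonChain S)

/-- The transition operator on nonnegative functions. -/
noncomputable def lop (F : S → ENNReal) (s : S) : ENNReal :=
  ∫⁻ k, F (c.step k s) ∂poissonMeasure (c.rate s)

lemma lop_mono {F G : S → ENNReal} (h : ∀ x, F x ≤ G x) (x : S) : c.lop F x ≤ c.lop G x :=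
  lintegral_mono fun _ => h _

lemma edist_op_iterate_const_le {f : S → ℝ} {B : ℝ} (hf : ∀ s, |f s| ≤ B) (b : ℝ) (m : ℕ) (x : S) :
    edist (c.op^[m] f x) b ≤ c.lop^[m] (fun x => edist (f x) b) x := by
  induction m generalizing x with
  | zero => simp
  | succ m ih =>
    rw [Function.iterate_succ_apply', Function.iterate_succ_apply']
    refine le_trans ?_ (c.lop_mono ih x)
    have hb := c.abs_op_iterate_le hf m
    have : c.op (c.op^[m] f) x - b
        = ∫ k, (c.op^[m] f (c.step k x) - b) ∂poissonMeasure (c.rate x) := by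
      rw [integral_sub (integrable_poissonMeasure_of_bounded fun k => hb _) (integrable_const _)]
      simp [op]
    rw [edist_eq_enorm_sub, this]
    refine (enorm_integral_le_lintegral_enorm _).trans (le_of_eq ?_)
    simp [lop, edist_eq_enorm_sub]

lemma lop_iterate_V_le (a b : ℝ≥0) (m : ℕ) (x : S) :
    c.lop^[m] (fun x => a + b * c.V x) x ≤ a + b * (c.V x + c.driftConst) := by
  have key : ∀ (d e : ℝ≥0) (x : S), c.lop (fun x => d + e * c.V x) x
      ≤ d + e * (c.γ * c.V x + c.C) := by
    intro d e x
    rw [lop, lintegral_add_left .of_discrete, lintegral_const_mul _ .of_discrete]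
    simp only [lintegral_const, measure_univ, mul_one]
    gcongr
    exact c.drift x
  have hγ1 : c.γ ≤ 1 := c.γ_lt_one.le
  have aux : ∀ (m : ℕ) (x : S), c.lop^[m] (fun x => a + b * c.V x) x
      ≤ ((a + b * c.C * ∑ i ∈ Finset.range m, c.γ ^ i : ℝ≥0) : ENNReal)
        + ((b * c.γ ^ m : ℝ≥0) : ENNReal) * c.V x := by
    intro m
    induction m with
    | zero => intro x; simp
    | succ m ih =>
      intro x
      rw [Function.iterate_succ_apply']
      refine (c.lop_mono ih x).trans ((key _ _ x).trans (le_of_eq ?_))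
      rw [Finset.sum_range_succ]
      push_cast
      ring
  refine (aux m x).trans ?_
  have h2 : c.C * ∑ i ∈ Finset.range m, c.γ ^ i ≤ c.driftConst := by
    have h1 : (0 : ℝ) < 1 - c.γ := by have := c.γ_lt_one; rw [sub_pos]; exact_mod_cast this
    rw [driftConst, ← NNReal.coe_le_coe]
    push_cast [NNReal.coe_sub c.γ_lt_one.le]
    rw [le_div_iff₀ h1, mul_assoc, mul_comm (Finset.sum _ _), mul_neg_geom_sum]
    have : (0 : ℝ) ≤ c.γ ^ m := by positivity
    nlinarith [c.C.2, mul_nonneg c.C.2 this]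
  have h3 : c.γ ^ m ≤ 1 := pow_le_one' hγ1 m
  have e : (a : ENNReal) + (b : ENNReal) * (c.V x + c.driftConst)
      = ((a + b * c.driftConst : ℝ≥0) : ENNReal) + ((b * 1 : ℝ≥0) : ENNReal) * c.V x := by
    push_cast; ring
  rw [e, mul_assoc b]
  gcongr

/-- The iterates of the transition operator on `f` tend to the constant `m`. -/
def ErgodicTo (f : S → ℝ) (m : ℝ) : Prop :=
  ∀ ε > 0, ∃ N, ∀ n ≥ N, ∀ x, |c.op^[n] f x - m| ≤ ε * (1 + c.V x)

/-- The value at `0` after `k + n` steps is an average, over the state reached after `k` steps, of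
the `n`-th iterate. By forgetting, that iterate is nearly constant up to the weight `V`, whose
averages are bounded in `k`. So the values at `0` form a Cauchy sequence, and no invariant law has
to be constructed. -/
theorem exists_ergodicTo {f : S → ℝ} {B L : ℝ≥0} (hf : ∀ s, |f s| ≤ B)
    (hL : LipschitzWith L f) : ∃ m, c.ErgodicTo f m := by
  set K : ℝ := 1 + 2 * c.V 0 + c.driftConst with hK
  have hK0 : 0 < K := by positivity
  have h1 : ∀ ε > 0, ∃ N, ∀ n ≥ N, ∀ k, |c.op^[k + n] f 0 - c.op^[n] f 0| ≤ ε * K := by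
    intro ε hε
    obtain ⟨N, hN⟩ := c.exists_abs_op_iterate_sub_le hf hL hε
    refine ⟨N, fun n hn k => ?_⟩
    have h2 := c.edist_op_iterate_const_le (c.abs_op_iterate_le hf n) (c.op^[n] f 0) k 0
    rw [← Function.iterate_add_apply] at h2
    lift ε to ℝ≥0 using hε.le
    have h3 : ∀ x, edist (c.op^[n] f x) (c.op^[n] f 0)
        ≤ ((ε * (1 + c.V 0) : ℝ≥0) : ENNReal) + (ε : ENNReal) * c.V x := by
      intro x
      rw [edist_dist, Real.dist_eq]
      have : ((ε * (1 + c.V 0) : ℝ≥0) : ENNReal) + (ε : ENNReal) * c.V x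
          = ENNReal.ofReal (ε * (1 + c.V x + c.V 0)) := by
        have e : (ε * (1 + c.V x + c.V 0) : ℝ) = ((ε * (1 + c.V 0) + ε * c.V x : ℝ≥0) : ℝ) := by
          push_cast; ring
        rw [e, ENNReal.ofReal_coe_nnreal]; push_cast; rfl
      rw [this]
      exact ENNReal.ofReal_le_ofReal (hN n hn x 0)
    have h4 : ∀ (m : ℕ) (x : S), c.lop^[m] (fun x => edist (c.op^[n] f x) (c.op^[n] f 0)) x
        ≤ c.lop^[m] (fun x => ((ε * (1 + c.V 0) : ℝ≥0) : ENNReal) + (ε : ENNReal) * c.V x) x := by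
      intro m
      induction m with
      | zero => exact h3
      | succ m ih =>
        intro x
        simp only [Function.iterate_succ_apply']
        exact c.lop_mono ih x
    have h5 := h2.trans ((h4 k 0).trans (c.lop_iterate_V_le _ _ k 0))
    rw [edist_dist, Real.dist_eq] at h5
    have h6 : ((ε * (1 + c.V 0) : ℝ≥0) : ENNReal) + (ε : ENNReal) * (c.V 0 + c.driftConst)
        = ENNReal.ofReal (ε * K) := by
      have e : (ε * K : ℝ) = ((ε * (1 + c.V 0) + ε * (c.V 0 + c.driftConst) : ℝ≥0) : ℝ) := by
        rw [hK]; push_cast; ring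
      rw [e, ENNReal.ofReal_coe_nnreal]; push_cast; rfl
    rw [h6] at h5
    exact (ENNReal.ofReal_le_ofReal_iff (by positivity)).1 h5
  have hc : CauchySeq (fun n => c.op^[n] f 0) := by
    refine Metric.cauchySeq_iff'.2 fun ε hε => ?_
    obtain ⟨N, hN⟩ := h1 (ε / 2 / K) (by positivity)
    refine ⟨N, fun n hn => ?_⟩
    have := hN N le_rfl (n - N)
    rw [Nat.sub_add_cancel hn, div_mul_cancel₀ _ hK0.ne'] at this
    rw [Real.dist_eq]
    linarith
  obtain ⟨m, hm⟩ := cauchySeq_tendsto_of_complete hc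
  refine ⟨m, fun ε hε => ?_⟩
  obtain ⟨N, hN⟩ := c.exists_abs_op_iterate_sub_le hf hL (ε := ε / 2 / (1 + c.V 0)) (by positivity)
  obtain ⟨N', hN'⟩ := h1 (ε / 2 / K) (by positivity)
  refine ⟨max N N', fun n hn x => ?_⟩
  have h2 : |c.op^[n] f 0 - m| ≤ ε / 2 := by
    have h3 : Tendsto (fun k => |c.op^[k + n] f 0 - c.op^[n] f 0|) atTop
        (𝓝 |m - c.op^[n] f 0|) := ((hm.comp (tendsto_add_atTop_nat n)).sub_const _).abs
    rw [abs_sub_comm]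
    refine le_of_tendsto h3 (.of_forall fun k => ?_)
    have := hN' n (le_trans (le_max_right _ _) hn) k
    rwa [div_mul_cancel₀ _ hK0.ne'] at this
  have h3 := hN n (le_trans (le_max_left _ _) hn) x 0
  have h4 : ε / 2 / (1 + c.V 0) * (1 + c.V x + c.V 0) ≤ ε / 2 * (1 + c.V x) := by
    rw [div_mul_eq_mul_div, div_le_iff₀ (by positivity)]
    have : (0 : ℝ) ≤ c.V x * c.V 0 := by positivity
    nlinarith
  have h5 := abs_sub_le (c.op^[n] f x) (c.op^[n] f 0) m
  have h6 : (0 : ℝ) ≤ c.V x := (c.V x).2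
  nlinarith

variable {Ω : Type*} [mΩ : MeasurableSpace Ω] [MeasurableSpace S]

/-- The process `X`, with counts `Y`, is a realization of the chain. -/
structure IsRealizedBy (P : Measure Ω) (ℱ : Filtration ℕ mΩ) (Y : ℕ → Ω → ℕ)
    (X : ℕ → Ω → S) : Prop where
  counts : PoissonCounts P ℱ Y (fun k ω => c.rate (X k ω))
  measurable : ∀ k, Measurable[ℱ k] (X k)
  step_eq : ∀ k ω, X (k + 1) ω = c.step (Y k ω) (X k ω)

/-- The law `μ` describes the long-run behaviour of the chain. -/
def IsErgodicMeasure (μ : Measure S) : Prop :=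
  ∀ (f : S → ℝ) (B L : ℝ≥0), (∀ s, |f s| ≤ B) → LipschitzWith L f → c.ErgodicTo f (∫ s, f s ∂μ)

namespace IsRealizedBy

variable {c} [BorelSpace S] {P : Measure Ω} {ℱ : Filtration ℕ mΩ} {Y : ℕ → Ω → ℕ} {X : ℕ → Ω → S}

omit [BorelSpace S] in
lemma measurable' (h : c.IsRealizedBy P ℱ Y X) (k : ℕ) : Measurable (X k) :=
  (h.measurable k).mono (ℱ.le k) le_rfl

lemma integral_succ [IsProbabilityMeasure P] (h : c.IsRealizedBy P ℱ Y X) {k : ℕ} {G : Ω → ℝ}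
    (hG : Measurable[ℱ k] G) {K : ℝ} (hK : ∀ ω, |G ω| ≤ K) {f : S → ℝ} {B : ℝ}
    (hf : ∀ s, |f s| ≤ B) (hfc : Continuous f) :
    ∫ ω, G ω * f (X (k + 1) ω) ∂P = ∫ ω, G ω * c.op f (X k ω) ∂P := by
  simp_rw [h.step_eq]
  rw [h.counts.integral_count k (g := fun ω j => G ω * f (c.step j (X k ω)))]
  · simp_rw [integral_const_mul]; rfl
  · intro j
    exact (hG.mul ((hfc.measurable.comp (c.lipschitz_step j).continuous.measurable).comp
      (h.measurable k))).stronglyMeasurable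
  · refine Integrable.of_bound (C := K * B) ?_ (.of_forall fun ω => ?_)
    · simp_rw [← h.step_eq]
      exact ((hG.mono (ℱ.le k) le_rfl).mul
        (hfc.measurable.comp (h.measurable' (k + 1)))).aestronglyMeasurable
    · rw [Real.norm_eq_abs, abs_mul]
      exact mul_le_mul (hK ω) (hf _) (abs_nonneg _) ((abs_nonneg _).trans (hK ω))

/-- The Markov property over `n` steps. The induction varies `f`, because each step replaces it by
`c.op f`, which is again bounded and Lipschitz. -/
lemma integral_add [IsProbabilityMeasure P] (h : c.IsRealizedBy P ℱ Y X) {k : ℕ} {G : Ω → ℝ}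
    (hG : Measurable[ℱ k] G) {K : ℝ} (hK : ∀ ω, |G ω| ≤ K) {f : S → ℝ} {B L : ℝ≥0}
    (hf : ∀ s, |f s| ≤ B) (hL : LipschitzWith L f) (n : ℕ) :
    ∫ ω, G ω * f (X (k + n) ω) ∂P = ∫ ω, G ω * c.op^[n] f (X k ω) ∂P := by
  induction n generalizing f L with
  | zero => simp
  | succ n ih =>
    rw [← add_assoc, h.integral_succ (hG.mono (ℱ.mono (Nat.le_add_right k n)) le_rfl) hK hf
      hL.continuous, ih (c.abs_op_le hf) (c.lipschitzWith_op hf hL), Function.iterate_succ_apply]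

lemma lintegral_V_le (h : c.IsRealizedBy P ℱ Y X) [IsProbabilityMeasure P] {D : ℝ≥0}
    (hD : ∫⁻ ω, c.V (X 0 ω) ∂P ≤ D) (k : ℕ) :
    ∫⁻ ω, c.V (X k ω) ∂P ≤ ((D + c.driftConst : ℝ≥0) : ENNReal) := by
  induction k with
  | zero => exact hD.trans (by simp)
  | succ k ih =>
    simp_rw [h.step_eq]
    rw [h.counts.lintegral_count k (g := fun ω j => (c.V (c.step j (X k ω)) : ENNReal))]
    · calc ∫⁻ ω, ∫⁻ j, (c.V (c.step j (X k ω)) : ENNReal) ∂poissonMeasure (c.rate (X k ω)) ∂P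
          ≤ ∫⁻ ω, (c.γ * c.V (X k ω) + c.C) ∂P := lintegral_mono fun ω => c.drift _
        _ = c.γ * ∫⁻ ω, c.V (X k ω) ∂P + c.C := by
            rw [lintegral_add_right _ measurable_const, lintegral_const_mul' _ _ (by simp)]; simp
        _ ≤ c.γ * ((D + c.driftConst : ℝ≥0) : ENNReal) + c.C := by gcongr
        _ ≤ _ := by
            rw [← ENNReal.coe_mul, ← ENNReal.coe_add, ENNReal.coe_le_coe, mul_add]
            calc c.γ * D + c.γ * c.driftConst + c.C
                ≤ 1 * D + (c.γ * c.driftConst + 2 * c.C) := by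
                  rw [add_assoc, two_mul]
                  gcongr
                  · exact c.γ_lt_one.le
                  · exact le_self_add
              _ = _ := by rw [one_mul, c.driftConst_eq]
    · intro j
      exact (c.continuous_V.measurable.comp
        ((c.lipschitz_step j).continuous.measurable.comp (h.measurable k))).coe_nnreal_ennreal

lemma integrable_V (h : c.IsRealizedBy P ℱ Y X) [IsProbabilityMeasure P] {D : ℝ≥0}
    (hD : ∫⁻ ω, c.V (X 0 ω) ∂P ≤ D) (k : ℕ) : Integrable (fun ω => (c.V (X k ω) : ℝ)) P := by
  refine ⟨(c.continuous_V.measurable.comp (h.measurable' k)).coe_nnreal_real.aestronglyMeasurable,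
    ?_⟩
  refine lt_of_le_of_lt (le_of_eq (lintegral_congr fun ω => ?_))
    ((h.lintegral_V_le hD k).trans_lt ENNReal.coe_lt_top)
  simp [enorm_eq_nnnorm]

lemma integral_V_le (h : c.IsRealizedBy P ℱ Y X) [IsProbabilityMeasure P] {D : ℝ≥0}
    (hD : ∫⁻ ω, c.V (X 0 ω) ∂P ≤ D) (k : ℕ) :
    ∫ ω, (c.V (X k ω) : ℝ) ∂P ≤ D + c.driftConst := by
  rw [integral_eq_lintegral_of_nonneg_ae (.of_forall fun ω => NNReal.coe_nonneg _)
    (h.integrable_V hD k).aestronglyMeasurable]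
  refine ENNReal.toReal_le_of_le_ofReal (by positivity) ?_
  rw [← NNReal.coe_add, ENNReal.ofReal_coe_nnreal]
  simpa using h.lintegral_V_le hD k

/-- Law of large numbers for bounded Lipschitz functions of the chain. -/
theorem tendsto_lintegral_average [IsProbabilityMeasure P] (h : c.IsRealizedBy P ℱ Y X) {D : ℝ≥0}
    (hD : ∫⁻ ω, c.V (X 0 ω) ∂P ≤ D) {f : S → ℝ} {B L : ℝ≥0}
    (hf : ∀ s, |f s| ≤ B) (hL : LipschitzWith L f) {m : ℝ} (hm : c.ErgodicTo f m) :
    Tendsto (fun n : ℕ => ∫⁻ ω, ‖(n : ℝ)⁻¹ * ∑ k ∈ Finset.range n, (f (X k ω) - m)‖ₑ ∂P)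
      atTop (𝓝 0) := by
  have hmeas : ∀ k, Measurable[ℱ k] (fun ω => f (X k ω) - m) := fun k =>
    (hL.continuous.measurable.comp (h.measurable k)).sub_const m
  have hb : ∀ k ω, |f (X k ω) - m| ≤ B + |m| := fun k ω =>
    (abs_sub _ _).trans (by gcongr; exact hf _)
  have hu : ∀ k, MemLp (fun ω => f (X k ω) - m) 2 P := fun k =>
    MemLp.of_bound ((hmeas k).mono (ℱ.le k) le_rfl).aestronglyMeasurable (B + |m|)
      (.of_forall fun ω => by simpa using hb k ω)
  refine tendsto_lintegral_average_of_correlation hu (A := (B + |m|) ^ 2) ?_ ?_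
  · intro k
    have : ∫ ω, (f (X k ω) - m) ^ 2 ∂P ≤ ∫ ω, (B + |m|) ^ 2 ∂P :=
      integral_mono (hu k).integrable_sq (integrable_const _) fun ω =>
        sq_le_sq' (by linarith [neg_abs_le (f (X k ω) - m), hb k ω])
          ((le_abs_self _).trans (hb k ω))
    simpa using this
  · intro ε hε
    set K : ℝ := (B + |m|) * (1 + (D + c.driftConst)) + 1 with hK
    have hK0 : 0 < K := by positivity
    obtain ⟨N, hN⟩ := hm (ε / K) (by positivity)
    refine ⟨N, fun k l hkl _ => ?_⟩
    obtain ⟨n, rfl⟩ : ∃ n, l = k + n := ⟨l - k, by omega⟩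
    have hn : N ≤ n := by omega
    have hs1 := h.integral_add (hmeas k) (hb k) hf hL n
    have i1 : ∀ (u : Ω → ℝ), Measurable u → (∀ ω, |u ω| ≤ B) →
        Integrable (fun ω => (f (X k ω) - m) * u ω) P := fun u hu1 hu2 =>
      Integrable.of_bound (C := (B + |m|) * B)
        (((hmeas k).mono (ℱ.le k) le_rfl).mul hu1).aestronglyMeasurable
        (.of_forall fun ω => by
          rw [Real.norm_eq_abs, abs_mul]
          exact mul_le_mul (hb k ω) (hu2 ω) (abs_nonneg _) (by positivity))
    obtain ⟨L', hL'⟩ := c.lipschitzWith_op_iterate hf hL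
    -- Conditioning on time `k` turns the later factor into the `n`-th iterate at `X k`, which is
    -- close to `m`.
    have e1 : ∫ ω, (f (X k ω) - m) * (f (X (k + n) ω) - m) ∂P
        = ∫ ω, (f (X k ω) - m) * (c.op^[n] f (X k ω) - m) ∂P := by
      simp_rw [mul_sub]
      have i3 : Integrable (fun ω => (f (X k ω) - m) * m) P :=
        ((hu k).integrable one_le_two).mul_const m
      rw [integral_sub (i1 (fun ω => f (X (k + n) ω))
          (hL.continuous.measurable.comp (h.measurable' _)) fun ω => hf _) i3,
        integral_sub (i1 (fun ω => c.op^[n] f (X k ω)) ((hL' n).continuous.measurable.comp (h.measurable' _))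
          fun ω => c.abs_op_iterate_le hf n _) i3, hs1]
    rw [e1, ← Real.norm_eq_abs]
    have e2 : ∫ ω, (B + |m|) * (ε / K * (1 + c.V (X k ω))) ∂P ≤ ε := by
      rw [integral_const_mul, integral_const_mul, MeasureTheory.integral_add (integrable_const _)
        (h.integrable_V hD k)]
      simp only [integral_const, probReal_univ, smul_eq_mul, mul_one]
      calc (B + |m|) * (ε / K * (1 + ∫ ω, (c.V (X k ω) : ℝ) ∂P))
          ≤ (B + |m|) * (ε / K * (1 + (D + c.driftConst))) := by
            gcongr
            exact h.integral_V_le hD k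
        _ = ε / K * (K - 1) := by rw [hK]; ring
        _ ≤ ε / K * K := by gcongr; linarith
        _ = ε := div_mul_cancel₀ _ hK0.ne'
    refine le_trans (norm_integral_le_of_norm_le ?_ (.of_forall fun ω => ?_)) e2
    · exact (((integrable_const _).add (h.integrable_V hD k)).const_mul _).const_mul _
    · rw [Real.norm_eq_abs, abs_mul]
      exact mul_le_mul (hb k ω) (hN n hn _) (abs_nonneg _) (by positivity)

/-- Expectations along the chain tend to the ergodic limit. -/
theorem tendsto_integral [IsProbabilityMeasure P] (h : c.IsRealizedBy P ℱ Y X) {D : ℝ≥0}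
    (hD : ∫⁻ ω, c.V (X 0 ω) ∂P ≤ D) {f : S → ℝ} {B L : ℝ≥0}
    (hf : ∀ s, |f s| ≤ B) (hL : LipschitzWith L f) {m : ℝ} (hm : c.ErgodicTo f m) :
    Tendsto (fun n : ℕ => ∫ ω, f (X n ω) ∂P) atTop (𝓝 m) := by
  rw [Metric.tendsto_atTop]
  intro ε hε
  set K : ℝ := 1 + (D + c.driftConst) with hK
  have hK0 : 0 < K := by positivity
  obtain ⟨N, hN⟩ := hm (ε / 2 / K) (by positivity)
  refine ⟨N, fun n hn => ?_⟩
  have h1 := h.integral_add (k := 0) (G := fun _ => 1) measurable_const (K := 1) (by simp) hf hL n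
  simp only [zero_add, one_mul] at h1
  obtain ⟨L', hL'⟩ := c.lipschitzWith_op_iterate hf hL
  have h2 : ∫ ω, c.op^[n] f (X 0 ω) ∂P - m = ∫ ω, (c.op^[n] f (X 0 ω) - m) ∂P := by
    rw [integral_sub _ (integrable_const _)]
    · simp
    · exact Integrable.of_bound
        ((hL' n).continuous.measurable.comp (h.measurable' 0)).aestronglyMeasurable B
        (.of_forall fun ω => by simpa using c.abs_op_iterate_le hf n _)
  rw [Real.dist_eq, h1, h2, ← Real.norm_eq_abs]
  have h3 : ∫ ω, ε / 2 / K * (1 + c.V (X 0 ω)) ∂P ≤ ε / 2 := by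
    rw [integral_const_mul, MeasureTheory.integral_add (integrable_const _) (h.integrable_V hD 0)]
    simp only [integral_const, probReal_univ, smul_eq_mul, mul_one]
    calc ε / 2 / K * (1 + ∫ ω, (c.V (X 0 ω) : ℝ) ∂P) ≤ ε / 2 / K * K := by
          gcongr
          exact add_le_add_right (h.integral_V_le hD 0) _
      _ = ε / 2 := div_mul_cancel₀ _ hK0.ne'
  refine lt_of_le_of_lt (le_trans (norm_integral_le_of_norm_le ?_ (.of_forall fun ω => ?_)) h3)
    (by linarith)
  · exact ((integrable_const _).add (h.integrable_V hD 0)).const_mul _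
  · exact hN n hn _

end IsRealizedBy

end PoissonChain

/-! ### Cutoffs -/

/-- Cutoff function: `1` on the ball of radius `M` and `0` outside the ball of radius `M + 1`. -/
noncomputable def normCutoff {S : Type*} [NormedAddCommGroup S] (M : ℝ) (s : S) : ℝ :=
  max 0 (min 1 (M + 1 - ‖s‖))

section Cutoff

variable {S : Type*} [NormedAddCommGroup S]

lemma normCutoff_nonneg (M : ℝ) (s : S) : 0 ≤ normCutoff M s := le_max_left _ _

lemma normCutoff_le_one (M : ℝ) (s : S) : normCutoff M s ≤ 1 := max_le zero_le_one (min_le_left _ _)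

lemma normCutoff_eq_one {M : ℝ} {s : S} (h : ‖s‖ ≤ M) : normCutoff M s = 1 := by
  rw [normCutoff, min_eq_left (by linarith), max_eq_right zero_le_one]

lemma normCutoff_eq_zero {M : ℝ} {s : S} (h : M + 1 ≤ ‖s‖) : normCutoff M s = 0 := by
  rw [normCutoff, max_eq_left]
  exact (min_le_right _ _).trans (by linarith)

lemma monotone_normCutoff (s : S) : Monotone fun M : ℝ => normCutoff M s := fun M M' h => by
  simp only [normCutoff]
  gcongr

lemma abs_normCutoff_sub_le (M : ℝ) (s t : S) :
    |normCutoff M s - normCutoff M t| ≤ dist s t := by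
  unfold normCutoff
  rw [max_comm, max_comm 0 (min 1 (M + 1 - ‖t‖))]
  refine (abs_max_sub_max_le_abs _ _ _).trans ?_
  rw [min_comm, min_comm 1 (M + 1 - ‖t‖)]
  refine (abs_min_sub_min_le_max _ _ _ _).trans ?_
  simp only [sub_self, abs_zero]
  refine max_le ?_ dist_nonneg
  rw [sub_sub_sub_cancel_left, dist_comm, dist_eq_norm]
  exact abs_norm_sub_norm_le _ _

/-- On the compact ball of radius `M + 1` the function is bounded and Lipschitz, and outside it the
product vanishes. In the product rule it suffices that one of the two points lies in the ball. -/
lemma exists_bound_lipschitz_cutoff [ProperSpace S] {H : S → ℝ} (hH : LocallyLipschitz H) (M : ℝ) :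
    ∃ B L : ℝ≥0, (∀ s, |normCutoff M s * H s| ≤ B) ∧
      LipschitzWith L (fun s => normCutoff M s * H s) := by
  have hK : IsCompact (Metric.closedBall (0 : S) (M + 1)) := isCompact_closedBall _ _
  obtain ⟨L, hL⟩ := (hH.locallyLipschitzOn (s := Metric.closedBall (0 : S) (M + 1))
    ).exists_lipschitzOnWith_of_compact hK
  obtain ⟨B, hB⟩ := hK.exists_bound_of_continuousOn hH.continuous.continuousOn
  have hB0 : ∀ s ∈ Metric.closedBall (0 : S) (M + 1), |H s| ≤ B.toNNReal := fun s hs =>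
    (hB s hs).trans (Real.le_coe_toNNReal B)
  have hmem : ∀ s : S, s ∉ Metric.closedBall (0 : S) (M + 1) → normCutoff M s = 0 := fun s hs =>
    normCutoff_eq_zero (by simpa using le_of_lt (by simpa using hs : M + 1 < ‖s‖))
  refine ⟨B.toNNReal, L + B.toNNReal, fun s => ?_, LipschitzWith.of_dist_le_mul fun s t => ?_⟩
  · by_cases hs : s ∈ Metric.closedBall (0 : S) (M + 1)
    · rw [abs_mul, abs_of_nonneg (normCutoff_nonneg M s)]
      exact (mul_le_of_le_one_left (abs_nonneg _) (normCutoff_le_one M s)).trans (hB0 s hs)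
    · simp [hmem s hs]
  · have main : ∀ s t : S, s ∈ Metric.closedBall (0 : S) (M + 1) →
        |normCutoff M s * H s - normCutoff M t * H t| ≤ (L + B.toNNReal : ℝ≥0) * dist s t := by
      intro s t hs
      have h1 : |normCutoff M s - normCutoff M t| * |H s| ≤ B.toNNReal * dist s t := by
        rw [mul_comm]
        exact mul_le_mul (hB0 s hs) (abs_normCutoff_sub_le M s t) (abs_nonneg _) (NNReal.coe_nonneg _)
      by_cases ht : t ∈ Metric.closedBall (0 : S) (M + 1)
      · have h2 : |normCutoff M t * (H s - H t)| ≤ L * dist s t := by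
          rw [abs_mul, abs_of_nonneg (normCutoff_nonneg M t)]
          refine (mul_le_of_le_one_left (abs_nonneg _) (normCutoff_le_one M t)).trans ?_
          rw [← Real.dist_eq]
          exact hL.dist_le_mul s hs t ht
        have e : normCutoff M s * H s - normCutoff M t * H t
            = (normCutoff M s - normCutoff M t) * H s + normCutoff M t * (H s - H t) := by ring
        rw [e]
        refine (abs_add_le _ _).trans ?_
        rw [abs_mul]
        push_cast
        linarith
      · have e : normCutoff M s * H s - normCutoff M t * H t
            = (normCutoff M s - normCutoff M t) * H s := by rw [hmem t ht]; ring
        rw [e, abs_mul]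
        push_cast
        have : (0 : ℝ) ≤ L * dist s t := by positivity
        linarith
    rw [Real.dist_eq]
    by_cases hs : s ∈ Metric.closedBall (0 : S) (M + 1)
    · exact main s t hs
    · by_cases ht : t ∈ Metric.closedBall (0 : S) (M + 1)
      · rw [abs_sub_comm, dist_comm]; exact main t s ht
      · rw [hmem s hs, hmem t ht]; simp; positivity

/-- The error lives where `‖s‖ > M`. There `(1 + ‖s‖) / M ≥ 1`, so one more power of the norm buys
the small factor `C / M`. -/
lemma enorm_sub_cutoff_le {H : S → ℝ} {C : ℝ≥0} {p : ℕ} (hC : ∀ s, |H s| ≤ C * (1 + ‖s‖) ^ p)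
    {M : ℝ} (hM : 0 < M) (s : S) :
    ‖H s - normCutoff M s * H s‖ₑ ≤ ENNReal.ofReal (C / M) * ‖1 + ‖s‖‖ₑ ^ (p + 1) := by
  rw [← enorm_pow, Real.enorm_eq_ofReal_abs, Real.enorm_eq_ofReal (by positivity),
    ← ENNReal.ofReal_mul (by positivity)]
  refine ENNReal.ofReal_le_ofReal ?_
  rcases le_or_gt ‖s‖ M with h | h
  · rw [normCutoff_eq_one h]; simp; positivity
  · have e : H s - normCutoff M s * H s = (1 - normCutoff M s) * H s := by ring
    rw [e, abs_mul, abs_of_nonneg (by linarith [normCutoff_le_one M s])]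
    calc (1 - normCutoff M s) * |H s| ≤ 1 * (C * (1 + ‖s‖) ^ p) :=
          mul_le_mul (by linarith [normCutoff_nonneg M s]) (hC s) (abs_nonneg _) zero_le_one
      _ ≤ ((1 + ‖s‖) / M) * (C * (1 + ‖s‖) ^ p) := by
          gcongr
          rw [le_div_iff₀ hM]
          linarith
      _ = _ := by ring

end Cutoff

lemma LocallyLipschitz.real_mul {S : Type*} [PseudoEMetricSpace S] {f g : S → ℝ}
    (hf : LocallyLipschitz f) (hg : LocallyLipschitz g) : LocallyLipschitz fun s => f s * g s := by
  have h : LocallyLipschitz (fun p : ℝ × ℝ => p.1 * p.2) :=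
    (contDiff_fst.mul contDiff_snd : ContDiff ℝ 1 _).locallyLipschitz
  exact h.comp (hf.prodMk hg)

lemma LocallyLipschitz.real_pow {S : Type*} [PseudoEMetricSpace S] {f : S → ℝ}
    (hf : LocallyLipschitz f) (q : ℕ) : LocallyLipschitz fun s => f s ^ q := by
  have h : LocallyLipschitz (fun x : ℝ => x ^ q) :=
    (contDiff_id.pow q : ContDiff ℝ 1 _).locallyLipschitz
  exact h.comp hf

/-! ### Laws of large numbers for functions of polynomial growth -/

namespace PoissonChain.IsRealizedBy

variable {S : Type*} [NormedAddCommGroup S] [ProperSpace S] [MeasurableSpace S] [BorelSpace S]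
  {c : PoissonChain S} {Ω : Type*} [mΩ : MeasurableSpace Ω]
  {P : Measure Ω} {ℱ : Filtration ℕ mΩ} {Y : ℕ → Ω → ℕ} {X : ℕ → Ω → S}

/-- The ergodic law inherits the moments of the chain. -/
theorem lintegral_norm_pow_lt_top [IsProbabilityMeasure P] (h : c.IsRealizedBy P ℱ Y X) {D : ℝ≥0}
    (hD : ∫⁻ ω, c.V (X 0 ω) ∂P ≤ D) (hmom : HasUniformMoments P fun k ω => ‖X k ω‖)
    {μ : Measure S} [IsProbabilityMeasure μ] (hμ : c.IsErgodicMeasure μ) (q : ℕ) :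
    ∫⁻ s, ‖s‖ₑ ^ q ∂μ < ⊤ := by
  obtain ⟨C, hC⟩ := hmom.bound q
  have hlip : LocallyLipschitz fun s : S => ‖s‖ ^ q :=
    (LipschitzWith.locallyLipschitz (K := 1) lipschitzWith_one_norm).real_pow q
  have hle : ∀ M : ℕ, ∫⁻ s, ENNReal.ofReal (normCutoff (M : ℝ) s * ‖s‖ ^ q) ∂μ ≤ C := by
    intro M
    obtain ⟨B, L, hB, hL⟩ := exists_bound_lipschitz_cutoff hlip (M : ℝ)
    have h1 := h.tendsto_integral hD hB hL (hμ _ B L hB hL)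
    have h0 : ∀ s : S, 0 ≤ normCutoff (M : ℝ) s * ‖s‖ ^ q := fun s =>
      mul_nonneg (normCutoff_nonneg _ _) (by positivity)
    have h2 : ∫ s, normCutoff (M : ℝ) s * ‖s‖ ^ q ∂μ ≤ C := by
      refine le_of_tendsto h1 (.of_forall fun n => ?_)
      rw [integral_eq_lintegral_of_nonneg_ae (.of_forall fun ω => h0 _)
        (hL.continuous.measurable.comp (h.measurable' n)).aestronglyMeasurable]
      refine ENNReal.toReal_le_of_le_ofReal C.2 ?_
      rw [ENNReal.ofReal_coe_nnreal]
      refine le_trans (lintegral_mono fun ω => ?_) (hC n)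
      rw [← enorm_pow, Real.enorm_eq_ofReal (by positivity)]
      exact ENNReal.ofReal_le_ofReal (mul_le_of_le_one_left (by positivity) (normCutoff_le_one _ _))
    rw [← ofReal_integral_eq_lintegral_ofReal (Integrable.of_bound
      hL.continuous.measurable.aestronglyMeasurable B (.of_forall fun s => by simpa using hB s))
      (.of_forall h0), ← ENNReal.ofReal_coe_nnreal]
    exact ENNReal.ofReal_le_ofReal h2
  have hlim := lintegral_tendsto_of_tendsto_of_monotone (μ := μ)
    (f := fun (M : ℕ) s => ENNReal.ofReal (normCutoff (M : ℝ) s * ‖s‖ ^ q)) (F := fun s => ‖s‖ₑ ^ q)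
    (fun M => by
      obtain ⟨B, L, hB, hL⟩ := exists_bound_lipschitz_cutoff hlip (M : ℝ)
      exact hL.continuous.measurable.ennreal_ofReal.aemeasurable)
    (.of_forall fun s M M' hM => ENNReal.ofReal_le_ofReal (by
      gcongr
      exact monotone_normCutoff s (by exact_mod_cast hM)))
    (.of_forall fun s => by
      refine tendsto_const_nhds.congr' ?_
      filter_upwards [eventually_ge_atTop ⌈‖s‖⌉₊] with M hM
      rw [normCutoff_eq_one (Nat.ceil_le.1 hM), one_mul, ENNReal.ofReal_pow (norm_nonneg _),
        ofReal_norm])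
  exact (le_of_tendsto' hlim hle).trans_lt ENNReal.coe_lt_top

/-- Law of large numbers for functions of the chain with polynomial growth. -/
theorem tendsto_lintegral_average_of_growth [IsProbabilityMeasure P] (h : c.IsRealizedBy P ℱ Y X)
    {D : ℝ≥0} (hD : ∫⁻ ω, c.V (X 0 ω) ∂P ≤ D) (hmom : HasUniformMoments P fun k ω => ‖X k ω‖)
    {μ : Measure S} [IsProbabilityMeasure μ] (hμ : c.IsErgodicMeasure μ) {H : S → ℝ}
    (hH : LocallyLipschitz H) {C : ℝ≥0} {p : ℕ} (hC : ∀ s, |H s| ≤ C * (1 + ‖s‖) ^ p) :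
    Integrable H μ ∧
    Tendsto (fun n : ℕ => ∫⁻ ω, ‖(n : ℝ)⁻¹ * ∑ k ∈ Finset.range n, H (X k ω) - ∫ s, H s ∂μ‖ₑ ∂P)
      atTop (𝓝 0) := by
  have hmom1 : HasUniformMoments P fun k ω => 1 + ‖X k ω‖ := (HasUniformMoments.const 1).add hmom
  obtain ⟨D1, hD1⟩ := hmom1.bound (p + 1)
  have hμmom : HasUniformMoments μ fun _ s => 1 + ‖s‖ := by
    refine (HasUniformMoments.const 1).add ⟨fun _ => measurable_norm.aemeasurable, fun q => ?_⟩
    refine ⟨(∫⁻ s, ‖s‖ₑ ^ q ∂μ).toNNReal, fun _ => ?_⟩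
    rw [ENNReal.coe_toNNReal (h.lintegral_norm_pow_lt_top hD hmom hμ q).ne]
    simp
  obtain ⟨D2, hD2⟩ := hμmom.bound (p + 1)
  have hHm : Measurable H := hH.continuous.measurable
  have hint : Integrable H μ := by
    refine ((hμmom.pow p).const_mul C).integrable 0 |>.mono hHm.aestronglyMeasurable
      (.of_forall fun s => ?_)
    rw [Real.norm_of_nonneg (by positivity : 0 ≤ (C : ℝ) * (1 + ‖s‖) ^ p)]
    exact hC s
  refine ⟨hint, ?_⟩
  rw [ENNReal.tendsto_nhds_zero]
  intro ε hε
  rcases eq_or_ne ε ⊤ with rfl | hεt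
  · simp
  have hεr : 0 < ε.toReal := ENNReal.toReal_pos hε.ne' hεt
  -- The cutoff level makes the truncation errors along the chain and under `μ` both at most `ε /
  -- 3`.
  obtain ⟨M, hM0, hM1, hM2⟩ : ∃ M : ℝ, 0 < M ∧ ENNReal.ofReal (C / M) * D1 ≤ ε / 3 ∧
      ENNReal.ofReal (C / M) * D2 ≤ ε / 3 := by
    set M : ℝ := (C * (D1 + D2) + 1) * 3 / ε.toReal with hM
    have hM0 : 0 < M := by positivity
    have h3 : ∀ D' : ℝ≥0, D' ≤ D1 + D2 → ENNReal.ofReal (C / M) * D' ≤ ε / 3 := by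
      intro D' hD'
      rw [← ENNReal.ofReal_toReal hεt, ← ENNReal.ofReal_coe_nnreal,
        ← ENNReal.ofReal_mul (by positivity),
        show (3 : ENNReal) = ENNReal.ofReal 3 by norm_num,
        ← ENNReal.ofReal_div_of_pos (by norm_num)]
      refine ENNReal.ofReal_le_ofReal ?_
      have h4 : (D' : ℝ) ≤ D1 + D2 := by exact_mod_cast hD'
      rw [div_mul_eq_mul_div, div_le_div_iff₀ hM0 (by norm_num), hM,
        mul_div_cancel₀ _ hεr.ne']
      have : (C : ℝ) * D' ≤ C * (D1 + D2) := by gcongr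
      linarith
    exact ⟨M, hM0, h3 _ le_self_add, h3 _ le_add_self⟩
  obtain ⟨B, L, hB, hL⟩ := exists_bound_lipschitz_cutoff hH M
  have hlln := h.tendsto_lintegral_average hD hB hL (hμ _ B L hB hL)
  have hcm : Measurable (fun s => normCutoff M s * H s) := hL.continuous.measurable
  filter_upwards [ENNReal.tendsto_nhds_zero.1 hlln (ε / 3) (ENNReal.div_pos hε.ne' (by norm_num)),
    eventually_gt_atTop 0] with n hn hn0
  have hn0' : (n : ℝ) ≠ 0 := by positivity
  set A := fun ω => (n : ℝ)⁻¹ * ∑ k ∈ Finset.range n,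
    (H (X k ω) - normCutoff M (X k ω) * H (X k ω)) with hA
  set A' := fun ω => (n : ℝ)⁻¹ * ∑ k ∈ Finset.range n,
    (normCutoff M (X k ω) * H (X k ω) - ∫ s, normCutoff M s * H s ∂μ) with hA'
  set a : ℝ := ∫ s, (normCutoff M s * H s - H s) ∂μ with ha
  have hai : Integrable (fun s => normCutoff M s * H s) μ :=
    Integrable.of_bound hcm.aestronglyMeasurable B (.of_forall fun s => by simpa using hB s)
  -- Truncation error along the chain, law of large numbers for the truncated function, truncation
  -- error under `μ`.
  have hdecomp : ∀ ω, (n : ℝ)⁻¹ * ∑ k ∈ Finset.range n, H (X k ω) - ∫ s, H s ∂μ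
      = A ω + A' ω + a := by
    intro ω
    rw [hA, hA', ha, integral_sub hai hint]
    simp only [Finset.sum_sub_distrib, Finset.sum_const, Finset.card_range, nsmul_eq_mul, mul_sub]
    rw [inv_mul_cancel_left₀ hn0']
    ring
  have hAm : Measurable A := (Finset.measurable_fun_sum _ fun k _ =>
    (hHm.comp (h.measurable' k)).sub (hcm.comp (h.measurable' k))).const_mul _
  have hA'm : Measurable A' := (Finset.measurable_fun_sum _ fun k _ =>
    (hcm.comp (h.measurable' k)).sub_const _).const_mul _
  have b1 : ∫⁻ ω, ‖A ω‖ₑ ∂P ≤ ε / 3 := by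
    have h5 : ENNReal.ofReal (C / M) * D1 ≠ ⊤ := ENNReal.mul_ne_top ENNReal.ofReal_ne_top (by simp)
    refine le_trans (HasUniformMoments.lintegral_average_le
      (C := (ENNReal.ofReal (C / M) * D1).toNNReal) (fun k =>
      ((hHm.comp (h.measurable' k)).sub (hcm.comp (h.measurable' k))).aemeasurable)
      (fun k => ?_) n) ?_
    · rw [ENNReal.coe_toNNReal h5]
      refine (lintegral_mono fun ω => enorm_sub_cutoff_le hC hM0 (X k ω)).trans ?_
      rw [lintegral_const_mul' _ _ ENNReal.ofReal_ne_top]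
      gcongr
      exact hD1 k
    · rw [ENNReal.coe_toNNReal h5]; exact hM1
  have b3 : ‖a‖ₑ ≤ ε / 3 := by
    refine (enorm_integral_le_lintegral_enorm _).trans (le_trans ?_ hM2)
    simp_rw [← enorm_neg (normCutoff M _ * H _ - H _), neg_sub]
    refine (lintegral_mono fun s => enorm_sub_cutoff_le hC hM0 s).trans ?_
    rw [lintegral_const_mul' _ _ ENNReal.ofReal_ne_top]
    gcongr
    exact hD2 0
  calc ∫⁻ ω, ‖(n : ℝ)⁻¹ * ∑ k ∈ Finset.range n, H (X k ω) - ∫ s, H s ∂μ‖ₑ ∂P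
      ≤ ∫⁻ ω, (‖A ω‖ₑ + ‖A' ω‖ₑ + ‖a‖ₑ) ∂P := by
        refine lintegral_mono fun ω => ?_
        rw [hdecomp]
        exact (enorm_add_le _ _).trans (by gcongr; exact enorm_add_le _ _)
    _ = ∫⁻ ω, ‖A ω‖ₑ ∂P + ∫⁻ ω, ‖A' ω‖ₑ ∂P + ‖a‖ₑ := by
        rw [lintegral_add_right _ measurable_const, lintegral_add_left hAm.enorm]
        simp
    _ ≤ ε / 3 + ε / 3 + ε / 3 := by gcongr
    _ = ε := ENNReal.add_thirds ε

theorem negligible_average_of_growth [IsProbabilityMeasure P] (h : c.IsRealizedBy P ℱ Y X)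
    {D : ℝ≥0} (hD : ∫⁻ ω, c.V (X 0 ω) ∂P ≤ D) (hmom : HasUniformMoments P fun k ω => ‖X k ω‖)
    {μ : Measure S} [IsProbabilityMeasure μ] (hμ : c.IsErgodicMeasure μ) {H : S → ℝ}
    (hH : LocallyLipschitz H) {C : ℝ≥0} {p : ℕ} (hC : ∀ s, |H s| ≤ C * (1 + ‖s‖) ^ p) :
    NegligibleInProb P
      (fun n ω => (n : ℝ)⁻¹ * ∑ k ∈ Finset.range n, H (X k ω) - ∫ s, H s ∂μ) := by
  refine NegligibleInProb.of_lintegral (fun n => ?_)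
    (h.tendsto_lintegral_average_of_growth hD hmom hμ hH hC).2
  exact (((Finset.measurable_fun_sum _ fun k _ =>
    hH.continuous.measurable.comp (h.measurable' k)).const_mul _).sub_const _).aemeasurable

end PoissonChain.IsRealizedBy

/-! ### The threshold model as a contractive chain with an exponential Lyapunov function -/

lemma lintegral_exp_poissonMeasure (q : ℝ≥0) (u : ℝ) :
    ∫⁻ k : ℕ, ENNReal.ofReal (Real.exp (u * k)) ∂poissonMeasure q
      = ENNReal.ofReal (Real.exp (q * (Real.exp u - 1))) := by
  rw [lintegral_countable']
  simp_rw [poissonMeasure_singleton, ← ENNReal.ofReal_mul (Real.exp_pos _).le]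
  have h : ∀ k : ℕ, Real.exp (u * k) * (Real.exp (-q) * q ^ k / (k.factorial : ℝ))
      = Real.exp (-q) * ((q * Real.exp u) ^ k / (k.factorial : ℝ)) := by
    intro k
    rw [mul_pow, ← Real.exp_nat_mul, mul_comm u]
    ring
  simp_rw [h]
  have hs : HasSum (fun k : ℕ => Real.exp (-q) * ((q * Real.exp u) ^ k / (k.factorial : ℝ)))
      (Real.exp (-q) * Real.exp (q * Real.exp u)) := by
    refine HasSum.mul_left _ ?_
    rw [Real.exp_eq_exp_ℝ]
    exact NormedSpace.expSeries_div_hasSum_exp _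
  rw [← ENNReal.ofReal_tsum_of_nonneg (fun k => by positivity) hs.summable, hs.tsum_eq,
    ← Real.exp_add]
  congr 2
  ring

namespace SETPAR

/-- The gradient, in the parameter, of the next intensity. -/
def regressor (r y : ℕ) (l : ℝ) : Fin 6 → ℝ :=
  if y ≤ r then ![1, l, y, 0, 0, 0] else ![0, 0, 0, 1, l, y]

lemma nextIntensity_eq_sum (r : ℕ) (θ : Param) (y : ℕ) (l : ℝ) :
    nextIntensity r θ y l = ∑ i, θ i * regressor r y l i := by
  unfold nextIntensity dCoef aCoef bCoef regressor
  split_ifs <;> simp [Fin.sum_univ_six]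

/-- The derivative of the regressor in the last intensity. -/
def regimeDir (r y : ℕ) : Fin 6 → ℝ := if y ≤ r then Pi.single 1 1 else Pi.single 4 1

lemma aCoef_eq_sum (r : ℕ) (θ : Param) (y : ℕ) :
    aCoef r θ y = ∑ i, θ i * regimeDir r y i := by
  unfold aCoef regimeDir
  split_ifs <;> simp [Fin.sum_univ_six]

lemma regressor_sub (r y : ℕ) (l l' : ℝ) (i : Fin 6) :
    regressor r y l i - regressor r y l' i = regimeDir r y i * (l - l') := by
  unfold regressor regimeDir
  split_ifs <;> fin_cases i <;> simp

lemma abs_regimeDir_le (r y : ℕ) (i : Fin 6) : |regimeDir r y i| ≤ 1 := by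
  unfold regimeDir
  split_ifs <;> fin_cases i <;> simp

lemma abs_regressor_le (r y : ℕ) (l : ℝ) (i : Fin 6) : |regressor r y l i| ≤ 1 + |l| + y := by
  have h1 : (0 : ℝ) ≤ y := by positivity
  have h2 := abs_nonneg l
  unfold regressor
  split_ifs <;> fin_cases i <;> simp <;> linarith

lemma nextIntensity_sub (r : ℕ) (θ : Param) (y : ℕ) (l l' : ℝ) :
    nextIntensity r θ y l - nextIntensity r θ y l' = aCoef r θ y * (l - l') := by
  unfold nextIntensity; ring

/-- The largest of the two autoregressive coefficients. -/
def maxCoef (θ : Param) : ℝ := max (θ 1) (θ 4)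

lemma aCoef_le_maxCoef (r : ℕ) (θ : Param) (y : ℕ) : aCoef r θ y ≤ maxCoef θ := by
  unfold aCoef maxCoef; split_ifs <;> simp

lemma aCoef_pos {θ : Param} (hθ : θ ∈ paramSpace) (r y : ℕ) : 0 < aCoef r θ y := by
  unfold aCoef; split_ifs <;> exact hθ.1 _

lemma bCoef_pos {θ : Param} (hθ : θ ∈ paramSpace) (r y : ℕ) : 0 < bCoef r θ y := by
  unfold bCoef; split_ifs <;> exact hθ.1 _

lemma dCoef_pos {θ : Param} (hθ : θ ∈ paramSpace) (r y : ℕ) : 0 < dCoef r θ y := by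
  unfold dCoef; split_ifs <;> exact hθ.1 _

lemma maxCoef_pos {θ : Param} (hθ : θ ∈ paramSpace) : 0 < maxCoef θ := lt_max_of_lt_left (hθ.1 1)

lemma maxCoef_lt_one {θ : Param} (hθ : θ ∈ paramSpace) : maxCoef θ < 1 :=
  max_lt hθ.2.1 (by linarith [hθ.2.2.2, hθ.1 5])

lemma nextIntensity_pos {θ : Param} (hθ : θ ∈ paramSpace) (r y : ℕ) {l : ℝ} (hl : 0 ≤ l) :
    0 < nextIntensity r θ y l := by
  have h1 := mul_nonneg (aCoef_pos hθ r y).le hl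
  have h2 := mul_nonneg (bCoef_pos hθ r y).le (Nat.cast_nonneg (α := ℝ) y)
  unfold nextIntensity
  linarith [dCoef_pos hθ r y]

/-- Intensity of the true model, intensity computed from the observations, and scaled derivative
of the latter. -/
abbrev State : Type := ℝ × ℝ × (Fin 6 → ℝ)

/-- Scale of the derivative in the state. -/
noncomputable def scale (θ : Param) : ℝ := (1 - maxCoef θ) / 2

/-- One step of the joint recursion of the intensities and of the derivative. -/
noncomputable def stateStep (r : ℕ) (θ : Param) (y : ℕ) (s : State) : State :=
  (nextIntensity r θ y s.1, nextIntensity r θ y s.2.1,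
    fun i => aCoef r θ y * s.2.2 i + scale θ * regressor r y s.2.1 i)

/-- The contraction rate of the recursion. -/
noncomputable def contractionRate (θ : Param) : ℝ≥0 := ((1 + maxCoef θ) / 2).toNNReal

lemma scale_pos {θ : Param} (hθ : θ ∈ paramSpace) : 0 < scale θ := by
  have := maxCoef_lt_one hθ; unfold scale; linarith

lemma scale_le_one {θ : Param} (hθ : θ ∈ paramSpace) : scale θ ≤ 1 := by
  have := maxCoef_pos hθ; unfold scale; linarith

lemma coe_contractionRate {θ : Param} (hθ : θ ∈ paramSpace) :
    (contractionRate θ : ℝ) = (1 + maxCoef θ) / 2 :=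
  Real.coe_toNNReal _ (by linarith [maxCoef_pos hθ])

lemma contractionRate_lt_one {θ : Param} (hθ : θ ∈ paramSpace) : contractionRate θ < 1 := by
  rw [← NNReal.coe_lt_coe, coe_contractionRate hθ]
  have := maxCoef_lt_one hθ
  push_cast; linarith

lemma abs_nextIntensity_sub_le {θ : Param} (hθ : θ ∈ paramSpace) (r y : ℕ) (l l' : ℝ) :
    |nextIntensity r θ y l - nextIntensity r θ y l'| ≤ maxCoef θ * |l - l'| := by
  rw [nextIntensity_sub, abs_mul, abs_of_pos (aCoef_pos hθ r y)]
  gcongr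
  exact aCoef_le_maxCoef r θ y

/-- For a common count the regime is common, and the intensities contract by at most `maxCoef θ`.
The derivative also feels the difference of the intensities, with a coefficient at most `scale θ`.
The scale is chosen such that `maxCoef θ + scale θ` is the rate `(1 + maxCoef θ) / 2 < 1`. -/
lemma lipschitzWith_stateStep {θ : Param} (hθ : θ ∈ paramSpace) (r y : ℕ) :
    LipschitzWith (contractionRate θ) (stateStep r θ y) := by
  have hm1 := maxCoef_lt_one hθ
  have hm0 := maxCoef_pos hθ
  refine LipschitzWith.of_dist_le_mul fun s t => ?_
  have h1 : |s.1 - t.1| ≤ dist s t := by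
    rw [← Real.dist_eq]; exact le_max_left _ _
  have h2 : |s.2.1 - t.2.1| ≤ dist s t := by
    rw [← Real.dist_eq]; exact (le_max_left _ _).trans (le_max_right _ _)
  have h3 : ∀ i, |s.2.2 i - t.2.2 i| ≤ dist s t := fun i => by
    rw [← Real.dist_eq]
    exact (dist_le_pi_dist s.2.2 t.2.2 i).trans ((le_max_right _ _).trans (le_max_right _ _))
  have h0 : 0 ≤ dist s t := dist_nonneg
  rw [coe_contractionRate hθ]
  have hle : maxCoef θ * dist s t ≤ (1 + maxCoef θ) / 2 * dist s t := by
    gcongr; linarith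
  refine max_le ?_ (max_le ?_ ?_)
  · rw [Real.dist_eq]
    refine (abs_nextIntensity_sub_le hθ r y _ _).trans (le_trans ?_ hle)
    gcongr
  · rw [Real.dist_eq]
    refine (abs_nextIntensity_sub_le hθ r y _ _).trans (le_trans ?_ hle)
    gcongr
  · refine (dist_pi_le_iff (by positivity)).2 fun i => ?_
    rw [Real.dist_eq]
    have e : (stateStep r θ y s).2.2 i - (stateStep r θ y t).2.2 i
        = aCoef r θ y * (s.2.2 i - t.2.2 i)
          + scale θ * (regimeDir r y i * (s.2.1 - t.2.1)) := by
      rw [← regressor_sub]; simp only [stateStep]; ring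
    rw [e]
    refine (abs_add_le _ _).trans ?_
    rw [abs_mul, abs_mul, abs_mul, abs_of_pos (aCoef_pos hθ r y), abs_of_pos (scale_pos hθ)]
    have b1 : aCoef r θ y * |s.2.2 i - t.2.2 i| ≤ maxCoef θ * dist s t :=
      mul_le_mul (aCoef_le_maxCoef r θ y) (h3 i) (abs_nonneg _) hm0.le
    have b2 : scale θ * (|regimeDir r y i| * |s.2.1 - t.2.1|) ≤ scale θ * (1 * dist s t) := by
      have := (scale_pos hθ).le
      gcongr
      exact abs_regimeDir_le r y i
    rw [scale] at *
    linarith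

lemma norm_stateStep_zero_le {θ : Param} (hθ : θ ∈ paramSpace) (r y : ℕ) :
    ‖stateStep r θ y 0‖ ≤ (1 + ∑ i, θ i) * (1 + y) := by
  have hpos : ∀ i, 0 < θ i := hθ.1
  have hsum : ∀ i, θ i ≤ ∑ i, θ i := fun i =>
    Finset.single_le_sum (f := fun i => θ i) (fun j _ => (hpos j).le) (Finset.mem_univ i)
  have hs0 : 0 ≤ ∑ i, θ i := Finset.sum_nonneg fun i _ => (hpos i).le
  have hy : (0 : ℝ) ≤ y := by positivity
  have h1 : |nextIntensity r θ y 0| ≤ (1 + ∑ i, θ i) * (1 + y) := by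
    rw [abs_of_pos (nextIntensity_pos hθ r y le_rfl)]
    have hd : dCoef r θ y ≤ ∑ i, θ i := by unfold dCoef; split_ifs <;> exact hsum _
    have hb : bCoef r θ y ≤ ∑ i, θ i := by unfold bCoef; split_ifs <;> exact hsum _
    have : bCoef r θ y * y ≤ (∑ i, θ i) * y := by gcongr
    unfold nextIntensity
    nlinarith
  refine max_le h1 (max_le h1 ?_)
  refine (pi_norm_le_iff_of_nonneg (by positivity)).2 fun i => ?_
  simp only [stateStep, Prod.snd_zero, Prod.fst_zero, Pi.zero_apply, mul_zero, zero_add,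
    Real.norm_eq_abs]
  rw [abs_mul, abs_of_pos (scale_pos hθ)]
  have h2 := abs_regressor_le r y 0 i
  rw [abs_zero, add_zero] at h2
  calc scale θ * |regressor r y 0 i| ≤ 1 * (1 + y) :=
        mul_le_mul (scale_le_one hθ) h2 (abs_nonneg _) zero_le_one
    _ ≤ _ := by gcongr; linarith

lemma norm_stateStep_le {θ : Param} (hθ : θ ∈ paramSpace) (r y : ℕ) (s : State) :
    ‖stateStep r θ y s‖ ≤ contractionRate θ * ‖s‖ + (1 + ∑ i, θ i) * (1 + y) := by
  have h := (lipschitzWith_stateStep hθ r y).dist_le_mul s 0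
  rw [dist_zero_right, dist_eq_norm] at h
  have := norm_le_norm_sub_add (stateStep r θ y s) (stateStep r θ y 0)
  linarith [norm_stateStep_zero_le hθ r y]

/-- Exponent of the exponential Lyapunov function. -/
noncomputable def expRate (θ : Param) : ℝ := (1 - θ 4 - θ 5) / 2

lemma expRate_pos {θ : Param} (hθ : θ ∈ paramSpace) : 0 < expRate θ := by
  have := hθ.2.2.2; unfold expRate; linarith

lemma expRate_mul_pos {θ : Param} (hθ : θ ∈ paramSpace) : 0 < expRate θ * θ 5 :=
  mul_pos (expRate_pos hθ) (hθ.1 5)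

/-- Decrease factor of the exponential Lyapunov function. -/
noncomputable def expDecay (θ : Param) : ℝ := max (θ 1) ((1 + θ 4 + θ 5) / 2)

lemma expDecay_lt_one {θ : Param} (hθ : θ ∈ paramSpace) : expDecay θ < 1 :=
  max_lt hθ.2.1 (by linarith [hθ.2.2.2])

/-- In the upper regime the exponential moment with exponent `σ` of the next intensity is governed
by `exp (l (σ a₂ + exp (σ b₂) - 1))`. Since `exp u - 1 ≤ u + u ^ 2`, the bracket is at most `σ (a₂ +
b₂ + σ)`, and `σ = (1 - a₂ - b₂) / 2` makes this `σ (1 + a₂ + b₂) / 2`. -/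
lemma exp_moment_rate_le {θ : Param} (hθ : θ ∈ paramSpace) :
    expRate θ * θ 4 + (Real.exp (expRate θ * θ 5) - 1) ≤ expRate θ * expDecay θ := by
  have h4 := hθ.1 4
  have h5 := hθ.1 5
  have h45 := hθ.2.2.2
  have hσ := expRate_pos hθ
  have hσ1 : expRate θ ≤ 1 := by unfold expRate; linarith
  have hu : expRate θ * θ 5 ≤ 1 := by nlinarith
  have h1 := Real.abs_exp_sub_one_sub_id_le (x := expRate θ * θ 5)
    (by rw [abs_of_pos (expRate_mul_pos hθ)]; exact hu)
  have h2 := (abs_le.1 h1).2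
  have h3 : (expRate θ * θ 5) ^ 2 ≤ expRate θ * expRate θ := by
    have : θ 5 ^ 2 ≤ 1 := by nlinarith
    nlinarith [mul_pos hσ hσ]
  have h6 : (1 + θ 4 + θ 5) / 2 ≤ expDecay θ := le_max_right _ _
  have h7 : expRate θ * ((1 + θ 4 + θ 5) / 2) ≤ expRate θ * expDecay θ := by gcongr
  have h8 : expRate θ * (expRate θ + θ 4 + θ 5) = expRate θ * ((1 + θ 4 + θ 5) / 2) := by
    unfold expRate; ring
  nlinarith

lemma exp_expRate_sub_one_le {θ : Param} (hθ : θ ∈ paramSpace) :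
    Real.exp (expRate θ * θ 5) - 1 ≤ expRate θ * expDecay θ := by
  have := exp_moment_rate_le hθ
  linarith [mul_pos (expRate_pos hθ) (hθ.1 4)]

/-- The chain lives on all real states, with the positive part of the first coordinate as rate. This
reduces the drift estimate to nonnegative intensities. -/
lemma toNNReal_nextIntensity_le {θ : Param} (hθ : θ ∈ paramSpace) (r y : ℕ) (l : ℝ) :
    ((nextIntensity r θ y l).toNNReal : ℝ) ≤ nextIntensity r θ y (l.toNNReal : ℝ) := by
  rw [Real.coe_toNNReal']
  refine max_le ?_ (nextIntensity_pos hθ r y (NNReal.coe_nonneg _)).le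
  unfold nextIntensity
  have := (aCoef_pos hθ r y).le
  gcongr
  exact Real.le_coe_toNNReal l

/-- In the lower regime the next intensity is at most a constant plus `a₁ l`. In the upper regime
the Poisson exponential moment applies. Both give at most a constant times `exp (κ σ l)` with `κ <
1`, which is absorbed by `exp (σ l) / 2` plus a constant. The norm contracts up to a term linear in
the count, which the same exponential dominates. -/
lemma exists_drift {θ : Param} (hθ : θ ∈ paramSpace) (r : ℕ) : ∃ C : ℝ≥0, ∀ s : State,
    ∫⁻ k, ((Real.exp (expRate θ * (stateStep r θ k s).1.toNNReal)).toNNReal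
        + ‖stateStep r θ k s‖₊ : ℝ≥0) ∂poissonMeasure s.1.toNNReal
      ≤ contractionRate θ * (((Real.exp (expRate θ * s.1.toNNReal)).toNNReal + ‖s‖₊ : ℝ≥0) : ENNReal)
        + C := by
  have hσ := expRate_pos hθ
  set σ := expRate θ with hσd
  set u := σ * θ 5 with hu
  have hu0 : 0 < u := expRate_mul_pos hθ
  set c1 := Real.exp (σ * (θ 0 + θ 2 * r)) with hc1
  set c2 := Real.exp (σ * θ 3) with hc2
  set K := (1 + ∑ i, θ i) * (1 + 1 / u) with hK
  have hsum0 : 0 ≤ ∑ i, θ i := Finset.sum_nonneg fun i _ => (hθ.1 i).le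
  have hK0 : 0 < K := by positivity
  set c3 := c1 + c2 + K with hc3
  have hc30 : 0 < c3 := by positivity
  set κ := expDecay θ with hκ
  have hκ1 : κ < 1 := expDecay_lt_one hθ
  have hκ0 : 0 < κ := lt_max_of_lt_left (hθ.1 1)
  -- From here on `c3 * exp (κ x) ≤ exp x / 2`; before, the left side is bounded by `C`.
  set x0 := Real.log (2 * c3) / (1 - κ) with hx0
  set C := c3 * Real.exp (max x0 0) with hC
  have hC0 : 0 ≤ C := by positivity
  have hfin : ∀ x : ℝ, 0 ≤ x → c3 * Real.exp (κ * x) ≤ 1 / 2 * Real.exp x + C := by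
    intro x hx
    rcases le_or_gt x0 x with h | h
    · have h1 : c3 ≤ 1 / 2 * Real.exp ((1 - κ) * x) := by
        have h2 : Real.log (2 * c3) ≤ (1 - κ) * x := by
          rw [hx0, div_le_iff₀ (by linarith)] at h; linarith
        have h3 := Real.exp_le_exp.2 h2
        rw [Real.exp_log (by positivity)] at h3
        linarith
      calc c3 * Real.exp (κ * x) ≤ 1 / 2 * Real.exp ((1 - κ) * x) * Real.exp (κ * x) := by gcongr
        _ = 1 / 2 * Real.exp x := by rw [mul_assoc, ← Real.exp_add]; ring_nf
        _ ≤ _ := by linarith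
    · have h1 : Real.exp (κ * x) ≤ Real.exp (max x0 0) := by
        refine Real.exp_le_exp.2 ?_
        calc κ * x ≤ 1 * x := by gcongr
          _ ≤ max x0 0 := by rw [one_mul]; exact h.le.trans (le_max_left _ _)
      have := Real.exp_pos x
      calc c3 * Real.exp (κ * x) ≤ C := by rw [hC]; gcongr
        _ ≤ _ := by linarith
  refine ⟨C.toNNReal, fun s => ?_⟩
  set q : ℝ≥0 := s.1.toNNReal with hq
  -- Both regimes are bounded at once: the lower one by a term free of `k`, the upper one and the
  -- linear growth of the norm by a multiple of `exp (u k)`.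
  have hpt : ∀ k : ℕ, (((Real.exp (σ * (stateStep r θ k s).1.toNNReal)).toNNReal
        + ‖stateStep r θ k s‖₊ : ℝ≥0) : ENNReal)
      ≤ ENNReal.ofReal (c1 * Real.exp (σ * θ 1 * q) + contractionRate θ * ‖s‖)
        + ENNReal.ofReal (c2 * Real.exp (σ * θ 4 * q) + K) * ENNReal.ofReal (Real.exp (u * k)) := by
    intro k
    rw [← ENNReal.ofReal_mul (by positivity), ← ENNReal.ofReal_add (by positivity) (by positivity),
      ← ENNReal.ofReal_coe_nnreal]
    refine ENNReal.ofReal_le_ofReal ?_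
    push_cast
    rw [Real.coe_toNNReal _ (Real.exp_pos _).le]
    have hexp1 : 1 ≤ Real.exp (u * k) := Real.one_le_exp (by positivity)
    have h1 : Real.exp (σ * (stateStep r θ k s).1.toNNReal)
        ≤ c1 * Real.exp (σ * θ 1 * q) + c2 * Real.exp (σ * θ 4 * q) * Real.exp (u * k) := by
      have h2 : σ * ((stateStep r θ k s).1.toNNReal : ℝ) ≤ σ * nextIntensity r θ k q := by
        gcongr
        exact toNNReal_nextIntensity_le hθ r k s.1
      refine (Real.exp_le_exp.2 h2).trans ?_
      by_cases hk : k ≤ r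
      · have h3 : σ * nextIntensity r θ k q ≤ σ * (θ 0 + θ 2 * r) + σ * θ 1 * q := by
          have h4 : (k : ℝ) ≤ r := by exact_mod_cast hk
          have h5 : θ 2 * (k : ℝ) ≤ θ 2 * r := by have := (hθ.1 2).le; gcongr
          have h6 : nextIntensity r θ k q ≤ (θ 0 + θ 2 * r) + θ 1 * q := by
            unfold nextIntensity dCoef aCoef bCoef
            rw [if_pos hk, if_pos hk, if_pos hk]
            linarith
          calc _ ≤ σ * ((θ 0 + θ 2 * r) + θ 1 * q) := by gcongr
            _ = _ := by ring
        refine (Real.exp_le_exp.2 h3).trans ?_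
        rw [Real.exp_add]
        have : 0 ≤ c2 * Real.exp (σ * θ 4 * q) * Real.exp (u * k) := by positivity
        linarith
      · have h3 : σ * nextIntensity r θ k q = σ * θ 3 + σ * θ 4 * q + u * k := by
          unfold nextIntensity dCoef aCoef bCoef
          rw [if_neg hk, if_neg hk, if_neg hk, hu]
          ring
        rw [h3, Real.exp_add, Real.exp_add]
        have : 0 ≤ c1 * Real.exp (σ * θ 1 * q) := by positivity
        linarith
    have h2 := norm_stateStep_le hθ r k s
    have h3 : (1 + ∑ i, θ i) * (1 + (k : ℝ)) ≤ K * Real.exp (u * k) := by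
      rw [hK, mul_assoc]
      gcongr
      have h4 : u * k + 1 ≤ Real.exp (u * k) := Real.add_one_le_exp _
      have h5 : (k : ℝ) ≤ 1 / u * Real.exp (u * k) := by
        rw [div_mul_eq_mul_div, le_div_iff₀ hu0]; linarith
      linarith
    linarith
  have hint : ∫⁻ k, (((Real.exp (σ * (stateStep r θ k s).1.toNNReal)).toNNReal
        + ‖stateStep r θ k s‖₊ : ℝ≥0) : ENNReal) ∂poissonMeasure q
      ≤ ENNReal.ofReal (c1 * Real.exp (σ * θ 1 * q) + contractionRate θ * ‖s‖)
        + ENNReal.ofReal (c2 * Real.exp (σ * θ 4 * q) + K)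
          * ENNReal.ofReal (Real.exp (q * (Real.exp u - 1))) := by
    refine (lintegral_mono hpt).trans (le_of_eq ?_)
    rw [lintegral_add_left measurable_const, lintegral_const_mul _ .of_discrete,
      lintegral_exp_poissonMeasure]
    simp
  refine hint.trans ?_
  rw [← ENNReal.ofReal_mul (by positivity), ← ENNReal.ofReal_add (by positivity) (by positivity),
    ← ENNReal.ofReal_coe_nnreal (p := C.toNNReal), ← ENNReal.coe_mul,
    ← ENNReal.ofReal_coe_nnreal (p := contractionRate θ * _),
    ← ENNReal.ofReal_add (by positivity) (by positivity)]
  refine ENNReal.ofReal_le_ofReal ?_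
  push_cast
  rw [Real.coe_toNNReal _ (Real.exp_pos _).le, Real.coe_toNNReal _ hC0]
  have hq0 : (0 : ℝ) ≤ q := q.2
  have e1 : Real.exp (σ * θ 1 * q) ≤ Real.exp (κ * (σ * q)) := by
    refine Real.exp_le_exp.2 ?_
    have : θ 1 ≤ κ := le_max_left _ _
    calc σ * θ 1 * q = θ 1 * (σ * q) := by ring
      _ ≤ _ := by gcongr
  have e2 : Real.exp (σ * θ 4 * q) * Real.exp (q * (Real.exp u - 1)) ≤ Real.exp (κ * (σ * q)) := by
    rw [← Real.exp_add]
    refine Real.exp_le_exp.2 ?_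
    calc σ * θ 4 * q + q * (Real.exp u - 1) = (σ * θ 4 + (Real.exp u - 1)) * q := by ring
      _ ≤ σ * κ * q := by gcongr; exact exp_moment_rate_le hθ
      _ = _ := by ring
  have e3 : Real.exp (q * (Real.exp u - 1)) ≤ Real.exp (κ * (σ * q)) := by
    refine Real.exp_le_exp.2 ?_
    calc q * (Real.exp u - 1) = (Real.exp u - 1) * q := by ring
      _ ≤ σ * κ * q := by gcongr; exact exp_expRate_sub_one_le hθ
      _ = _ := by ring
  have e4 := hfin (σ * q) (by positivity)
  have e5 : (1 / 2 : ℝ) ≤ contractionRate θ := by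
    rw [coe_contractionRate hθ]; linarith [maxCoef_pos hθ]
  calc c1 * Real.exp (σ * θ 1 * q) + contractionRate θ * ‖s‖
        + (c2 * Real.exp (σ * θ 4 * q) + K) * Real.exp (q * (Real.exp u - 1))
      = c1 * Real.exp (σ * θ 1 * q)
        + c2 * (Real.exp (σ * θ 4 * q) * Real.exp (q * (Real.exp u - 1)))
        + K * Real.exp (q * (Real.exp u - 1)) + contractionRate θ * ‖s‖ := by ring
    _ ≤ c1 * Real.exp (κ * (σ * q)) + c2 * Real.exp (κ * (σ * q)) + K * Real.exp (κ * (σ * q))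
        + contractionRate θ * ‖s‖ := by gcongr
    _ = c3 * Real.exp (κ * (σ * q)) + contractionRate θ * ‖s‖ := by rw [hc3]; ring
    _ ≤ 1 / 2 * Real.exp (σ * q) + C + contractionRate θ * ‖s‖ := by linarith
    _ ≤ contractionRate θ * Real.exp (σ * q) + C + contractionRate θ * ‖s‖ := by gcongr
    _ = _ := by ring

/-- The joint recursion of the intensities and of the derivative, as a chain driven by Poisson
counts. -/
noncomputable def stateChain (r : ℕ) (θ : Param) (hθ : θ ∈ paramSpace) : PoissonChain State where
  step := stateStep r θ
  rate s := s.1.toNNReal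
  ρ := contractionRate θ
  ρ_lt_one := contractionRate_lt_one hθ
  lipschitz_step := lipschitzWith_stateStep hθ r
  lipschitz_rate := by
    have := Real.lipschitzWith_toNNReal.comp (LipschitzWith.prod_fst (α := ℝ) (β := ℝ × (Fin 6 → ℝ)))
    rwa [mul_one] at this
  V s := (Real.exp (expRate θ * s.1.toNNReal)).toNNReal + ‖s‖₊
  continuous_V := by fun_prop
  γ := contractionRate θ
  γ_lt_one := contractionRate_lt_one hθ
  C := (exists_drift hθ r).choose
  drift := (exists_drift hθ r).choose_spec
  norm_le_V s := le_add_self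

end SETPAR

/-! ### Poisson means -/

lemma hasSum_poisson_mean (q : ℝ≥0) :
    HasSum (fun k : ℕ => Real.exp (-q) * (q : ℝ) ^ k / (k.factorial : ℝ) * k) q := by
  rw [← hasSum_nat_add_iff' 1]
  simp only [Finset.range_one, Finset.sum_singleton, Nat.cast_zero, mul_zero, sub_zero]
  have h := (hasSum_one_poissonMeasure q).mul_left (q : ℝ)
  rw [mul_one] at h
  refine (congrArg (HasSum · (q : ℝ)) (funext fun k => ?_)).mp h
  rw [Nat.factorial_succ]
  push_cast
  have : (k : ℝ) + 1 ≠ 0 := by positivity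
  field_simp
  ring

lemma integral_sub_mean_poissonMeasure (q : ℝ≥0) :
    ∫ j : ℕ, ((j : ℝ) - q) ∂poissonMeasure q = 0 := by
  rw [integral_poissonMeasure]
  have h := (hasSum_poisson_mean q).sub ((hasSum_one_poissonMeasure q).mul_right (q : ℝ))
  simp only [one_mul, sub_self] at h
  rw [← h.tsum_eq]
  simp only [smul_eq_mul, mul_sub]

lemma integral_indicator_sub_poissonMeasure (q : ℝ≥0) (y : ℕ) :
    ∫ j : ℕ, ((if j = y then 1 else 0 : ℝ) - (poissonMeasure q).real {y}) ∂poissonMeasure q = 0 := by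
  have e : (fun j : ℕ => (if j = y then 1 else 0 : ℝ)) = ({y} : Set ℕ).indicator 1 := by
    ext j; simp [Set.indicator_apply]
  rw [integral_sub (integrable_poissonMeasure_of_bounded (B := 1) fun k => by split_ifs <;> simp)
    (integrable_const _), e, integral_indicator_one (by measurability)]
  simp

/-! ### Stochastic lemmas -/

/-- Geometric weights keep the expected absolute sum bounded in `n`, so division by `√n` suffices.
The lemma serves to exchange the true intensity for the observable one. -/
lemma HasUniformMoments.negligible_of_geometric {Ω : Type*} [MeasurableSpace Ω] {P : Measure Ω}
    {U W : ℕ → Ω → ℝ} (hW : HasUniformMoments P W) {ρ : ℝ} (hρ0 : 0 ≤ ρ) (hρ : ρ < 1)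
    (hU : ∀ k, AEMeasurable (U k) P) (h : ∀ k ω, |U k ω| ≤ ρ ^ k * |W k ω|) :
    NegligibleInProb P (fun n ω => (√(n : ℝ))⁻¹ * ∑ k ∈ Finset.range n, U k ω) := by
  obtain ⟨C, hC⟩ := hW.exists_lintegral_le
  refine NegligibleInProb.of_lintegral
    (fun n => (Finset.aemeasurable_fun_sum _ fun k _ => hU k).const_mul _) ?_
  have hle : ∀ n : ℕ, ∫⁻ ω, ‖(√(n : ℝ))⁻¹ * ∑ k ∈ Finset.range n, U k ω‖ₑ ∂P
      ≤ ENNReal.ofReal ((√(n : ℝ))⁻¹ * ((1 - ρ)⁻¹ * C)) := by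
    intro n
    calc ∫⁻ ω, ‖(√(n : ℝ))⁻¹ * ∑ k ∈ Finset.range n, U k ω‖ₑ ∂P
        ≤ ∫⁻ ω, ENNReal.ofReal (√(n : ℝ))⁻¹
          * ∑ k ∈ Finset.range n, ENNReal.ofReal (ρ ^ k) * ‖W k ω‖ₑ ∂P := by
          refine lintegral_mono fun ω => ?_
          rw [enorm_mul, Real.enorm_eq_ofReal (by positivity)]
          gcongr
          refine (enorm_sum_le _ _).trans (Finset.sum_le_sum fun k _ => ?_)
          rw [Real.enorm_eq_ofReal_abs, Real.enorm_eq_ofReal_abs,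
            ← ENNReal.ofReal_mul (by positivity)]
          exact ENNReal.ofReal_le_ofReal (h k ω)
      _ = ENNReal.ofReal (√(n : ℝ))⁻¹
          * ∑ k ∈ Finset.range n, ENNReal.ofReal (ρ ^ k) * ∫⁻ ω, ‖W k ω‖ₑ ∂P := by
          rw [lintegral_const_mul' _ _ ENNReal.ofReal_ne_top,
            lintegral_finsetSum' _ fun k _ => (hW.aemeasurable k).enorm.const_mul _]
          simp_rw [lintegral_const_mul' _ _ ENNReal.ofReal_ne_top]
      _ ≤ ENNReal.ofReal (√(n : ℝ))⁻¹
          * ∑ k ∈ Finset.range n, ENNReal.ofReal (ρ ^ k) * ENNReal.ofReal C := by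
          gcongr
          rw [ENNReal.ofReal_coe_nnreal]
          exact hC _
      _ = ENNReal.ofReal ((√(n : ℝ))⁻¹ * ((∑ k ∈ Finset.range n, ρ ^ k) * C)) := by
          rw [← Finset.sum_mul, ← ENNReal.ofReal_sum_of_nonneg (fun k _ => by positivity),
            ← ENNReal.ofReal_mul (Finset.sum_nonneg fun k _ => by positivity),
            ← ENNReal.ofReal_mul (by positivity)]
      _ ≤ _ := by
          refine ENNReal.ofReal_le_ofReal ?_
          gcongr
          rw [← tsum_geometric_of_lt_one hρ0 hρ]
          exact (summable_geometric_of_lt_one hρ0 hρ).sum_le_tsum _ fun k _ => by positivity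
  refine tendsto_of_tendsto_of_tendsto_of_le_of_le tendsto_const_nhds ?_ (fun _ => zero_le) hle
  have h1 : Tendsto (fun n : ℕ => (√(n : ℝ))⁻¹ * ((1 - ρ)⁻¹ * C)) atTop (𝓝 (0 * ((1 - ρ)⁻¹ * C))) :=
    (tendsto_inv_atTop_zero.comp (Real.tendsto_sqrt_atTop.comp tendsto_natCast_atTop_atTop)
      ).mul_const _
  simpa using ENNReal.tendsto_ofReal h1

lemma NegligibleInProb.average_of_sqrt {Ω : Type*} [MeasurableSpace Ω] {P : Measure Ω}
    {U : ℕ → Ω → ℝ}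
    (h : NegligibleInProb P (fun n ω => (√(n : ℝ))⁻¹ * ∑ k ∈ Finset.range n, U k ω)) :
    NegligibleInProb P (fun n ω => (n : ℝ)⁻¹ * ∑ k ∈ Finset.range n, U k ω) := by
  refine h.mono fun n ω => ?_
  rw [abs_mul, abs_mul, abs_inv, abs_inv, Nat.abs_cast, abs_of_nonneg (Real.sqrt_nonneg _)]
  rcases Nat.eq_zero_or_pos n with rfl | hn
  · simp
  gcongr
  have : (1 : ℝ) ≤ n := by exact_mod_cast hn
  exact Real.sqrt_le_iff.2 ⟨by linarith, by nlinarith⟩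

/-! ### Martingale sums of functions of the counts -/

section Martingale

variable {Ω : Type*} [mΩ : MeasurableSpace Ω] {P : Measure Ω}
  {ℱ : Filtration ℕ mΩ} {Y : ℕ → Ω → ℕ} {lam : ℕ → Ω → ℝ≥0} {G : ℕ → Ω → ℝ} {e : ℕ → ℝ≥0 → ℝ}

/-- Everything but the last innovation is known before the count `Y l` is drawn, and that innovation
has conditional mean zero. -/
lemma PoissonCounts.integral_mul_eq_zero (h : PoissonCounts P ℱ Y lam)
    (hG : ∀ k, Measurable[ℱ k] (G k)) (hGm : HasUniformMoments P G)
    (he : ∀ j, Measurable (e j)) (hz : ∀ l, ∫ j, e j l ∂poissonMeasure l = 0)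
    (hem : HasUniformMoments P fun k ω => e (Y k ω) (lam k ω)) {k l : ℕ} (hkl : k < l) :
    ∫ ω, G k ω * e (Y k ω) (lam k ω) * (G l ω * e (Y l ω) (lam l ω)) ∂P = 0 := by
  have hu := hGm.mul hem
  have hek : Measurable[ℱ l] (fun ω => e (Y k ω) (lam k ω)) := by
    have h1 : Measurable (fun p : ℕ × ℝ≥0 => e p.1 p.2) := measurable_from_prod_countable_right he
    exact h1.comp (((h.measurable_count k).mono (ℱ.mono hkl) le_rfl).prodMk
      ((h.measurable_rate k).mono (ℱ.mono hkl.le) le_rfl))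
  have hGk : Measurable[ℱ l] (G k) := (hG k).mono (ℱ.mono hkl.le) le_rfl
  have e1 : ∀ ω, G k ω * e (Y k ω) (lam k ω) * (G l ω * e (Y l ω) (lam l ω))
      = (G k ω * e (Y k ω) (lam k ω) * G l ω) * e (Y l ω) (lam l ω) := fun ω => by ring
  simp_rw [e1]
  refine h.integral_eq_zero_of_past l (G := fun ω => G k ω * e (Y k ω) (lam k ω) * G l ω)
    ((hGk.mul hek).mul (hG l)) he hz ?_
  simp_rw [← e1]
  exact MemLp.integrable_mul (hu.memLp_two k) (hu.memLp_two l)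

lemma PoissonCounts.martingale_average [IsProbabilityMeasure P] (h : PoissonCounts P ℱ Y lam)
    (hG : ∀ k, Measurable[ℱ k] (G k)) (hGm : HasUniformMoments P G)
    (he : ∀ j, Measurable (e j)) (hz : ∀ l, ∫ j, e j l ∂poissonMeasure l = 0)
    (hem : HasUniformMoments P fun k ω => e (Y k ω) (lam k ω)) :
    NegligibleInProb P
      (fun n ω => (n : ℝ)⁻¹ * ∑ k ∈ Finset.range n, G k ω * e (Y k ω) (lam k ω)) := by
  have hu := hGm.mul hem
  obtain ⟨A, -, hA⟩ := hu.exists_integral_sq_le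
  refine NegligibleInProb.of_lintegral
    (fun n => (Finset.aemeasurable_fun_sum _ fun k _ => hu.aemeasurable k).const_mul _)
    (tendsto_lintegral_average_of_correlation hu.memLp_two hA fun ε hε => ⟨0, fun k l _ hkl => ?_⟩)
  rw [h.integral_mul_eq_zero hG hGm he hz hem hkl]
  simpa using hε.le

/-- The increments are orthogonal, so the second moment of the sum is at most linear in `n`. -/
lemma PoissonCounts.martingale_bounded [IsProbabilityMeasure P] (h : PoissonCounts P ℱ Y lam)
    (hG : ∀ k, Measurable[ℱ k] (G k)) (hGm : HasUniformMoments P G)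
    (he : ∀ j, Measurable (e j)) (hz : ∀ l, ∫ j, e j l ∂poissonMeasure l = 0)
    (hem : HasUniformMoments P fun k ω => e (Y k ω) (lam k ω)) :
    BoundedInProb P
      (fun n ω => (√(n : ℝ))⁻¹ * ∑ k ∈ Finset.range n, G k ω * e (Y k ω) (lam k ω)) := by
  have hu := hGm.mul hem
  obtain ⟨A, hA0, hA⟩ := hu.exists_integral_sq_le
  have hS : ∀ n : ℕ, MemLp (fun ω => (√(n : ℝ))⁻¹ * ∑ k ∈ Finset.range n,
      G k ω * e (Y k ω) (lam k ω)) 2 P := fun n =>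
    (memLp_finsetSum _ fun k _ => hu.memLp_two k).const_mul _
  refine BoundedInProb.of_lintegral (C := (√A).toNNReal) (fun n => (hS n).aemeasurable) fun n => ?_
  refine lintegral_enorm_le_of_integral_sq_le (hS n) ?_
  simp_rw [mul_pow]
  rw [integral_const_mul, inv_pow, Real.sq_sqrt (Nat.cast_nonneg n)]
  have h1 := integral_sq_sum_le hu.memLp_two hA le_rfl (N := 0) (fun k l _ hkl => by
    rw [h.integral_mul_eq_zero hG hGm he hz hem hkl, abs_zero]) n
  simp only [Nat.cast_zero, mul_zero, zero_add, one_mul, zero_mul, add_zero] at h1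
  rcases Nat.eq_zero_or_pos n with rfl | hn
  · simpa using hA0
  · rw [inv_mul_le_iff₀ (by positivity)]
    exact h1

end Martingale

/-! ### Observable intensities and samples with bounded initial intensity -/

namespace SETPAR

/-- Intensities computed by the recursion along a path of counts. -/
def pathIntensity (r : ℕ) (x : ℝ) (θ : Param) (y : ℕ → ℕ) : ℕ → ℝ
  | 0 => x
  | k + 1 => nextIntensity r θ (y k) (pathIntensity r x θ y k)

/-- Derivatives in the parameter of the intensities computed along a path of counts. -/
def pathDeriv (r : ℕ) (x : ℝ) (θ : Param) (y : ℕ → ℕ) : ℕ → Fin 6 → ℝ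
  | 0 => 0
  | k + 1 => fun i => aCoef r θ (y k) * pathDeriv r x θ y k i
      + regressor r (y k) (pathIntensity r x θ y k) i

/-- A uniform lower bound for the intensities. -/
def lowerBound (x : ℝ) (θ : Param) : ℝ := min x (min (θ 0) (θ 3))

lemma lowerBound_pos {x : ℝ} (hx : 0 < x) {θ : Param} (hθ : θ ∈ paramSpace) :
    0 < lowerBound x θ := lt_min hx (lt_min (hθ.1 0) (hθ.1 3))

lemma lowerBound_le_nextIntensity {θ : Param} (hθ : θ ∈ paramSpace) (x : ℝ) (r y : ℕ) {l : ℝ}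
    (hl : 0 ≤ l) : lowerBound x θ ≤ nextIntensity r θ y l := by
  have h1 := mul_nonneg (aCoef_pos hθ r y).le hl
  have h2 := mul_nonneg (bCoef_pos hθ r y).le (Nat.cast_nonneg (α := ℝ) y)
  have h3 : lowerBound x θ ≤ dCoef r θ y := by
    unfold dCoef lowerBound
    split_ifs
    · exact (min_le_right _ _).trans (min_le_left _ _)
    · exact (min_le_right _ _).trans (min_le_right _ _)
  unfold nextIntensity
  linarith

lemma lowerBound_le_pathIntensity {x : ℝ} (hx : 0 < x) {θ : Param} (hθ : θ ∈ paramSpace) (r : ℕ)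
    (y : ℕ → ℕ) (k : ℕ) : lowerBound x θ ≤ pathIntensity r x θ y k := by
  induction k with
  | zero => exact min_le_left _ _
  | succ k ih =>
    exact lowerBound_le_nextIntensity hθ x r _ ((lowerBound_pos hx hθ).le.trans ih)

lemma pathIntensity_pos {x : ℝ} (hx : 0 < x) {θ : Param} (hθ : θ ∈ paramSpace) (r : ℕ)
    (y : ℕ → ℕ) (k : ℕ) : 0 < pathIntensity r x θ y k :=
  (lowerBound_pos hx hθ).trans_le (lowerBound_le_pathIntensity hx hθ r y k)

/-- A one-sided sample from the model, with a bounded initial intensity. -/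
structure BoundedSample {Ω : Type*} [mΩ : MeasurableSpace Ω] (P : Measure Ω) (ℱ : Filtration ℕ mΩ)
    (Y : ℕ → Ω → ℕ) (lam : ℕ → Ω → ℝ≥0) (r : ℕ) (θ : Param) : Prop where
  counts : PoissonCounts P ℱ Y lam
  recursion : ∀ k ω, (lam (k + 1) ω : ℝ) = nextIntensity r θ (Y k ω) (lam k ω)
  bounded : ∃ K : ℝ≥0, ∀ ω, lam 0 ω ≤ K

/-- The state process of a sample. -/
noncomputable def jointState {Ω : Type*} (Y : ℕ → Ω → ℕ) (lam : ℕ → Ω → ℝ≥0) (r : ℕ) (x : ℝ)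
    (θ : Param) (k : ℕ) (ω : Ω) : State :=
  (lam k ω, pathIntensity r x θ (fun k => Y k ω) k,
    fun i => scale θ * pathDeriv r x θ (fun k => Y k ω) k i)

lemma measurable_nextIntensity (r : ℕ) (θ : Param) (y : ℕ) : Measurable (nextIntensity r θ y) := by
  unfold nextIntensity; fun_prop

lemma measurable_regressor (r y : ℕ) (i : Fin 6) : Measurable fun l => regressor r y l i := by
  unfold regressor
  split_ifs <;> fin_cases i <;> simp <;> fun_prop

namespace BoundedSample

variable {Ω : Type*} [mΩ : MeasurableSpace Ω] {P : Measure Ω} {ℱ : Filtration ℕ mΩ}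
  {Y : ℕ → Ω → ℕ} {lam : ℕ → Ω → ℝ≥0} {r : ℕ} {θ₀ : Param}

lemma measurable_pathIntensity (h : BoundedSample P ℱ Y lam r θ₀) (x : ℝ) (θ : Param) (k : ℕ) :
    Measurable[ℱ k] fun ω => pathIntensity r x θ (fun k => Y k ω) k := by
  induction k with
  | zero => exact measurable_const
  | succ k ih =>
    have h1 : Measurable (fun p : ℕ × ℝ => nextIntensity r θ p.1 p.2) :=
      measurable_from_prod_countable_right fun y => measurable_nextIntensity r θ y
    exact h1.comp ((h.counts.measurable_count k).prodMk (ih.mono (ℱ.mono (Nat.le_succ k)) le_rfl))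

lemma measurable_pathDeriv (h : BoundedSample P ℱ Y lam r θ₀) (x : ℝ) (θ : Param) (k : ℕ)
    (i : Fin 6) : Measurable[ℱ k] fun ω => pathDeriv r x θ (fun k => Y k ω) k i := by
  induction k with
  | zero => exact measurable_const
  | succ k ih =>
    have h1 : Measurable (fun p : ℕ × ℝ × ℝ => aCoef r θ p.1 * p.2.2 + regressor r p.1 p.2.1 i) :=
      measurable_from_prod_countable_right fun y =>
        (measurable_snd.const_mul (aCoef r θ y)).add
          ((measurable_regressor r y i).comp measurable_fst)
    exact h1.comp ((h.counts.measurable_count k).prodMk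
      (((h.measurable_pathIntensity x θ k).mono (ℱ.mono (Nat.le_succ k)) le_rfl).prodMk
        (ih.mono (ℱ.mono (Nat.le_succ k)) le_rfl)))

lemma isRealizedBy (h : BoundedSample P ℱ Y lam r θ₀) (hθ : θ₀ ∈ paramSpace) (x : ℝ) :
    (stateChain r θ₀ hθ).IsRealizedBy P ℱ Y (jointState Y lam r x θ₀) := by
  refine ⟨?_, fun k => ?_, fun k ω => ?_⟩
  · have : (fun k ω => (stateChain r θ₀ hθ).rate (jointState Y lam r x θ₀ k ω)) = lam := by
      ext k ω; simp [stateChain, jointState]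
    rw [this]
    exact h.counts
  · have h1 : Measurable[ℱ k] fun ω i => scale θ₀ * pathDeriv r x θ₀ (fun k => Y k ω) k i :=
      @measurable_pi_lambda _ _ _ (ℱ k) _ _ fun i =>
        (measurable_const_mul (scale θ₀)).comp (h.measurable_pathDeriv x θ₀ k i)
    exact (measurable_coe_nnreal_real.comp (h.counts.measurable_rate k)).prodMk
      ((h.measurable_pathIntensity x θ₀ k).prodMk h1)
  · refine Prod.ext (h.recursion k ω) (Prod.ext rfl ?_)
    ext i
    simp only [jointState, stateChain, stateStep, pathDeriv]
    ring

lemma exists_lintegral_V_le [IsProbabilityMeasure P] (h : BoundedSample P ℱ Y lam r θ₀)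
    (hθ : θ₀ ∈ paramSpace) (x : ℝ) : ∃ D : ℝ≥0,
      ∫⁻ ω, (stateChain r θ₀ hθ).V (jointState Y lam r x θ₀ 0 ω) ∂P ≤ D := by
  obtain ⟨K, hK⟩ := h.bounded
  refine ⟨(Real.exp (expRate θ₀ * K)).toNNReal + (K + ‖x‖₊), ?_⟩
  refine (lintegral_mono fun ω => ENNReal.coe_le_coe.2
    (?_ : _ ≤ (Real.exp (expRate θ₀ * K)).toNNReal + (K + ‖x‖₊))).trans (by simp)
  have hσ := (expRate_pos hθ).le
  refine add_le_add ?_ ?_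
  · refine Real.toNNReal_le_toNNReal (Real.exp_le_exp.2 ?_)
    simp only [jointState, Real.toNNReal_coe]
    gcongr
    exact hK ω
  · rw [← NNReal.coe_le_coe]
    push_cast
    refine max_le ?_ (max_le ?_ ?_)
    · simp only [jointState, NNReal.norm_eq]
      have : (lam 0 ω : ℝ) ≤ K := by exact_mod_cast hK ω
      linarith [norm_nonneg x]
    · simp [jointState, pathIntensity]
    · have : (jointState Y lam r x θ₀ 0 ω).2.2 = 0 := by
        ext i; simp [jointState, pathDeriv]
      rw [this, norm_zero]; positivity

lemma exists_lintegral_exp_le [IsProbabilityMeasure P] (h : BoundedSample P ℱ Y lam r θ₀)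
    (hθ : θ₀ ∈ paramSpace) : ∃ C : ℝ≥0, ∀ k,
      ∫⁻ ω, ENNReal.ofReal (Real.exp (expRate θ₀ * lam k ω)) ∂P ≤ C := by
  obtain ⟨D, hD⟩ := h.exists_lintegral_V_le hθ 0
  refine ⟨_, fun k => le_trans (lintegral_mono fun ω => ?_)
    ((h.isRealizedBy hθ 0).lintegral_V_le hD k)⟩
  rw [ENNReal.ofReal]
  refine ENNReal.coe_le_coe.2 ?_
  simp [stateChain, jointState]

/-- With `u = σ b₂`, the exponential moment of the count is that of `lam` with exponent `exp u - 1 ≤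
σ`, which the Lyapunov function controls. Powers are dominated by exponentials. -/
lemma hasUniformMoments_count [IsProbabilityMeasure P] (h : BoundedSample P ℱ Y lam r θ₀)
    (hθ : θ₀ ∈ paramSpace) : HasUniformMoments P (fun k ω => (Y k ω : ℝ)) := by
  have hYm : ∀ k, Measurable fun ω => (Y k ω : ℝ) := fun k =>
    measurable_from_nat.comp (h.counts.measurable_count' k)
  refine ⟨fun k => (hYm k).aemeasurable, fun p => ?_⟩
  obtain ⟨C, hC⟩ := h.exists_lintegral_exp_le hθ
  set u := expRate θ₀ * θ₀ 5 with hu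
  have hu0 : 0 < u := expRate_mul_pos hθ
  set A := (p.factorial : ℝ) / u ^ p with hA
  have hA0 : 0 ≤ A := by positivity
  refine ⟨A.toNNReal * C, fun k => ?_⟩
  calc ∫⁻ ω, ‖(Y k ω : ℝ)‖ₑ ^ p ∂P
      ≤ ∫⁻ ω, ENNReal.ofReal A * ENNReal.ofReal (Real.exp (u * Y k ω)) ∂P := by
        refine lintegral_mono fun ω => ?_
        rw [← ENNReal.ofReal_mul hA0, ← enorm_pow, Real.enorm_eq_ofReal (by positivity)]
        refine ENNReal.ofReal_le_ofReal ?_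
        have := Real.pow_div_factorial_le_exp (u * Y k ω) (by positivity) p
        rw [div_le_iff₀ (by positivity), mul_pow] at this
        rw [hA, div_mul_eq_mul_div, le_div_iff₀ (by positivity)]
        linarith
    _ = ENNReal.ofReal A * ∫⁻ ω, ENNReal.ofReal (Real.exp (lam k ω * (Real.exp u - 1))) ∂P := by
        rw [lintegral_const_mul' _ _ ENNReal.ofReal_ne_top]
        congr 1
        rw [h.counts.lintegral_count k (g := fun _ j => ENNReal.ofReal (Real.exp (u * j)))
          fun j => measurable_const]
        simp_rw [lintegral_exp_poissonMeasure]
    _ ≤ ENNReal.ofReal A * C := by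
        gcongr
        refine (lintegral_mono fun ω => ?_).trans (hC k)
        refine ENNReal.ofReal_le_ofReal (Real.exp_le_exp.2 ?_)
        rw [mul_comm]
        gcongr
        refine (exp_expRate_sub_one_le hθ).trans ?_
        exact mul_le_of_le_one_right (expRate_pos hθ).le (expDecay_lt_one hθ).le
    _ = _ := by rw [ENNReal.ofReal]; push_cast; rfl

/-- The norm is dominated by an exponential smoothing of the counts, built from the contraction
bound for one step. -/
lemma hasUniformMoments_norm_state [IsProbabilityMeasure P] (h : BoundedSample P ℱ Y lam r θ₀)
    (hθ : θ₀ ∈ paramSpace) (x : ℝ) :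
    HasUniformMoments P (fun k ω => ‖jointState Y lam r x θ₀ k ω‖) := by
  obtain ⟨K, hK⟩ := h.bounded
  have hX := h.isRealizedBy hθ x
  let W : ℕ → Ω → ℝ := fun k ω => Nat.rec (motive := fun _ => ℝ) ((K : ℝ) + ‖x‖)
    (fun k w => contractionRate θ₀ * w + (1 + ∑ i, θ₀ i) * (1 + Y k ω)) k
  have hW : HasUniformMoments P W :=
    HasUniformMoments.of_recursion (x := (K : ℝ) + ‖x‖)
      (((HasUniformMoments.const 1).add (h.hasUniformMoments_count hθ)).const_mul
        (1 + ∑ i, θ₀ i)) (a := contractionRate θ₀) (NNReal.coe_nonneg _)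
        (by exact_mod_cast contractionRate_lt_one hθ) (fun ω => rfl) (fun k ω => rfl)
  have hle : ∀ k ω, ‖jointState Y lam r x θ₀ k ω‖ ≤ W k ω := by
    intro k ω
    induction k with
    | zero =>
      refine max_le ?_ (max_le ?_ ?_)
      · simp only [jointState, NNReal.norm_eq]
        have : (lam 0 ω : ℝ) ≤ K := by exact_mod_cast hK ω
        change (lam 0 ω : ℝ) ≤ (K : ℝ) + ‖x‖
        linarith [norm_nonneg x]
      · change ‖x‖ ≤ (K : ℝ) + ‖x‖
        linarith [K.2]
      · have : (jointState Y lam r x θ₀ 0 ω).2.2 = 0 := by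
          ext i; simp [jointState, pathDeriv]
        rw [this, norm_zero]
        change 0 ≤ (K : ℝ) + ‖x‖
        positivity
    | succ k ih =>
      rw [hX.step_eq]
      refine (norm_stateStep_le hθ r _ _).trans ?_
      change _ ≤ contractionRate θ₀ * W k ω + (1 + ∑ i, θ₀ i) * (1 + Y k ω)
      gcongr
  refine hW.mono (fun k => (hX.measurable' k).norm.aemeasurable) fun k => .of_forall fun ω => ?_
  rw [abs_of_nonneg (norm_nonneg _)]
  exact (hle k ω).trans (le_abs_self _)

lemma hasUniformMoments_rate [IsProbabilityMeasure P] (h : BoundedSample P ℱ Y lam r θ₀)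
    (hθ : θ₀ ∈ paramSpace) : HasUniformMoments P (fun k ω => (lam k ω : ℝ)) := by
  refine (h.hasUniformMoments_norm_state hθ 0).mono
    (fun k => (h.counts.measurable_rate' k).coe_nnreal_real.aemeasurable)
    fun k => .of_forall fun ω => ?_
  rw [abs_of_nonneg (norm_nonneg _)]
  exact norm_fst_le (jointState Y lam r 0 θ₀ k ω)

lemma hasUniformMoments_pathIntensity [IsProbabilityMeasure P] (h : BoundedSample P ℱ Y lam r θ₀)
    (hθ : θ₀ ∈ paramSpace) (x : ℝ) :
    HasUniformMoments P (fun k ω => pathIntensity r x θ₀ (fun k => Y k ω) k) := by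
  refine (h.hasUniformMoments_norm_state hθ x).mono
    (fun k => ((h.measurable_pathIntensity x θ₀ k).mono (ℱ.le k) le_rfl).aemeasurable)
    fun k => .of_forall fun ω => ?_
  rw [abs_of_nonneg (norm_nonneg _)]
  exact (norm_fst_le (jointState Y lam r x θ₀ k ω).2).trans
    (norm_snd_le (jointState Y lam r x θ₀ k ω))

lemma hasUniformMoments_pathDeriv [IsProbabilityMeasure P] (h : BoundedSample P ℱ Y lam r θ₀)
    (hθ : θ₀ ∈ paramSpace) (x : ℝ) (i : Fin 6) :
    HasUniformMoments P (fun k ω => pathDeriv r x θ₀ (fun k => Y k ω) k i) := by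
  refine ((h.hasUniformMoments_norm_state hθ x).const_mul (scale θ₀)⁻¹).mono
    (fun k => ((h.measurable_pathDeriv x θ₀ k i).mono (ℱ.le k) le_rfl).aemeasurable)
    fun k => .of_forall fun ω => ?_
  have hs := scale_pos hθ
  rw [abs_mul, abs_of_nonneg (norm_nonneg _), abs_inv, abs_of_pos hs]
  have h1 : scale θ₀ * |pathDeriv r x θ₀ (fun k => Y k ω) k i| ≤ ‖jointState Y lam r x θ₀ k ω‖ := by
    have h2 := (norm_le_pi_norm (jointState Y lam r x θ₀ k ω).2.2 i).trans
      ((norm_snd_le (jointState Y lam r x θ₀ k ω).2).trans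
        (norm_snd_le (jointState Y lam r x θ₀ k ω)))
    simpa [jointState, abs_mul, abs_of_pos hs] using h2
  rw [inv_mul_eq_div, le_div_iff₀ hs]
  linarith

/-- Two solutions driven by the same counts are always in the same regime, so their distance
decreases by the factor `maxCoef θ₀` each time. -/
lemma abs_rate_sub_pathIntensity_le (h : BoundedSample P ℱ Y lam r θ₀) (hθ : θ₀ ∈ paramSpace)
    (x : ℝ) : ∃ C : ℝ, 0 ≤ C ∧ ∀ k ω, |(lam k ω : ℝ) - pathIntensity r x θ₀ (fun k => Y k ω) k|
      ≤ maxCoef θ₀ ^ k * C := by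
  obtain ⟨K, hK⟩ := h.bounded
  refine ⟨K + |x|, by positivity, fun k ω => ?_⟩
  induction k with
  | zero =>
    have : (lam 0 ω : ℝ) ≤ K := by exact_mod_cast hK ω
    rw [pow_zero, one_mul]
    refine (abs_sub _ _).trans ?_
    rw [abs_of_nonneg (NNReal.coe_nonneg _)]
    exact add_le_add this le_rfl
  | succ k ih =>
    rw [h.recursion]
    refine (abs_nextIntensity_sub_le hθ r _ _ _).trans ?_
    rw [pow_succ', mul_assoc]
    gcongr
    exact (maxCoef_pos hθ).le

/-- Laws of large numbers for functions of the state. -/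
lemma negligible_average_state [IsProbabilityMeasure P] (h : BoundedSample P ℱ Y lam r θ₀)
    (hθ : θ₀ ∈ paramSpace) (x : ℝ) {μ : Measure State} [IsProbabilityMeasure μ]
    (hμ : (stateChain r θ₀ hθ).IsErgodicMeasure μ) {H : State → ℝ}
    (hH : LocallyLipschitz H) {C : ℝ≥0} {p : ℕ} (hC : ∀ s, |H s| ≤ C * (1 + ‖s‖) ^ p) :
    Integrable H μ ∧ NegligibleInProb P (fun n ω => (n : ℝ)⁻¹ * ∑ k ∈ Finset.range n,
      H (jointState Y lam r x θ₀ k ω) - ∫ s, H s ∂μ) := by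
  obtain ⟨D, hD⟩ := h.exists_lintegral_V_le hθ x
  have hm := h.hasUniformMoments_norm_state hθ x
  exact ⟨((h.isRealizedBy hθ x).tendsto_lintegral_average_of_growth hD hm hμ hH hC).1,
    (h.isRealizedBy hθ x).negligible_average_of_growth hD hm hμ hH hC⟩

lemma martingale_average_count [IsProbabilityMeasure P] (h : BoundedSample P ℱ Y lam r θ₀)
    (hθ : θ₀ ∈ paramSpace) {G : ℕ → Ω → ℝ} (hG : ∀ k, Measurable[ℱ k] (G k))
    (hGm : HasUniformMoments P G) : NegligibleInProb P
      (fun n ω => (n : ℝ)⁻¹ * ∑ k ∈ Finset.range n, G k ω * ((Y k ω : ℝ) - lam k ω)) :=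
  h.counts.martingale_average hG hGm (e := fun j l => (j : ℝ) - l) (fun j => by fun_prop)
    integral_sub_mean_poissonMeasure
    ((h.hasUniformMoments_count hθ).sub (h.hasUniformMoments_rate hθ))

/-- Lets the indicator of a count be replaced by its conditional probability, which, unlike the
indicator, is a function of the state. -/
lemma martingale_average_singleton [IsProbabilityMeasure P] (h : BoundedSample P ℱ Y lam r θ₀)
    (y : ℕ) {G : ℕ → Ω → ℝ} (hG : ∀ k, Measurable[ℱ k] (G k))
    (hGm : HasUniformMoments P G) : NegligibleInProb P
      (fun n ω => (n : ℝ)⁻¹ * ∑ k ∈ Finset.range n,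
        G k ω * ((if Y k ω = y then 1 else 0) - (poissonMeasure (lam k ω)).real {y})) := by
  have hm : ∀ j : ℕ, Measurable fun l : ℝ≥0 =>
      ((if j = y then 1 else 0 : ℝ) - (poissonMeasure l).real {y}) := by
    intro j
    simp_rw [poissonMeasure_real_singleton]
    fun_prop
  refine h.counts.martingale_average hG hGm
    (e := fun j l => (if j = y then 1 else 0) - (poissonMeasure l).real {y}) hm
    (fun l => integral_indicator_sub_poissonMeasure l y) ?_
  refine (HasUniformMoments.const (P := P) 1).mono (fun k => ?_) fun k => .of_forall fun ω => ?_
  · have h1 : Measurable (fun p : ℕ × ℝ≥0 =>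
        ((if p.1 = y then 1 else 0 : ℝ) - (poissonMeasure p.2).real {y})) :=
      measurable_from_prod_countable_right hm
    exact (h1.comp ((h.counts.measurable_count' k).prodMk
      (h.counts.measurable_rate' k))).aemeasurable
  · have h0 : 0 ≤ (poissonMeasure (lam k ω)).real {y} := measureReal_nonneg
    have h1 : (poissonMeasure (lam k ω)).real {y} ≤ 1 := measureReal_le_one
    rw [abs_one, abs_le]
    split_ifs <;> constructor <;> linarith

end BoundedSample

end SETPAR

namespace SETPAR

/-! ### Envelopes along a path -/

/-- Exponential smoothing of the sequence `u`. -/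
def expSmooth (a b : ℝ) (u : ℕ → ℝ) : ℕ → ℝ
  | 0 => b
  | k + 1 => a * expSmooth a b u k + u k

lemma expSmooth_nonneg {a b : ℝ} (ha : 0 ≤ a) (hb : 0 ≤ b) {u : ℕ → ℝ} (hu : ∀ k, 0 ≤ u k) (k : ℕ) :
    0 ≤ expSmooth a b u k := by
  induction k with
  | zero => exact hb
  | succ k ih => exact add_nonneg (mul_nonneg ha ih) (hu k)

lemma abs_le_expSmooth {a b : ℝ} (ha : 0 ≤ a) {u w : ℕ → ℝ} (h0 : |w 0| ≤ b)
    (h : ∀ k, |w (k + 1)| ≤ a * |w k| + u k) (k : ℕ) : |w k| ≤ expSmooth a b u k := by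
  induction k with
  | zero => exact h0
  | succ k ih => exact (h k).trans (by rw [expSmooth]; gcongr)

/-- Bounds valid for all parameters in the set `E`. -/
structure UniformBounds (E : Set Param) (x a c m : ℝ) : Prop where
  subset : E ⊆ paramSpace
  x_pos : 0 < x
  a_nonneg : 0 ≤ a
  a_lt_one : a < 1
  c_nonneg : 0 ≤ c
  m_pos : 0 < m
  maxCoef_le : ∀ θ ∈ E, maxCoef θ ≤ a
  apply_le : ∀ θ ∈ E, ∀ i, θ i ≤ c
  le_lowerBound : ∀ θ ∈ E, m ≤ lowerBound x θ

lemma continuous_apply_param (i : Fin 6) : Continuous fun θ : Param => θ i :=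
  by fun_prop

lemma exists_uniformBounds {E : Set Param} (hE : IsCompact E) (hne : E.Nonempty)
    (hsub : E ⊆ paramSpace) {x : ℝ} (hx : 0 < x) : ∃ a c m, UniformBounds E x a c m := by
  have hc := continuous_apply_param
  obtain ⟨θ₁, h₁, h₁'⟩ := hE.exists_isMaxOn hne
    (f := maxCoef) ((hc 1).max (hc 4)).continuousOn
  obtain ⟨θ₂, h₂, h₂'⟩ := hE.exists_isMaxOn hne (f := fun θ : Param => ∑ i, θ i)
    (continuous_finsetSum _ fun i _ => hc i).continuousOn
  obtain ⟨θ₃, h₃, h₃'⟩ := hE.exists_isMinOn hne (f := lowerBound x)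
    (continuous_const.min ((hc 0).min (hc 3))).continuousOn
  refine ⟨maxCoef θ₁, ∑ i, θ₂ i, lowerBound x θ₃, hsub, hx, (maxCoef_pos (hsub h₁)).le,
    maxCoef_lt_one (hsub h₁), Finset.sum_nonneg fun i _ => ((hsub h₂).1 i).le,
    lowerBound_pos hx (hsub h₃), fun θ h => h₁' h, fun θ h i => ?_, fun θ h => h₃' h⟩
  exact (Finset.single_le_sum (f := fun i => θ i) (fun j _ => ((hsub h).1 j).le)
    (Finset.mem_univ i)).trans (h₂' h)

/-- Envelope of the intensities. -/
def envelope (x a c : ℝ) (y : ℕ → ℕ) : ℕ → ℝ := expSmooth a x fun k => c * (1 + y k)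

/-- Envelope of the first-order variation of the intensities in the parameter. -/
def envelopeOne (x a c : ℝ) (y : ℕ → ℕ) : ℕ → ℝ :=
  expSmooth a 0 fun k => 6 * (1 + envelope x a c y k + y k)

/-- Envelope of the second-order variation of the intensities in the parameter. -/
def envelopeTwo (x a c : ℝ) (y : ℕ → ℕ) : ℕ → ℝ := expSmooth a 0 (envelopeOne x a c y)

/-- Envelope of the third-order variation of the intensities in the parameter. -/
def envelopeThree (x a c : ℝ) (y : ℕ → ℕ) : ℕ → ℝ := expSmooth a 0 (envelopeTwo x a c y)

/-- Second-order coefficients of the intensities in the parameter. -/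
def pathSecond (r : ℕ) (x : ℝ) (θ : Param) (y : ℕ → ℕ) : ℕ → Fin 6 → Fin 6 → ℝ
  | 0 => 0
  | k + 1 => fun i j => aCoef r θ (y k) * pathSecond r x θ y k i j
      + regimeDir r (y k) i * pathDeriv r x θ y k j

lemma abs_apply_le_norm (v : Param) (i : Fin 6) : |v i| ≤ ‖v‖ := by
  simpa using PiLp.norm_apply_le v i

lemma abs_sum_mul_le (v : Param) {w : Fin 6 → ℝ} {b : ℝ} (hw : ∀ i, |w i| ≤ b) :
    |∑ i, v i * w i| ≤ ‖v‖ * (6 * b) := by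
  refine (Finset.abs_sum_le_sum_abs _ _).trans ?_
  calc ∑ i, |v i * w i| ≤ ∑ _i : Fin 6, ‖v‖ * b := by
        refine Finset.sum_le_sum fun i _ => ?_
        rw [abs_mul]
        exact mul_le_mul (abs_apply_le_norm v i) (hw i) (abs_nonneg _) (norm_nonneg _)
    _ = _ := by simp; ring

lemma abs_sum_mul_regimeDir_le (v : Param) (r y : ℕ) : |∑ i, v i * regimeDir r y i| ≤ ‖v‖ := by
  unfold regimeDir
  split_ifs
  · simpa [Pi.single_apply] using abs_apply_le_norm v 1
  · simpa [Pi.single_apply] using abs_apply_le_norm v 4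

lemma aCoef_sub (r : ℕ) (θ θ' : Param) (y : ℕ) :
    aCoef r θ y - aCoef r θ' y = ∑ i, (θ - θ') i * regimeDir r y i := by
  rw [aCoef_eq_sum, aCoef_eq_sum, ← Finset.sum_sub_distrib]
  exact Finset.sum_congr rfl fun i _ => by simp; ring

/-- The parameter enters linearly, so its increment pairs with the regressor at the unperturbed
intensity. All expansions below rest on this identity. -/
lemma nextIntensity_sub_eq (r : ℕ) (θ θ' : Param) (y : ℕ) (s t : ℝ) :
    nextIntensity r θ y s - nextIntensity r θ' y t
      = aCoef r θ y * (s - t) + ∑ i, (θ - θ') i * regressor r y t i := by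
  have h := nextIntensity_sub r θ y s t
  have h1 : nextIntensity r θ y t - nextIntensity r θ' y t
      = ∑ i, (θ - θ') i * regressor r y t i := by
    rw [nextIntensity_eq_sum, nextIntensity_eq_sum, ← Finset.sum_sub_distrib]
    exact Finset.sum_congr rfl fun i _ => by simp; ring
  linarith

namespace UniformBounds

variable {E : Set Param} {x a c m : ℝ} {r : ℕ} {θ θ' : Param}

lemma abs_aCoef_le (h : UniformBounds E x a c m) (hθ : θ ∈ E) (r y : ℕ) : |aCoef r θ y| ≤ a := by
  rw [abs_of_pos (aCoef_pos (h.subset hθ) r y)]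
  exact (aCoef_le_maxCoef r θ y).trans (h.maxCoef_le θ hθ)

lemma le_pathIntensity (h : UniformBounds E x a c m) (hθ : θ ∈ E) (r : ℕ) (y : ℕ → ℕ) (k : ℕ) :
    m ≤ pathIntensity r x θ y k :=
  (h.le_lowerBound θ hθ).trans (lowerBound_le_pathIntensity h.x_pos (h.subset hθ) r y k)

lemma abs_pathIntensity_le (h : UniformBounds E x a c m) (hθ : θ ∈ E) (r : ℕ) (y : ℕ → ℕ) (k : ℕ) :
    |pathIntensity r x θ y k| ≤ envelope x a c y k := by
  refine abs_le_expSmooth h.a_nonneg (abs_of_pos h.x_pos).le (fun k => ?_) k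
  rw [pathIntensity, nextIntensity]
  have h1 : |dCoef r θ (y k)| ≤ c := by
    rw [abs_of_pos (dCoef_pos (h.subset hθ) r _)]
    unfold dCoef; split_ifs <;> exact h.apply_le θ hθ _
  have h2 : |bCoef r θ (y k)| ≤ c := by
    rw [abs_of_pos (bCoef_pos (h.subset hθ) r _)]
    unfold bCoef; split_ifs <;> exact h.apply_le θ hθ _
  have h3 := h.abs_aCoef_le hθ r (y k)
  calc _ ≤ |dCoef r θ (y k)| + |aCoef r θ (y k)| * |pathIntensity r x θ y k|
        + |bCoef r θ (y k)| * y k := by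
        refine (abs_add_le _ _).trans (add_le_add ((abs_add_le _ _).trans (by rw [abs_mul])) ?_)
        rw [abs_mul, Nat.abs_cast]
    _ ≤ c + a * |pathIntensity r x θ y k| + c * y k := by gcongr
    _ = _ := by ring

lemma envelope_nonneg (h : UniformBounds E x a c m) (y : ℕ → ℕ) (k : ℕ) :
    0 ≤ envelope x a c y k :=
  expSmooth_nonneg h.a_nonneg h.x_pos.le (fun _ => mul_nonneg h.c_nonneg (by positivity)) k

lemma envelopeOne_nonneg (h : UniformBounds E x a c m) (y : ℕ → ℕ) (k : ℕ) :
    0 ≤ envelopeOne x a c y k :=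
  expSmooth_nonneg h.a_nonneg le_rfl (fun k => by have := h.envelope_nonneg y k; positivity) k

lemma envelopeTwo_nonneg (h : UniformBounds E x a c m) (y : ℕ → ℕ) (k : ℕ) :
    0 ≤ envelopeTwo x a c y k :=
  expSmooth_nonneg h.a_nonneg le_rfl (h.envelopeOne_nonneg y) k

lemma abs_regressor_le (h : UniformBounds E x a c m) (hθ : θ ∈ E) (r : ℕ) (y : ℕ → ℕ) (k : ℕ)
    (i : Fin 6) : |regressor r (y k) (pathIntensity r x θ y k) i| ≤ 1 + envelope x a c y k + y k :=
  (SETPAR.abs_regressor_le r _ _ i).trans (by gcongr; exact h.abs_pathIntensity_le hθ r y k)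

lemma abs_pathIntensity_sub_le (h : UniformBounds E x a c m) (hθ : θ ∈ E) (hθ' : θ' ∈ E) (r : ℕ)
    (y : ℕ → ℕ) (k : ℕ) : |pathIntensity r x θ y k - pathIntensity r x θ' y k|
      ≤ ‖θ - θ'‖ * envelopeOne x a c y k := by
  induction k with
  | zero => simp [pathIntensity, envelopeOne, expSmooth]
  | succ k ih =>
    rw [pathIntensity, pathIntensity, nextIntensity_sub_eq, envelopeOne, expSmooth]
    calc _ ≤ a * (‖θ - θ'‖ * envelopeOne x a c y k)
          + ‖θ - θ'‖ * (6 * (1 + envelope x a c y k + y k)) := by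
          refine (abs_add_le _ _).trans (add_le_add ?_ ?_)
          · rw [abs_mul]
            exact mul_le_mul (h.abs_aCoef_le hθ r _) ih (abs_nonneg _) h.a_nonneg
          · exact abs_sum_mul_le _ (h.abs_regressor_le hθ' r y k)
      _ = _ := by rw [envelopeOne]; ring

lemma abs_sum_pathDeriv_le (h : UniformBounds E x a c m) (hθ : θ ∈ E) (r : ℕ)
    (y : ℕ → ℕ) (v : Param) (k : ℕ) :
    |∑ i, v i * pathDeriv r x θ y k i| ≤ ‖v‖ * envelopeOne x a c y k := by
  induction k with
  | zero => simp [pathDeriv, envelopeOne, expSmooth]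
  | succ k ih =>
    have e : ∑ i, v i * pathDeriv r x θ y (k + 1) i
        = aCoef r θ (y k) * ∑ i, v i * pathDeriv r x θ y k i
          + ∑ i, v i * regressor r (y k) (pathIntensity r x θ y k) i := by
      rw [Finset.mul_sum, ← Finset.sum_add_distrib]
      exact Finset.sum_congr rfl fun i _ => by rw [pathDeriv]; ring
    rw [e, envelopeOne, expSmooth]
    calc _ ≤ a * (‖v‖ * envelopeOne x a c y k)
          + ‖v‖ * (6 * (1 + envelope x a c y k + y k)) := by
          refine (abs_add_le _ _).trans (add_le_add ?_ ?_)
          · rw [abs_mul]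
            exact mul_le_mul (h.abs_aCoef_le hθ r _) ih (abs_nonneg _) h.a_nonneg
          · exact abs_sum_mul_le _ (h.abs_regressor_le hθ r y k)
      _ = _ := by rw [envelopeOne]; ring

lemma abs_pathDeriv_le (h : UniformBounds E x a c m) (hθ : θ ∈ E) (r : ℕ)
    (y : ℕ → ℕ) (k : ℕ) (i : Fin 6) : |pathDeriv r x θ y k i| ≤ envelopeOne x a c y k := by
  have := h.abs_sum_pathDeriv_le hθ r y (EuclideanSpace.single i 1) k
  simpa [PiLp.single_apply, Finset.sum_ite_eq] using this

/-- By bilinearity the remainder obeys the same recursion, driven by the increment of the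
autoregressive coefficient times the increment of the intensity, a product of order two. -/
lemma abs_pathIntensity_sub_linear_le (h : UniformBounds E x a c m) (hθ : θ ∈ E) (hθ' : θ' ∈ E)
    (r : ℕ) (y : ℕ → ℕ) (k : ℕ) :
    |pathIntensity r x θ y k - pathIntensity r x θ' y k
        - ∑ i, (θ - θ') i * pathDeriv r x θ' y k i|
      ≤ ‖θ - θ'‖ ^ 2 * envelopeTwo x a c y k := by
  induction k with
  | zero => simp [pathIntensity, pathDeriv, envelopeTwo, expSmooth]
  | succ k ih =>
    set v := θ - θ' with hv
    have e : pathIntensity r x θ y (k + 1) - pathIntensity r x θ' y (k + 1)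
        - ∑ i, v i * pathDeriv r x θ' y (k + 1) i
        = aCoef r θ' (y k) * (pathIntensity r x θ y k - pathIntensity r x θ' y k
            - ∑ i, v i * pathDeriv r x θ' y k i)
          + (∑ i, v i * regimeDir r (y k) i)
            * (pathIntensity r x θ y k - pathIntensity r x θ' y k) := by
      have e1 : ∑ i, v i * pathDeriv r x θ' y (k + 1) i
          = aCoef r θ' (y k) * ∑ i, v i * pathDeriv r x θ' y k i
            + ∑ i, v i * regressor r (y k) (pathIntensity r x θ' y k) i := by
        rw [Finset.mul_sum, ← Finset.sum_add_distrib]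
        exact Finset.sum_congr rfl fun i _ => by rw [pathDeriv]; ring
      rw [e1, pathIntensity, pathIntensity, nextIntensity_sub_eq, ← aCoef_sub]
      ring
    rw [e, envelopeTwo, expSmooth]
    calc _ ≤ a * (‖v‖ ^ 2 * envelopeTwo x a c y k) + ‖v‖ * (‖v‖ * envelopeOne x a c y k) := by
          refine (abs_add_le _ _).trans (add_le_add ?_ ?_)
          · rw [abs_mul]
            exact mul_le_mul (h.abs_aCoef_le hθ' r _) ih (abs_nonneg _) h.a_nonneg
          · rw [abs_mul]
            exact mul_le_mul (abs_sum_mul_regimeDir_le _ _ _)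
              (h.abs_pathIntensity_sub_le hθ hθ' r y k) (abs_nonneg _) (norm_nonneg _)
      _ = _ := by rw [envelopeTwo]; ring

/-- One order further, the remainder is driven by the increment of the coefficient times the
remainder of order two. The double sum is the full quadratic term, so the factor one half of a
Taylor formula is already inside `pathSecond`, which need not be symmetric. -/
lemma abs_pathIntensity_sub_quadratic_le (h : UniformBounds E x a c m) (hθ : θ ∈ E) (hθ' : θ' ∈ E)
    (r : ℕ) (y : ℕ → ℕ) (k : ℕ) :
    |pathIntensity r x θ y k - pathIntensity r x θ' y k
        - ∑ i, (θ - θ') i * pathDeriv r x θ' y k i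
        - ∑ i, ∑ j, (θ - θ') i * (θ - θ') j * pathSecond r x θ' y k i j|
      ≤ ‖θ - θ'‖ ^ 3 * envelopeThree x a c y k := by
  induction k with
  | zero => simp [pathIntensity, pathDeriv, pathSecond, envelopeThree, expSmooth]
  | succ k ih =>
    set v := θ - θ' with hv
    have e : pathIntensity r x θ y (k + 1) - pathIntensity r x θ' y (k + 1)
        - ∑ i, v i * pathDeriv r x θ' y (k + 1) i
        - ∑ i, ∑ j, v i * v j * pathSecond r x θ' y (k + 1) i j
        = aCoef r θ' (y k) * (pathIntensity r x θ y k - pathIntensity r x θ' y k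
            - ∑ i, v i * pathDeriv r x θ' y k i
            - ∑ i, ∑ j, v i * v j * pathSecond r x θ' y k i j)
          + (∑ i, v i * regimeDir r (y k) i)
            * (pathIntensity r x θ y k - pathIntensity r x θ' y k
              - ∑ i, v i * pathDeriv r x θ' y k i) := by
      have e1 : ∑ i, v i * pathDeriv r x θ' y (k + 1) i
          = aCoef r θ' (y k) * ∑ i, v i * pathDeriv r x θ' y k i
            + ∑ i, v i * regressor r (y k) (pathIntensity r x θ' y k) i := by
        rw [Finset.mul_sum, ← Finset.sum_add_distrib]
        exact Finset.sum_congr rfl fun i _ => by rw [pathDeriv]; ring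
      have e2 : ∑ i, ∑ j, v i * v j * pathSecond r x θ' y (k + 1) i j
          = aCoef r θ' (y k) * ∑ i, ∑ j, v i * v j * pathSecond r x θ' y k i j
            + (∑ i, v i * regimeDir r (y k) i) * ∑ j, v j * pathDeriv r x θ' y k j := by
        rw [Finset.sum_mul_sum, Finset.mul_sum, ← Finset.sum_add_distrib]
        refine Finset.sum_congr rfl fun i _ => ?_
        rw [Finset.mul_sum, ← Finset.sum_add_distrib]
        exact Finset.sum_congr rfl fun j _ => by rw [pathSecond]; ring
      rw [e1, e2, pathIntensity, pathIntensity, nextIntensity_sub_eq, ← aCoef_sub]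
      ring
    rw [e, envelopeThree, expSmooth]
    calc _ ≤ a * (‖v‖ ^ 3 * envelopeThree x a c y k)
          + ‖v‖ * (‖v‖ ^ 2 * envelopeTwo x a c y k) := by
          refine (abs_add_le _ _).trans (add_le_add ?_ ?_)
          · rw [abs_mul]
            exact mul_le_mul (h.abs_aCoef_le hθ' r _) ih (abs_nonneg _) h.a_nonneg
          · rw [abs_mul]
            exact mul_le_mul (abs_sum_mul_regimeDir_le _ _ _)
              (h.abs_pathIntensity_sub_linear_le hθ hθ' r y k) (abs_nonneg _) (norm_nonneg _)
      _ = _ := by rw [envelopeThree]; ring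

lemma abs_pathDeriv_sub_le (h : UniformBounds E x a c m) (hθ : θ ∈ E) (hθ' : θ' ∈ E)
    (r : ℕ) (y : ℕ → ℕ) (k : ℕ) (i : Fin 6) :
    |pathDeriv r x θ y k i - pathDeriv r x θ' y k i| ≤ 2 * ‖θ - θ'‖ * envelopeTwo x a c y k := by
  induction k with
  | zero => simp [pathDeriv, envelopeTwo, expSmooth]
  | succ k ih =>
    have e : pathDeriv r x θ y (k + 1) i - pathDeriv r x θ' y (k + 1) i
        = aCoef r θ (y k) * (pathDeriv r x θ y k i - pathDeriv r x θ' y k i)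
          + ((∑ i, (θ - θ') i * regimeDir r (y k) i) * pathDeriv r x θ' y k i
          + regimeDir r (y k) i * (pathIntensity r x θ y k - pathIntensity r x θ' y k)) := by
      rw [← regressor_sub, ← aCoef_sub, pathDeriv, pathDeriv]
      ring
    rw [e, envelopeTwo, expSmooth]
    calc _ ≤ a * (2 * ‖θ - θ'‖ * envelopeTwo x a c y k) + (‖θ - θ'‖ * envelopeOne x a c y k
          + 1 * (‖θ - θ'‖ * envelopeOne x a c y k)) := by
          refine (abs_add_le _ _).trans (add_le_add ?_ ((abs_add_le _ _).trans (add_le_add ?_ ?_)))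
          · rw [abs_mul]
            exact mul_le_mul (h.abs_aCoef_le hθ r _) ih (abs_nonneg _) h.a_nonneg
          · rw [abs_mul]
            exact mul_le_mul (abs_sum_mul_regimeDir_le _ _ _)
              (h.abs_pathDeriv_le hθ' r y k i) (abs_nonneg _) (norm_nonneg _)
          · rw [abs_mul]
            exact mul_le_mul (abs_regimeDir_le _ _ _)
              (h.abs_pathIntensity_sub_le hθ hθ' r y k) (abs_nonneg _) zero_le_one
      _ = _ := by rw [envelopeTwo]; ring

lemma abs_pathSecond_le (h : UniformBounds E x a c m) (hθ : θ ∈ E) (r : ℕ)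
    (y : ℕ → ℕ) (k : ℕ) (i j : Fin 6) : |pathSecond r x θ y k i j| ≤ envelopeTwo x a c y k := by
  refine abs_le_expSmooth (w := fun k => pathSecond r x θ y k i j) h.a_nonneg (by simp [pathSecond])
    (fun k => ?_) k
  simp only [pathSecond]
  refine (abs_add_le _ _).trans (add_le_add ?_ ?_)
  · rw [abs_mul]
    gcongr
    exact h.abs_aCoef_le hθ r _
  · rw [abs_mul]
    exact (mul_le_of_le_one_left (abs_nonneg _) (abs_regimeDir_le _ _ _)).trans
      (h.abs_pathDeriv_le hθ r y k j)

end UniformBounds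

/-! ### The logarithm -/

lemma abs_log_sub_log_le {s t m : ℝ} (hm : 0 < m) (hs : m ≤ s) (ht : m ≤ t) :
    |Real.log s - Real.log t| ≤ |s - t| / m := by
  have key : ∀ s t : ℝ, m ≤ s → m ≤ t → Real.log s - Real.log t ≤ |s - t| / m := by
    intro s t hs ht
    have h0 : 0 < t := hm.trans_le ht
    rw [← Real.log_div (hm.trans_le hs).ne' h0.ne']
    refine (Real.log_le_sub_one_of_pos (div_pos (hm.trans_le hs) h0)).trans ?_
    rw [div_sub_one h0.ne']
    refine (div_le_div_of_nonneg_right (le_abs_self _) h0.le).trans ?_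
    gcongr
  rw [abs_le]
  constructor
  · have := key t s ht hs
    rw [abs_sub_comm] at this
    linarith
  · exact key s t hs ht

/-- Lower bound on the Kullback-Leibler divergence of two Poisson laws. -/
lemma sq_div_le_poisson_divergence {s t b : ℝ} (hs : 0 < s) (ht : 0 < t) (hsb : s ≤ b)
    (htb : t ≤ b) : (s - t) ^ 2 / (4 * b) ≤ s - t - t * (Real.log s - Real.log t) := by
  -- Applying `log x ≤ x - 1` to the ratio of the square roots bounds the divergence below by `(√s -
  -- √t) ^ 2`. The factor `(√s + √t) ^ 2 ≤ 4 b` then gives the squared difference.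
  have h1 : Real.log s - Real.log t = 2 * Real.log (√s / √t) := by
    rw [Real.log_div (Real.sqrt_pos.2 hs).ne' (Real.sqrt_pos.2 ht).ne', Real.log_sqrt hs.le,
      Real.log_sqrt ht.le]
    ring
  have hs' := Real.sqrt_pos.2 hs
  have ht' := Real.sqrt_pos.2 ht
  have h2 := Real.log_le_sub_one_of_pos (div_pos hs' ht')
  have es := Real.sq_sqrt hs.le
  have et := Real.sq_sqrt ht.le
  have h3 : t * (Real.log s - Real.log t) ≤ 2 * (√s * √t) - 2 * t := by
    rw [h1]
    calc t * (2 * Real.log (√s / √t)) ≤ t * (2 * (√s / √t - 1)) := by gcongr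
      _ = _ := by
        have e : t * (2 * (√s / √t - 1)) = 2 * (√t ^ 2 * (√s / √t)) - 2 * t := by rw [et]; ring
        rw [e]
        congr 2
        field_simp
  have h4 : (s - t) ^ 2 / (4 * b) ≤ (√s - √t) ^ 2 := by
    rw [div_le_iff₀ (by linarith)]
    have : (s - t) ^ 2 = (√s - √t) ^ 2 * (√s + √t) ^ 2 := by
      nth_rewrite 1 [← es, ← et]; ring
    rw [this]
    gcongr
    nlinarith [sq_nonneg (√s - √t)]
  nlinarith

/-- A Taylor bound if the relative increment is at most `1 / 2`. Otherwise every term is crudely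
bounded by a multiple of the cube. -/
lemma abs_log_sub_quadratic_le {s t m : ℝ} (hm : 0 < m) (hs : m ≤ s) (ht : m ≤ t) :
    |Real.log s - Real.log t - (s - t) / t + (s - t) ^ 2 / (2 * t ^ 2)| ≤ 9 * (|s - t| / m) ^ 3 := by
  have hs0 := hm.trans_le hs
  have ht0 := hm.trans_le ht
  set w := |s - t| / m with hw
  set u := (s - t) / t with hu
  have hw0 : 0 ≤ w := by positivity
  have huw : |u| ≤ w := by
    rw [hu, hw, abs_div, abs_of_pos ht0]
    gcongr
  have e : (s - t) ^ 2 / (2 * t ^ 2) = u ^ 2 / 2 := by rw [hu]; field_simp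
  rw [e]
  rcases le_or_gt |u| (1 / 2) with h | h
  · have h1 := Real.abs_log_sub_add_sum_range_le (x := -u) (by rw [abs_neg]; linarith) 2
    have e1 : 1 - -u = s / t := by rw [hu]; field_simp; ring
    rw [e1, Real.log_div hs0.ne' ht0.ne'] at h1
    simp only [Finset.sum_range_succ, Finset.sum_range_zero, abs_neg] at h1
    have e2 : Real.log s - Real.log t - u + u ^ 2 / 2
        = 0 + (-u) ^ (0 + 1) / ((0 : ℕ) + 1 : ℝ) + (-u) ^ (1 + 1) / ((1 : ℕ) + 1 : ℝ)
          + (Real.log s - Real.log t) := by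
      push_cast; ring
    rw [e2]
    refine h1.trans ?_
    rw [div_le_iff₀ (by linarith)]
    have h3 : |u| ^ 3 ≤ w ^ 3 := by gcongr
    have h4 : 0 ≤ w ^ 3 := by positivity
    have h5 := mul_nonneg h4 (sub_nonneg.2 h)
    norm_num at h3 ⊢
    linarith
  · have h1 := abs_log_sub_log_le hm hs ht
    have hw2 : 1 / 2 ≤ w := h.le.trans huw
    calc _ ≤ |Real.log s - Real.log t| + |u| + u ^ 2 / 2 := by
          refine (abs_add_le _ _).trans (add_le_add (abs_sub _ _) ?_)
          rw [abs_of_nonneg (by positivity)]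
      _ ≤ w + w + w ^ 2 / 2 := by
          rw [← sq_abs u]
          gcongr
      -- From `w ≥ 1 / 2` follow `2 w ≤ 8 w ^ 3` and `w ^ 2 / 2 ≤ w ^ 3`; this is the source of the
      -- constant `9`.
      _ ≤ _ := by nlinarith [mul_nonneg hw0 (sub_nonneg.2 hw2), mul_nonneg (sq_nonneg w) (sub_nonneg.2 hw2)]

end SETPAR

lemma locallyLipschitz_inv_max {m : ℝ} (hm : 0 < m) :
    LocallyLipschitz fun x : ℝ => (max x m)⁻¹ := by
  refine (LipschitzWith.of_dist_le_mul (K := (m⁻¹ ^ 2).toNNReal) fun x y => ?_).locallyLipschitz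
  have hx : m ≤ max x m := le_max_right _ _
  have hy : m ≤ max y m := le_max_right _ _
  have hx0 := hm.trans_le hx
  have hy0 := hm.trans_le hy
  rw [Real.dist_eq, Real.dist_eq, inv_sub_inv hx0.ne' hy0.ne', abs_div, abs_of_pos (mul_pos hx0 hy0),
    Real.coe_toNNReal _ (by positivity), div_eq_mul_inv, mul_comm, abs_sub_comm]
  refine mul_le_mul ?_ (abs_max_sub_max_le_abs _ _ _) (abs_nonneg _) (by positivity)
  rw [inv_pow, sq]; gcongr

/-! ### Laws of large numbers for the information matrices and the regressors -/

namespace SETPAR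

/-- The limit of the averages of the information matrices, computed from the ergodic law `μ` of the
state. -/
noncomputable def limitInfo (μ : Measure State) (θ : Param) (m : ℝ) (i j : Fin 6) : ℝ :=
  ∫ s, ((scale θ)⁻¹ * s.2.2 i) * ((scale θ)⁻¹ * s.2.2 j) * (max s.2.1 m)⁻¹ ∂μ

/-- Weight of the count `y` times the product of the regressors. -/
noncomputable def regressorWeight (r y : ℕ) (i j : Fin 6) (s : State) : ℝ :=
  Real.exp (-max s.1 0) * max s.1 0 ^ y / (y.factorial : ℝ)
    * (regressor r y s.2.1 i * regressor r y s.2.1 j)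

lemma measurable_regimeDir_mul (r : ℕ) (θ : Param) (i : Fin 6) :
    Measurable fun p : ℕ × ℝ × ℝ => aCoef r θ p.1 * p.2.1 + regimeDir r p.1 i * p.2.2 :=
  measurable_from_prod_countable_right fun y =>
    (measurable_fst.const_mul (aCoef r θ y)).add (measurable_snd.const_mul (regimeDir r y i))

namespace BoundedSample

variable {Ω : Type*} [mΩ : MeasurableSpace Ω] {P : Measure Ω} {ℱ : Filtration ℕ mΩ}
  {Y : ℕ → Ω → ℕ} {lam : ℕ → Ω → ℝ≥0} {r : ℕ} {θ₀ : Param} {E : Set Param} {x a c m : ℝ}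

lemma measurable_pathSecond (h : BoundedSample P ℱ Y lam r θ₀) (x : ℝ) (θ : Param) (k : ℕ)
    (i j : Fin 6) : Measurable[ℱ k] fun ω => pathSecond r x θ (fun k => Y k ω) k i j := by
  induction k with
  | zero => exact measurable_const
  | succ k ih =>
    exact (measurable_regimeDir_mul r θ i).comp ((h.counts.measurable_count k).prodMk
      ((ih.mono (ℱ.mono (Nat.le_succ k)) le_rfl).prodMk
        ((h.measurable_pathDeriv x θ k j).mono (ℱ.mono (Nat.le_succ k)) le_rfl)))

section Moments

variable [IsProbabilityMeasure P] (h : BoundedSample P ℱ Y lam r θ₀) (hE : UniformBounds E x a c m)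
  (hθ : θ₀ ∈ E)

include h hE hθ

lemma hasUniformMoments_envelope :
    HasUniformMoments P fun k ω => envelope x a c (fun k => Y k ω) k :=
  HasUniformMoments.of_recursion
    (((HasUniformMoments.const 1).add (h.hasUniformMoments_count (hE.subset hθ))).const_mul c)
    hE.a_nonneg hE.a_lt_one (fun _ => rfl) fun _ _ => rfl

lemma hasUniformMoments_envelopeOne :
    HasUniformMoments P fun k ω => envelopeOne x a c (fun k => Y k ω) k :=
  HasUniformMoments.of_recursion
    ((((HasUniformMoments.const 1).add (h.hasUniformMoments_envelope hE hθ)).add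
      (h.hasUniformMoments_count (hE.subset hθ))).const_mul 6)
    hE.a_nonneg hE.a_lt_one (fun _ => rfl) fun _ _ => rfl

lemma hasUniformMoments_envelopeTwo :
    HasUniformMoments P fun k ω => envelopeTwo x a c (fun k => Y k ω) k :=
  HasUniformMoments.of_recursion (h.hasUniformMoments_envelopeOne hE hθ)
    hE.a_nonneg hE.a_lt_one (fun _ => rfl) fun _ _ => rfl

lemma hasUniformMoments_envelopeThree :
    HasUniformMoments P fun k ω => envelopeThree x a c (fun k => Y k ω) k :=
  HasUniformMoments.of_recursion (h.hasUniformMoments_envelopeTwo hE hθ)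
    hE.a_nonneg hE.a_lt_one (fun _ => rfl) fun _ _ => rfl

lemma hasUniformMoments_inv_pathIntensity :
    HasUniformMoments P fun k ω => (pathIntensity r x θ₀ (fun k => Y k ω) k)⁻¹ := by
  refine (HasUniformMoments.const (P := P) m⁻¹).mono (fun k =>
    ((h.measurable_pathIntensity x θ₀ k).mono (ℱ.le k) le_rfl).inv.aemeasurable)
    fun k => .of_forall fun ω => ?_
  have hm := hE.m_pos
  have hp := hE.le_pathIntensity hθ r (fun k => Y k ω) k
  rw [abs_of_pos (inv_pos.2 (hm.trans_le hp)), abs_of_pos (inv_pos.2 hm)]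
  gcongr

lemma hasUniformMoments_pathSecond (i j : Fin 6) :
    HasUniformMoments P fun k ω => pathSecond r x θ₀ (fun k => Y k ω) k i j :=
  (h.hasUniformMoments_envelopeTwo hE hθ).mono
    (fun k => ((h.measurable_pathSecond x θ₀ k i j).mono (ℱ.le k) le_rfl).aemeasurable)
    fun k => .of_forall fun _ => (hE.abs_pathSecond_le hθ r _ k i j).trans (le_abs_self _)

lemma hasUniformMoments_log {θ : Param} (hθ' : θ ∈ E) :
    HasUniformMoments P fun k ω => Real.log (pathIntensity r x θ (fun k => Y k ω) k)
      - Real.log (pathIntensity r x θ₀ (fun k => Y k ω) k) := by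
  refine ((h.hasUniformMoments_envelopeOne hE hθ).const_mul (‖θ - θ₀‖ / m)).mono (fun k =>
    (((h.measurable_pathIntensity x θ k).mono (ℱ.le k) le_rfl).log.sub
    ((h.measurable_pathIntensity x θ₀ k).mono (ℱ.le k) le_rfl).log).aemeasurable)
    fun k => .of_forall fun ω => ?_
  refine (abs_log_sub_log_le hE.m_pos (hE.le_pathIntensity hθ' r _ k)
    (hE.le_pathIntensity hθ r _ k)).trans ?_
  have hm := hE.m_pos
  refine le_trans ?_ (le_abs_self _)
  rw [div_mul_eq_mul_div]
  gcongr
  exact hE.abs_pathIntensity_sub_le hθ' hθ r _ k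

end Moments

variable [IsProbabilityMeasure P]

/-- The intensity may be replaced by the one computed from the observations. -/
lemma negligible_rate_sub (h : BoundedSample P ℱ Y lam r θ₀) (hθ : θ₀ ∈ paramSpace) (x : ℝ)
    {G : ℕ → Ω → ℝ} (hGm : HasUniformMoments P G) :
    NegligibleInProb P (fun n ω => (√(n : ℝ))⁻¹ * ∑ k ∈ Finset.range n,
      G k ω * ((lam k ω : ℝ) - pathIntensity r x θ₀ (fun k => Y k ω) k)) := by
  obtain ⟨C, hC0, hC⟩ := h.abs_rate_sub_pathIntensity_le hθ x
  refine (hGm.const_mul C).negligible_of_geometric (maxCoef_pos hθ).le (maxCoef_lt_one hθ)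
    (fun k => (hGm.aemeasurable k).mul
      (((h.counts.measurable_rate' k).coe_nnreal_real).sub
        ((h.measurable_pathIntensity x θ₀ k).mono (ℱ.le k) le_rfl)).aemeasurable) fun k ω => ?_
  rw [abs_mul, abs_mul, abs_of_nonneg hC0]
  calc |G k ω| * _ ≤ |G k ω| * (maxCoef θ₀ ^ k * C) := by gcongr; exact hC k ω
    _ = _ := by ring

lemma average_centered (h : BoundedSample P ℱ Y lam r θ₀) (hθ : θ₀ ∈ paramSpace) (x : ℝ)
    {G : ℕ → Ω → ℝ} (hG : ∀ k, Measurable[ℱ k] (G k)) (hGm : HasUniformMoments P G) :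
    NegligibleInProb P (fun n ω => (n : ℝ)⁻¹ * ∑ k ∈ Finset.range n,
      G k ω * ((Y k ω : ℝ) - pathIntensity r x θ₀ (fun k => Y k ω) k)) := by
  refine ((h.martingale_average_count hθ hG hGm).add
    (h.negligible_rate_sub hθ x hGm).average_of_sqrt).mono fun n ω => le_of_eq ?_
  rw [← mul_add, ← Finset.sum_add_distrib]
  simp_rw [← mul_add, sub_add_sub_cancel]

variable {μ : Measure State} [IsProbabilityMeasure μ]

/-- Law of large numbers for the information matrices. -/
lemma negligible_average_info (h : BoundedSample P ℱ Y lam r θ₀) (hθ : θ₀ ∈ paramSpace)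
    (hx : 0 < x) (hμ : (stateChain r θ₀ hθ).IsErgodicMeasure μ) (i j : Fin 6) :
    Integrable (fun s : State => ((scale θ₀)⁻¹ * s.2.2 i) * ((scale θ₀)⁻¹ * s.2.2 j)
      * (max s.2.1 (lowerBound x θ₀))⁻¹) μ ∧
    NegligibleInProb P (fun n ω => (n : ℝ)⁻¹ * ∑ k ∈ Finset.range n,
      pathDeriv r x θ₀ (fun k => Y k ω) k i * pathDeriv r x θ₀ (fun k => Y k ω) k j
        * (pathIntensity r x θ₀ (fun k => Y k ω) k)⁻¹ - limitInfo μ θ₀ (lowerBound x θ₀) i j) := by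
  set m := lowerBound x θ₀
  have hm : 0 < m := lowerBound_pos hx hθ
  have hs := scale_pos hθ
  have hcoord : ∀ i : Fin 6, LocallyLipschitz fun s : State => (scale θ₀)⁻¹ * s.2.2 i := fun i =>
    (by fun_prop : ContDiff ℝ 1 fun s : State => (scale θ₀)⁻¹ * s.2.2 i).locallyLipschitz
  -- The maximum with `m` makes the inverse locally Lipschitz on the whole state space. It is
  -- inactive along the sample, where the observable intensity never falls below `m`.
  have hH : LocallyLipschitz fun s : State =>
      ((scale θ₀)⁻¹ * s.2.2 i) * ((scale θ₀)⁻¹ * s.2.2 j) * (max s.2.1 m)⁻¹ :=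
    ((hcoord i).real_mul (hcoord j)).real_mul ((locallyLipschitz_inv_max hm).comp
      (by fun_prop : ContDiff ℝ 1 fun s : State => s.2.1).locallyLipschitz)
  have key := h.negligible_average_state hθ x hμ hH (p := 2)
    (C := ((scale θ₀)⁻¹ ^ 2 * m⁻¹).toNNReal) fun s => ?_
  · refine ⟨key.1, key.2.mono fun n ω => le_of_eq ?_⟩
    unfold limitInfo
    congr 4 with k
    simp only [jointState, inv_mul_cancel_left₀ hs.ne']
    rw [max_eq_left (lowerBound_le_pathIntensity hx hθ r _ k)]
  · rw [Real.coe_toNNReal _ (by positivity)]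
    have h1 : ∀ i, |(scale θ₀)⁻¹ * s.2.2 i| ≤ (scale θ₀)⁻¹ * (1 + ‖s‖) := fun i => by
      rw [abs_mul, abs_of_pos (inv_pos.2 hs)]
      gcongr
      have := (norm_le_pi_norm s.2.2 i).trans ((norm_snd_le s.2).trans (norm_snd_le s))
      rw [Real.norm_eq_abs] at this
      linarith
    have h2 : |(max s.2.1 m)⁻¹| ≤ m⁻¹ := by
      rw [abs_of_pos (inv_pos.2 (hm.trans_le (le_max_right _ _)))]
      gcongr
      exact le_max_right _ _
    rw [abs_mul, abs_mul]
    calc _ ≤ (scale θ₀)⁻¹ * (1 + ‖s‖) * ((scale θ₀)⁻¹ * (1 + ‖s‖)) * m⁻¹ := by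
          gcongr
          · exact h1 i
          · exact h1 j
      _ = _ := by ring

/-- The information equality in empirical form. With weight `Y k` this is the second derivative of
the likelihood, with weight `lam k` the conditional variance of the score. Replacing either weight
by the observable intensity changes the average by a martingale or a geometric error, and one power
of the inverse cancels. -/
lemma negligible_average_count_info (h : BoundedSample P ℱ Y lam r θ₀)
    (hE : UniformBounds E x a c m) (hθ : θ₀ ∈ E)
    (hμ : (stateChain r θ₀ (hE.subset hθ)).IsErgodicMeasure μ) (i j : Fin 6) :
    NegligibleInProb P (fun n ω => (n : ℝ)⁻¹ * ∑ k ∈ Finset.range n,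
      Y k ω * (pathDeriv r x θ₀ (fun k => Y k ω) k i * pathDeriv r x θ₀ (fun k => Y k ω) k j
        * (pathIntensity r x θ₀ (fun k => Y k ω) k)⁻¹ ^ 2)
        - limitInfo μ θ₀ (lowerBound x θ₀) i j) ∧
    NegligibleInProb P (fun n ω => (n : ℝ)⁻¹ * ∑ k ∈ Finset.range n,
      lam k ω * (pathDeriv r x θ₀ (fun k => Y k ω) k i * pathDeriv r x θ₀ (fun k => Y k ω) k j
        * (pathIntensity r x θ₀ (fun k => Y k ω) k)⁻¹ ^ 2)
        - limitInfo μ θ₀ (lowerBound x θ₀) i j) := by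
  have hθ' := hE.subset hθ
  set G : ℕ → Ω → ℝ := fun k ω => pathDeriv r x θ₀ (fun k => Y k ω) k i
    * pathDeriv r x θ₀ (fun k => Y k ω) k j * (pathIntensity r x θ₀ (fun k => Y k ω) k)⁻¹ ^ 2
    with hGdef
  have hG : ∀ k, Measurable[ℱ k] (G k) := fun k =>
    ((h.measurable_pathDeriv x θ₀ k i).mul (h.measurable_pathDeriv x θ₀ k j)).mul
      ((h.measurable_pathIntensity x θ₀ k).inv.pow_const 2)
  have hGm : HasUniformMoments P G :=
    ((h.hasUniformMoments_pathDeriv hθ' x i).mul (h.hasUniformMoments_pathDeriv hθ' x j)).mul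
      ((h.hasUniformMoments_inv_pathIntensity hE hθ).pow 2)
  have h1 := (h.negligible_average_info hθ' hE.x_pos hμ i j).2
  have e : ∀ k ω, pathDeriv r x θ₀ (fun k => Y k ω) k i * pathDeriv r x θ₀ (fun k => Y k ω) k j
      * (pathIntensity r x θ₀ (fun k => Y k ω) k)⁻¹
      = G k ω * pathIntensity r x θ₀ (fun k => Y k ω) k := fun k ω => by
    have := (pathIntensity_pos hE.x_pos hθ' r (fun k => Y k ω) k).ne'
    rw [hGdef]
    field_simp
  constructor
  · refine (h1.add (h.average_centered hθ' x hG hGm)).mono fun n ω => le_of_eq ?_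
    rw [sub_add_eq_add_sub, ← mul_add, ← Finset.sum_add_distrib]
    congr 4 with k
    rw [e]; ring
  · refine (h1.add (h.negligible_rate_sub hθ' x hGm).average_of_sqrt).mono fun n ω => le_of_eq ?_
    rw [sub_add_eq_add_sub, ← mul_add, ← Finset.sum_add_distrib]
    congr 4 with k
    rw [e]; ring

lemma locallyLipschitz_regressorWeight (r y : ℕ) (i j : Fin 6) :
    LocallyLipschitz (regressorWeight r y i j) := by
  have h0 : LocallyLipschitz fun s : State => max s.1 0 :=
    (((LipschitzWith.id (α := ℝ)).max_const 0).locallyLipschitz).comp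
      (by fun_prop : ContDiff ℝ 1 fun s : State => s.1).locallyLipschitz
  have h1 : LocallyLipschitz fun u : ℝ => Real.exp (-u) * u ^ y / (y.factorial : ℝ) :=
    (by fun_prop : ContDiff ℝ 1 fun u : ℝ =>
      Real.exp (-u) * u ^ y / (y.factorial : ℝ)).locallyLipschitz
  have h2 : ∀ i, LocallyLipschitz fun s : State => regressor r y s.2.1 i := fun i => by
    refine (LipschitzWith.of_dist_le_mul (K := 1) fun s t => ?_).locallyLipschitz
    rw [Real.dist_eq, regressor_sub, abs_mul, ← Real.dist_eq, NNReal.coe_one]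
    refine mul_le_mul (abs_regimeDir_le r y i) ?_ dist_nonneg zero_le_one
    exact (le_max_left _ _).trans (le_max_right _ _)
  exact (h1.comp h0).real_mul ((h2 i).real_mul (h2 j))

lemma abs_regressorWeight_le (r y : ℕ) (i j : Fin 6) (s : State) :
    |regressorWeight r y i j s| ≤ ((1 + y) ^ 2 : ℝ≥0) * (1 + ‖s‖) ^ 2 := by
  have h0 : 0 ≤ max s.1 0 := le_max_right _ _
  have h1 : Real.exp (-max s.1 0) * max s.1 0 ^ y / (y.factorial : ℝ) ≤ 1 := by
    lift max s.1 0 to ℝ≥0 using h0 with u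
    rw [← poissonMeasure_real_singleton]
    exact measureReal_le_one
  have h2 : ∀ i, |regressor r y s.2.1 i| ≤ (1 + y) * (1 + ‖s‖) := fun i => by
    have h3 := (norm_fst_le s.2).trans (norm_snd_le s)
    rw [Real.norm_eq_abs] at h3
    refine (abs_regressor_le r y _ i).trans ?_
    have : 0 ≤ (y : ℝ) * ‖s‖ := by positivity
    nlinarith
  unfold regressorWeight
  rw [abs_mul, abs_mul, abs_of_nonneg (by positivity)]
  calc _ ≤ 1 * (((1 + y) * (1 + ‖s‖)) * ((1 + y) * (1 + ‖s‖))) := by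
        gcongr
        · exact h2 i
        · exact h2 j
    _ = _ := by push_cast; ring

/-- Law of large numbers for the products of the regressors. -/
lemma negligible_average_regressor (h : BoundedSample P ℱ Y lam r θ₀) (hθ : θ₀ ∈ paramSpace)
    (x : ℝ) (hμ : (stateChain r θ₀ hθ).IsErgodicMeasure μ) (y : ℕ) (i j : Fin 6) :
    Integrable (regressorWeight r y i j) μ ∧
    NegligibleInProb P (fun n ω => (n : ℝ)⁻¹ * ∑ k ∈ Finset.range n,
      (if Y k ω = y then 1 else 0) * (regressor r y (pathIntensity r x θ₀ (fun k => Y k ω) k) i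
        * regressor r y (pathIntensity r x θ₀ (fun k => Y k ω) k) j)
        - ∫ s, regressorWeight r y i j s ∂μ) := by
  obtain ⟨hi, h1⟩ := h.negligible_average_state hθ x hμ (locallyLipschitz_regressorWeight r y i j)
    (abs_regressorWeight_le r y i j)
  refine ⟨hi, ?_⟩
  set z : Fin 6 → ℕ → Ω → ℝ := fun i k ω => regressor r y (pathIntensity r x θ₀ (fun k => Y k ω) k) i
  have hz : ∀ i k, Measurable[ℱ k] (z i k) := fun i k =>
    (measurable_regressor r y i).comp (h.measurable_pathIntensity x θ₀ k)
  have hzm : ∀ i, HasUniformMoments P (z i) := fun i => by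
    refine (((HasUniformMoments.const 1).add (h.hasUniformMoments_pathIntensity hθ x).abs).add
      (HasUniformMoments.const y)).mono (fun k => ((hz i k).mono (ℱ.le k) le_rfl).aemeasurable)
      fun k => .of_forall fun ω => ?_
    exact (abs_regressor_le r y _ i).trans (le_abs_self _)
  -- The averages with the Poisson mass at `y` converge as functions of the state, and the indicator
  -- differs from that mass by a martingale increment.
  refine (h1.add (h.martingale_average_singleton y (fun k => (hz i k).mul (hz j k))
    ((hzm i).mul (hzm j)))).mono fun n ω => le_of_eq ?_
  rw [sub_add_eq_add_sub, ← mul_add, ← Finset.sum_add_distrib]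
  congr 4 with k
  simp only [regressorWeight, jointState, max_eq_left (NNReal.coe_nonneg (lam k ω)),
    poissonMeasure_real_singleton, z, Pi.mul_apply]
  ring

end BoundedSample

end SETPAR

/-! ### Central limit theorem for Poisson martingale differences -/

lemma norm_exp_mul_I_taylor_le (t : ℝ) :
    ‖Complex.exp (t * Complex.I) - 1 - t * Complex.I + (t : ℂ) ^ 2 / 2‖ ≤ 4 * |t| ^ 3 := by
  have hn : ‖(t : ℂ) * Complex.I‖ = |t| := by simp
  rcases le_or_gt |t| 1 with h | h
  · have h1 := Complex.exp_bound (x := t * Complex.I) (by rw [hn]; exact h) (n := 3) (by norm_num)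
    rw [hn] at h1
    have e : Complex.exp (t * Complex.I) - 1 - t * Complex.I + (t : ℂ) ^ 2 / 2
        = Complex.exp (t * Complex.I)
          - ∑ m ∈ Finset.range 3, (t * Complex.I) ^ m / (m.factorial : ℂ) := by
      simp only [Finset.sum_range_succ, Finset.sum_range_zero, mul_pow, Complex.I_sq]
      norm_num [Nat.factorial]
      ring
    rw [e]
    refine h1.trans ?_
    rw [mul_comm]
    gcongr
    norm_num [Nat.factorial]
  · calc _ ≤ ‖Complex.exp (t * Complex.I)‖ + ‖(1 : ℂ)‖ + ‖(t : ℂ) * Complex.I‖ + ‖(t : ℂ) ^ 2 / 2‖ :=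
          (norm_add_le _ _).trans (add_le_add ((norm_sub_le _ _).trans
            (add_le_add (norm_sub_le _ _) le_rfl)) le_rfl)
      _ = 1 + 1 + |t| + |t| ^ 2 / 2 := by
          rw [Complex.norm_exp_ofReal_mul_I, hn]; simp
      _ ≤ 4 * |t| ^ 3 := by nlinarith [sq_nonneg (|t| - 1), mul_pos (sub_pos.2 h) (sub_pos.2 h)]

/-- Exponential martingale increment of a Poisson count `j` with mean `l`. -/
noncomputable def poissonTilt (t l : ℝ) (j : ℕ) : ℂ :=
  Complex.exp (t * Complex.I * (j - l) - l * (Complex.exp (t * Complex.I) - 1 - t * Complex.I))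

lemma integral_exp_mul_I_poissonMeasure (l : ℝ≥0) (t : ℝ) :
    ∫ j : ℕ, Complex.exp (t * Complex.I * j) ∂poissonMeasure l
      = Complex.exp (l * (Complex.exp (t * Complex.I) - 1)) := by
  rw [← charFun_map_cast_poissonMeasure, charFun_apply, integral_map .of_discrete (by fun_prop)]
  refine integral_congr_ae (.of_forall fun j => ?_)
  simp only [Real.inner_apply]
  congr 1
  push_cast
  ring

lemma integral_poissonTilt (t : ℝ) (l : ℝ≥0) :
    ∫ j, poissonTilt t l j ∂poissonMeasure l = 1 := by
  have e : ∀ j : ℕ, poissonTilt t l j = Complex.exp (-(l * (Complex.exp (t * Complex.I) - 1)))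
      * Complex.exp (t * Complex.I * j) := by
    intro j
    rw [poissonTilt, ← Complex.exp_add]
    congr 1
    ring
  simp_rw [e]
  rw [integral_const_mul, integral_exp_mul_I_poissonMeasure, ← Complex.exp_add]
  simp

/-- The modulus is `exp (l (1 - cos t))`. Hence products of tilts are bounded as soon as the
accumulated variance is. -/
lemma norm_poissonTilt_le (t l : ℝ) (hl : 0 ≤ l) (j : ℕ) :
    ‖poissonTilt t l j‖ ≤ Real.exp (l * t ^ 2 / 2) := by
  rw [poissonTilt, Complex.norm_exp]
  have e : (t * Complex.I * (j - l)
      - l * (Complex.exp (t * Complex.I) - 1 - t * Complex.I) : ℂ).re = l * (1 - Real.cos t) := by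
    simp [Complex.exp_ofReal_mul_I_re]
    ring
  rw [e]
  refine Real.exp_le_exp.2 ?_
  have := Real.one_sub_sq_div_two_le_cos (x := t)
  nlinarith

lemma measurable_poissonTilt (j : ℕ) : Measurable fun p : ℝ × ℝ => poissonTilt p.1 p.2 j := by
  unfold poissonTilt; fun_prop

section

variable {Ω : Type*}

/-- Predictable truncation keeping the accumulated variance below `C`. -/
noncomputable def truncatedWeight (lam : ℕ → Ω → ℝ≥0) (w : ℕ → Ω → ℝ) (C : ℝ) (k : ℕ) (ω : Ω) : ℝ :=
  if ∑ j ∈ Finset.range (k + 1), lam j ω * w j ω ^ 2 ≤ C then w k ω else 0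

lemma sum_truncatedWeight_le (lam : ℕ → Ω → ℝ≥0) (w : ℕ → Ω → ℝ) {C : ℝ} (hC : 0 ≤ C) (n : ℕ)
    (ω : Ω) : ∑ k ∈ Finset.range n, lam k ω * truncatedWeight lam w C k ω ^ 2 ≤ C := by
  have h1 : ∀ n, ∑ k ∈ Finset.range n, lam k ω * truncatedWeight lam w C k ω ^ 2
      ≤ ∑ k ∈ Finset.range n, lam k ω * w k ω ^ 2 := fun n => by
    refine Finset.sum_le_sum fun k _ => ?_
    unfold truncatedWeight
    split_ifs
    · exact le_rfl
    · simp; positivity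
  induction n with
  | zero => simpa
  | succ n ih =>
    by_cases h : ∑ j ∈ Finset.range (n + 1), lam j ω * w j ω ^ 2 ≤ C
    · exact (h1 _).trans h
    · rw [Finset.sum_range_succ, truncatedWeight, if_neg h]
      simpa using ih

lemma truncatedWeight_eq (lam : ℕ → Ω → ℝ≥0) (w : ℕ → Ω → ℝ) {C : ℝ} {n : ℕ} {ω : Ω}
    (h : ∑ k ∈ Finset.range n, lam k ω * w k ω ^ 2 ≤ C) {k : ℕ} (hk : k < n) :
    truncatedWeight lam w C k ω = w k ω := by
  rw [truncatedWeight, if_pos]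
  refine le_trans (Finset.sum_le_sum_of_subset_of_nonneg ?_ fun _ _ _ => by positivity) h
  exact Finset.range_subset_range.2 hk

variable [mΩ : MeasurableSpace Ω] {P : Measure Ω}

/-- Bounded convergence in probability: the integral is at most `ε` plus the bound times the measure
of the event where the norm exceeds `ε`. -/
lemma tendsto_integral_of_negligible [IsProbabilityMeasure P] {U : ℕ → Ω → ℂ}
    {B : ℝ} (hB : ∀ n ω, ‖U n ω‖ ≤ B)
    (h : NegligibleInProb P fun n ω => ‖U n ω‖) :
    Tendsto (fun n => ∫ ω, U n ω ∂P) atTop (𝓝 0) := by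
  have hB0 : 0 ≤ B := by
    obtain ⟨ω⟩ : Nonempty Ω := nonempty_of_isProbabilityMeasure P
    exact (norm_nonneg _).trans (hB 0 ω)
  have hle : ∀ n (ε : ℝ), 0 < ε →
      ‖∫ ω, U n ω ∂P‖ ≤ ε + B * P.real {ω | ε ≤ |‖U n ω‖|} := by
    intro n ε hε
    -- The event need not be measurable, so a measurable superset of the same measure replaces it.
    obtain ⟨T, hT1, hT2, hT3⟩ := exists_measurable_superset P {ω | ε ≤ |‖U n ω‖|}
      |>.imp fun T hT => hT
    have hi1 : Integrable (fun ω => B * T.indicator (1 : Ω → ℝ) ω) P :=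
      (show Integrable (T.indicator (1 : Ω → ℝ)) P from
        (integrable_const (1 : ℝ)).indicator hT2).const_mul B
    have hi : Integrable (fun ω => ε + B * T.indicator (1 : Ω → ℝ) ω) P := (integrable_const _).add hi1
    refine (norm_integral_le_of_norm_le hi (.of_forall fun ω => ?_)).trans (le_of_eq ?_)
    · by_cases hω : ω ∈ T
      · simp only [Set.indicator_of_mem hω, Pi.one_apply]
        linarith [hB n ω]
      · have h2 : ω ∉ {ω | ε ≤ |‖U n ω‖|} := fun h3 => hω (hT1 h3)
        simp only [Set.mem_ofPred_eq, abs_norm, not_le] at h2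
        simp only [Set.indicator_of_notMem hω]
        linarith
    · rw [integral_add (integrable_const _) hi1, integral_const_mul,
        integral_indicator_one hT2, measureReal_def, hT3]
      simp [measureReal_def]
  rw [tendsto_zero_iff_norm_tendsto_zero, Metric.tendsto_atTop]
  intro ε hε
  have h1 := (ENNReal.tendsto_toReal ENNReal.zero_ne_top).comp (h (ε / 2) (by positivity))
  have h2 := h1.const_mul B
  simp only [ENNReal.toReal_zero, mul_zero] at h2
  obtain ⟨N, hN⟩ := (h2.eventually (gt_mem_nhds (by positivity : 0 < ε / 2))).exists_forall_of_atTop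
  refine ⟨N, fun n hn => ?_⟩
  have h3 := hN n hn
  have h4 := hle n (ε / 2) (by positivity)
  rw [Real.dist_eq, sub_zero, abs_norm]
  simp only [Function.comp] at h3
  rw [measureReal_def] at h4
  linarith

namespace PoissonCounts

variable {ℱ : Filtration ℕ mΩ} {Y : ℕ → Ω → ℕ} {lam : ℕ → Ω → ℝ≥0}

lemma measurable_truncatedWeight (h : PoissonCounts P ℱ Y lam) {w : ℕ → Ω → ℝ}
    (hw : ∀ k, Measurable[ℱ k] (w k)) (C : ℝ) (k : ℕ) :
    Measurable[ℱ k] (truncatedWeight lam w C k) := by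
  have h1 : Measurable[ℱ k] fun ω => ∑ j ∈ Finset.range (k + 1), (lam j ω : ℝ) * w j ω ^ 2 := by
    refine Finset.measurable_fun_sum _ fun j hj => ?_
    have hjk : j ≤ k := Nat.lt_succ_iff.1 (Finset.mem_range.1 hj)
    exact (measurable_coe_nnreal_real.comp
      ((h.measurable_rate j).mono (ℱ.mono hjk) le_rfl)).mul
      (((hw j).mono (ℱ.mono hjk) le_rfl).pow_const 2)
  exact Measurable.ite (measurableSet_le h1 measurable_const) (hw k) measurable_const

lemma measurable_prod_poissonTilt (h : PoissonCounts P ℱ Y lam) {v : ℕ → Ω → ℝ}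
    (hv : ∀ k, Measurable[ℱ k] (v k)) (n : ℕ) :
    Measurable[ℱ n] fun ω => ∏ k ∈ Finset.range n, poissonTilt (v k ω) (lam k ω) (Y k ω) := by
  induction n with
  | zero => simp
  | succ n ih =>
    have hn : ℱ n ≤ ℱ (n + 1) := ℱ.mono (Nat.le_succ n)
    have h1 : Measurable (fun p : ℕ × ℝ × ℝ => poissonTilt p.2.1 p.2.2 p.1) :=
      measurable_from_prod_countable_right measurable_poissonTilt
    have h2 : Measurable[ℱ (n + 1)] fun ω => (lam n ω : ℝ) :=
      measurable_coe_nnreal_real.comp ((h.measurable_rate n).mono hn le_rfl)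
    have h3 : Measurable[ℱ (n + 1)] fun ω => (Y n ω, v n ω, (lam n ω : ℝ)) :=
      (h.measurable_count n).prodMk (((hv n).mono hn le_rfl).prodMk h2)
    have h4 := h1.comp h3
    simp only [Function.comp_def] at h4
    simp_rw [Finset.prod_range_succ]
    have h5 : Measurable[ℱ (n + 1)] fun ω =>
        ∏ k ∈ Finset.range n, poissonTilt (v k ω) (lam k ω) (Y k ω) := ih.mono hn le_rfl
    have h6 : Measurable fun p : ℂ × ℂ => p.1 * p.2 := measurable_fst.mul measurable_snd
    exact h6.comp (h5.prodMk h4)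

omit mΩ in
lemma norm_prod_poissonTilt_le {v : ℕ → Ω → ℝ} {C : ℝ} {ω : Ω} {n : ℕ}
    (hC : ∑ k ∈ Finset.range n, lam k ω * v k ω ^ 2 ≤ C) :
    ‖∏ k ∈ Finset.range n, poissonTilt (v k ω) (lam k ω) (Y k ω)‖ ≤ Real.exp (C / 2) := by
  rw [norm_prod]
  calc ∏ k ∈ Finset.range n, ‖poissonTilt (v k ω) (lam k ω) (Y k ω)‖
      ≤ ∏ k ∈ Finset.range n, Real.exp (lam k ω * v k ω ^ 2 / 2) :=
        Finset.prod_le_prod (fun _ _ => norm_nonneg _) fun k _ =>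
          norm_poissonTilt_le _ _ (NNReal.coe_nonneg _) _
    _ = Real.exp ((∑ k ∈ Finset.range n, lam k ω * v k ω ^ 2) / 2) := by
        rw [← Real.exp_sum, Finset.sum_div]
    _ ≤ _ := by gcongr

/-- Each factor has conditional mean one given the past, so the product is a martingale. The bound
on the accumulated variance supplies integrability. -/
lemma integral_prod_poissonTilt [IsProbabilityMeasure P] (h : PoissonCounts P ℱ Y lam)
    {v : ℕ → Ω → ℝ} (hv : ∀ k, Measurable[ℱ k] (v k)) {C : ℝ}
    (hC : ∀ n ω, ∑ k ∈ Finset.range n, lam k ω * v k ω ^ 2 ≤ C) (n : ℕ) :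
    ∫ ω, ∏ k ∈ Finset.range n, poissonTilt (v k ω) (lam k ω) (Y k ω) ∂P = 1 := by
  induction n with
  | zero => simp
  | succ n ih =>
    have h1 := h.integral_count n (g := fun ω j =>
      (∏ k ∈ Finset.range n, poissonTilt (v k ω) (lam k ω) (Y k ω))
        * poissonTilt (v n ω) (lam n ω) j) (fun j => ?_) ?_
    · simp_rw [Finset.prod_range_succ]
      rw [h1, ← ih]
      refine integral_congr_ae (.of_forall fun ω => ?_)
      simp only [integral_const_mul, integral_poissonTilt, mul_one]
    · exact ((h.measurable_prod_poissonTilt hv n).mul ((measurable_poissonTilt j).comp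
        ((hv n).prodMk (measurable_coe_nnreal_real.comp
          (h.measurable_rate n))))).stronglyMeasurable
    · simp_rw [← Finset.prod_range_succ (fun k => poissonTilt (v k _) (lam k _) (Y k _))]
      exact Integrable.of_bound ((h.measurable_prod_poissonTilt hv (n + 1)).mono
        (ℱ.le _) le_rfl).aestronglyMeasurable _
        (.of_forall fun ω => norm_prod_poissonTilt_le (hC (n + 1) ω))

/-- **Central limit theorem** for sums of centered Poisson counts with predictable weights. -/
theorem tendsto_integral_exp [IsProbabilityMeasure P] (h : PoissonCounts P ℱ Y lam)
    {w : ℕ → Ω → ℝ} (hw : ∀ k, Measurable[ℱ k] (w k)) {q : ℝ} (hq : 0 ≤ q)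
    (h2 : NegligibleInProb P
      (fun n ω => (n : ℝ)⁻¹ * ∑ k ∈ Finset.range n, lam k ω * w k ω ^ 2 - q))
    (h3 : NegligibleInProb P
      (fun n ω => (√(n : ℝ))⁻¹ * ((n : ℝ)⁻¹ * ∑ k ∈ Finset.range n, lam k ω * |w k ω| ^ 3))) :
    Tendsto (fun n : ℕ => ∫ ω, Complex.exp
      (((√(n : ℝ))⁻¹ * ∑ k ∈ Finset.range n, w k ω * ((Y k ω : ℝ) - lam k ω) : ℝ) * Complex.I) ∂P)
      atTop (𝓝 (Complex.exp ((-q / 2 : ℝ) : ℂ))) := by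
  let u : ℕ → ℕ → Ω → ℝ := fun n k ω => (√(n : ℝ))⁻¹ * w k ω
  -- The truncation bounds the exponential martingale, and it is inactive with probability tending
  -- to one because the accumulated variance tends to `q`.
  let v : ℕ → ℕ → Ω → ℝ := fun n => truncatedWeight lam (u n) (q + 1)
  have hq1 : 0 ≤ q + 1 := by linarith
  have hu : ∀ n k, Measurable[ℱ k] (u n k) := fun n k =>
    (measurable_const_mul _).comp (hw k)
  have hv : ∀ n k, Measurable[ℱ k] (v n k) := fun n k =>
    h.measurable_truncatedWeight (hu n) _ k
  have hvC : ∀ n N ω, ∑ k ∈ Finset.range N, lam k ω * v n k ω ^ 2 ≤ q + 1 := fun n N ω =>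
    sum_truncatedWeight_le lam (u n) hq1 N ω
  let Z : ℕ → Ω → ℝ := fun n ω =>
    (√(n : ℝ))⁻¹ * ∑ k ∈ Finset.range n, w k ω * ((Y k ω : ℝ) - lam k ω)
  -- The expectation of `T n` is exactly the limit, so it suffices that `T n` approximates the
  -- exponential of `Z n` boundedly and in probability.
  let T : ℕ → Ω → ℂ := fun n ω => Complex.exp ((-q / 2 : ℝ) : ℂ)
    * ∏ k ∈ Finset.range n, poissonTilt (v n k ω) (lam k ω) (Y k ω)
  let U : ℕ → Ω → ℂ := fun n ω => Complex.exp ((Z n ω : ℝ) * Complex.I) - T n ω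
  have hZm : ∀ n, Measurable (Z n) := fun n => (Finset.measurable_fun_sum _ fun k _ =>
    ((hw k).mono (ℱ.le k) le_rfl).mul ((measurable_from_nat.comp (h.measurable_count' k)).sub
      (h.measurable_rate' k).coe_nnreal_real)).const_mul _
  have hTm : ∀ n, Measurable (T n) := fun n =>
    ((h.measurable_prod_poissonTilt (hv n) n).mono (ℱ.le n) le_rfl).const_mul _
  have hexp : ‖Complex.exp ((-q / 2 : ℝ) : ℂ)‖ ≤ 1 := by
    rw [← Complex.ofReal_exp, Complex.norm_real, Real.norm_of_nonneg (Real.exp_pos _).le]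
    exact Real.exp_le_one_iff.2 (by linarith)
  have hTb : ∀ n ω, ‖T n ω‖ ≤ Real.exp ((q + 1) / 2) := fun n ω => by
    rw [norm_mul]
    exact (mul_le_of_le_one_left (norm_nonneg _) hexp).trans (norm_prod_poissonTilt_le (hvC n n ω))
  have hEb : ∀ n ω, ‖Complex.exp ((Z n ω : ℝ) * Complex.I)‖ = 1 := fun n ω =>
    Complex.norm_exp_ofReal_mul_I _
  have hEm : ∀ n, Measurable fun ω => Complex.exp ((Z n ω : ℝ) * Complex.I) := fun n => by
    have := hZm n; fun_prop
  set B : ℝ := 1 + Real.exp ((q + 1) / 2) with hB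
  have hUb : ∀ n ω, ‖U n ω‖ ≤ B := fun n ω =>
    (norm_sub_le _ _).trans (add_le_add (hEb n ω).le (hTb n ω))
  have hB0 : 0 ≤ B := by positivity
  have hU : NegligibleInProb P fun n ω => ‖U n ω‖ := by
    refine NegligibleInProb.of_event (((h2.const_mul (1 / 2)).abs.add
      (h3.const_mul 4).abs).const_mul (2 + B)) h2 one_pos (.of_forall fun n => .of_forall fun ω hω => ?_)
    have hs : ∀ k, (u n k ω) ^ 2 = (n : ℝ)⁻¹ * w k ω ^ 2 := fun k => by
      simp only [u, mul_pow, inv_pow, Real.sq_sqrt (Nat.cast_nonneg n)]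
    have hsum : ∑ k ∈ Finset.range n, lam k ω * u n k ω ^ 2
        = (n : ℝ)⁻¹ * ∑ k ∈ Finset.range n, lam k ω * w k ω ^ 2 := by
      rw [Finset.mul_sum]
      exact Finset.sum_congr rfl fun k _ => by rw [hs]; ring
    have hle : ∑ k ∈ Finset.range n, lam k ω * u n k ω ^ 2 ≤ q + 1 := by
      rw [hsum]; linarith [(abs_lt.1 hω).2]
    have hvu : ∀ k ∈ Finset.range n, v n k ω = u n k ω := fun k hk =>
      truncatedWeight_eq lam (u n) hle (Finset.mem_range.1 hk)
    set A : ℂ := ∑ k ∈ Finset.range n, lam k ω * (Complex.exp (u n k ω * Complex.I) - 1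
      - u n k ω * Complex.I) with hA
    -- Without truncation the two differ by the factor `exp (-(A + q / 2))`, where `A` is the
    -- compensator, approximately minus half the accumulated variance.
    have hT : T n ω = Complex.exp ((Z n ω : ℝ) * Complex.I)
        * Complex.exp (-(A + (q / 2 : ℝ))) := by
      have e1 : ∏ k ∈ Finset.range n, poissonTilt (v n k ω) (lam k ω) (Y k ω)
          = Complex.exp ((Z n ω : ℝ) * Complex.I - A) := by
        rw [hA, Finset.prod_congr rfl fun k hk => by rw [hvu k hk]]
        simp only [poissonTilt, ← Complex.exp_sum, Finset.sum_sub_distrib]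
        congr 2
        simp only [Z, u]
        push_cast
        rw [Finset.mul_sum, Finset.sum_mul]
        exact Finset.sum_congr rfl fun k _ => by ring
      simp only [T, e1, ← Complex.exp_add]
      congr 1
      push_cast
      ring
    have hAb : ‖A + (q / 2 : ℝ)‖ ≤ |1 / 2 * ((n : ℝ)⁻¹ * ∑ k ∈ Finset.range n, lam k ω * w k ω ^ 2 - q)|
        + |4 * ((√(n : ℝ))⁻¹ * ((n : ℝ)⁻¹ * ∑ k ∈ Finset.range n, lam k ω * |w k ω| ^ 3))| := by
      have e2 : A + (q / 2 : ℝ) = ∑ k ∈ Finset.range n, lam k ω * (Complex.exp (u n k ω * Complex.I)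
          - 1 - u n k ω * Complex.I + (u n k ω : ℂ) ^ 2 / 2)
          - ((1 / 2 * ((n : ℝ)⁻¹ * ∑ k ∈ Finset.range n, lam k ω * w k ω ^ 2 - q) : ℝ) : ℂ) := by
        rw [← hsum, hA]
        push_cast
        simp only [mul_add, Finset.sum_add_distrib, mul_sub, Finset.mul_sum]
        have : ∑ k ∈ Finset.range n, (lam k ω : ℂ) * ((u n k ω : ℂ) ^ 2 / 2)
            = ∑ k ∈ Finset.range n, (1 / 2 : ℂ) * ((lam k ω : ℂ) * (u n k ω : ℂ) ^ 2) :=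
          Finset.sum_congr rfl fun k _ => by ring
        rw [this]
        ring
      rw [e2]
      refine (norm_sub_le _ _).trans ?_
      rw [add_comm, Complex.norm_real, Real.norm_eq_abs]
      gcongr
      rw [abs_of_nonneg (by positivity)]
      refine (norm_sum_le _ _).trans ?_
      rw [Finset.mul_sum, Finset.mul_sum, Finset.mul_sum]
      refine Finset.sum_le_sum fun k _ => ?_
      rw [norm_mul]
      calc _ ≤ (lam k ω : ℝ) * (4 * |u n k ω| ^ 3) := by
            gcongr
            · simp
            · exact norm_exp_mul_I_taylor_le _
        _ = _ := by
            simp only [u, abs_mul, mul_pow]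
            rw [abs_of_nonneg (by positivity), pow_succ (√(n : ℝ))⁻¹ 2, inv_pow,
              Real.sq_sqrt (Nat.cast_nonneg n)]
            ring
    -- The constant `2` comes from `|exp z - 1| ≤ 2 |z|` for `|z| ≤ 1`, and `B` from the trivial
    -- bound on `U` when `|z| > 1`.
    have hfin : ‖U n ω‖ ≤ (2 + B) * ‖A + (q / 2 : ℝ)‖ := by
      rcases le_or_gt ‖A + (q / 2 : ℝ)‖ 1 with hle1 | hgt
      · have e3 : U n ω = Complex.exp ((Z n ω : ℝ) * Complex.I)
            * -(Complex.exp (-(A + (q / 2 : ℝ))) - 1) := by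
          simp only [U, hT]; ring
        rw [e3, norm_mul, hEb, one_mul, norm_neg]
        refine (Complex.norm_exp_sub_one_le (by rwa [norm_neg])).trans ?_
        rw [norm_neg]
        gcongr
        linarith
      · exact (hUb n ω).trans (by nlinarith)
    rw [abs_norm]
    refine hfin.trans (le_trans ?_ (le_abs_self _))
    gcongr
  have hlim := tendsto_integral_of_negligible hUb hU
  have hfin : ∀ n, ∫ ω, U n ω ∂P = ∫ ω, Complex.exp ((Z n ω : ℝ) * Complex.I) ∂P
      - Complex.exp ((-q / 2 : ℝ) : ℂ) := by
    intro n
    rw [integral_sub (Integrable.of_bound (hEm n).aestronglyMeasurable 1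
      (.of_forall fun ω => (hEb n ω).le)) (Integrable.of_bound (hTm n).aestronglyMeasurable _
      (.of_forall fun ω => hTb n ω)), integral_const_mul,
      h.integral_prod_poissonTilt (hv n) (hvC n), mul_one]
  have hlim' := hlim.add_const (Complex.exp ((-q / 2 : ℝ) : ℂ))
  rw [zero_add] at hlim'
  exact hlim'.congr fun n => by
    rw [hfin n, sub_add_cancel]

end PoissonCounts

end

namespace SETPAR

/-! ### Quadratic expansion of the likelihood -/

/-- The log-likelihood along a path of counts. -/
noncomputable def pathLik (r : ℕ) (x : ℝ) (y : ℕ → ℕ) (n : ℕ) (θ : Param) : ℝ :=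
  ∑ k ∈ Finset.range n, (-pathIntensity r x θ y k + y k * Real.log (pathIntensity r x θ y k))

/-- The score along a path of counts. -/
noncomputable def pathScore (r : ℕ) (x : ℝ) (y : ℕ → ℕ) (n : ℕ) (θ : Param) (i : Fin 6) : ℝ :=
  ∑ k ∈ Finset.range n,
    pathDeriv r x θ y k i * (pathIntensity r x θ y k)⁻¹ * (y k - pathIntensity r x θ y k)

/-- Second-order remainder of the log-likelihood. -/
noncomputable def secondRemainder (r : ℕ) (x : ℝ) (y : ℕ → ℕ) (n : ℕ) (θ : Param)
    (G : Matrix (Fin 6) (Fin 6) ℝ) : ℝ :=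
  ∑ i, ∑ j, (|(n : ℝ)⁻¹ * ∑ k ∈ Finset.range n, pathSecond r x θ y k i j
      * (pathIntensity r x θ y k)⁻¹ * (y k - pathIntensity r x θ y k)|
    + |(n : ℝ)⁻¹ * ∑ k ∈ Finset.range n, y k * (pathDeriv r x θ y k i * pathDeriv r x θ y k j
      * (pathIntensity r x θ y k)⁻¹ ^ 2) - G i j|)

/-- Third-order remainder of the log-likelihood. -/
noncomputable def thirdRemainder (x a c m : ℝ) (y : ℕ → ℕ) (k : ℕ) : ℝ :=
  9 * m⁻¹ ^ 3 * (y k * envelopeOne x a c y k ^ 3)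
    + m⁻¹ * ((y k + envelope x a c y k) * envelopeThree x a c y k)
    + m⁻¹ ^ 2 * (y k * (envelopeTwo x a c y k * envelopeOne x a c y k))

lemma abs_sum_sum_mul_le (v : Param) (A : Fin 6 → Fin 6 → ℝ) :
    |∑ i, ∑ j, v i * v j * A i j| ≤ ‖v‖ ^ 2 * ∑ i, ∑ j, |A i j| := by
  rw [Finset.mul_sum]
  refine (Finset.abs_sum_le_sum_abs _ _).trans (Finset.sum_le_sum fun i _ => ?_)
  rw [Finset.mul_sum]
  refine (Finset.abs_sum_le_sum_abs _ _).trans (Finset.sum_le_sum fun j _ => ?_)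
  rw [abs_mul, abs_mul, sq]
  gcongr <;> exact abs_apply_le_norm _ _

/-- Expansion of one term of the log-likelihood. -/
lemma abs_term_sub_le {s p y L q m b₁ b₂ b₃ l : ℝ} (hm : 0 < m) (hs : m ≤ s) (hp : m ≤ p)
    (hy : 0 ≤ y) (hpl : p ≤ l) (h1 : |s - p| ≤ b₁) (hL : |L| ≤ b₁) (h2 : |s - p - L| ≤ b₂)
    (h3 : |s - p - L - q| ≤ b₃) :
    |(-s + y * Real.log s) - (-p + y * Real.log p)
        - (L * p⁻¹ * (y - p) + q * p⁻¹ * (y - p) - y * (L ^ 2 * p⁻¹ ^ 2) / 2)|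
      ≤ 9 * m⁻¹ ^ 3 * (y * b₁ ^ 3) + m⁻¹ * ((y + l) * b₃) + m⁻¹ ^ 2 * (y * (b₂ * b₁)) := by
  have hp0 := hm.trans_le hp
  -- Three sources of error: the cubic remainder of the logarithm, the cubic remainder of the
  -- intensity, and the replacement of `(s - p) ^ 2` by `L ^ 2`.
  have e : (-s + y * Real.log s) - (-p + y * Real.log p)
        - (L * p⁻¹ * (y - p) + q * p⁻¹ * (y - p) - y * (L ^ 2 * p⁻¹ ^ 2) / 2)
      = y * (Real.log s - Real.log p - (s - p) / p + (s - p) ^ 2 / (2 * p ^ 2))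
        + p⁻¹ * ((y - p) * (s - p - L - q))
        + -(p⁻¹ ^ 2 * (y * ((s - p - L) * ((s - p + L) / 2)))) := by
    field_simp
    ring
  have hpm : p⁻¹ ≤ m⁻¹ := by gcongr
  have hpi : 0 ≤ p⁻¹ := (inv_pos.2 hp0).le
  rw [e]
  refine (abs_add_le _ _).trans (add_le_add ((abs_add_le _ _).trans (add_le_add ?_ ?_)) ?_)
  · rw [abs_mul, abs_of_nonneg hy]
    calc _ ≤ y * (9 * (|s - p| / m) ^ 3) := by gcongr; exact abs_log_sub_quadratic_le hm hs hp
      _ ≤ y * (9 * (b₁ / m) ^ 3) := by gcongr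
      _ = _ := by rw [div_eq_mul_inv, mul_pow]; ring
  · rw [abs_mul, abs_mul, abs_of_nonneg hpi]
    have : |y - p| ≤ y + l := by
      refine (abs_sub _ _).trans ?_
      rw [abs_of_nonneg hy, abs_of_pos hp0]
      linarith
    have : 0 ≤ y + l := (abs_nonneg _).trans this
    gcongr
  · rw [abs_neg, abs_mul, abs_mul, abs_mul, abs_pow, abs_of_nonneg hpi, abs_of_nonneg hy]
    have : |(s - p + L) / 2| ≤ b₁ := by
      rw [abs_div, abs_two]
      linarith [abs_add_le (s - p) L]
    have : 0 ≤ b₂ := (abs_nonneg _).trans h2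
    gcongr

/-- Quadratic expansion of the log-likelihood. -/
lemma UniformBounds.abs_pathLik_sub_le {E : Set Param} {x a c m : ℝ} (h : UniformBounds E x a c m)
    {θ θ' : Param} (hθ : θ ∈ E) (hθ' : θ' ∈ E) (r : ℕ) (y : ℕ → ℕ) (n : ℕ)
    (G : Matrix (Fin 6) (Fin 6) ℝ) :
    |pathLik r x y n θ - pathLik r x y n θ' - (∑ i, (θ - θ') i * pathScore r x y n θ' i
        - n / 2 * ∑ i, ∑ j, (θ - θ') i * (θ - θ') j * G i j)|
      ≤ n * (‖θ - θ'‖ ^ 2 * secondRemainder r x y n θ' G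
        + ‖θ - θ'‖ ^ 3 * ((n : ℝ)⁻¹ * ∑ k ∈ Finset.range n, thirdRemainder x a c m y k)) := by
  rcases Nat.eq_zero_or_pos n with rfl | hn
  · simp [pathLik, pathScore]
  have hn0 : (n : ℝ) ≠ 0 := by positivity
  set v := θ - θ' with hv
  let s : ℕ → ℝ := fun k => pathIntensity r x θ y k
  let p : ℕ → ℝ := fun k => pathIntensity r x θ' y k
  let L : ℕ → ℝ := fun k => ∑ i, v i * pathDeriv r x θ' y k i
  let q : ℕ → ℝ := fun k => ∑ i, ∑ j, v i * v j * pathSecond r x θ' y k i j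
  let A : Fin 6 → Fin 6 → ℝ := fun i j => (n : ℝ)⁻¹ * ∑ k ∈ Finset.range n,
    pathSecond r x θ' y k i j * (p k)⁻¹ * (y k - p k)
  let B : Fin 6 → Fin 6 → ℝ := fun i j => (n : ℝ)⁻¹ * ∑ k ∈ Finset.range n,
    y k * (pathDeriv r x θ' y k i * pathDeriv r x θ' y k j * (p k)⁻¹ ^ 2) - G i j
  let T : ℕ → ℝ := fun k => (-s k + y k * Real.log (s k)) - (-p k + y k * Real.log (p k))
    - (L k * (p k)⁻¹ * (y k - p k) + q k * (p k)⁻¹ * (y k - p k) - y k * (L k ^ 2 * (p k)⁻¹ ^ 2) / 2)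
  have hT : ∀ k, |T k| ≤ ‖v‖ ^ 3 * thirdRemainder x a c m y k := by
    intro k
    have hd := abs_term_sub_le h.m_pos (h.le_pathIntensity hθ r y k) (h.le_pathIntensity hθ' r y k)
      (Nat.cast_nonneg (y k)) ((le_abs_self _).trans (h.abs_pathIntensity_le hθ' r y k))
      (h.abs_pathIntensity_sub_le hθ hθ' r y k) (h.abs_sum_pathDeriv_le hθ' r y v k)
      (h.abs_pathIntensity_sub_linear_le hθ hθ' r y k)
      (h.abs_pathIntensity_sub_quadratic_le hθ hθ' r y k)
    refine hd.trans (le_of_eq ?_)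
    unfold thirdRemainder
    ring
  have h1 : ∑ i, v i * pathScore r x y n θ' i = ∑ k ∈ Finset.range n, L k * (p k)⁻¹ * (y k - p k) := by
    simp only [pathScore, Finset.mul_sum, L, Finset.sum_mul]
    rw [Finset.sum_comm]
    exact Finset.sum_congr rfl fun k _ => Finset.sum_congr rfl fun i _ => by ring
  have h2 : n * ∑ i, ∑ j, v i * v j * A i j
      = ∑ k ∈ Finset.range n, q k * (p k)⁻¹ * (y k - p k) := by
    have e1 : ∀ i j, (n : ℝ) * (v i * v j * A i j)
        = ∑ k ∈ Finset.range n, v i * v j * pathSecond r x θ' y k i j * (p k)⁻¹ * (y k - p k) := by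
      intro i j
      simp only [A]
      rw [mul_left_comm, mul_inv_cancel_left₀ hn0, Finset.mul_sum]
      exact Finset.sum_congr rfl fun k _ => by ring
    simp only [Finset.mul_sum, e1, q, Finset.sum_mul]
    rw [Finset.sum_comm (s := Finset.range n)]
    exact Finset.sum_congr rfl fun i _ => Finset.sum_comm
  have h3 : n * ∑ i, ∑ j, v i * v j * B i j
      = ∑ k ∈ Finset.range n, y k * (L k ^ 2 * (p k)⁻¹ ^ 2) - n * ∑ i, ∑ j, v i * v j * G i j := by
    have e1 : ∀ i j, (n : ℝ) * (v i * v j * B i j)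
        = ∑ k ∈ Finset.range n, y k * ((v i * pathDeriv r x θ' y k i) * (v j * pathDeriv r x θ' y k j)
          * (p k)⁻¹ ^ 2) - n * (v i * v j * G i j) := by
      intro i j
      simp only [B]
      rw [mul_left_comm, mul_sub, mul_inv_cancel_left₀ hn0, mul_sub, Finset.mul_sum]
      congr 1
      · exact Finset.sum_congr rfl fun k _ => by ring
      · ring
    simp only [Finset.mul_sum, e1, Finset.sum_sub_distrib, L, sq (∑ i, v i * pathDeriv r x θ' y _ i),
      Finset.sum_mul]
    congr 1
    rw [Finset.sum_comm (s := Finset.range n)]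
    refine Finset.sum_congr rfl fun i _ => ?_
    rw [Finset.sum_comm]
    exact Finset.sum_congr rfl fun k _ => Finset.sum_congr rfl fun j _ => by ring
  -- `A` collects the second-order variation of the intensities against centred counts, `B` the
  -- deviation of the empirical Hessian from `G`, and `T` the cubic errors.
  have e : pathLik r x y n θ - pathLik r x y n θ' - (∑ i, v i * pathScore r x y n θ' i
        - n / 2 * ∑ i, ∑ j, v i * v j * G i j)
      = n * ∑ i, ∑ j, v i * v j * A i j - 1 / 2 * (n * ∑ i, ∑ j, v i * v j * B i j)
        + ∑ k ∈ Finset.range n, T k := by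
    rw [h1, h2, h3]
    simp only [T, pathLik, Finset.sum_sub_distrib, Finset.sum_add_distrib, ← Finset.sum_div, s, p]
    ring
  have hA := abs_sum_sum_mul_le v A
  have hB := abs_sum_sum_mul_le v B
  have hT' : |∑ k ∈ Finset.range n, T k|
      ≤ n * (‖v‖ ^ 3 * ((n : ℝ)⁻¹ * ∑ k ∈ Finset.range n, thirdRemainder x a c m y k)) := by
    rw [mul_left_comm, mul_inv_cancel_left₀ hn0, Finset.mul_sum]
    exact (Finset.abs_sum_le_sum_abs _ _).trans (Finset.sum_le_sum fun k _ => hT k)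
  have hB0 : 0 ≤ ‖v‖ ^ 2 * ∑ i, ∑ j, |B i j| := by positivity
  have hsec : secondRemainder r x y n θ' G = ∑ i, ∑ j, |A i j| + ∑ i, ∑ j, |B i j| := by
    simp only [secondRemainder, Finset.sum_add_distrib]
    rfl
  rw [e, hsec, mul_add (n : ℝ), mul_add (‖v‖ ^ 2), mul_add (n : ℝ)]
  refine (abs_add_le _ _).trans (add_le_add ((abs_sub _ _).trans (add_le_add ?_ ?_)) hT')
  · rw [abs_mul, Nat.abs_cast]
    gcongr
  · rw [abs_mul, abs_mul, Nat.abs_cast, abs_of_pos (by norm_num : (0 : ℝ) < 1 / 2)]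
    have : (n : ℝ) * |∑ i, ∑ j, v i * v j * B i j| ≤ n * (‖v‖ ^ 2 * ∑ i, ∑ j, |B i j|) := by gcongr
    have h0 : 0 ≤ (n : ℝ) * |∑ i, ∑ j, v i * v j * B i j| := by positivity
    linarith

/-! ### Comparison of a maximizer with the maximizer of the quadratic approximation -/

lemma dotProduct_mulVec_comm {G : Matrix (Fin 6) (Fin 6) ℝ} (hG : G.IsSymm) (u w : Fin 6 → ℝ) :
    u ⬝ᵥ G.mulVec w = w ⬝ᵥ G.mulVec u := by
  rw [Matrix.dotProduct_mulVec, ← Matrix.mulVec_transpose, hG.eq, dotProduct_comm]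

lemma completing_square {G : Matrix (Fin 6) (Fin 6) ℝ} (hG : G.IsSymm) (u w : Fin 6 → ℝ) :
    u ⬝ᵥ G.mulVec w - 1 / 2 * (u ⬝ᵥ G.mulVec u)
      = 1 / 2 * (w ⬝ᵥ G.mulVec w) - 1 / 2 * ((u - w) ⬝ᵥ G.mulVec (u - w)) := by
  rw [Matrix.mulVec_sub, sub_dotProduct, dotProduct_sub, dotProduct_sub,
    dotProduct_mulVec_comm hG w u]
  ring

lemma abs_dotProduct_le_norm (u w : Param) : |(u : Fin 6 → ℝ) ⬝ᵥ (w : Fin 6 → ℝ)| ≤ ‖u‖ * ‖w‖ := by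
  have := abs_real_inner_le_norm u w
  rwa [EuclideanSpace.inner_eq_star_dotProduct, dotProduct_comm] at this

lemma exists_le_quadratic {G : Matrix (Fin 6) (Fin 6) ℝ} (hG : G.PosDef) :
    ∃ g > 0, ∀ u : Param, g * ‖u‖ ^ 2 ≤ (u : Fin 6 → ℝ) ⬝ᵥ G.mulVec u := by
  have hc : Continuous fun u : Param => (u : Fin 6 → ℝ) ⬝ᵥ G.mulVec u := by
    have : Continuous fun u : Param => (u : Fin 6 → ℝ) := PiLp.continuous_ofLp 2 _
    exact this.dotProduct (continuous_const.matrix_mulVec this)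
  obtain ⟨u₀, hu₀, hmin⟩ := (isCompact_sphere (0 : Param) 1).exists_isMinOn
    ⟨EuclideanSpace.single 0 1, by simp⟩ hc.continuousOn
  have hpos : ∀ u : Param, u ≠ 0 → 0 < (u : Fin 6 → ℝ) ⬝ᵥ G.mulVec u := fun u hu => by
    have := hG.dotProduct_mulVec_pos (x := (u : Fin 6 → ℝ)) (by simpa using hu)
    simpa using this
  refine ⟨_, hpos u₀ (fun h => by simp [h] at hu₀), fun u => ?_⟩
  rcases eq_or_ne u 0 with rfl | hu
  · simp
  have h1 := hmin (show ‖u‖⁻¹ • u ∈ Metric.sphere (0 : Param) 1 by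
    simp [norm_smul, inv_mul_cancel₀ (norm_ne_zero_iff.2 hu)])
  simp only [Set.mem_ofPred_eq, WithLp.ofLp_smul, Matrix.mulVec_smul, smul_dotProduct, dotProduct_smul,
    smul_eq_mul] at h1
  have h2 : 0 < ‖u‖ := norm_pos_iff.2 hu
  calc _ ≤ (‖u‖⁻¹ * (‖u‖⁻¹ * ((u : Fin 6 → ℝ) ⬝ᵥ G.mulVec u))) * ‖u‖ ^ 2 := by gcongr
    _ = _ := by field_simp

lemma norm_le_of_mulVec_eq {G : Matrix (Fin 6) (Fin 6) ℝ} {g : ℝ} (hg : 0 < g)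
    (hGg : ∀ u : Param, g * ‖u‖ ^ 2 ≤ (u : Fin 6 → ℝ) ⬝ᵥ G.mulVec u) {s w : Param}
    (hw : G.mulVec w = s) : ‖w‖ ≤ g⁻¹ * ‖s‖ := by
  have h1 := hGg w
  rw [hw] at h1
  have h2 := (h1.trans (le_abs_self _)).trans (abs_dotProduct_le_norm w s)
  rw [inv_mul_eq_div, le_div_iff₀ hg]
  rcases (norm_nonneg w).eq_or_lt with h0 | h0
  · rw [← h0]; simp
  · nlinarith

/-- A maximizer of a function with a quadratic expansion is close to the maximizer of the quadratic
form. -/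
lemma norm_sq_le_of_quadratic_expansion {G : Matrix (Fin 6) (Fin 6) ℝ} (hG : G.IsSymm) {g : ℝ}
    (hg : 0 < g) (hGg : ∀ u : Param, g * ‖u‖ ^ 2 ≤ (u : Fin 6 → ℝ) ⬝ᵥ G.mulVec u) {N : ℝ}
    (hN : 0 < N) {s w v : Param} (hw : G.mulVec w = s) {Q : Param → ℝ} {ε K : ℝ}
    (hQ : ∀ u, u = v ∨ u = N⁻¹ • w → |Q u - (N * ((u : Fin 6 → ℝ) ⬝ᵥ s)
      - N ^ 2 / 2 * ((u : Fin 6 → ℝ) ⬝ᵥ G.mulVec u))| ≤ N ^ 2 * (‖u‖ ^ 2 * ε + ‖u‖ ^ 3 * K))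
    (hv0 : 0 ≤ Q v) (hvw : Q (N⁻¹ • w) ≤ Q v) (hε : 0 ≤ ε) (hK : 0 ≤ K)
    (hsmall : ε + K * ‖v‖ ≤ g / 4) :
    ‖N • v - w‖ ^ 2 ≤ 2 / g * ((ε + K * ‖v‖) * (4 / g * ‖s‖) ^ 2
      + (ε + K * ‖N⁻¹ • w‖) * (g⁻¹ * ‖s‖) ^ 2) := by
  have hv := abs_le.1 (hQ v (Or.inl rfl))
  have hw' := abs_le.1 (hQ _ (Or.inr rfl))
  have hws := norm_le_of_mulVec_eq hg hGg hw
  -- As `Q v ≥ 0`, the quadratic form is dominated by the linear term plus an error, and `hsmall`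
  -- lets half of the quadratic lower bound absorb that error.
  have hvs : ‖N • v‖ ≤ 4 / g * ‖s‖ := by
    rw [norm_smul, Real.norm_of_nonneg hN.le]
    have h1 := hGg v
    have h2 := (le_abs_self _).trans (abs_dotProduct_le_norm v s)
    have h4 : (ε + K * ‖v‖) * ‖v‖ ^ 2 ≤ g / 4 * ‖v‖ ^ 2 := by gcongr
    have h3 : N * (g / 4 * ‖v‖ ^ 2) ≤ ‖v‖ * ‖s‖ := by
      have h5 : N * (N * (g / 4 * ‖v‖ ^ 2)) ≤ N * (‖v‖ * ‖s‖) := by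
        have e1 : N * ((v : Fin 6 → ℝ) ⬝ᵥ (s : Fin 6 → ℝ)) ≤ N * (‖v‖ * ‖s‖) := by gcongr
        have e2 : N ^ 2 / 2 * (g * ‖v‖ ^ 2) ≤ N ^ 2 / 2 * ((v : Fin 6 → ℝ) ⬝ᵥ G.mulVec v) := by gcongr
        have e3 : N ^ 2 * ((ε + K * ‖v‖) * ‖v‖ ^ 2) ≤ N ^ 2 * (g / 4 * ‖v‖ ^ 2) := by gcongr
        nlinarith [hv.1, hv.2]
      exact le_of_mul_le_mul_left h5 hN
    rcases (norm_nonneg v).eq_or_lt with h0 | h0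
    · rw [← h0]; simp; positivity
    · rw [div_mul_eq_mul_div, le_div_iff₀ hg]
      nlinarith
  -- After completing the square, the quadratic approximation at `v` falls short of its maximum by
  -- half the form at `N • v - w`. Since `Q v` is at least `Q (N⁻¹ • w)`, this loss is at most the
  -- two expansion errors.
  have key : ∀ u : Param, N * ((u : Fin 6 → ℝ) ⬝ᵥ s) - N ^ 2 / 2 * ((u : Fin 6 → ℝ) ⬝ᵥ G.mulVec u)
      = 1 / 2 * ((w : Fin 6 → ℝ) ⬝ᵥ G.mulVec w)
        - 1 / 2 * ((N • u - w : Param) ⬝ᵥ G.mulVec (N • u - w : Param)) := by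
    intro u
    have h1 := completing_square hG (N • u : Param) w
    rw [hw] at h1 ⊢
    simp only [WithLp.ofLp_sub]
    rw [← h1]
    simp only [WithLp.ofLp_smul, Matrix.mulVec_smul, smul_dotProduct, dotProduct_smul, smul_eq_mul]
    ring
  rw [key] at hv hw'
  rw [smul_inv_smul₀ hN.ne', sub_self] at hw'
  simp only [WithLp.ofLp_zero, zero_dotProduct, mul_zero, sub_zero] at hw'
  have h1 := hGg (N • v - w)
  have e1 : N ^ 2 * (‖v‖ ^ 2 * ε + ‖v‖ ^ 3 * K) = (ε + K * ‖v‖) * ‖N • v‖ ^ 2 := by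
    rw [norm_smul, Real.norm_of_nonneg hN.le]; ring
  have e2 : N ^ 2 * (‖N⁻¹ • w‖ ^ 2 * ε + ‖N⁻¹ • w‖ ^ 3 * K)
      = (ε + K * ‖N⁻¹ • w‖) * ‖w‖ ^ 2 := by
    have : ‖w‖ = N * ‖N⁻¹ • w‖ := by
      rw [norm_smul, Real.norm_of_nonneg (inv_pos.2 hN).le, mul_inv_cancel_left₀ hN.ne']
    rw [this]; ring
  rw [e1] at hv
  rw [e2] at hw'
  have e3 : (ε + K * ‖v‖) * ‖N • v‖ ^ 2 ≤ (ε + K * ‖v‖) * (4 / g * ‖s‖) ^ 2 := by gcongr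
  have e4 : (ε + K * ‖N⁻¹ • w‖) * ‖w‖ ^ 2 ≤ (ε + K * ‖N⁻¹ • w‖) * (g⁻¹ * ‖s‖) ^ 2 := by gcongr
  rw [div_mul_eq_mul_div, le_div_iff₀ hg]
  nlinarith [hv.1, hv.2, hw'.1, hw'.2]

end SETPAR

/-- For arguments by finite nets: for each mesh `δ` the error splits into a negligible part and `δ`
times one quantity bounded in probability, independent of the mesh. -/
lemma NegligibleInProb.of_approx {Ω : Type*} [MeasurableSpace Ω] {P : Measure Ω}
    {U K : ℕ → Ω → ℝ} (hK : BoundedInProb P K)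
    (h : ∀ δ > 0, ∃ W, NegligibleInProb P W ∧ ∀ n, ∀ᵐ ω ∂P, |U n ω| ≤ |W n ω| + δ * |K n ω|) :
    NegligibleInProb P U := by
  intro ε hε
  rw [ENNReal.tendsto_nhds_zero]
  intro η hη
  obtain ⟨M, hM, hn⟩ := hK (η / 2) (ENNReal.half_pos hη.ne')
  obtain ⟨W, hW, hUW⟩ := h (ε / (2 * M)) (by positivity)
  filter_upwards [hn, ENNReal.tendsto_nhds_zero.1 (hW (ε / 2) (by positivity)) (η / 2)
    (ENNReal.half_pos hη.ne')] with n h1 h2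
  calc P {ω | ε ≤ |U n ω|} ≤ P ({ω | ε / 2 ≤ |W n ω|} ∪ {ω | M ≤ |K n ω|}) := by
        refine measure_mono_ae ?_
        filter_upwards [hUW n] with ω h3 h4
        by_contra hcon
        have h4' : ε ≤ |U n ω| := h4
        have h5 : ¬ (ε / 2 ≤ |W n ω| ∨ M ≤ |K n ω|) := hcon
        push Not at h5
        have h6 : ε / (2 * M) * |K n ω| ≤ ε / (2 * M) * M := by gcongr; exact h5.2.le
        have h7 : ε / (2 * M) * M = ε / 2 := by field_simp
        linarith [h5.1]
    _ ≤ η / 2 + η / 2 := (measure_union_le _ _).trans (add_le_add h2 h1)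
    _ = η := ENNReal.add_halves η

namespace SETPAR

/-! ### Consistency -/

/-- Counts at which the regressors determine the parameter. -/
def testCounts (r : ℕ) : Finset ℕ := {0, 1, r + 1, r + 2}

/-- Deviation of the averages of the products of regressors from their limits. -/
noncomputable def regressorError (r : ℕ) (x a c : ℝ) (y : ℕ → ℕ) (n : ℕ) (θ : Param)
    (Γ : ℕ → Fin 6 → Fin 6 → ℝ) : ℝ :=
  ∑ i, ∑ j, ∑ u ∈ testCounts r, |(n : ℝ)⁻¹ * ∑ k ∈ Finset.range n, (if y k = u then 1 else 0)
      * (regressor r u (pathIntensity r x θ y k) i * regressor r u (pathIntensity r x θ y k) j)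
      - Γ u i j| + 2 * ((n : ℝ)⁻¹ * envelopeOne x a c y n ^ 2)

/-- Times at which the count is not a test count contribute squares and are dropped. -/
lemma sum_test_le_sum_sq (r : ℕ) (y : ℕ → ℕ) (n : ℕ) (v : Param) (l : ℕ → ℝ) :
    ∑ i, ∑ j, v i * v j * ∑ u ∈ testCounts r, ∑ k ∈ Finset.range n, (if y k = u then 1 else 0)
      * (regressor r u (l k) i * regressor r u (l k) j)
    ≤ ∑ k ∈ Finset.range n, (∑ i, v i * regressor r (y k) (l k) i) ^ 2 := by
  have e : ∑ i, ∑ j, v i * v j * ∑ u ∈ testCounts r, ∑ k ∈ Finset.range n,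
      (if y k = u then 1 else 0) * (regressor r u (l k) i * regressor r u (l k) j)
      = ∑ k ∈ Finset.range n, ∑ u ∈ testCounts r, (if y k = u then 1 else 0)
        * (∑ i, v i * regressor r u (l k) i) ^ 2 := by
    have key : ∀ w : Fin 6 → ℝ, (∑ i, v i * w i) ^ 2 = ∑ i, ∑ j, v i * v j * (w i * w j) := fun w => by
      rw [sq, Finset.sum_mul_sum]
      exact Finset.sum_congr rfl fun i _ => Finset.sum_congr rfl fun j _ => by ring
    simp only [key, Finset.mul_sum]
    rw [Finset.sum_comm (s := Finset.range n)]
    simp_rw [Finset.sum_comm (s := Finset.univ) (t := testCounts r)]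
    refine Finset.sum_congr rfl fun u _ => ?_
    simp_rw [Finset.sum_comm (s := Finset.univ) (t := Finset.range n)]
    exact Finset.sum_congr rfl fun k _ => Finset.sum_congr rfl fun i _ =>
      Finset.sum_congr rfl fun j _ => by ring
  rw [e]
  refine Finset.sum_le_sum fun k _ => ?_
  simp only [ite_mul, one_mul, zero_mul, Finset.sum_ite_eq]
  split_ifs
  · exact le_rfl
  · positivity

/-- A parameter whose likelihood is at least that of `θ'` is close to `θ'`. -/
lemma UniformBounds.norm_sq_le_of_pathLik_le {E : Set Param} {x a c m : ℝ}
    (h : UniformBounds E x a c m) {θ θ' : Param} (hθ : θ ∈ E) (hθ' : θ' ∈ E) {r : ℕ} {y : ℕ → ℕ}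
    {n : ℕ} (hn : 0 < n) (hlik : pathLik r x y n θ' ≤ pathLik r x y n θ)
    {Γ : ℕ → Fin 6 → Fin 6 → ℝ} {g : ℝ} (hg : 0 < g)
    (hΓ : ∀ v : Param, g * ‖v‖ ^ 2 ≤ ∑ i, ∑ j, v i * v j * ∑ u ∈ testCounts r, Γ u i j)
    (hsmall : regressorError r x a c y n θ' Γ ≤ g / 2) :
    ‖θ - θ'‖ ^ 2 ≤ (8 / g) ^ 2 * (|(n : ℝ)⁻¹ * ∑ k ∈ Finset.range n,
        (Real.log (pathIntensity r x θ y k) - Real.log (pathIntensity r x θ' y k))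
          * (y k - pathIntensity r x θ' y k)|
      * ((n : ℝ)⁻¹ * ∑ k ∈ Finset.range n, 4 * (envelope x a c y k * envelopeOne x a c y k ^ 2))) := by
  have hn0 : (0 : ℝ) < n := by exact_mod_cast hn
  set v := θ - θ' with hv
  let s : ℕ → ℝ := fun k => pathIntensity r x θ y k
  let p : ℕ → ℝ := fun k => pathIntensity r x θ' y k
  let Λ : ℕ → ℝ := envelope x a c y
  let B : ℕ → ℝ := envelopeOne x a c y
  have hΛ : ∀ k, 0 < Λ k := fun k => (h.m_pos.trans_le (h.le_pathIntensity hθ r y k)).trans_le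
    ((le_abs_self _).trans (h.abs_pathIntensity_le hθ r y k))
  have hΔ : ∀ k, |s k - p k| ≤ ‖v‖ * B k := fun k => h.abs_pathIntensity_sub_le hθ hθ' r y k
  have hΔ2 : ∀ k, (s k - p k) ^ 2 ≤ ‖v‖ ^ 2 * B k ^ 2 := fun k => by
    rw [← sq_abs, ← mul_pow]; gcongr; exact hΔ k
  set T : ℝ := ∑ k ∈ Finset.range n, (Real.log (s k) - Real.log (p k)) * (y k - p k) with hT
  -- the divergence is bounded by the martingale part
  have h1 : ∑ k ∈ Finset.range n, (s k - p k) ^ 2 / (4 * Λ k) ≤ T := by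
    have h2 : ∀ k, (s k - p k) ^ 2 / (4 * Λ k) ≤ s k - p k - p k * (Real.log (s k) - Real.log (p k)) :=
      fun k => sq_div_le_poisson_divergence (h.m_pos.trans_le (h.le_pathIntensity hθ r y k))
        (h.m_pos.trans_le (h.le_pathIntensity hθ' r y k))
        ((le_abs_self _).trans (h.abs_pathIntensity_le hθ r y k))
        ((le_abs_self _).trans (h.abs_pathIntensity_le hθ' r y k))
    have h3 : pathLik r x y n θ - pathLik r x y n θ' = T - ∑ k ∈ Finset.range n,
        (s k - p k - p k * (Real.log (s k) - Real.log (p k))) := by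
      simp only [pathLik, hT, ← Finset.sum_sub_distrib]
      exact Finset.sum_congr rfl fun k _ => by ring
    have h4 := Finset.sum_le_sum (s := Finset.range n) fun k _ => h2 k
    linarith
  set A : ℝ := ∑ k ∈ Finset.range n, (s k - p k) ^ 2 with hA
  have hA0 : 0 ≤ A := Finset.sum_nonneg fun k _ => sq_nonneg _
  -- Cauchy–Schwarz removes the unbounded weights `1 / (4 Λ)`. One factor is the divergence; in the
  -- other the squared differences are bounded by the squared norm of `v` times the envelope.
  have h2 : A ^ 2 ≤ T * (‖v‖ ^ 2 * ∑ k ∈ Finset.range n, 4 * (Λ k * B k ^ 2)) := by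
    have h3 := Finset.sum_sq_le_sum_mul_sum_of_sq_le_mul (Finset.range n)
      (r := fun k => (s k - p k) ^ 2) (f := fun k => (s k - p k) ^ 2 / (4 * Λ k))
      (g := fun k => 4 * Λ k * (s k - p k) ^ 2)
      (fun k _ => by have := hΛ k; positivity) (fun k _ => by have := hΛ k; positivity)
      (fun k _ => le_of_eq (by have := (hΛ k).ne'; field_simp))
    refine h3.trans (mul_le_mul h1 ?_ (Finset.sum_nonneg fun k _ => by
      have := hΛ k; positivity) ((Finset.sum_nonneg fun k _ => by
      have := hΛ k; positivity).trans h1))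
    rw [Finset.mul_sum]
    refine Finset.sum_le_sum fun k _ => ?_
    have := hΛ k
    calc 4 * Λ k * (s k - p k) ^ 2 ≤ 4 * Λ k * (‖v‖ ^ 2 * B k ^ 2) := by gcongr; exact hΔ2 k
      _ = _ := by ring
  -- identification through the regressors
  have h3 : ∑ k ∈ Finset.range n, (∑ i, v i * regressor r (y k) (p k) i) ^ 2
      ≤ 4 * A + 2 * (‖v‖ ^ 2 * B n ^ 2) := by
    -- The recursion expresses the regressor part as the new difference minus `a` times the old one,
    -- and `a ≤ 1`.
    have h4 : ∀ k, (∑ i, v i * regressor r (y k) (p k) i) ^ 2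
        ≤ 2 * (s (k + 1) - p (k + 1)) ^ 2 + 2 * (s k - p k) ^ 2 := by
      intro k
      have e := nextIntensity_sub_eq r θ θ' (y k) (s k) (p k)
      have e' : s (k + 1) - p (k + 1) = aCoef r θ (y k) * (s k - p k)
          + ∑ i, v i * regressor r (y k) (p k) i := e
      have ha1 := h.abs_aCoef_le hθ r (y k)
      have ha2 : aCoef r θ (y k) ^ 2 ≤ 1 := by
        rw [← sq_abs]
        have := h.a_lt_one
        exact pow_le_one₀ (abs_nonneg _) (by linarith)
      have e2 : ∑ i, v i * regressor r (y k) (p k) i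
          = (s (k + 1) - p (k + 1)) - aCoef r θ (y k) * (s k - p k) := by linarith
      rw [e2]
      have : aCoef r θ (y k) ^ 2 * (s k - p k) ^ 2 ≤ 1 * (s k - p k) ^ 2 := by gcongr
      nlinarith [sq_nonneg ((s (k + 1) - p (k + 1)) + aCoef r θ (y k) * (s k - p k))]
    have h5 := Finset.sum_le_sum (s := Finset.range n) fun k _ => h4 k
    rw [Finset.sum_add_distrib, ← Finset.mul_sum, ← Finset.mul_sum] at h5
    have h6 : ∑ k ∈ Finset.range n, (s (k + 1) - p (k + 1)) ^ 2 ≤ A + ‖v‖ ^ 2 * B n ^ 2 := by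
      have h7 := Finset.sum_range_succ' (fun k => (s k - p k) ^ 2) n
      rw [Finset.sum_range_succ] at h7
      have := hΔ2 n
      have := sq_nonneg (s 0 - p 0)
      linarith
    linarith
  have h4 := (sum_test_le_sum_sq r y n v p).trans h3
  have h5 : n * (g / 2 * ‖v‖ ^ 2) ≤ 4 * A := by
    let W : Fin 6 → Fin 6 → ℝ := fun i j => ∑ u ∈ testCounts r, ((n : ℝ)⁻¹ * ∑ k ∈ Finset.range n,
      (if y k = u then 1 else 0) * (regressor r u (p k) i * regressor r u (p k) j) - Γ u i j)
    have e : ∑ i, ∑ j, v i * v j * ∑ u ∈ testCounts r, ∑ k ∈ Finset.range n,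
        (if y k = u then 1 else 0) * (regressor r u (p k) i * regressor r u (p k) j)
        = n * (∑ i, ∑ j, v i * v j * ∑ u ∈ testCounts r, Γ u i j + ∑ i, ∑ j, v i * v j * W i j) := by
      rw [← Finset.sum_add_distrib, Finset.mul_sum]
      refine Finset.sum_congr rfl fun i _ => ?_
      rw [← Finset.sum_add_distrib, Finset.mul_sum]
      refine Finset.sum_congr rfl fun j _ => ?_
      simp only [W, Finset.sum_sub_distrib, ← Finset.mul_sum]
      field_simp
      ring
    have hW := abs_sum_sum_mul_le v W
    have hW2 : ∑ i, ∑ j, |W i j| + 2 * ((n : ℝ)⁻¹ * B n ^ 2) ≤ g / 2 := by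
      refine le_trans (add_le_add ?_ le_rfl) hsmall
      exact Finset.sum_le_sum fun i _ => Finset.sum_le_sum fun j _ => Finset.abs_sum_le_sum_abs _ _
    rw [e] at h4
    have h6 := hΓ v
    have h7 : ‖v‖ ^ 2 * (∑ i, ∑ j, |W i j| + 2 * ((n : ℝ)⁻¹ * B n ^ 2)) ≤ ‖v‖ ^ 2 * (g / 2) := by
      gcongr
    have h8 : n * (g / 2 * ‖v‖ ^ 2) ≤ n * ((∑ i, ∑ j, v i * v j * ∑ u ∈ testCounts r, Γ u i j
        + ∑ i, ∑ j, v i * v j * W i j) - ‖v‖ ^ 2 * (2 * ((n : ℝ)⁻¹ * B n ^ 2))) := by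
      gcongr
      have := neg_abs_le (∑ i, ∑ j, v i * v j * W i j)
      linarith
    have h9 : (n : ℝ) * (‖v‖ ^ 2 * (2 * ((n : ℝ)⁻¹ * B n ^ 2))) = 2 * (‖v‖ ^ 2 * B n ^ 2) := by
      field_simp
    rw [mul_sub, h9] at h8
    linarith
  set K : ℝ := ∑ k ∈ Finset.range n, 4 * (Λ k * B k ^ 2) with hK
  have hK0 : 0 ≤ K := Finset.sum_nonneg fun k _ => by have := hΛ k; positivity
  -- The left side is of order four in `v`, the right side of order two; cancelling one squared norm
  -- leaves the claimed bound.
  have h6 : (n * (g / 8 * ‖v‖ ^ 2)) ^ 2 ≤ |T| * (‖v‖ ^ 2 * K) := by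
    calc (n * (g / 8 * ‖v‖ ^ 2)) ^ 2 ≤ A ^ 2 := by gcongr; linarith
      _ ≤ T * (‖v‖ ^ 2 * K) := h2
      _ ≤ _ := by gcongr; exact le_abs_self _
  rcases (norm_nonneg v).eq_or_lt with h0 | h0
  · rw [← h0, zero_pow two_ne_zero]
    have : 0 ≤ (n : ℝ)⁻¹ * K := by positivity
    positivity
  · rw [abs_mul, abs_inv, Nat.abs_cast]
    have h7 : ‖v‖ ^ 2 * (n * (g / 8)) ^ 2 ≤ |T| * K := by
      have : ‖v‖ ^ 2 * (‖v‖ ^ 2 * (n * (g / 8)) ^ 2) ≤ ‖v‖ ^ 2 * (|T| * K) := by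
        calc _ = (n * (g / 8 * ‖v‖ ^ 2)) ^ 2 := by ring
          _ ≤ _ := h6
          _ = _ := by ring
      exact le_of_mul_le_mul_left this (by positivity)
    calc ‖v‖ ^ 2 = (8 / g) ^ 2 * (n : ℝ)⁻¹ ^ 2 * (‖v‖ ^ 2 * (n * (g / 8)) ^ 2) := by field_simp
      _ ≤ (8 / g) ^ 2 * (n : ℝ)⁻¹ ^ 2 * (|T| * K) := by gcongr
      _ = _ := by ring

end SETPAR

/-! ### Transfer of convergence in probability to characteristic functions -/

section

variable {Ω : Type*} [MeasurableSpace Ω] {P : Measure Ω}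

lemma NegligibleInProb.of_tendsto {a : ℕ → ℝ} (ha : Tendsto a atTop (𝓝 0)) :
    NegligibleInProb P (fun n _ => a n) := by
  intro ε hε
  refine tendsto_const_nhds.congr' ?_
  filter_upwards [(tendsto_zero_iff_abs_tendsto_zero _ |>.1 ha).eventually_lt_const hε] with n hn
  have : {ω : Ω | ε ≤ |a n|} = ∅ := by
    ext; simpa using hn
  rw [this, measure_empty]

lemma BoundedInProb.sum [IsFiniteMeasure P] {ι : Type*} {s : Finset ι} {U : ι → ℕ → Ω → ℝ}
    (hU : ∀ i ∈ s, BoundedInProb P (U i)) :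
    BoundedInProb P (fun n ω => ∑ i ∈ s, U i n ω) := by
  classical
  induction s using Finset.induction_on with
  | empty => simpa using BoundedInProb.const 0
  | insert i s hi ih =>
    simp_rw [Finset.sum_insert hi]
    exact (hU i (by simp)).add (ih fun j hj => hU j (by simp [hj]))

lemma BoundedInProb.abs {U : ℕ → Ω → ℝ} (hU : BoundedInProb P U) :
    BoundedInProb P (fun n ω => |U n ω|) :=
  hU.mono_ae (.of_forall fun n => .of_forall fun ω => (abs_abs (U n ω)).le)

/-- Slutsky's argument: the complex exponential on the imaginary axis is bounded and Lipschitz with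
constant one. -/
lemma tendsto_integral_exp_of_negligible_sub [IsProbabilityMeasure P] {X Z : ℕ → Ω → ℝ}
    (hX : ∀ n, AEMeasurable (X n) P) (hZ : ∀ n, AEMeasurable (Z n) P)
    (h : NegligibleInProb P fun n ω => X n ω - Z n ω) {l : ℂ}
    (hl : Tendsto (fun n => ∫ ω, Complex.exp (Z n ω * Complex.I) ∂P) atTop (𝓝 l)) :
    Tendsto (fun n => ∫ ω, Complex.exp (X n ω * Complex.I) ∂P) atTop (𝓝 l) := by
  have hb : ∀ u : ℝ, ‖Complex.exp (u * Complex.I)‖ = 1 := Complex.norm_exp_ofReal_mul_I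
  have hint : ∀ {U : Ω → ℝ}, AEMeasurable U P →
      Integrable (fun ω => Complex.exp (U ω * Complex.I)) P := fun hU =>
    Integrable.of_bound (by fun_prop) 1 (.of_forall fun ω => (hb _).le)
  have h1 := tendsto_integral_of_negligible (P := P)
    (U := fun n ω => Complex.exp (X n ω * Complex.I) - Complex.exp (Z n ω * Complex.I)) (B := 2)
    (fun n ω => (norm_sub_le _ _).trans (by rw [hb, hb]; norm_num)) (h.mono fun n ω => by
      rw [abs_norm]
      have e : Complex.exp (X n ω * Complex.I) - Complex.exp (Z n ω * Complex.I)
          = Complex.exp (Z n ω * Complex.I)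
            * (Complex.exp (Complex.I * ((X n ω - Z n ω : ℝ) : ℂ)) - 1) := by
        rw [mul_sub, ← Complex.exp_add, mul_one]
        congr 2
        push_cast
        ring
      rw [e, norm_mul, hb, one_mul]
      exact Real.norm_exp_I_mul_ofReal_sub_one_le)
  have h2 := h1.add hl
  rw [zero_add] at h2
  refine h2.congr fun n => ?_
  rw [integral_sub (hint (hX n)) (hint (hZ n)), sub_add_cancel]

end

/-! ### Score, remainders and likelihood ratio on a bounded sample -/

namespace SETPAR

lemma norm_le_sum_abs (u : Param) : ‖u‖ ≤ ∑ i, |u i| := by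
  rw [EuclideanSpace.norm_eq]
  refine Real.sqrt_le_iff.2 ⟨Finset.sum_nonneg fun i _ => abs_nonneg _, ?_⟩
  simp only [Real.norm_eq_abs]
  exact Finset.sum_sq_le_sq_sum_of_nonneg fun i _ => abs_nonneg _

lemma sum_sum_eq_dotProduct (v : Param) (G : Matrix (Fin 6) (Fin 6) ℝ) :
    ∑ i, ∑ j, v i * v j * G i j = (v : Fin 6 → ℝ) ⬝ᵥ G.mulVec v := by
  simp only [dotProduct, Matrix.mulVec, Finset.mul_sum]
  exact Finset.sum_congr rfl fun i _ => Finset.sum_congr rfl fun j _ => by ring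

/-- The martingale part of the log-likelihood ratio. -/
noncomputable def logRatioAverage (r : ℕ) (x : ℝ) (y : ℕ → ℕ) (n : ℕ) (θ θ' : Param) : ℝ :=
  (n : ℝ)⁻¹ * ∑ k ∈ Finset.range n,
    (Real.log (pathIntensity r x θ y k) - Real.log (pathIntensity r x θ' y k))
      * (y k - pathIntensity r x θ' y k)

/-- The average of the information matrices along a path. -/
noncomputable def pathInfo (r : ℕ) (x : ℝ) (y : ℕ → ℕ) (n : ℕ) (θ : Param) (i j : Fin 6) : ℝ :=
  (n : ℝ)⁻¹ * ∑ k ∈ Finset.range n,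
    pathDeriv r x θ y k i * pathDeriv r x θ y k j * (pathIntensity r x θ y k)⁻¹

/-- The normalized score. -/
noncomputable def normalizedScore (r : ℕ) (x : ℝ) (y : ℕ → ℕ) (n : ℕ) (θ : Param) : Param :=
  WithLp.toLp 2 fun i => (√(n : ℝ))⁻¹ * pathScore r x y n θ i

namespace UniformBounds

variable {E : Set Param} {x a c m : ℝ} {r : ℕ} {θ θ' θ₀ : Param}

/-- A Lipschitz bound in the parameter whose constant is an average of envelopes, hence bounded in
probability uniformly over `E`. -/
lemma abs_logRatioAverage_sub_le (h : UniformBounds E x a c m) (hθ : θ ∈ E) (hθ' : θ' ∈ E)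
    (hθ₀ : θ₀ ∈ E) (y : ℕ → ℕ) (n : ℕ) :
    |logRatioAverage r x y n θ θ₀ - logRatioAverage r x y n θ' θ₀|
      ≤ ‖θ - θ'‖ * ((n : ℝ)⁻¹ * ∑ k ∈ Finset.range n,
        m⁻¹ * (envelopeOne x a c y k * (y k + envelope x a c y k))) := by
  rw [logRatioAverage, logRatioAverage, ← mul_sub, ← Finset.sum_sub_distrib, abs_mul, abs_inv,
    Nat.abs_cast, mul_left_comm, Finset.mul_sum]
  gcongr
  refine (Finset.abs_sum_le_sum_abs _ _).trans (Finset.sum_le_sum fun k _ => ?_)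
  have e : ∀ s t p q : ℝ, (s - p) * q - (t - p) * q = (s - t) * q := fun s t p q => by ring
  rw [e, abs_mul]
  have h1 := (abs_log_sub_log_le h.m_pos (h.le_pathIntensity hθ r y k)
    (h.le_pathIntensity hθ' r y k))
  have hm := h.m_pos
  calc _ ≤ ‖θ - θ'‖ * envelopeOne x a c y k / m * (y k + envelope x a c y k) := by
        refine mul_le_mul (h1.trans ?_) ((abs_sub _ _).trans ?_) (abs_nonneg _) ?_
        · gcongr; exact h.abs_pathIntensity_sub_le hθ hθ' r y k
        · rw [Nat.abs_cast]
          gcongr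
          exact h.abs_pathIntensity_le hθ₀ r y k
        · have := h.envelopeOne_nonneg y k
          positivity
    _ = _ := by ring

lemma abs_pathInfo_sub_le (h : UniformBounds E x a c m) (hθ : θ ∈ E) (hθ' : θ' ∈ E) (y : ℕ → ℕ)
    (n : ℕ) (i j : Fin 6) :
    |pathInfo r x y n θ i j - pathInfo r x y n θ' i j|
      ≤ ‖θ - θ'‖ * ((n : ℝ)⁻¹ * ∑ k ∈ Finset.range n,
        (4 * m⁻¹ * (envelopeTwo x a c y k * envelopeOne x a c y k)
          + m⁻¹ ^ 2 * envelopeOne x a c y k ^ 3)) := by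
  rw [pathInfo, pathInfo, ← mul_sub, ← Finset.sum_sub_distrib, abs_mul, abs_inv,
    Nat.abs_cast, mul_left_comm, Finset.mul_sum]
  gcongr
  refine (Finset.abs_sum_le_sum_abs _ _).trans (Finset.sum_le_sum fun k _ => ?_)
  have e : ∀ d d' f f' s p : ℝ, d * f * s - d' * f' * p
      = (d - d') * f * s + d' * (f - f') * s + d' * f' * (s - p) := fun d d' f f' s p => by ring
  have hm := h.m_pos
  have hs := h.le_pathIntensity hθ r y k
  have hp := h.le_pathIntensity hθ' r y k
  have hs0 := hm.trans_le hs
  have hp0 := hm.trans_le hp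
  have b1 := h.envelopeOne_nonneg y k
  have b2 := h.envelopeTwo_nonneg y k
  have hsi : |(pathIntensity r x θ y k)⁻¹| ≤ m⁻¹ := by
    rw [abs_of_pos (inv_pos.2 hs0)]; gcongr
  have hsp : |(pathIntensity r x θ y k)⁻¹ - (pathIntensity r x θ' y k)⁻¹|
      ≤ ‖θ - θ'‖ * envelopeOne x a c y k * m⁻¹ ^ 2 := by
    rw [inv_sub_inv hs0.ne' hp0.ne', abs_div, abs_sub_comm, abs_of_pos (mul_pos hs0 hp0),
      div_eq_mul_inv, inv_pow]
    gcongr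
    · exact h.abs_pathIntensity_sub_le hθ hθ' r y k
    · rw [sq]; gcongr
  rw [e]
  calc _ ≤ 2 * ‖θ - θ'‖ * envelopeTwo x a c y k * envelopeOne x a c y k * m⁻¹
        + envelopeOne x a c y k * (2 * ‖θ - θ'‖ * envelopeTwo x a c y k) * m⁻¹
        + envelopeOne x a c y k * envelopeOne x a c y k
          * (‖θ - θ'‖ * envelopeOne x a c y k * m⁻¹ ^ 2) := by
        refine (abs_add_le _ _).trans (add_le_add ((abs_add_le _ _).trans (add_le_add ?_ ?_)) ?_)
        · rw [abs_mul, abs_mul]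
          gcongr
          · exact h.abs_pathDeriv_sub_le hθ hθ' r y k i
          · exact h.abs_pathDeriv_le hθ r y k j
        · rw [abs_mul, abs_mul]
          gcongr
          · exact h.abs_pathDeriv_le hθ' r y k i
          · exact h.abs_pathDeriv_sub_le hθ hθ' r y k j
        · rw [abs_mul, abs_mul]
          gcongr
          · exact h.abs_pathDeriv_le hθ' r y k i
          · exact h.abs_pathDeriv_le hθ' r y k j
    _ = _ := by ring

end UniformBounds

namespace BoundedSample

variable {Ω : Type*} [mΩ : MeasurableSpace Ω] {P : Measure Ω} {ℱ : Filtration ℕ mΩ}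
  {Y : ℕ → Ω → ℕ} {lam : ℕ → Ω → ℝ≥0} {r : ℕ} {θ₀ : Param} {E : Set Param} {x a c m : ℝ}
  [IsProbabilityMeasure P] {μ : Measure State} [IsProbabilityMeasure μ]

/-- For a fixed parameter this is a martingale average up to a geometric error. A finite net of the
compact set and the Lipschitz bound extend it to the random parameter. -/
lemma negligible_logRatioAverage (h : BoundedSample P ℱ Y lam r θ₀) (hE : UniformBounds E x a c m)
    (hEc : IsCompact E) (hθ : θ₀ ∈ E) {θhat : ℕ → Ω → Param}
    (hmem : ∀ n, ∀ᵐ ω ∂P, θhat n ω ∈ E) :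
    NegligibleInProb P fun n ω => logRatioAverage r x (fun k => Y k ω) n (θhat n ω) θ₀ := by
  have hfix : ∀ θ ∈ E, NegligibleInProb P fun n ω => logRatioAverage r x (fun k => Y k ω) n θ θ₀ :=
    fun θ hθ' => h.average_centered (hE.subset hθ) x (fun k =>
      (Real.measurable_log.comp (h.measurable_pathIntensity x θ k)).sub
        (Real.measurable_log.comp (h.measurable_pathIntensity x θ₀ k)))
      (h.hasUniformMoments_log hE hθ hθ')
  have hK := (((h.hasUniformMoments_envelopeOne hE hθ).mul
    ((h.hasUniformMoments_count (hE.subset hθ)).add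
      (h.hasUniformMoments_envelope hE hθ))).const_mul m⁻¹).average
  refine NegligibleInProb.of_approx hK fun δ hδ => ?_
  obtain ⟨t, htE, htf, ht⟩ := hEc.finite_cover_balls hδ
  refine ⟨fun n ω => ∑ θ ∈ htf.toFinset, |logRatioAverage r x (fun k => Y k ω) n θ θ₀|,
    NegligibleInProb.sum fun θ hθt => (hfix θ (htE (htf.mem_toFinset.1 hθt))).abs, fun n => ?_⟩
  filter_upwards [hmem n] with ω hω
  obtain ⟨θ, hθt, hθb⟩ := Set.mem_iUnion₂.1 (ht hω)
  have h1 := hE.abs_logRatioAverage_sub_le (r := r) hω (htE hθt) hθ (fun k => Y k ω) n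
  have h2 : |logRatioAverage r x (fun k => Y k ω) n θ θ₀|
      ≤ ∑ θ ∈ htf.toFinset, |logRatioAverage r x (fun k => Y k ω) n θ θ₀| :=
    Finset.single_le_sum (f := fun θ => |logRatioAverage r x (fun k => Y k ω) n θ θ₀|)
      (fun _ _ => abs_nonneg _) (htf.mem_toFinset.2 hθt)
  have h3 := abs_sub_abs_le_abs_sub (logRatioAverage r x (fun k => Y k ω) n (θhat n ω) θ₀)
    (logRatioAverage r x (fun k => Y k ω) n θ θ₀)
  have h4 : ‖θhat n ω - θ‖ ≤ δ := by
    rw [← dist_eq_norm]; exact (Metric.mem_ball.1 hθb).le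
  have h5 : ∀ b : ℝ, ‖θhat n ω - θ‖ * b ≤ δ * |b| := fun b =>
    (mul_le_mul_of_nonneg_left (le_abs_self b) (norm_nonneg _)).trans
      (mul_le_mul_of_nonneg_right h4 (abs_nonneg _))
  have h6 := le_abs_self (∑ θ ∈ htf.toFinset, |logRatioAverage r x (fun k => Y k ω) n θ θ₀|)
  linarith [h5 ((n : ℝ)⁻¹ * ∑ k ∈ Finset.range n, m⁻¹ * (envelopeOne x a c (fun k => Y k ω) k
    * (Y k ω + envelope x a c (fun k => Y k ω) k)))]

lemma negligible_regressorError (h : BoundedSample P ℱ Y lam r θ₀) (hE : UniformBounds E x a c m)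
    (hθ : θ₀ ∈ E) (hμ : (stateChain r θ₀ (hE.subset hθ)).IsErgodicMeasure μ) :
    NegligibleInProb P fun n ω => regressorError r x a c (fun k => Y k ω) n θ₀
      fun u i j => ∫ s, regressorWeight r u i j s ∂μ := by
  refine NegligibleInProb.add (NegligibleInProb.sum fun i _ => NegligibleInProb.sum fun j _ =>
    NegligibleInProb.sum fun u _ =>
      (h.negligible_average_regressor (hE.subset hθ) x hμ u i j).2.abs) ?_
  have h1 := ((h.hasUniformMoments_envelopeOne hE hθ).pow 2).boundedInProb.mul_negligible
    (NegligibleInProb.of_tendsto (P := P) tendsto_inv_atTop_nhds_zero_nat)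
  exact (h1.const_mul 2).mono fun n ω => le_of_eq (by ring_nf)

lemma negligible_secondRemainder (h : BoundedSample P ℱ Y lam r θ₀) (hE : UniformBounds E x a c m)
    (hθ : θ₀ ∈ E) (hμ : (stateChain r θ₀ (hE.subset hθ)).IsErgodicMeasure μ) :
    NegligibleInProb P fun n ω => secondRemainder r x (fun k => Y k ω) n θ₀
      (Matrix.of (limitInfo μ θ₀ (lowerBound x θ₀))) :=
  NegligibleInProb.sum fun i _ => NegligibleInProb.sum fun j _ =>
    ((h.average_centered (hE.subset hθ) x
      (fun k => (h.measurable_pathSecond x θ₀ k i j).mul (h.measurable_pathIntensity x θ₀ k).inv)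
      ((h.hasUniformMoments_pathSecond hE hθ i j).mul
        (h.hasUniformMoments_inv_pathIntensity hE hθ))).abs).add
    (h.negligible_average_count_info hE hθ hμ i j).1.abs

lemma boundedInProb_thirdRemainder (h : BoundedSample P ℱ Y lam r θ₀) (hE : UniformBounds E x a c m)
    (hθ : θ₀ ∈ E) : BoundedInProb P fun n ω =>
      (n : ℝ)⁻¹ * ∑ k ∈ Finset.range n, thirdRemainder x a c m (fun k => Y k ω) k := by
  have hY := h.hasUniformMoments_count (hE.subset hθ)
  have h0 := h.hasUniformMoments_envelope hE hθ
  have h1 := h.hasUniformMoments_envelopeOne hE hθ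
  have h2 := h.hasUniformMoments_envelopeTwo hE hθ
  have h3 := h.hasUniformMoments_envelopeThree hE hθ
  exact (((((hY.mul (h1.pow 3)).const_mul _).add (((hY.add h0).mul h3).const_mul _)).add
    ((hY.mul (h2.mul h1)).const_mul _))).average

lemma hasUniformMoments_scoreWeight (h : BoundedSample P ℱ Y lam r θ₀)
    (hE : UniformBounds E x a c m) (hθ : θ₀ ∈ E) (i : Fin 6) : HasUniformMoments P fun k ω =>
      pathDeriv r x θ₀ (fun k => Y k ω) k i * (pathIntensity r x θ₀ (fun k => Y k ω) k)⁻¹ :=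
  (h.hasUniformMoments_pathDeriv (hE.subset hθ) x i).mul
    (h.hasUniformMoments_inv_pathIntensity hE hθ)

lemma boundedInProb_normalizedScore (h : BoundedSample P ℱ Y lam r θ₀)
    (hE : UniformBounds E x a c m) (hθ : θ₀ ∈ E) :
    BoundedInProb P fun n ω => ‖normalizedScore r x (fun k => Y k ω) n θ₀‖ := by
  have hi : ∀ i, BoundedInProb P fun n ω => normalizedScore r x (fun k => Y k ω) n θ₀ i := by
    intro i
    have hm := h.hasUniformMoments_scoreWeight hE hθ i
    have h1 := h.counts.martingale_bounded (fun k => (h.measurable_pathDeriv x θ₀ k i).mul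
      (h.measurable_pathIntensity x θ₀ k).inv) hm (e := fun j l => (j : ℝ) - l)
      (fun j => by fun_prop) integral_sub_mean_poissonMeasure
      ((h.hasUniformMoments_count (hE.subset hθ)).sub (h.hasUniformMoments_rate (hE.subset hθ)))
    have h2 := h.negligible_rate_sub (hE.subset hθ) x hm
    refine (h1.add h2.boundedInProb).mono_ae (.of_forall fun n => .of_forall fun ω => le_of_eq ?_)
    rw [← mul_add, ← Finset.sum_add_distrib]
    simp only [normalizedScore, pathScore, ← mul_add, sub_add_sub_cancel, Pi.mul_apply, Pi.inv_apply]
  refine (BoundedInProb.sum (s := Finset.univ) fun i _ => (hi i).abs).mono_ae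
    (.of_forall fun n => .of_forall fun ω => ?_)
  rw [abs_norm]
  exact (norm_le_sum_abs _).trans (le_abs_self _)

omit [IsProbabilityMeasure P] in
lemma measurable_normalizedScore (h : BoundedSample P ℱ Y lam r θ₀) (x : ℝ) (n : ℕ) (i : Fin 6) :
    Measurable fun ω => normalizedScore r x (fun k => Y k ω) n θ₀ i := by
  refine (Finset.measurable_fun_sum _ fun k _ => ?_).const_mul _
  have h1 := (h.measurable_pathDeriv x θ₀ k i).mono (ℱ.le k) le_rfl
  have h2 := (h.measurable_pathIntensity x θ₀ k).mono (ℱ.le k) le_rfl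
  exact (h1.mul h2.inv).mul ((measurable_from_nat.comp (h.counts.measurable_count' k)).sub h2)

/-- The normalized score is asymptotically normal. -/
lemma tendsto_integral_exp_normalizedScore (h : BoundedSample P ℱ Y lam r θ₀)
    (hE : UniformBounds E x a c m) (hθ : θ₀ ∈ E)
    (hμ : (stateChain r θ₀ (hE.subset hθ)).IsErgodicMeasure μ)
    (hG : (Matrix.of (limitInfo μ θ₀ (lowerBound x θ₀))).PosDef) (u : Param) :
    Tendsto (fun n => ∫ ω, Complex.exp
      (((u : Fin 6 → ℝ) ⬝ᵥ normalizedScore r x (fun k => Y k ω) n θ₀ : ℝ) * Complex.I) ∂P) atTop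
      (𝓝 (Complex.exp ((-((u : Fin 6 → ℝ) ⬝ᵥ
        (Matrix.of (limitInfo μ θ₀ (lowerBound x θ₀))).mulVec u) / 2 : ℝ) : ℂ))) := by
  set G := Matrix.of (limitInfo μ θ₀ (lowerBound x θ₀)) with hGdef
  let D : Fin 6 → ℕ → Ω → ℝ := fun i k ω =>
    pathDeriv r x θ₀ (fun k => Y k ω) k i * (pathIntensity r x θ₀ (fun k => Y k ω) k)⁻¹
  let w : ℕ → Ω → ℝ := fun k ω => ∑ i, u i * D i k ω
  have hD : ∀ i k, Measurable[ℱ k] (D i k) := fun i k =>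
    (h.measurable_pathDeriv x θ₀ k i).mul (h.measurable_pathIntensity x θ₀ k).inv
  have hDm : ∀ i, HasUniformMoments P (D i) := h.hasUniformMoments_scoreWeight hE hθ
  have hw : ∀ k, Measurable[ℱ k] (w k) := fun k =>
    Finset.measurable_fun_sum _ fun i _ => (measurable_const_mul _).comp (hD i k)
  have hwm : HasUniformMoments P w := HasUniformMoments.sum fun i _ => (hDm i).const_mul _
  have hlam := h.hasUniformMoments_rate (hE.subset hθ)
  have hq : 0 ≤ (u : Fin 6 → ℝ) ⬝ᵥ G.mulVec u := by
    simpa using hG.posSemidef.dotProduct_mulVec_nonneg (u : Fin 6 → ℝ)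
  have h2 : NegligibleInProb P (fun n ω => (n : ℝ)⁻¹ * ∑ k ∈ Finset.range n, lam k ω * w k ω ^ 2
      - (u : Fin 6 → ℝ) ⬝ᵥ G.mulVec u) := by
    have h3 : NegligibleInProb P fun n ω => ∑ i, ∑ j, u i * u j *
        ((n : ℝ)⁻¹ * ∑ k ∈ Finset.range n, lam k ω * (pathDeriv r x θ₀ (fun k => Y k ω) k i
          * pathDeriv r x θ₀ (fun k => Y k ω) k j * (pathIntensity r x θ₀ (fun k => Y k ω) k)⁻¹ ^ 2)
          - G i j) := NegligibleInProb.sum fun i _ => NegligibleInProb.sum fun j _ =>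
      (h.negligible_average_count_info hE hθ hμ i j).2.const_mul _
    refine h3.mono fun n ω => le_of_eq ?_
    rw [← sum_sum_eq_dotProduct]
    simp only [mul_sub, Finset.sum_sub_distrib, Finset.mul_sum]
    congr 2
    rw [Finset.sum_congr rfl fun i _ => Finset.sum_comm, Finset.sum_comm]
    refine Finset.sum_congr rfl fun k _ => ?_
    have key : w k ω ^ 2 = ∑ i, ∑ j, u i * D i k ω * (u j * D j k ω) := by
      rw [sq, Finset.sum_mul_sum]
    simp only [key, Finset.mul_sum]
    exact Finset.sum_congr rfl fun i _ => Finset.sum_congr rfl fun j _ => by simp only [D]; ring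
  have h3 : NegligibleInProb P (fun n ω =>
      (√(n : ℝ))⁻¹ * ((n : ℝ)⁻¹ * ∑ k ∈ Finset.range n, lam k ω * |w k ω| ^ 3)) := by
    have h4 : NegligibleInProb P fun n (_ : Ω) => (√(n : ℝ))⁻¹ := NegligibleInProb.of_tendsto
      (tendsto_inv_atTop_zero.comp (Real.tendsto_sqrt_atTop.comp tendsto_natCast_atTop_atTop))
    exact ((hlam.mul (hwm.abs.pow 3)).average.mul_negligible h4).mono fun n ω => by rw [mul_comm]
  -- The central limit theorem concerns the innovations `Y - lam`. The score subtracts the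
  -- observable intensity instead, a geometrically small difference.
  have h4 := h.counts.tendsto_integral_exp hw hq h2 h3
  refine tendsto_integral_exp_of_negligible_sub (fun n => ?_) (fun n => ?_) ?_ h4
  · exact (Finset.measurable_fun_sum _ fun i _ =>
      (h.measurable_normalizedScore x n i).const_mul _).aemeasurable
  · exact ((Finset.measurable_fun_sum _ fun k _ => ((hw k).mono (ℱ.le k) le_rfl).mul
      ((measurable_from_nat.comp (h.counts.measurable_count' k)).sub
        (h.counts.measurable_rate' k).coe_nnreal_real)).const_mul _).aemeasurable
  · refine (h.negligible_rate_sub (hE.subset hθ) x hwm).mono fun n ω => le_of_eq ?_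
    have key : (u : Fin 6 → ℝ) ⬝ᵥ normalizedScore r x (fun k => Y k ω) n θ₀ = (√(n : ℝ))⁻¹ *
        ∑ k ∈ Finset.range n, w k ω * (Y k ω - pathIntensity r x θ₀ (fun k => Y k ω) k) := by
      simp only [dotProduct, normalizedScore, pathScore, w, D, Finset.mul_sum, Finset.sum_mul]
      rw [Finset.sum_comm]
      exact Finset.sum_congr rfl fun k _ => Finset.sum_congr rfl fun i _ => by ring
    rw [key, ← mul_sub, ← Finset.sum_sub_distrib]
    congr 2
    exact Finset.sum_congr rfl fun k _ => by ring

end BoundedSample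

end SETPAR

/-! ### Consistency and asymptotic normality of the estimator on a bounded sample -/

namespace SETPAR

namespace BoundedSample

variable {Ω : Type*} [mΩ : MeasurableSpace Ω] {P : Measure Ω} {ℱ : Filtration ℕ mΩ}
  {Y : ℕ → Ω → ℕ} {lam : ℕ → Ω → ℝ≥0} {r : ℕ} {θ₀ : Param} {E : Set Param} {x a c m : ℝ}
  [IsProbabilityMeasure P] {μ : Measure State} [IsProbabilityMeasure μ] {θhat : ℕ → Ω → Param}

/-- Consistency of the maximum likelihood estimator. -/
lemma negligible_norm_sub (h : BoundedSample P ℱ Y lam r θ₀) (hE : UniformBounds E x a c m)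
    (hEc : IsCompact E) (hθ : θ₀ ∈ E) (hμ : (stateChain r θ₀ (hE.subset hθ)).IsErgodicMeasure μ)
    {g : ℝ} (hg : 0 < g) (hΓ : ∀ v : Param, g * ‖v‖ ^ 2
      ≤ ∑ i, ∑ j, v i * v j * ∑ u ∈ testCounts r, ∫ s, regressorWeight r u i j s ∂μ)
    (hmax : ∀ n, ∀ᵐ ω ∂P, θhat n ω ∈ E ∧
      IsMaxOn (pathLik r x (fun k => Y k ω) n) E (θhat n ω)) :
    NegligibleInProb P fun n ω => ‖θhat n ω - θ₀‖ := by
  have h1 := h.negligible_logRatioAverage hE hEc hθ fun n => (hmax n).mono fun ω h => h.1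
  have hK := (((h.hasUniformMoments_envelope hE hθ).mul
    ((h.hasUniformMoments_envelopeOne hE hθ).pow 2)).const_mul 4).average
  refine NegligibleInProb.of_sq (NegligibleInProb.of_event
    ((hK.mul_negligible h1.abs).const_mul ((8 / g) ^ 2)) (h.negligible_regressorError hE hθ hμ)
    (half_pos hg) ?_)
  filter_upwards [eventually_gt_atTop 0] with n hn
  filter_upwards [hmax n] with ω hω hsmall
  have h2 := hE.norm_sq_le_of_pathLik_le hω.1 hθ hn (hω.2 hθ) hg hΓ
    ((le_abs_self _).trans hsmall.le)
  rw [abs_of_nonneg (sq_nonneg _)]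
  refine h2.trans ((le_of_eq ?_).trans (le_abs_self _))
  rw [logRatioAverage]
  ring

/-- The estimation error is asymptotically linear in the score. -/
lemma negligible_norm_sub_score (h : BoundedSample P ℱ Y lam r θ₀) (hE : UniformBounds E x a c m)
    (hint : θ₀ ∈ interior E)
    (hμ : (stateChain r θ₀ (hE.subset (interior_subset hint))).IsErgodicMeasure μ)
    (hG : (Matrix.of (limitInfo μ θ₀ (lowerBound x θ₀))).PosDef)
    (hcons : NegligibleInProb P fun n ω => ‖θhat n ω - θ₀‖)
    (hmax : ∀ n, ∀ᵐ ω ∂P, θhat n ω ∈ E ∧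
      IsMaxOn (pathLik r x (fun k => Y k ω) n) E (θhat n ω)) :
    NegligibleInProb P fun n ω => ‖√(n : ℝ) • (θhat n ω - θ₀)
      - WithLp.toLp 2 ((Matrix.of (limitInfo μ θ₀ (lowerBound x θ₀)))⁻¹.mulVec
        (normalizedScore r x (fun k => Y k ω) n θ₀))‖ := by
  have hθ := interior_subset hint
  set G := Matrix.of (limitInfo μ θ₀ (lowerBound x θ₀)) with hGdef
  obtain ⟨g, hg, hGg⟩ := exists_le_quadratic hG
  obtain ⟨ρ, hρ, hball⟩ := Metric.isOpen_iff.1 isOpen_interior θ₀ hint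
  have hsym : G.IsSymm := by
    have := hG.isHermitian
    rwa [Matrix.IsHermitian, Matrix.conjTranspose_eq_transpose_of_trivial] at this
  have hdet : IsUnit G.det := (Matrix.isUnit_iff_isUnit_det _).1 hG.isUnit
  set w : ℕ → Ω → Param := fun n ω =>
    WithLp.toLp 2 (G⁻¹.mulVec (normalizedScore r x (fun k => Y k ω) n θ₀)) with hw
  have hGw : ∀ n ω, G.mulVec (w n ω) = normalizedScore r x (fun k => Y k ω) n θ₀ := fun n ω => by
    simp only [hw, Matrix.mulVec_mulVec, Matrix.mul_nonsing_inv _ hdet, Matrix.one_mulVec]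
  have hws : ∀ n ω, ‖w n ω‖ ≤ g⁻¹ * ‖normalizedScore r x (fun k => Y k ω) n θ₀‖ :=
    fun n ω => norm_le_of_mulVec_eq hg hGg (hGw n ω)
  have hS := h.boundedInProb_normalizedScore hE hθ
  have hε := (h.negligible_secondRemainder hE hθ hμ).abs
  have hK := (h.boundedInProb_thirdRemainder hE hθ).abs
  have hNw : NegligibleInProb P fun n ω => ‖(√(n : ℝ))⁻¹ • w n ω‖ := by
    have h4 : NegligibleInProb P fun n (_ : Ω) => (√(n : ℝ))⁻¹ := NegligibleInProb.of_tendsto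
      (tendsto_inv_atTop_zero.comp (Real.tendsto_sqrt_atTop.comp tendsto_natCast_atTop_atTop))
    refine ((hS.mul_negligible h4).const_mul g⁻¹).mono fun n ω => ?_
    rw [abs_norm, norm_smul, Real.norm_of_nonneg (by positivity)]
    refine le_trans ?_ (le_abs_self _)
    calc _ ≤ (√(n : ℝ))⁻¹ * (g⁻¹ * ‖normalizedScore r x (fun k => Y k ω) n θ₀‖) := by
          gcongr; exact hws n ω
      _ = _ := by ring
  have hε1 := hε.add (hK.mul_negligible hcons)
  have hε2 := hε.add (hK.mul_negligible hNw)
  have hS2 : BoundedInProb P fun n ω => ‖normalizedScore r x (fun k => Y k ω) n θ₀‖ ^ 2 := by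
    simpa only [sq] using hS.mul hS
  have hW := ((hS2.mul_negligible hε1).const_mul (2 / g * (4 / g) ^ 2)).add
    ((hS2.mul_negligible hε2).const_mul (2 / g * g⁻¹ ^ 2))
  refine NegligibleInProb.of_sq (NegligibleInProb.of_event hW (hε1.abs.add hNw.abs)
    (lt_min (show 0 < g / 4 by positivity) hρ) ?_)
  filter_upwards [eventually_gt_atTop 0] with n hn
  filter_upwards [hmax n] with ω hω hsmall
  have hn0 : (0 : ℝ) < n := by exact_mod_cast hn
  have hsq : √(n : ℝ) ^ 2 = n := Real.sq_sqrt hn0.le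
  have hN0 : 0 < √(n : ℝ) := Real.sqrt_pos.2 hn0
  have hs1 := (le_abs_self _).trans_lt hsmall
  rw [abs_norm] at hs1
  have ha := abs_nonneg (|secondRemainder r x (fun k => Y k ω) n θ₀ G|
    + |(n : ℝ)⁻¹ * ∑ k ∈ Finset.range n, thirdRemainder x a c m (fun k => Y k ω) k|
      * ‖θhat n ω - θ₀‖)
  have hb := le_abs_self (|secondRemainder r x (fun k => Y k ω) n θ₀ G|
    + |(n : ℝ)⁻¹ * ∑ k ∈ Finset.range n, thirdRemainder x a c m (fun k => Y k ω) k|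
      * ‖θhat n ω - θ₀‖)
  -- Here the interior hypothesis enters: the maximizer of the quadratic approximation must be a
  -- competitor of the estimator.
  have hwE : θ₀ + (√(n : ℝ))⁻¹ • w n ω ∈ E := by
    refine interior_subset (hball (Metric.mem_ball.2 ?_))
    rw [dist_eq_norm, add_sub_cancel_left]
    linarith [min_le_right (g / 4) ρ]
  have hQ : ∀ u : Param, θ₀ + u ∈ E →
      |(pathLik r x (fun k => Y k ω) n (θ₀ + u) - pathLik r x (fun k => Y k ω) n θ₀)
        - (√(n : ℝ) * ((u : Fin 6 → ℝ) ⬝ᵥ normalizedScore r x (fun k => Y k ω) n θ₀)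
        - √(n : ℝ) ^ 2 / 2 * ((u : Fin 6 → ℝ) ⬝ᵥ G.mulVec u))|
      ≤ √(n : ℝ) ^ 2 * (‖u‖ ^ 2 * |secondRemainder r x (fun k => Y k ω) n θ₀ G| + ‖u‖ ^ 3 *
        |(n : ℝ)⁻¹ * ∑ k ∈ Finset.range n, thirdRemainder x a c m (fun k => Y k ω) k|) := by
    intro u hu
    have h1 := hE.abs_pathLik_sub_le hu hθ r (fun k => Y k ω) n G
    simp only [add_sub_cancel_left] at h1
    have e : √(n : ℝ) * ((u : Fin 6 → ℝ) ⬝ᵥ normalizedScore r x (fun k => Y k ω) n θ₀)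
        = ∑ i, u i * pathScore r x (fun k => Y k ω) n θ₀ i := by
      simp only [dotProduct, normalizedScore, Finset.mul_sum]
      refine Finset.sum_congr rfl fun i _ => ?_
      field_simp
    rw [hsq, e, ← sum_sum_eq_dotProduct]
    refine h1.trans ?_
    gcongr <;> exact le_abs_self _
  have key := norm_sq_le_of_quadratic_expansion hsym hg hGg hN0 (hGw n ω) (v := θhat n ω - θ₀)
    (Q := fun u => pathLik r x (fun k => Y k ω) n (θ₀ + u) - pathLik r x (fun k => Y k ω) n θ₀)
    (ε := |secondRemainder r x (fun k => Y k ω) n θ₀ G|)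
    (K := |(n : ℝ)⁻¹ * ∑ k ∈ Finset.range n, thirdRemainder x a c m (fun k => Y k ω) k|)
    (by
      rintro u (rfl | rfl)
      · exact hQ _ (by simpa using hω.1)
      · exact hQ _ hwE)
    (by simpa using hω.2 hθ) (by simpa using hω.2 hwE) (abs_nonneg _) (abs_nonneg _)
    (by linarith [min_le_left (g / 4) ρ, norm_nonneg ((√(n : ℝ))⁻¹ • w n ω)])
  rw [abs_of_nonneg (sq_nonneg _)]
  refine key.trans ((le_of_eq ?_).trans (le_abs_self _))
  ring

/-- Asymptotic normality of the maximum likelihood estimator, in terms of characteristic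
functions. -/
lemma tendsto_integral_exp_estimator (h : BoundedSample P ℱ Y lam r θ₀)
    (hE : UniformBounds E x a c m) (hint : θ₀ ∈ interior E)
    (hμ : (stateChain r θ₀ (hE.subset (interior_subset hint))).IsErgodicMeasure μ)
    (hG : (Matrix.of (limitInfo μ θ₀ (lowerBound x θ₀))).PosDef)
    (hcons : NegligibleInProb P fun n ω => ‖θhat n ω - θ₀‖)
    (hmax : ∀ n, ∀ᵐ ω ∂P, θhat n ω ∈ E ∧
      IsMaxOn (pathLik r x (fun k => Y k ω) n) E (θhat n ω))
    (hmeas : ∀ n, AEMeasurable (θhat n) P) (u : Param) :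
    Tendsto (fun n : ℕ => ∫ ω, Complex.exp
      ((inner ℝ (√(n : ℝ) • (θhat n ω - θ₀)) u : ℝ) * Complex.I) ∂P) atTop
      (𝓝 (Complex.exp ((-((u : Fin 6 → ℝ) ⬝ᵥ
        (Matrix.of (limitInfo μ θ₀ (lowerBound x θ₀)))⁻¹.mulVec u) / 2 : ℝ) : ℂ))) := by
  have h0 := h.negligible_norm_sub_score hE hint hμ hG hcons hmax
  have hθ := interior_subset hint
  set G := Matrix.of (limitInfo μ θ₀ (lowerBound x θ₀)) with hGdef
  have hsym : G.IsSymm := by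
    have := hG.isHermitian
    rwa [Matrix.IsHermitian, Matrix.conjTranspose_eq_transpose_of_trivial] at this
  have hdet : IsUnit G.det := (Matrix.isUnit_iff_isUnit_det _).1 hG.isUnit
  -- Pairing `u` with `G⁻¹` of the score is pairing `z` with the score, and the form of `G` at `z`
  -- is that of `G⁻¹` at `u`.
  set z : Param := WithLp.toLp 2 (G⁻¹.mulVec u) with hz
  have h1 := h.tendsto_integral_exp_normalizedScore hE hθ hμ hG z
  have e1 : (z : Fin 6 → ℝ) ⬝ᵥ G.mulVec z = (u : Fin 6 → ℝ) ⬝ᵥ G⁻¹.mulVec u := by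
    simp only [hz, Matrix.mulVec_mulVec, Matrix.mul_nonsing_inv _ hdet, Matrix.one_mulVec]
    rw [dotProduct_comm]
  rw [← hGdef, e1] at h1
  refine tendsto_integral_exp_of_negligible_sub (fun n => ?_) (fun n => ?_) ?_ h1
  · have := ((hmeas n).sub_const θ₀).const_smul (√(n : ℝ))
    exact this.inner aemeasurable_const
  · exact (Finset.measurable_fun_sum _ fun i _ =>
      (h.measurable_normalizedScore x n i).const_mul _).aemeasurable
  · refine (h0.const_mul ‖u‖).mono fun n ω => ?_
    have e2 : (z : Fin 6 → ℝ) ⬝ᵥ normalizedScore r x (fun k => Y k ω) n θ₀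
        = (u : Fin 6 → ℝ) ⬝ᵥ G⁻¹.mulVec (normalizedScore r x (fun k => Y k ω) n θ₀) := by
      have hi : G⁻¹.IsSymm := by rw [Matrix.IsSymm, Matrix.transpose_nonsing_inv, hsym.eq]
      rw [Matrix.dotProduct_mulVec, ← Matrix.mulVec_transpose, hi.eq]
    have e3 : inner ℝ (√(n : ℝ) • (θhat n ω - θ₀)) u
        = (u : Fin 6 → ℝ) ⬝ᵥ (√(n : ℝ) • (θhat n ω - θ₀) : Param) := by
      simp [EuclideanSpace.inner_eq_star_dotProduct]
    rw [e2, e3, ← dotProduct_sub, abs_of_nonneg (a := ‖u‖ * _) (by positivity)]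
    exact abs_dotProduct_le_norm u (√(n : ℝ) • (θhat n ω - θ₀)
      - WithLp.toLp 2 (G⁻¹.mulVec (normalizedScore r x (fun k => Y k ω) n θ₀)))

/-- The law of large numbers at the true parameter, combined with consistency and a Lipschitz
constant bounded in probability. -/
lemma negligible_pathInfo_sub (h : BoundedSample P ℱ Y lam r θ₀) (hE : UniformBounds E x a c m)
    (hθ : θ₀ ∈ E) (hμ : (stateChain r θ₀ (hE.subset hθ)).IsErgodicMeasure μ)
    (hcons : NegligibleInProb P fun n ω => ‖θhat n ω - θ₀‖)
    (hmem : ∀ n, ∀ᵐ ω ∂P, θhat n ω ∈ E) (i j : Fin 6) :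
    NegligibleInProb P fun n ω => pathInfo r x (fun k => Y k ω) n (θhat n ω) i j
      - limitInfo μ θ₀ (lowerBound x θ₀) i j := by
  have h0 : NegligibleInProb P fun n ω => pathInfo r x (fun k => Y k ω) n θ₀ i j
      - limitInfo μ θ₀ (lowerBound x θ₀) i j :=
    (h.negligible_average_info (hE.subset hθ) hE.x_pos hμ i j).2
  have h1 := h.hasUniformMoments_envelopeOne hE hθ
  have h2 := h.hasUniformMoments_envelopeTwo hE hθ
  have hK := (((h2.mul h1).const_mul (4 * m⁻¹)).add ((h1.pow 3).const_mul (m⁻¹ ^ 2))).average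
  have h3 : NegligibleInProb P fun n ω => pathInfo r x (fun k => Y k ω) n (θhat n ω) i j
      - pathInfo r x (fun k => Y k ω) n θ₀ i j := by
    refine (hK.mul_negligible hcons).mono_ae (.of_forall fun n => ?_)
    filter_upwards [hmem n] with ω hω
    refine (hE.abs_pathInfo_sub_le hω hθ _ n i j).trans ((le_of_eq ?_).trans (le_abs_self _))
    rw [mul_comm]
  refine (h3.add h0).mono fun n ω => le_of_eq ?_
  ring_nf

end BoundedSample

end SETPAR

/-! ### From the two-sided model to bounded samples -/

namespace SETPAR

lemma pathIntensity_nonneg {x : ℝ} (hx : 0 ≤ x) {θ : Param} (hθ : θ ∈ paramSpace) (r : ℕ)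
    (y : ℕ → ℕ) (k : ℕ) : 0 ≤ pathIntensity r x θ y k := by
  induction k with
  | zero => exact hx
  | succ k ih => exact (nextIntensity_pos hθ r _ ih).le

variable {Ω : Type*} [mΩ : MeasurableSpace Ω] {P : Measure Ω}

lemma past_le {Y : ℤ → Ω → ℕ} (hY : ∀ t, Measurable (Y t)) (t : ℤ) : past Y t ≤ mΩ :=
  iSup₂_le fun s _ => (hY s).comap_le

omit mΩ in
lemma past_mono (Y : ℤ → Ω → ℕ) {s t : ℤ} (hst : s ≤ t) : past Y s ≤ past Y t :=
  iSup₂_le fun u hu => le_iSup₂_of_le u (hu.trans hst) le_rfl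

omit mΩ in
lemma measurable_past (Y : ℤ → Ω → ℕ) {s t : ℤ} (hst : s ≤ t) : Measurable[past Y t] (Y s) :=
  (comap_measurable (Y s)).mono (le_iSup₂_of_le s hst le_rfl) le_rfl

/-- The filtration generated by the counts, from time `0` on. -/
def pastFiltration (Y : ℤ → Ω → ℕ) (hY : ∀ t, Measurable (Y t)) : Filtration ℕ mΩ where
  seq k := past Y k
  mono' _ _ hkl := past_mono Y (by exact_mod_cast hkl)
  le' k := past_le hY k

namespace IsSETPAR

variable {r : ℕ} {θ : Param} {Y : ℤ → Ω → ℕ} {lam : ℤ → Ω → ℝ≥0}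

lemma ae_eq_pathIntensity (h : IsSETPAR P r θ Y lam) : ∀ᵐ ω ∂P, ∀ k : ℕ,
    (lam (k + 1) ω : ℝ) = pathIntensity r (lam 1 ω) θ (fun j => Y (j + 1) ω) k := by
  filter_upwards [ae_all_iff.2 h.recursion] with ω hω k
  induction k with
  | zero => simp [pathIntensity]
  | succ k ih =>
    have := hω (k + 1 + 1)
    rw [add_sub_cancel_right, ih] at this
    rw [pathIntensity, ← this]
    push_cast
    rfl

/-- The intensity is minus the logarithm of the conditional probability of a zero count, and so has
a version measurable in the past. -/
lemma exists_measurable_rate [IsProbabilityMeasure P] (h : IsSETPAR P r θ Y lam) (t : ℤ) :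
    ∃ g : Ω → ℝ≥0, Measurable[past Y (t - 1)] g ∧ g =ᵐ[P] lam t := by
  refine ⟨fun ω => (-Real.log ((P[(Y t ⁻¹' {0}).indicator (fun _ => (1 : ℝ)) |
    past Y (t - 1)]) ω)).toNNReal, ?_, ?_⟩
  · have h1 := (stronglyMeasurable_condExp (m := past Y (t - 1)) (μ := P)
      (f := (Y t ⁻¹' {0}).indicator (fun _ => (1 : ℝ)))).measurable
    exact measurable_real_toNNReal.comp ((Real.measurable_log.comp h1).neg)
  · filter_upwards [h.condLaw t 0] with ω hω
    rw [hω, measureReal_def, poissonMeasure_singleton]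
    simp [Real.exp_nonneg]

variable [IsProbabilityMeasure P]

lemma setLIntegral_poisson (h : IsSETPAR P r θ Y lam) (t : ℤ) (j : ℕ) {B : Set Ω}
    (hB : MeasurableSet[past Y (t - 1)] B) {l : Ω → ℝ≥0} (hl : Measurable l) (hle : l =ᵐ[P] lam t) :
    P (B ∩ Y t ⁻¹' {j}) = ∫⁻ ω in B, poissonMeasure (l ω) {j} ∂P := by
  have hle' := past_le h.measurable (t - 1)
  have hYj : MeasurableSet (Y t ⁻¹' {j}) := h.measurable t (measurableSet_singleton j)
  have hcont : Measurable fun q : ℝ≥0 => (poissonMeasure q).real {j} := by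
    simp_rw [measureReal_def, poissonMeasure_singleton]
    fun_prop
  have hint : Integrable (fun ω => (poissonMeasure (l ω)).real {j}) P :=
    Integrable.of_bound (hcont.comp hl).aestronglyMeasurable 1 (.of_forall fun ω => by
      rw [Real.norm_of_nonneg measureReal_nonneg]; exact measureReal_le_one)
  have h1 := setIntegral_condExp hle' (μ := P) (f := (Y t ⁻¹' {j}).indicator (fun _ => (1 : ℝ)))
    ((integrable_const 1).indicator hYj) hB
  have h2 : ∫ ω in B, (P[(Y t ⁻¹' {j}).indicator (fun _ => (1 : ℝ)) | past Y (t - 1)]) ω ∂P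
      = ∫ ω in B, (poissonMeasure (l ω)).real {j} ∂P := by
    refine setIntegral_congr_ae (hle' _ hB) ?_
    filter_upwards [h.condLaw t j, hle] with ω h3 h4 _
    rw [h3, h4]
  rw [h2] at h1
  change _ = ∫ x in B, (Y t ⁻¹' {j}).indicator 1 x ∂P at h1
  rw [integral_indicator_one hYj, measureReal_restrict_apply hYj, Set.inter_comm] at h1
  have h3 := ofReal_integral_eq_lintegral_ofReal (hint.mono_measure (Measure.restrict_le_self (s := B)))
    (.of_forall fun ω => measureReal_nonneg)
  rw [h1, ofReal_measureReal] at h3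
  rw [h3]
  exact lintegral_congr fun ω => ofReal_measureReal

/-- On the event that the initial intensity is bounded, the counts are a bounded sample. -/
lemma exists_boundedSample (h : IsSETPAR P r θ Y lam) (hθ : θ ∈ paramSpace) :
    ∃ g : Ω → ℝ≥0, Measurable g ∧ g =ᵐ[P] lam 1 ∧ ∀ K : ℝ≥0, P {ω | g ω ≤ K} ≠ 0 →
      BoundedSample (P[|{ω | g ω ≤ K}]) (pastFiltration Y h.measurable)
        (fun k ω => Y (k + 1) ω)
        (fun k ω => (pathIntensity r (min (g ω) K : ℝ≥0) θ (fun j => Y (j + 1) ω) k).toNNReal) r θ := by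
  obtain ⟨g, hg, hgl⟩ := h.exists_measurable_rate 1
  rw [show (1 : ℤ) - 1 = 0 by norm_num] at hg
  have hg' : Measurable g := hg.mono (past_le h.measurable 0) le_rfl
  -- The conditioning event belongs to the past at time `0`, so the conditional laws of `Y 1, Y 2,
  -- …` are unchanged. The minimum with `K` makes the bound hold everywhere, and it equals `g` on
  -- the event.
  refine ⟨g, hg', hgl, fun K hK => ?_⟩
  set A := {ω | g ω ≤ K} with hA
  have hA0 : MeasurableSet[past Y 0] A := hg measurableSet_Iic
  have hAm : MeasurableSet A := past_le h.measurable 0 _ hA0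
  have hmeas : ∀ f : Ω → ℝ≥0, Measurable[past Y 0] f → ∀ k : ℕ, Measurable[past Y k]
      fun ω => pathIntensity r (f ω) θ (fun j => Y (j + 1) ω) k := by
    intro f hf k
    induction k with
    | zero => exact measurable_coe_nnreal_real.comp hf
    | succ k ih =>
      have h1 : Measurable (fun p : ℕ × ℝ => nextIntensity r θ p.1 p.2) :=
        measurable_from_prod_countable_right fun y => measurable_nextIntensity r θ y
      exact h1.comp ((measurable_past Y (by push_cast; rfl)).prodMk
        (ih.mono (past_mono Y (by push_cast; linarith)) le_rfl))
  have hmin : Measurable[past Y 0] fun ω => min (g ω) K := hg.min measurable_const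
  refine ⟨⟨fun k => ?_, fun k => ?_, fun k j B hB => ?_⟩, fun k ω => ?_, ⟨K, fun ω => ?_⟩⟩
  · exact measurable_past Y (by push_cast; rfl)
  · exact measurable_real_toNNReal.comp (hmeas _ hmin k)
  · have hB' : MeasurableSet[past Y ((k + 1 : ℤ) - 1)] (A ∩ B) := by
      rw [add_sub_cancel_right]
      exact (past_mono Y (by positivity) _ hA0).inter hB
    have hL : Measurable fun ω => (pathIntensity r (g ω) θ (fun j => Y (j + 1) ω) k).toNNReal :=
      measurable_real_toNNReal.comp ((hmeas g hg k).mono (past_le h.measurable k) le_rfl)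
    have hLe : (fun ω => (pathIntensity r (g ω) θ (fun j => Y (j + 1) ω) k).toNNReal)
        =ᵐ[P] lam (k + 1) := by
      filter_upwards [h.ae_eq_pathIntensity, hgl] with ω h1 h2
      rw [h2, ← h1 k, Real.toNNReal_coe]
    have h1 := h.setLIntegral_poisson (k + 1) j hB' hL hLe
    have hBm : MeasurableSet B := past_le h.measurable k _ hB
    rw [cond_apply hAm, ← Set.inter_assoc, h1, ProbabilityTheory.cond, Measure.restrict_smul, lintegral_smul_measure,
      Measure.restrict_restrict hBm, Set.inter_comm B A, smul_eq_mul]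
    congr 1
    refine setLIntegral_congr_fun (hAm.inter hBm) fun ω hω => ?_
    have : min (g ω) K = g ω := min_eq_left hω.1
    simp only [this]
  · have h0 := pathIntensity_nonneg (NNReal.coe_nonneg (min (g ω) K)) hθ r (fun j => Y (j + 1) ω) k
    rw [Real.coe_toNNReal _ (pathIntensity_nonneg (NNReal.coe_nonneg _) hθ r _ _),
      Real.coe_toNNReal _ h0]
    simp [pathIntensity]
  · change ((min (g ω) K : ℝ≥0) : ℝ).toNNReal ≤ K
    rw [Real.toNNReal_coe]
    exact min_le_right _ _

end IsSETPAR

end SETPAR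

/-! ### The stationary solution along paths of subexponential growth -/

namespace SETPAR

/-- The last `n` counts before time `t`. -/
def window (y : ℤ → ℕ) (t : ℤ) (n : ℕ) : ℕ → ℕ := fun k => y (t - n + k)

/-- A window fixes where the reading starts, not where it ends. Hence one more count read from the
left is the window of the preceding time, and recursions in `n` go together with a shift in `t`. -/
lemma window_succ (y : ℤ → ℕ) (t : ℤ) (n : ℕ) : window y t (n + 1) = window y (t - 1) n := by
  funext k
  unfold window
  congr 1
  push_cast
  ring

lemma window_apply_self (y : ℤ → ℕ) (t : ℤ) (n : ℕ) : window y t n n = y t := by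
  simp [window]

/-- Uniformly subexponential growth in the past. -/
def Tempered (f : ℕ → ℤ → ℝ) : Prop :=
  ∀ p > (1 : ℝ), ∀ t : ℤ, ∃ C : ℝ, ∀ n j : ℕ, |f n (t - j)| ≤ C * p ^ j

namespace Tempered

variable {f g w : ℕ → ℤ → ℝ}

lemma const (a : ℝ) : Tempered fun _ _ => a := fun _ hp _ =>
  ⟨|a|, fun _ _ => le_mul_of_one_le_right (abs_nonneg a) (one_le_pow₀ hp.le)⟩

lemma add (hf : Tempered f) (hg : Tempered g) : Tempered fun n t => f n t + g n t := by
  intro p hp t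
  obtain ⟨C, hC⟩ := hf p hp t
  obtain ⟨C', hC'⟩ := hg p hp t
  exact ⟨C + C', fun n j => (abs_add_le _ _).trans (by linarith [hC n j, hC' n j])⟩

lemma const_mul (hf : Tempered f) (a : ℝ) : Tempered fun n t => a * f n t := by
  intro p hp t
  obtain ⟨C, hC⟩ := hf p hp t
  refine ⟨|a| * C, fun n j => ?_⟩
  rw [abs_mul, mul_assoc]
  gcongr
  exact hC n j

lemma exists_bound (hf : Tempered f) (t : ℤ) : ∃ C : ℝ, ∀ n, |f n t| ≤ C := by
  obtain ⟨C, hC⟩ := hf 2 one_lt_two t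
  exact ⟨C, fun n => by simpa using hC n 0⟩

/-- Going one step further back costs a factor `q` in growth but gains the factor `a`, so the bound
survives if `a q < 1`. -/
lemma of_recursion {a x : ℝ} (ha : 0 ≤ a) (ha1 : a < 1) (hw : Tempered w) (h0 : ∀ t, f 0 t = x)
    (h : ∀ n t, f (n + 1) t = a * f n (t - 1) + w n (t - 1)) : Tempered f := by
  intro p hp t
  -- A rate above `1`, at most `p`, with `a q < 1`.
  set q := min p (2 / (1 + a)) with hq
  have hq1 : 1 < q := lt_min hp (by rw [lt_div_iff₀ (by linarith)]; linarith)
  have haq : a * q < 1 := by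
    refine (mul_le_mul_of_nonneg_left (min_le_right p _) ha).trans_lt ?_
    rw [mul_div_assoc', div_lt_one (by linarith)]
    linarith
  have hq0 : 0 < q := one_pos.trans hq1
  obtain ⟨C, hC⟩ := hw q hq1 t
  have hC0 : 0 ≤ C := by simpa using (abs_nonneg _).trans (hC 0 0)
  set M := max |x| (C * q / (1 - a * q)) with hM
  have hM0 : 0 ≤ M := (abs_nonneg x).trans (le_max_left _ _)
  have hMC : C * q ≤ M * (1 - a * q) := by
    rw [← div_le_iff₀ (by linarith)]; exact le_max_right _ _
  have key : ∀ n j : ℕ, |f n (t - j)| ≤ M * q ^ j := by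
    intro n
    induction n with
    | zero =>
      intro j
      rw [h0]
      exact (le_max_left _ _).trans (le_mul_of_one_le_right hM0 (one_le_pow₀ hq1.le))
    | succ n ih =>
      intro j
      have e : t - (j : ℤ) - 1 = t - ((j + 1 : ℕ) : ℤ) := by push_cast; ring
      rw [h, e]
      have h1 := ih (j + 1)
      have h2 := hC n (j + 1)
      calc _ ≤ a * |f n (t - ((j + 1 : ℕ) : ℤ))| + |w n (t - ((j + 1 : ℕ) : ℤ))| := by
            refine (abs_add_le _ _).trans ?_
            rw [abs_mul, abs_of_nonneg ha]
        _ ≤ a * (M * q ^ (j + 1)) + C * q ^ (j + 1) := by gcongr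
        _ = (M * (a * q) + C * q) * q ^ j := by ring
        _ ≤ M * q ^ j := by
            gcongr
            linarith
  refine ⟨M, fun n j => (key n j).trans ?_⟩
  gcongr
  exact min_le_left _ _

end Tempered

/-- Subexponential growth in the past of a path of counts. -/
def TemperedPath (y : ℤ → ℕ) : Prop := Tempered fun _ t => (y t : ℝ)

lemma isOpen_paramSpace : IsOpen paramSpace := by
  have h : ∀ i : Fin 6, Continuous fun θ : Param => θ i := continuous_apply_param
  unfold paramSpace
  simp only [Set.ofPred_and, Set.ofPred_forall]
  exact (isOpen_iInter_of_finite fun i => isOpen_lt continuous_const (h i)).inter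
    ((isOpen_lt (h 1) continuous_const).inter ((isOpen_lt (h 2) continuous_const).inter
      (isOpen_lt ((h 4).add (h 5)) continuous_const)))

lemma exists_uniformBounds_nhds {θ : Param} (hθ : θ ∈ paramSpace) {x : ℝ} (hx : 0 < x) :
    ∃ E a c m, UniformBounds E x a c m ∧ E ∈ 𝓝 θ := by
  obtain ⟨ε, hε, hb⟩ := Metric.nhds_basis_closedBall.mem_iff.1 (isOpen_paramSpace.mem_nhds hθ)
  obtain ⟨a, c, m, h⟩ := exists_uniformBounds (isCompact_closedBall θ ε)
    ⟨θ, Metric.mem_closedBall_self hε.le⟩ hb hx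
  exact ⟨_, a, c, m, h, Metric.closedBall_mem_nhds θ hε⟩

/-- The linear form with given partial derivatives. -/
noncomputable def gradientForm (d : Fin 6 → ℝ) : Param →L[ℝ] ℝ :=
  ∑ i, d i • EuclideanSpace.proj (𝕜 := ℝ) i

lemma gradientForm_apply (d : Fin 6 → ℝ) (v : Param) : gradientForm d v = ∑ i, v i * d i := by
  simp [gradientForm, mul_comm]

lemma partials_eq_of_hasFDerivAt {f : Param → ℝ} {d : Fin 6 → ℝ} {θ : Param}
    (h : HasFDerivAt f (gradientForm d) θ) : partials f θ = d := by
  ext i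
  rw [partials, h.fderiv, gradientForm_apply]
  simp

lemma hasFDerivAt_of_quadratic_bound {f : Param → ℝ} {d : Fin 6 → ℝ} {θ₀ : Param} {E : Set Param}
    (hE : E ∈ 𝓝 θ₀) {C : ℝ}
    (h : ∀ θ ∈ E, |f θ - f θ₀ - ∑ i, (θ - θ₀) i * d i| ≤ ‖θ - θ₀‖ ^ 2 * C) :
    HasFDerivAt f (gradientForm d) θ₀ := by
  have h1 : (fun θ => f θ - f θ₀ - gradientForm d (θ - θ₀)) =O[𝓝 θ₀] fun θ => ‖θ - θ₀‖ ^ 2 := by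
    refine Asymptotics.IsBigO.of_bound C ?_
    filter_upwards [hE] with θ hθ
    rw [gradientForm_apply, Real.norm_eq_abs, Real.norm_of_nonneg (by positivity), mul_comm C]
    exact h θ hθ
  have h2 := (h1.hasFDerivAt one_lt_two).add
    (((gradientForm d).hasFDerivAt (x := θ₀)).add_const (f θ₀ - gradientForm d θ₀))
  rw [zero_add] at h2
  refine h2.congr_of_eventuallyEq (.of_forall fun θ => ?_)
  simp only [Pi.add_apply, map_sub]
  ring

lemma hasFDerivAt_pathIntensity {θ : Param} (hθ : θ ∈ paramSpace) {x : ℝ} (hx : 0 < x) (r : ℕ)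
    (y : ℕ → ℕ) (k : ℕ) :
    HasFDerivAt (fun ϑ => pathIntensity r x ϑ y k) (gradientForm (pathDeriv r x θ y k)) θ := by
  obtain ⟨E, a, c, m, h, hE⟩ := exists_uniformBounds_nhds hθ hx
  exact hasFDerivAt_of_quadratic_bound hE fun ϑ hϑ =>
    h.abs_pathIntensity_sub_linear_le hϑ (mem_of_mem_nhds hE) r y k

/-- Unrolling the recursion over the last `n` counts yields a partial sum of the series plus the
initial value damped by the product of coefficients. -/
lemma pathIntensity_window (r : ℕ) (x : ℝ) (θ : Param) (y : ℤ → ℕ) (t : ℤ) (n : ℕ) :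
    pathIntensity r x θ (window y t n) n = ∑ k ∈ Finset.range n, statTerm r θ y t k
      + (∏ j ∈ Finset.range n, aCoef r θ (y (t - 1 - j))) * x := by
  induction n generalizing t with
  | zero => simp [pathIntensity]
  | succ n ih =>
    have e : ∀ j : ℕ, t - 1 - ((j + 1 : ℕ) : ℤ) = t - 1 - 1 - j := fun j => by push_cast; ring
    have h1 : ∀ k, statTerm r θ y t (k + 1) = aCoef r θ (y (t - 1)) * statTerm r θ y (t - 1) k := by
      intro k
      simp only [statTerm, Finset.prod_range_succ', e]
      simp only [Nat.cast_zero, sub_zero]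
      ring
    have h0 : statTerm r θ y t 0 = dCoef r θ (y (t - 1)) + bCoef r θ (y (t - 1)) * y (t - 1) := by
      simp [statTerm]
    rw [pathIntensity, window_succ, ih, window_apply_self, Finset.sum_range_succ',
      Finset.prod_range_succ', h0]
    simp only [h1, e, ← Finset.mul_sum, Nat.cast_zero, sub_zero, nextIntensity]
    ring

lemma statTerm_nonneg {θ : Param} (hθ : θ ∈ paramSpace) (r : ℕ) (y : ℤ → ℕ) (t : ℤ) (k : ℕ) :
    0 ≤ statTerm r θ y t k := by
  unfold statTerm
  have h1 := (dCoef_pos hθ r (y (t - 1 - k))).le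
  have h2 := (bCoef_pos hθ r (y (t - 1 - k))).le
  have h3 := Finset.prod_nonneg fun j (_ : j ∈ Finset.range k) =>
    (aCoef_pos hθ r (y (t - 1 - j))).le
  positivity

lemma prod_aCoef_le {θ : Param} (hθ : θ ∈ paramSpace) (r : ℕ) (y : ℤ → ℕ) (t : ℤ) (n : ℕ) :
    ∏ j ∈ Finset.range n, aCoef r θ (y (t - 1 - j)) ≤ maxCoef θ ^ n := by
  refine (Finset.prod_le_prod (fun j _ => (aCoef_pos hθ r _).le)
    fun j _ => aCoef_le_maxCoef r θ _).trans ?_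
  simp

lemma prod_aCoef_nonneg {θ : Param} (hθ : θ ∈ paramSpace) (r : ℕ) (y : ℤ → ℕ) (t : ℤ) (n : ℕ) :
    0 ≤ ∏ j ∈ Finset.range n, aCoef r θ (y (t - 1 - j)) :=
  Finset.prod_nonneg fun _ _ => (aCoef_pos hθ r _).le

lemma tendsto_prod_aCoef {θ : Param} (hθ : θ ∈ paramSpace) (r : ℕ) (y : ℤ → ℕ) (t : ℤ) :
    Tendsto (fun n => ∏ j ∈ Finset.range n, aCoef r θ (y (t - 1 - j))) atTop (𝓝 0) :=
  squeeze_zero (prod_aCoef_nonneg hθ r y t) (prod_aCoef_le hθ r y t)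
    (tendsto_pow_atTop_nhds_zero_of_lt_one (maxCoef_pos hθ).le (maxCoef_lt_one hθ))

lemma tendsto_pathIntensity_window {θ : Param} (hθ : θ ∈ paramSpace) {r : ℕ} {y : ℤ → ℕ} {t : ℤ}
    (h : Summable (statTerm r θ y t)) (x : ℝ) :
    Tendsto (fun n => pathIntensity r x θ (window y t n) n) atTop (𝓝 (statIntensity r θ y t)) := by
  simp_rw [pathIntensity_window]
  have := h.hasSum.tendsto_sum_nat.add ((tendsto_prod_aCoef hθ r y t).mul_const x)
  rwa [zero_mul, add_zero] at this

namespace TemperedPath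

variable {y : ℤ → ℕ} {r : ℕ} {θ : Param} {E : Set Param} {x a c m : ℝ}

lemma envelope (hy : TemperedPath y) (h : UniformBounds E x a c m) :
    Tempered fun n t => envelope x a c (window y t n) n := by
  refine Tempered.of_recursion h.a_nonneg h.a_lt_one
    (((Tempered.const 1).add hy).const_mul c) (x := x) (fun t => rfl) fun n t => ?_
  rw [← window_succ, ← window_apply_self y (t - 1) n, ← window_succ]
  rfl

lemma envelopeOne (hy : TemperedPath y) (h : UniformBounds E x a c m) :
    Tempered fun n t => envelopeOne x a c (window y t n) n := by
  refine Tempered.of_recursion h.a_nonneg h.a_lt_one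
    ((((Tempered.const 1).add (hy.envelope h)).add hy).const_mul 6) (x := 0) (fun t => rfl)
    fun n t => ?_
  rw [← window_apply_self y (t - 1) n, ← window_succ]
  rfl

lemma envelopeTwo (hy : TemperedPath y) (h : UniformBounds E x a c m) :
    Tempered fun n t => envelopeTwo x a c (window y t n) n := by
  refine Tempered.of_recursion h.a_nonneg h.a_lt_one (hy.envelopeOne h) (x := 0) (fun t => rfl)
    fun n t => ?_
  rw [← window_succ]
  rfl

lemma summable_statTerm (hy : TemperedPath y) (hθ : θ ∈ paramSpace) (r : ℕ) (t : ℤ) :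
    Summable (statTerm r θ y t) := by
  obtain ⟨E, a, c, m, h, hE⟩ := exists_uniformBounds_nhds hθ one_pos
  obtain ⟨C, hC⟩ := (hy.envelope h).exists_bound t
  refine summable_of_sum_range_le (c := C) (statTerm_nonneg hθ r y t) fun n => ?_
  have h1 := (abs_le.1 ((h.abs_pathIntensity_le (mem_of_mem_nhds hE) r (window y t n) n))).2
  rw [pathIntensity_window] at h1
  have h2 := prod_aCoef_nonneg hθ r y t n
  linarith [le_abs_self (SETPAR.envelope 1 a c (window y t n) n), hC n]

end TemperedPath

/-- The state after the last `n` counts before time `t`, from the initial intensity `1`. -/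
noncomputable def windowState (r : ℕ) (θ : Param) (y : ℤ → ℕ) (t : ℤ) (n : ℕ) : State :=
  (pathIntensity r 1 θ (window y t n) n, pathIntensity r 1 θ (window y t n) n,
    fun i => scale θ * pathDeriv r 1 θ (window y t n) n i)

/-- The stationary intensity and its scaled derivative. -/
noncomputable def statState (r : ℕ) (θ : Param) (y : ℤ → ℕ) (t : ℤ) : State :=
  (statIntensity r θ y t, statIntensity r θ y t,
    fun i => scale θ * partials (fun ϑ => statIntensity r ϑ y t) θ i)

lemma windowState_succ (r : ℕ) (θ : Param) (y : ℤ → ℕ) (t : ℤ) (n : ℕ) :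
    windowState r θ y t (n + 1) = stateStep r θ (y (t - 1)) (windowState r θ y (t - 1) n) := by
  simp only [windowState, stateStep, window_succ, pathIntensity, pathDeriv, window_apply_self]
  refine Prod.ext rfl (Prod.ext rfl ?_)
  ext i
  simp only
  ring

namespace TemperedPath

variable {y : ℤ → ℕ} {r : ℕ} {θ : Param}

/-- Consecutive windows differ only in their oldest count, whose influence is damped by `ρ ^ n`.
Temperedness lets that count grow by at most `p ^ n` with `ρ p < 1`, so the states form a Cauchy
sequence. -/
lemma exists_tendsto_windowState (hy : TemperedPath y) (hθ : θ ∈ paramSpace) (r : ℕ) (t : ℤ) :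
    ∃ X, Tendsto (windowState r θ y t) atTop (𝓝 X) := by
  set ρ : ℝ := (contractionRate θ : ℝ) with hρ
  have hρ0 : 0 ≤ ρ := NNReal.coe_nonneg _
  have hρ1 : ρ < 1 := by exact_mod_cast contractionRate_lt_one hθ
  set p := 2 / (1 + ρ) with hp
  have hp1 : 1 < p := by rw [lt_div_iff₀ (by linarith)]; linarith
  have hρp : ρ * p < 1 := by rw [mul_div_assoc', div_lt_one (by linarith)]; linarith
  obtain ⟨C, hC⟩ := hy p hp1 (t - 1)
  have hC0 : 0 ≤ C := by simpa using (abs_nonneg _).trans (hC 0 0)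
  set X₀ : State := (1, 1, 0) with hX₀
  have hX0 : ∀ s, windowState r θ y s 0 = X₀ := fun s => by
    simp only [windowState, pathIntensity, pathDeriv, Pi.zero_apply, mul_zero]; rfl
  set A := 1 + ∑ i, θ i with hA
  have hA0 : 0 ≤ A := add_nonneg zero_le_one (Finset.sum_nonneg fun i _ => (hθ.1 i).le)
  have h1 : ∀ (n : ℕ) (s : ℤ), dist (windowState r θ y s n) (windowState r θ y s (n + 1))
      ≤ ρ ^ n * (2 * ‖X₀‖ + A * (1 + y (s - 1 - n))) := by
    intro n
    induction n with
    | zero =>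
      intro s
      rw [windowState_succ, hX0, hX0, dist_eq_norm, pow_zero, one_mul, Nat.cast_zero, sub_zero]
      refine (norm_sub_le _ _).trans ?_
      have := norm_stateStep_le hθ r (y (s - 1)) X₀
      nlinarith [norm_nonneg X₀]
    | succ n ih =>
      intro s
      rw [windowState_succ r θ y s n, windowState_succ r θ y s (n + 1)]
      refine ((lipschitzWith_stateStep hθ r (y (s - 1))).dist_le_mul _ _).trans ?_
      refine (mul_le_mul_of_nonneg_left (ih (s - 1)) hρ0).trans (le_of_eq ?_)
      rw [pow_succ', mul_assoc]
      push_cast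
      rw [show s - 1 - ((n : ℤ) + 1) = s - 1 - 1 - n by ring]
  refine cauchySeq_tendsto_of_complete
    (cauchySeq_of_le_geometric (ρ * p) (2 * ‖X₀‖ + A * (1 + C)) hρp fun n => (h1 n t).trans ?_)
  have h2 : (y (t - 1 - n) : ℝ) ≤ C * p ^ n := (le_abs_self _).trans (hC 0 n)
  have h3 : 1 ≤ p ^ n := one_le_pow₀ hp1.le
  calc _ ≤ ρ ^ n * (2 * ‖X₀‖ * p ^ n + A * (1 * p ^ n + C * p ^ n)) := by
        have := le_mul_of_one_le_right (a := 2 * ‖X₀‖) (by positivity) h3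
        gcongr
        linarith
    _ = _ := by rw [mul_pow]; ring

/-- The second-order bound for finite windows has a constant that is uniform in the window length,
so it passes to the limit together with the derivatives. -/
lemma exists_hasFDerivAt_statIntensity (hy : TemperedPath y) (hθ : θ ∈ paramSpace) (r : ℕ) (t : ℤ) :
    ∃ d : Fin 6 → ℝ, HasFDerivAt (fun ϑ => statIntensity r ϑ y t) (gradientForm d) θ ∧
      ∀ i, Tendsto (fun n => pathDeriv r 1 θ (window y t n) n i) atTop (𝓝 (d i)) := by
  obtain ⟨X, hX⟩ := hy.exists_tendsto_windowState hθ r t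
  have hd : ∀ i, Tendsto (fun n => pathDeriv r 1 θ (window y t n) n i) atTop
      (𝓝 ((scale θ)⁻¹ * X.2.2 i)) := by
    intro i
    have h1 := ((((continuous_apply i).comp (continuous_snd.comp continuous_snd)).tendsto X).comp
      hX).const_mul (scale θ)⁻¹
    refine h1.congr fun n => ?_
    simp only [Function.comp_def, windowState]
    rw [inv_mul_cancel_left₀ (scale_pos hθ).ne']
  refine ⟨_, ?_, hd⟩
  obtain ⟨E, a, c, m, h, hE⟩ := exists_uniformBounds_nhds hθ one_pos
  obtain ⟨C, hC⟩ := (hy.envelopeTwo h).exists_bound t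
  refine hasFDerivAt_of_quadratic_bound hE (C := C) fun ϑ hϑ => ?_
  have h1 := ((tendsto_pathIntensity_window (h.subset hϑ)
    (hy.summable_statTerm (h.subset hϑ) r t) 1).sub (tendsto_pathIntensity_window hθ
    (hy.summable_statTerm hθ r t) 1)).sub
      (tendsto_finsetSum Finset.univ fun i _ => (hd i).const_mul ((ϑ - θ) i))
  refine le_of_tendsto h1.abs (.of_forall fun n => ?_)
  refine (h.abs_pathIntensity_sub_linear_le hϑ (mem_of_mem_nhds hE) r (window y t n) n).trans ?_
  gcongr
  exact (le_abs_self _).trans (hC n)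

lemma differentiableAt_statIntensity (hy : TemperedPath y) (hθ : θ ∈ paramSpace) (r : ℕ) (t : ℤ) :
    DifferentiableAt ℝ (fun ϑ => statIntensity r ϑ y t) θ := by
  obtain ⟨d, hd, -⟩ := hy.exists_hasFDerivAt_statIntensity hθ r t
  exact hd.differentiableAt

lemma tendsto_windowState (hy : TemperedPath y) (hθ : θ ∈ paramSpace) (r : ℕ) (t : ℤ) :
    Tendsto (windowState r θ y t) atTop (𝓝 (statState r θ y t)) := by
  obtain ⟨d, hd, hlim⟩ := hy.exists_hasFDerivAt_statIntensity hθ r t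
  have h1 := tendsto_pathIntensity_window hθ (hy.summable_statTerm hθ r t) 1
  refine h1.prodMk_nhds (h1.prodMk_nhds (tendsto_pi_nhds.2 fun i => ?_))
  rw [partials_eq_of_hasFDerivAt hd]
  exact (hlim i).const_mul _

lemma statState_succ (hy : TemperedPath y) (hθ : θ ∈ paramSpace) (r : ℕ) (t : ℤ) :
    statState r θ y (t + 1) = stateStep r θ (y t) (statState r θ y t) := by
  have h1 := (tendsto_add_atTop_iff_nat 1).2 (hy.tendsto_windowState hθ r (t + 1))
  simp only [windowState_succ, add_sub_cancel_right] at h1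
  exact tendsto_nhds_unique h1 (((lipschitzWith_stateStep hθ r (y t)).continuous.tendsto _).comp
    (hy.tendsto_windowState hθ r t))

end TemperedPath

lemma statTerm_shift (r : ℕ) (θ : Param) (y : ℤ → ℕ) (t : ℤ) :
    statTerm r θ (fun s => y (s + 1)) t = statTerm r θ y (t + 1) := by
  have e : ∀ j : ℕ, t - 1 - j + 1 = t + 1 - 1 - j := fun j => by ring
  funext k
  simp only [statTerm, e]

lemma statState_shift (r : ℕ) (θ : Param) (y : ℤ → ℕ) (t : ℤ) :
    statState r θ (fun s => y (s + 1)) t = statState r θ y (t + 1) := by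
  simp only [statState, statIntensity, statTerm_shift]

end SETPAR

/-! ### Stationary laws: identification of the intensity -/

lemma lintegral_natCast_poissonMeasure (q : ℝ≥0) :
    ∫⁻ j : ℕ, (j : ENNReal) ∂poissonMeasure q = q := by
  rw [lintegral_countable']
  have h := hasSum_poisson_mean q
  rw [← ENNReal.ofReal_coe_nnreal, ← h.tsum_eq,
    ENNReal.ofReal_tsum_of_nonneg (fun k => by positivity) h.summable]
  refine tsum_congr fun k => ?_
  rw [poissonMeasure_singleton, mul_comm, ← ENNReal.ofReal_natCast k,
    ← ENNReal.ofReal_mul (by positivity)]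

namespace SETPAR

variable {Ω : Type*} [mΩ : MeasurableSpace Ω] {P : Measure Ω}

namespace IsSETPAR

variable {r : ℕ} {θ : Param} {Y : ℤ → Ω → ℕ} {lam : ℤ → Ω → ℝ≥0}

lemma exists_lintegral_count [IsProbabilityMeasure P] (h : IsSETPAR P r θ Y lam) (t : ℤ) :
    ∃ l : Ω → ℝ≥0, Measurable l ∧ l =ᵐ[P] lam t ∧ ∀ F : ℕ → ENNReal,
      ∫⁻ ω, F (Y t ω) ∂P = ∫⁻ ω, ∫⁻ j, F j ∂poissonMeasure (l ω) ∂P := by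
  obtain ⟨l, hl, hle⟩ := h.exists_measurable_rate t
  have hl' : Measurable l := hl.mono (past_le h.measurable _) le_rfl
  refine ⟨l, hl', hle, fun F => ?_⟩
  have hm : ∀ j : ℕ, Measurable fun ω => poissonMeasure (l ω) {j} := fun j => by
    simp_rw [poissonMeasure_singleton]
    fun_prop
  have h1 : ∀ j : ℕ, P (Y t ⁻¹' {j}) = ∫⁻ ω, poissonMeasure (l ω) {j} ∂P := fun j => by
    simpa using h.setLIntegral_poisson t j MeasurableSet.univ hl' hle
  have hF : Measurable F := measurable_from_nat
  rw [← lintegral_map hF (h.measurable t), lintegral_countable']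
  simp_rw [lintegral_countable']
  rw [lintegral_tsum fun j => ((hm j).const_mul _).aemeasurable]
  refine tsum_congr fun j => ?_
  rw [lintegral_const_mul _ (hm j), Measure.map_apply (h.measurable t) (measurableSet_singleton j),
    h1]

lemma ae_eq_pathIntensity_window (h : IsSETPAR P r θ Y lam) : ∀ᵐ ω ∂P, ∀ (t : ℤ) (n : ℕ),
    (lam t ω : ℝ) = pathIntensity r (lam (t - n) ω) θ (window (fun s => Y s ω) t n) n := by
  filter_upwards [ae_all_iff.2 h.recursion] with ω hω t n
  induction n generalizing t with
  | zero => simp [pathIntensity]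
  | succ n ih =>
    rw [hω t, pathIntensity, window_succ, window_apply_self, ih (t - 1),
      show t - 1 - (n : ℤ) = t - (n + 1 : ℕ) by push_cast; ring]

end IsSETPAR

lemma measurable_aCoef (r : ℕ) (θ : Param) (t : ℤ) :
    Measurable fun y : ℤ → ℕ => aCoef r θ (y t) :=
  (measurable_from_nat (f := fun y : ℕ => aCoef r θ y)).comp (measurable_pi_apply t)

lemma measurable_statTerm (r : ℕ) (θ : Param) (t : ℤ) (k : ℕ) :
    Measurable fun y => statTerm r θ y t k := by
  refine (Finset.measurable_fun_prod _ fun j _ => measurable_aCoef r θ _).mul ?_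
  exact (measurable_from_nat (f := fun y : ℕ => dCoef r θ y + bCoef r θ y * y)).comp
    (measurable_pi_apply (t - 1 - (k : ℤ)))

lemma measurable_statIntensity (r : ℕ) (θ : Param) (t : ℤ) :
    Measurable fun y => statIntensity r θ y t :=
  Measurable.tsum fun k => measurable_statTerm r θ t k

lemma statIntensity_nonneg {θ : Param} (hθ : θ ∈ paramSpace) (r : ℕ) (y : ℤ → ℕ) (t : ℤ) :
    0 ≤ statIntensity r θ y t := tsum_nonneg (statTerm_nonneg hθ r y t)

lemma measurable_windowState (r : ℕ) (θ : Param) (t : ℤ) (n : ℕ) :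
    Measurable fun y => windowState r θ y t n := by
  induction n generalizing t with
  | zero =>
    have : (fun y => windowState r θ y t 0) = fun _ => ((1, 1, 0) : State) := by
      funext y
      simp only [windowState, pathIntensity, pathDeriv, Pi.zero_apply, mul_zero]
      rfl
    rw [this]
    exact measurable_const
  | succ n ih =>
    simp_rw [windowState_succ]
    have h1 : Measurable fun p : ℕ × State => stateStep r θ p.1 p.2 := by
      refine measurable_from_prod_countable_right fun y => ?_
      refine ((measurable_nextIntensity r θ y).comp measurable_fst).prodMk
        (((measurable_nextIntensity r θ y).comp (measurable_fst.comp measurable_snd)).prodMk ?_)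
      refine measurable_pi_lambda _ fun i => ?_
      have h2 : Measurable fun s : State => aCoef r θ y * s.2.2 i :=
        ((measurable_pi_apply i).comp (measurable_snd.comp measurable_snd)).const_mul _
      have h3 : Measurable fun s : State => scale θ * regressor r y s.2.1 i :=
        ((measurable_regressor r y i).comp (measurable_fst.comp measurable_snd)).const_mul _
      exact h2.add h3
    exact h1.comp ((measurable_pi_apply (t - 1)).prodMk (ih (t - 1)))

namespace IsStationaryLaw

variable {r : ℕ} {θ : Param} {π : Measure (ℤ → ℕ)}

lemma measurable_shift : Measurable fun (y : ℤ → ℕ) (t : ℤ) => y (t + 1) :=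
  measurable_pi_lambda _ fun t => measurable_pi_apply (t + 1)

lemma integral_eq (h : IsStationaryLaw r θ π) {Φ : ℤ → (ℤ → ℕ) → ℝ}
    (hΦ : ∀ t, AEStronglyMeasurable (Φ t) π)
    (hs : ∀ t y, Φ t (fun s => y (s + 1)) = Φ (t + 1) y) (s t : ℤ) :
    ∫ y, Φ s y ∂π = ∫ y, Φ t y ∂π := by
  have h1 : ∀ u, ∫ y, Φ (u + 1) y ∂π = ∫ y, Φ u y ∂π := fun u => by
    simp_rw [← hs u]
    rw [← integral_map (φ := fun (y : ℤ → ℕ) (t : ℤ) => y (t + 1)) measurable_shift.aemeasurable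
      (by rw [h.shiftInvariant.map_eq]; exact hΦ u), h.shiftInvariant.map_eq]
  have h2 : ∀ u, ∫ y, Φ u y ∂π = ∫ y, Φ 0 y ∂π := fun u => by
    induction u using Int.induction_on with
    | zero => rfl
    | succ i ih => rw [h1, ih]
    | pred i ih => rw [← ih, ← h1, sub_add_cancel]
  rw [h2 s, h2 t]

lemma lintegral_count_eq (h : IsStationaryLaw r θ π) (F : ℕ → ENNReal) (s t : ℤ) :
    ∫⁻ y, F (y s) ∂π = ∫⁻ y, F (y t) ∂π := by
  have h1 : ∀ u : ℤ, ∫⁻ y, F (y (u + 1)) ∂π = ∫⁻ y, F (y u) ∂π := fun u =>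
    h.shiftInvariant.lintegral_comp (f := fun y => F (y u))
      (measurable_from_nat.comp (measurable_pi_apply u))
  have h2 : ∀ u : ℤ, ∫⁻ y, F (y u) ∂π = ∫⁻ y, F (y 0) ∂π := fun u => by
    induction u using Int.induction_on with
    | zero => rfl
    | succ i ih => rw [h1, ih]
    | pred i ih => rw [← ih, ← h1, sub_add_cancel]
  rw [h2 s, h2 t]

/-- Under the stationary law, the intensity is the stationary solution of the recursion. -/
lemma ae_rate_eq (h : IsStationaryLaw r θ π) (hθ : θ ∈ paramSpace) {lam : ℤ → (ℤ → ℕ) → ℝ≥0}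
    (hlam : IsSETPAR π r θ (fun t y => y t) lam) (t : ℤ) :
    ∀ᵐ y ∂π, Summable (statTerm r θ y t) ∧ (lam t y : ℝ) = statIntensity r θ y t := by
  have := h.isProbabilityMeasure
  have ha0 := maxCoef_pos hθ
  -- Any solution of the recursion exceeds the series by a nonnegative remainder, at most `a ^ n`
  -- times the intensity `n` steps earlier.
  have hsum : ∀ᵐ y ∂π, Summable (statTerm r θ y t) ∧ ∀ n : ℕ,
      0 ≤ (lam t y : ℝ) - statIntensity r θ y t ∧
      (lam t y : ℝ) - statIntensity r θ y t ≤ maxCoef θ ^ n * lam (t - n) y := by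
    filter_upwards [hlam.ae_eq_pathIntensity_window] with y hy
    have h1 := fun n => (hy t n).trans (pathIntensity_window r (lam (t - n) y) θ y t n)
    have h2 : ∀ n, ∑ k ∈ Finset.range n, statTerm r θ y t k ≤ lam t y := fun n => by
      have := mul_nonneg (prod_aCoef_nonneg hθ r y t n) (NNReal.coe_nonneg (lam (t - n) y))
      linarith [h1 n]
    have hs := summable_of_sum_range_le (statTerm_nonneg hθ r y t) h2
    refine ⟨hs, fun n => ⟨sub_nonneg.2 (hs.tsum_le_of_sum_range_le h2), ?_⟩⟩
    have h3 : ∑ k ∈ Finset.range n, statTerm r θ y t k ≤ statIntensity r θ y t :=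
      hs.sum_le_tsum _ fun k _ => statTerm_nonneg hθ r y t k
    have h4 : (∏ j ∈ Finset.range n, aCoef r θ (y (t - 1 - j))) * (lam (t - n) y : ℝ)
        ≤ maxCoef θ ^ n * lam (t - n) y := by
      gcongr
      exact prod_aCoef_le hθ r y t n
    linarith [h1 n]
  obtain ⟨l, hl, hle, -⟩ := hlam.exists_lintegral_count t
  set R : (ℤ → ℕ) → ℝ := fun y => (l y : ℝ) - statIntensity r θ y t with hR
  have hRm : Measurable R := hl.coe_nnreal_real.sub (measurable_statIntensity r θ t)
  -- Where the remainder is positive, the intensity at time `t - n` grows at least like `a ^ (-n)`.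
  -- But the Laplace transform of the count is the same at all times, and conditionally on the
  -- intensity it is `exp (-κ lam)`, so the limit in `n` bounds it by the probability that the
  -- remainder vanishes.
  have hlap : ∀ u : ℝ, 0 < u → ∫⁻ y, ENNReal.ofReal (Real.exp (-u * y t)) ∂π
      ≤ π {y | R y ≤ 0} := by
    intro u hu
    set κ := 1 - Real.exp (-u) with hκ
    have hκ0 : 0 < κ := by
      have := Real.exp_lt_exp.2 (neg_lt_zero.2 hu)
      rw [Real.exp_zero] at this
      linarith
    have hn : ∀ n : ℕ, ∫⁻ y, ENNReal.ofReal (Real.exp (-u * y t)) ∂π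
        ≤ ∫⁻ y, ENNReal.ofReal (Real.exp (-(κ * max (R y) 0 * (maxCoef θ)⁻¹ ^ n))) ∂π := by
      intro n
      obtain ⟨l', -, hle', hlin⟩ := hlam.exists_lintegral_count (t - n)
      rw [h.lintegral_count_eq (fun j => ENNReal.ofReal (Real.exp (-u * j))) t (t - n),
        hlin fun j => ENNReal.ofReal (Real.exp (-u * j))]
      simp_rw [lintegral_exp_poissonMeasure]
      refine lintegral_mono_ae ?_
      filter_upwards [hle', hle, hsum] with y h1 h2 h3
      refine ENNReal.ofReal_le_ofReal (Real.exp_le_exp.2 ?_)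
      have h4 := h3.2 n
      rw [← h2] at h4
      rw [max_eq_left h4.1, h1]
      have h5 : R y * (maxCoef θ)⁻¹ ^ n ≤ lam (t - n) y := by
        rw [inv_pow, ← div_eq_mul_inv, div_le_iff₀ (by positivity), mul_comm]
        exact h4.2
      have h6 : κ * (R y * (maxCoef θ)⁻¹ ^ n) ≤ κ * lam (t - n) y := by gcongr
      rw [hκ] at h6 ⊢
      nlinarith
    have hlim : Tendsto (fun n : ℕ => ∫⁻ y, ENNReal.ofReal
        (Real.exp (-(κ * max (R y) 0 * (maxCoef θ)⁻¹ ^ n))) ∂π) atTop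
        (𝓝 (∫⁻ y, {y | R y ≤ 0}.indicator 1 y ∂π)) := by
      refine tendsto_lintegral_of_dominated_convergence (fun _ => 1) (fun n => by fun_prop)
        (fun n => .of_forall fun y => ?_) (by simp) (.of_forall fun y => ?_)
      · rw [← ENNReal.ofReal_one]
        refine ENNReal.ofReal_le_ofReal (Real.exp_le_one_iff.2 ?_)
        rw [neg_nonpos]
        have : 0 ≤ max (R y) 0 := le_max_right _ _
        positivity
      · rcases le_or_gt (R y) 0 with hy | hy
        · rw [max_eq_right hy, Set.indicator_of_mem (by exact hy)]
          simp
        · rw [max_eq_left hy.le, Set.indicator_of_notMem (by simpa using hy)]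
          have h1 : Tendsto (fun n : ℕ => (maxCoef θ)⁻¹ ^ n) atTop atTop :=
            tendsto_pow_atTop_atTop_of_one_lt ((one_lt_inv₀ ha0).2 (maxCoef_lt_one hθ))
          have h2 := Real.tendsto_exp_neg_atTop_nhds_zero.comp
            (h1.const_mul_atTop (show 0 < κ * R y by positivity))
          simpa [Function.comp_def] using (ENNReal.continuous_ofReal.tendsto 0).comp h2
    refine (ge_of_tendsto' hlim hn).trans (le_of_eq ?_)
    exact lintegral_indicator_one (hRm measurableSet_Iic)
  -- Letting `u` tend to `0`, the Laplace transform of the finite count tends to `1`.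
  have hone : (1 : ENNReal) ≤ π {y | R y ≤ 0} := by
    have hlim : Tendsto (fun n : ℕ => ∫⁻ y, ENNReal.ofReal
        (Real.exp (-((n : ℝ) + 1)⁻¹ * y t)) ∂π) atTop (𝓝 (∫⁻ _, 1 ∂π)) := by
      refine tendsto_lintegral_of_dominated_convergence (fun _ => 1) (fun n => ?_)
        (fun n => .of_forall fun y => ?_) (by simp) (.of_forall fun y => ?_)
      · exact (measurable_from_nat (f := fun j : ℕ =>
          ENNReal.ofReal (Real.exp (-((n : ℝ) + 1)⁻¹ * j)))).comp (measurable_pi_apply t)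
      · rw [← ENNReal.ofReal_one]
        refine ENNReal.ofReal_le_ofReal (Real.exp_le_one_iff.2 ?_)
        rw [neg_mul, neg_nonpos]
        positivity
      · have h1 : Tendsto (fun n : ℕ => Real.exp (-((n : ℝ) + 1)⁻¹ * y t)) atTop
            (𝓝 (Real.exp (-0 * y t))) :=
          (Real.continuous_exp.tendsto _).comp
            (((tendsto_inv_atTop_zero.comp (tendsto_atTop_add_const_right _ 1
              tendsto_natCast_atTop_atTop)).neg).mul_const _)
        simpa [Function.comp_def] using (ENNReal.continuous_ofReal.tendsto _).comp h1
    rw [lintegral_one, measure_univ] at hlim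
    exact le_of_tendsto' hlim fun n => hlap _ (by positivity)
  have hae : ∀ᵐ y ∂π, R y ≤ 0 := by
    rw [ae_iff]
    have := prob_compl_eq_zero_iff (μ := π) (s := {y | R y ≤ 0}) (hRm measurableSet_Iic)
    exact this.2 (le_antisymm prob_le_one hone)
  filter_upwards [hae, hsum, hle] with y h1 h2 h3
  refine ⟨h2.1, le_antisymm ?_ (sub_nonneg.1 (h2.2 0).1)⟩
  rw [← h3]
  exact sub_nonpos.1 h1

end IsStationaryLaw

end SETPAR

/-! ### Stationary expectations as ergodic limits -/

namespace SETPAR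

lemma tendsto_measure_le {α : Type*} [MeasurableSpace α] {ν : Measure α} [IsProbabilityMeasure ν]
    (g : α → ℝ≥0) : Tendsto (fun K : ℕ => ν {b | g b ≤ K}) atTop (𝓝 1) := by
  have h1 : Monotone fun K : ℕ => {b | g b ≤ K} := fun K L hKL b hb =>
    le_trans (show g b ≤ K from hb) (by exact_mod_cast hKL)
  have h2 := tendsto_measure_iUnion_atTop (μ := ν) h1
  have h3 : ⋃ K : ℕ, {b | g b ≤ K} = Set.univ := by
    ext b
    simpa using exists_nat_ge (g b)
  rwa [h3, measure_univ] at h2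

lemma tendsto_measureReal_le {α : Type*} [MeasurableSpace α] {ν : Measure α}
    [IsProbabilityMeasure ν] (g : α → ℝ≥0) :
    Tendsto (fun K : ℕ => ν.real {b | g b ≤ K}) atTop (𝓝 1) := by
  have := (ENNReal.tendsto_toReal ENNReal.one_ne_top).comp (tendsto_measure_le (ν := ν) g)
  simpa [Function.comp_def, measureReal_def] using this

/-- The stationary intensity, and the observable intensity and its scaled derivative. -/
noncomputable def sampleState (r : ℕ) (θ : Param) (y : ℤ → ℕ) (n : ℕ) : State :=
  (statIntensity r θ y (n + 1), pathIntensity r 1 θ (fun j => y (j + 1)) n,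
    fun i => scale θ * pathDeriv r 1 θ (fun j => y (j + 1)) n i)

namespace IsStationaryLaw

variable {r : ℕ} {θ : Param} {π : Measure (ℤ → ℕ)}

/-- The stationary law, conditioned on a bounded intensity at time `1`, itself yields a bounded
sample, whose intensity is almost surely the stationary series. The results for the chain thus apply
to it. -/
lemma exists_sample (h : IsStationaryLaw r θ π) (hθ : θ ∈ paramSpace) :
    ∃ g : (ℤ → ℕ) → ℝ≥0, Measurable g ∧ ∀ K : ℝ≥0, π {y | g y ≤ K} ≠ 0 →
      ∃ lam : ℕ → (ℤ → ℕ) → ℝ≥0, BoundedSample (π[|{y | g y ≤ K}])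
        (pastFiltration (fun t (y : ℤ → ℕ) => y t) measurable_pi_apply)
        (fun k y => y (k + 1)) lam r θ ∧
        ∀ᵐ y ∂π[|{y | g y ≤ K}], ∀ k, (lam k y : ℝ) = statIntensity r θ y (k + 1) := by
  have := h.isProbabilityMeasure
  obtain ⟨lam, hlam⟩ := h.model
  obtain ⟨g, hg, hgl, hS⟩ := hlam.exists_boundedSample hθ
  refine ⟨g, hg, fun K hK => ⟨_, hS K hK, ?_⟩⟩
  have h1 : ∀ᵐ y ∂π, ∀ k : ℕ, pathIntensity r (g y) θ (fun j => y (j + 1)) k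
      = statIntensity r θ y (k + 1) := by
    filter_upwards [hgl, hlam.ae_eq_pathIntensity,
      ae_all_iff.2 fun t => h.ae_rate_eq hθ hlam t] with y h2 h3 h4 k
    rw [h2, ← h3 k, (h4 _).2]
  filter_upwards [cond_absolutelyContinuous.ae_le h1, ae_cond_mem (hg measurableSet_Iic)]
    with y h2 h3 k
  rw [Real.coe_toNNReal _ (pathIntensity_nonneg (NNReal.coe_nonneg _) hθ r _ _),
    min_eq_left (show g y ≤ K from h3), h2]

/-- Stationary expectations are ergodic limits. -/
lemma ergodicTo (h : IsStationaryLaw r θ π) (hθ : θ ∈ paramSpace) {f : State → ℝ} {B L : ℝ≥0}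
    (hf : ∀ s, |f s| ≤ B) (hL : LipschitzWith L f) {F : ℕ → (ℤ → ℕ) → ℝ}
    (hFm : ∀ n, AEStronglyMeasurable (F n) π) (hFB : ∀ n y, |F n y| ≤ B) {e : ℝ}
    (he : ∀ n, ∫ y, F n y ∂π = e)
    (hF : ∀ᵐ y ∂π, Tendsto (fun n => F n y - f (sampleState r θ y n)) atTop (𝓝 0)) :
    (stateChain r θ hθ).ErgodicTo f e := by
  have := h.isProbabilityMeasure
  obtain ⟨m, hm⟩ := (stateChain r θ hθ).exists_ergodicTo hf hL
  obtain ⟨g, hg, hS⟩ := h.exists_sample hθ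
  -- Conditionally on the bounded initial intensity the expectations tend to `m`, while
  -- unconditionally they equal `e` at all times. The complement of the event contributes at most
  -- `B` times its probability, which vanishes as `K` grows.
  have hK : ∀ K : ℕ, π {y | g y ≤ K} ≠ 0 →
      |e - π.real {y | g y ≤ K} * m| ≤ B * (1 - π.real {y | g y ≤ K}) := by
    intro K hK0
    set A := {y | g y ≤ K} with hA
    have hAm : MeasurableSet A := hg measurableSet_Iic
    have hprob : IsProbabilityMeasure (π[|A]) := cond_isProbabilityMeasure hK0
    obtain ⟨lam, hs, hl⟩ := hS K hK0
    obtain ⟨D, hD⟩ := hs.exists_lintegral_V_le hθ 1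
    have hX := hs.isRealizedBy hθ 1
    have h1 := hX.tendsto_integral hD hf hL hm
    have hstate : ∀ᵐ y ∂π[|A], ∀ n, jointState (fun k (y : ℤ → ℕ) => y (k + 1)) lam r 1 θ n y
        = sampleState r θ y n := by
      filter_upwards [hl] with y hy n
      simp only [jointState, sampleState, hy]
    have hFm' : ∀ n, AEStronglyMeasurable (F n) (π[|A]) := fun n =>
      (hFm n).mono_ac cond_absolutelyContinuous
    have hfm : ∀ n, AEStronglyMeasurable (fun y => f (jointState (fun k (y : ℤ → ℕ) => y (k + 1))
        lam r 1 θ n y)) (π[|A]) := fun n =>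
      (hL.continuous.measurable.comp (hX.measurable' n)).aestronglyMeasurable
    have h2 : Tendsto (fun n => ∫ y, (F n y - f (jointState (fun k (y : ℤ → ℕ) => y (k + 1))
        lam r 1 θ n y)) ∂π[|A]) atTop (𝓝 (∫ _, 0 ∂π[|A])) := by
      refine tendsto_integral_of_dominated_convergence (fun _ => (B : ℝ) + B)
        (fun n => (hFm' n).sub (hfm n)) (integrable_const _)
        (fun n => .of_forall fun y => (abs_sub _ _).trans (add_le_add (hFB n y) (hf _))) ?_
      filter_upwards [cond_absolutelyContinuous.ae_le hF, hstate] with y h3 h4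
      simpa only [h4] using h3
    have h3 : Tendsto (fun n => ∫ y, F n y ∂π[|A]) atTop (𝓝 m) := by
      have h4 := h2.add h1
      rw [integral_zero, zero_add] at h4
      refine h4.congr fun n => ?_
      rw [← integral_add]
      · simp
      · exact Integrable.of_bound ((hFm' n).sub (hfm n)) (B + B) (.of_forall fun y =>
          (abs_sub _ _).trans (add_le_add (hFB n y) (hf _)))
      · exact Integrable.of_bound (hfm n) B (.of_forall fun y => hf _)
    have hA0 : π.real A ≠ 0 := by
      rw [measureReal_def]; exact (ENNReal.toReal_pos hK0 (measure_ne_top _ _)).ne'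
    have h4 : ∀ n, π.real A * ∫ y, F n y ∂π[|A] = ∫ y in A, F n y ∂π := fun n => by
      rw [ProbabilityTheory.cond, integral_smul_measure, ENNReal.toReal_inv, smul_eq_mul,
        ← measureReal_def, mul_inv_cancel_left₀ hA0]
    have h5 := (h3.const_mul (π.real A)).const_sub e
    refine le_of_tendsto h5.abs (.of_forall fun n => ?_)
    have hi : Integrable (F n) π := Integrable.of_bound (hFm n) B (.of_forall fun y => hFB n y)
    rw [h4, ← he n, ← integral_add_compl hAm hi, add_sub_cancel_left, ← probReal_compl_eq_one_sub hAm]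
    exact norm_setIntegral_le_of_norm_le_const (f := F n) (C := B) (measure_lt_top _ _)
      fun y _ => hFB n y
  have hreal := tendsto_measureReal_le (ν := π) g
  have hfin : |e - 1 * m| ≤ B * (1 - 1) := by
    refine le_of_tendsto_of_tendsto ((hreal.mul_const m).const_sub e).abs
      ((hreal.const_sub 1).const_mul _) ?_
    filter_upwards [hreal.eventually_ne one_ne_zero] with K hK1
    exact hK K fun h0 => hK1 (by rw [measureReal_def, h0]; rfl)
  rw [sub_self, mul_zero, one_mul] at hfin
  have : e = m := sub_eq_zero.1 (abs_eq_zero.1 (le_antisymm hfin (abs_nonneg _)))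
  rwa [this]

lemma statIntensity_shift (y : ℤ → ℕ) (t : ℤ) :
    statIntensity r θ (fun s => y (s + 1)) t = statIntensity r θ y (t + 1) := by
  simp only [statIntensity, statTerm_shift]

/-- No moment is part of the definition of a stationary law. Truncated at `M`, the stationary mean
is an ergodic limit and so inherits the bound along a conditioned sample, uniformly in `M`. -/
lemma exists_lintegral_statIntensity_le (h : IsStationaryLaw r θ π) (hθ : θ ∈ paramSpace) :
    ∃ C : ℝ≥0, ∀ t, ∫⁻ y, ENNReal.ofReal (statIntensity r θ y t) ∂π ≤ C := by
  have := h.isProbabilityMeasure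
  obtain ⟨g, hg, hS⟩ := h.exists_sample hθ
  obtain ⟨K, hK⟩ := ((tendsto_measure_le (ν := π) g).eventually_ne one_ne_zero).exists
  have hprob : IsProbabilityMeasure (π[|{y | g y ≤ K}]) := cond_isProbabilityMeasure hK
  obtain ⟨lam, hs, -⟩ := hS K hK
  obtain ⟨C, hC⟩ := (hs.hasUniformMoments_rate hθ).exists_lintegral_le
  obtain ⟨D, hD⟩ := hs.exists_lintegral_V_le hθ 1
  have hX := hs.isRealizedBy hθ 1
  have hmeas := measurable_statIntensity r θ
  refine ⟨C, fun t => ?_⟩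
  have key : ∀ M : ℕ, ∫⁻ y, ENNReal.ofReal (min (statIntensity r θ y t) M) ∂π ≤ C := by
    intro M
    set f : State → ℝ := fun s => min (max s.1 0) M with hf
    have hf0 : ∀ s, 0 ≤ f s := fun s => le_min (le_max_right _ _) (Nat.cast_nonneg M)
    have hfB : ∀ s, |f s| ≤ (M : ℝ≥0) := fun s => by
      rw [abs_of_nonneg (hf0 s)]; exact min_le_right _ _
    have hL : LipschitzWith 1 f := by
      have h1 : LipschitzWith 1 fun u : ℝ => min (max u 0) (M : ℝ) :=
        (LipschitzWith.id.max_const 0).min_const M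
      have h2 := h1.comp (LipschitzWith.prod_fst (α := ℝ) (β := ℝ × (Fin 6 → ℝ)))
      rwa [mul_one] at h2
    have hinv := h.integral_eq (Φ := fun t y => min (statIntensity r θ y t) (M : ℝ))
      (fun t => ((hmeas t).min measurable_const).aestronglyMeasurable)
      (fun t y => by rw [statIntensity_shift])
    have hmin0 : ∀ (s : ℤ) (y : ℤ → ℕ), 0 ≤ min (statIntensity r θ y s) (M : ℝ) := fun s y =>
      le_min (statIntensity_nonneg hθ r y s) (Nat.cast_nonneg M)
    have h1 := h.ergodicTo hθ hfB hL (F := fun n y => min (statIntensity r θ y (n + 1)) (M : ℝ))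
      (fun n => ((hmeas _).min measurable_const).aestronglyMeasurable)
      (fun n y => by rw [abs_of_nonneg (hmin0 _ _)]; exact min_le_right _ _)
      (fun n => hinv (n + 1) t)
      (.of_forall fun y => by
        refine tendsto_const_nhds.congr fun n => ?_
        simp only [hf, sampleState, max_eq_left (statIntensity_nonneg hθ r y _), sub_self])
    have h2 := hX.tendsto_integral hD hfB hL h1
    have h3 : ∫ y, min (statIntensity r θ y t) (M : ℝ) ∂π ≤ C := by
      refine le_of_tendsto h2 (.of_forall fun n => ?_)
      rw [integral_eq_lintegral_of_nonneg_ae (.of_forall fun y => hf0 _)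
        (hL.continuous.measurable.comp (hX.measurable' n)).aestronglyMeasurable]
      refine ENNReal.toReal_le_of_le_ofReal C.2 ?_
      rw [ENNReal.ofReal_coe_nnreal]
      refine (lintegral_mono fun y => ?_).trans (hC n)
      rw [Real.enorm_eq_ofReal_abs]
      refine ENNReal.ofReal_le_ofReal ((min_le_left _ _).trans ?_)
      simp [jointState]
    rw [← ofReal_integral_eq_lintegral_ofReal _ (.of_forall fun y => hmin0 t y)]
    · rw [← ENNReal.ofReal_coe_nnreal]
      exact ENNReal.ofReal_le_ofReal h3
    · exact Integrable.of_bound ((hmeas t).min measurable_const).aestronglyMeasurable M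
        (.of_forall fun y => by
          rw [Real.norm_of_nonneg (hmin0 _ _)]; exact min_le_right _ _)
  refine le_of_tendsto' (lintegral_tendsto_of_tendsto_of_monotone
    (fun M : ℕ => (((hmeas t).min measurable_const).ennreal_ofReal).aemeasurable)
    (.of_forall fun y M N hMN => ?_) (.of_forall fun y => ?_)) key
  · refine ENNReal.ofReal_le_ofReal ?_
    gcongr
  · refine tendsto_const_nhds.congr' ?_
    obtain ⟨M, hM⟩ := exists_nat_ge (statIntensity r θ y t)
    filter_upwards [eventually_ge_atTop M] with N hN
    rw [min_eq_left (hM.trans (by exact_mod_cast hN))]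

/-- The counts have bounded means, so their geometrically discounted sums into the past are
integrable and almost surely finite. -/
lemma ae_temperedPath (h : IsStationaryLaw r θ π) (hθ : θ ∈ paramSpace) :
    ∀ᵐ y ∂π, TemperedPath y := by
  have := h.isProbabilityMeasure
  obtain ⟨lam, hlam⟩ := h.model
  obtain ⟨C, hC⟩ := h.exists_lintegral_statIntensity_le hθ
  have hY : ∀ t : ℤ, ∫⁻ y, (y t : ENNReal) ∂π ≤ C := fun t => by
    obtain ⟨l, -, hle, hlin⟩ := hlam.exists_lintegral_count t
    rw [hlin fun j => (j : ENNReal)]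
    simp_rw [lintegral_natCast_poissonMeasure]
    refine le_trans (lintegral_mono_ae ?_) (hC t)
    filter_upwards [hle, h.ae_rate_eq hθ hlam t] with y h1 h2
    rw [h1, ← h2.2, ENNReal.ofReal_coe_nnreal]
  -- A sequence of rates decreasing to `1`, so that countably many null sets cover all `p > 1`.
  let q : ℕ → ℝ≥0 := fun m => 1 + ((m : ℝ≥0) + 1)⁻¹
  have hq1 : ∀ m, 1 < q m := fun m => lt_add_of_pos_right _ (by positivity)
  have hsum : ∀ᵐ y ∂π, ∀ (m : ℕ) (t : ℤ),
      ∑' j : ℕ, (((q m)⁻¹ ^ j : ℝ≥0) : ENNReal) * (y (t - j) : ENNReal) < ⊤ := by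
    refine ae_all_iff.2 fun m => ae_all_iff.2 fun t => ?_
    have hm : ∀ j : ℕ, Measurable fun y : ℤ → ℕ =>
        (((q m)⁻¹ ^ j : ℝ≥0) : ENNReal) * (y (t - j) : ENNReal) := fun j =>
      ((measurable_from_nat (f := fun i : ℕ => (i : ENNReal))).comp
        (measurable_pi_apply (t - (j : ℤ)))).const_mul _
    refine ae_lt_top (Measurable.tsum hm) ?_
    · rw [lintegral_tsum fun j => (hm j).aemeasurable]
      have h1 : ∀ j : ℕ, ∫⁻ y, (((q m)⁻¹ ^ j : ℝ≥0) : ENNReal) * (y (t - j) : ENNReal) ∂π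
          ≤ (((q m)⁻¹ ^ j * C : ℝ≥0) : ENNReal) := fun j => by
        rw [lintegral_const_mul' _ _ ENNReal.coe_ne_top, ENNReal.coe_mul]
        gcongr
        exact hY _
      refine ((ENNReal.tsum_le_tsum h1).trans_lt ?_).ne
      have h2 : Summable fun j : ℕ => (q m)⁻¹ ^ j * C :=
        (NNReal.summable_geometric (inv_lt_one_of_one_lt₀ (hq1 m))).mul_right C
      rw [← ENNReal.coe_tsum h2]
      exact ENNReal.coe_lt_top
  filter_upwards [hsum] with y hy p hp t
  obtain ⟨m, hm⟩ := exists_nat_one_div_lt (sub_pos.2 hp)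
  have hqp : (q m : ℝ) ≤ p := by
    simp only [q]
    push_cast
    rw [one_div] at hm
    linarith
  obtain ⟨X, hX, hle⟩ : ∃ X < (⊤ : ENNReal), ∀ j : ℕ,
      (((q m)⁻¹ ^ j : ℝ≥0) : ENNReal) * (y (t - j) : ENNReal) ≤ X :=
    ⟨_, hy m t, ENNReal.le_tsum⟩
  refine ⟨X.toReal, fun _ j => ?_⟩
  have h2 := ENNReal.toReal_mono hX.ne (hle j)
  rw [ENNReal.toReal_mul, ENNReal.coe_toReal, ENNReal.toReal_natCast] at h2
  push_cast at h2
  have hq0 : (0 : ℝ) < q m := by exact_mod_cast one_pos.trans (hq1 m)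
  rw [inv_pow, inv_mul_le_iff₀ (by positivity), mul_comm] at h2
  rw [Nat.abs_cast]
  refine h2.trans ?_
  gcongr

end IsStationaryLaw

end SETPAR

/-! ### The ergodic law and the independence of the regressors -/

namespace SETPAR

lemma posDef_of_quadratic {G : Matrix (Fin 6) (Fin 6) ℝ} (hs : ∀ i j, G i j = G j i)
    (h : ∀ v : Fin 6 → ℝ, ∑ i, ∑ j, v i * v j * G i j ≤ 0 → v = 0) : G.PosDef := by
  refine Matrix.PosDef.of_dotProduct_mulVec_pos (Matrix.IsHermitian.ext fun i j => ?_)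
    fun v hv => ?_
  · simpa using hs j i
  · by_contra hneg
    refine hv (h v (le_trans (le_of_eq ?_) (not_lt.1 hneg)))
    simp only [star_trivial, dotProduct, Matrix.mulVec, Finset.mul_sum]
    exact Finset.sum_congr rfl fun i _ => Finset.sum_congr rfl fun j _ => by ring

/-- A vector at which the quadratic form of second moments vanishes is almost surely orthogonal. -/
lemma ae_eq_zero_of_quadratic_nonpos {α ι : Type*} [MeasurableSpace α] {ν : Measure α}
    {s : Finset ι} {w : ι → α → ℝ} {Z : ι → α → Fin 6 → ℝ} (hw : ∀ u ∈ s, ∀ b, 0 ≤ w u b)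
    (hint : ∀ u ∈ s, ∀ i j, Integrable (fun b => w u b * (Z u b i * Z u b j)) ν) {v : Fin 6 → ℝ}
    (hv : ∑ i, ∑ j, v i * v j * ∑ u ∈ s, ∫ b, w u b * (Z u b i * Z u b j) ∂ν ≤ 0) :
    ∀ u ∈ s, ∀ᵐ b ∂ν, w u b * (∑ i, v i * Z u b i) ^ 2 = 0 := by
  have hsq : ∀ u b, w u b * (∑ i, v i * Z u b i) ^ 2
      = ∑ i, ∑ j, v i * v j * (w u b * (Z u b i * Z u b j)) := fun u b => by
    rw [sq, Finset.sum_mul_sum, Finset.mul_sum]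
    refine Finset.sum_congr rfl fun i _ => ?_
    rw [Finset.mul_sum]
    exact Finset.sum_congr rfl fun j _ => by ring
  have hi : ∀ u ∈ s, Integrable (fun b => w u b * (∑ i, v i * Z u b i) ^ 2) ν := fun u hu => by
    simp_rw [hsq]
    exact integrable_finsetSum _ fun i _ => integrable_finsetSum _ fun j _ =>
      (hint u hu i j).const_mul _
  have h0 : ∀ u ∈ s, 0 ≤ ∫ b, w u b * (∑ i, v i * Z u b i) ^ 2 ∂ν := fun u hu =>
    integral_nonneg fun b => mul_nonneg (hw u hu b) (sq_nonneg _)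
  have hsum : ∑ u ∈ s, ∫ b, w u b * (∑ i, v i * Z u b i) ^ 2 ∂ν ≤ 0 := by
    refine le_trans (le_of_eq ?_) hv
    have h1 : ∀ u ∈ s, ∫ b, w u b * (∑ i, v i * Z u b i) ^ 2 ∂ν
        = ∑ i, ∑ j, v i * v j * ∫ b, w u b * (Z u b i * Z u b j) ∂ν := fun u hu => by
      simp_rw [hsq]
      rw [integral_finsetSum _ fun i _ => integrable_finsetSum _ fun j _ =>
        (hint u hu i j).const_mul _]
      refine Finset.sum_congr rfl fun i _ => ?_
      rw [integral_finsetSum _ fun j _ => (hint u hu i j).const_mul _]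
      simp_rw [integral_const_mul]
    rw [Finset.sum_congr rfl h1, Finset.sum_comm]
    refine Finset.sum_congr rfl fun i _ => ?_
    rw [Finset.sum_comm]
    simp_rw [Finset.mul_sum]
  intro u hu
  have h2 : ∫ b, w u b * (∑ i, v i * Z u b i) ^ 2 ∂ν = 0 :=
    (Finset.sum_eq_zero_iff_of_nonneg h0).1 (le_antisymm hsum (Finset.sum_nonneg h0)) u hu
  exact (integral_eq_zero_iff_of_nonneg (fun b => mul_nonneg (hw u hu b) (sq_nonneg _))
    (hi u hu)).1 h2

namespace TemperedPath

variable {y : ℤ → ℕ} {r : ℕ} {θ : Param}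

lemma statIntensity_succ (hy : TemperedPath y) (hθ : θ ∈ paramSpace) (r : ℕ) (t : ℤ) :
    statIntensity r θ y (t + 1) = nextIntensity r θ (y t) (statIntensity r θ y t) :=
  congrArg Prod.fst (hy.statState_succ hθ r t)

lemma sampleState_succ (hy : TemperedPath y) (hθ : θ ∈ paramSpace) (r n : ℕ) :
    sampleState r θ y (n + 1) = stateStep r θ (y (n + 1)) (sampleState r θ y n) := by
  refine Prod.ext ?_ (Prod.ext rfl ?_)
  · have := hy.statIntensity_succ hθ r (n + 1)
    simp only [sampleState, stateStep]
    push_cast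
    exact this
  · ext i
    simp only [sampleState, stateStep, pathDeriv]
    ring

lemma lowerBound_le_statIntensity (hy : TemperedPath y) (hθ : θ ∈ paramSpace) (x : ℝ) (r : ℕ)
    (t : ℤ) : lowerBound x θ ≤ statIntensity r θ y t := by
  have := hy.statIntensity_succ hθ r (t - 1)
  rw [sub_add_cancel] at this
  rw [this]
  exact lowerBound_le_nextIntensity hθ x r _ (statIntensity_nonneg hθ r y _)

lemma statIntensity_pos (hy : TemperedPath y) (hθ : θ ∈ paramSpace) (r : ℕ) (t : ℤ) :
    0 < statIntensity r θ y t :=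
  (lowerBound_pos one_pos hθ).trans_le (hy.lowerBound_le_statIntensity hθ 1 r t)

end TemperedPath

namespace IsStationaryLaw

variable {r : ℕ} {θ : Param} {π : Measure (ℤ → ℕ)}

lemma aemeasurable_statState (h : IsStationaryLaw r θ π) (hθ : θ ∈ paramSpace) (t : ℤ) :
    AEMeasurable (fun y => statState r θ y t) π :=
  aemeasurable_of_tendsto_metrizable_ae atTop
    (fun n => (measurable_windowState r θ t n).aemeasurable)
    ((h.ae_temperedPath hθ).mono fun _ hy => hy.tendsto_windowState hθ r t)

/-- The stationary state and the state computed from time `1` on are driven by the same counts and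
merge geometrically. So bounded Lipschitz functions have the same limiting means, and those of the
stationary state do not depend on time. -/
lemma isErgodicMeasure (h : IsStationaryLaw r θ π) (hθ : θ ∈ paramSpace) (t : ℤ) :
    (stateChain r θ hθ).IsErgodicMeasure (π.map fun y => statState r θ y t) := by
  intro f B L hf hL
  have hmeas : ∀ t, AEStronglyMeasurable (fun y => f (statState r θ y t)) π := fun t =>
    (hL.continuous.measurable.comp_aemeasurable (h.aemeasurable_statState hθ t)).aestronglyMeasurable
  rw [integral_map (h.aemeasurable_statState hθ t) hL.continuous.aestronglyMeasurable]
  refine h.ergodicTo hθ hf hL (F := fun n y => f (statState r θ y (n + 1))) (fun n => hmeas _)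
    (fun n y => hf _) (fun n => h.integral_eq (Φ := fun t y => f (statState r θ y t)) hmeas
      (fun t y => by rw [statState_shift]) (n + 1) t) ?_
  filter_upwards [h.ae_temperedPath hθ] with y hy
  have h1 : ∀ n : ℕ, dist (statState r θ y (n + 1)) (sampleState r θ y n)
      ≤ (contractionRate θ : ℝ) ^ n * dist (statState r θ y 1) (sampleState r θ y 0) := by
    intro n
    induction n with
    | zero => simp
    | succ n ih =>
      rw [hy.sampleState_succ hθ, hy.statState_succ hθ r, pow_succ', mul_assoc]
      push_cast
      exact ((lipschitzWith_stateStep hθ r _).dist_le_mul _ _).trans (by gcongr)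
  have h2 : Tendsto (fun n : ℕ => (L : ℝ) * ((contractionRate θ : ℝ) ^ n
      * dist (statState r θ y 1) (sampleState r θ y 0))) atTop (𝓝 0) := by
    have h3 := tendsto_pow_atTop_nhds_zero_of_lt_one (NNReal.coe_nonneg (contractionRate θ))
      (by exact_mod_cast contractionRate_lt_one hθ)
    simpa using (h3.mul_const (dist (statState r θ y 1) (sampleState r θ y 0))).const_mul (L : ℝ)
  refine squeeze_zero_norm (fun n => ?_) h2
  rw [← dist_eq_norm]
  exact (hL.dist_le_mul _ _).trans (by gcongr; exact h1 n)

/-- A property of the intensity that holds whenever the next count has a given value holds almost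
surely. -/
lemma ae_of_ae_count_eq (h : IsStationaryLaw r θ π) (hθ : θ ∈ paramSpace) (t : ℤ) (u : ℕ)
    {Q : ℝ → Prop} (hQ : MeasurableSet {l | Q l})
    (hae : ∀ᵐ y ∂π, y t = u → Q (statIntensity r θ y t)) :
    ∀ᵐ y ∂π, Q (statIntensity r θ y t) := by
  have := h.isProbabilityMeasure
  obtain ⟨lam, hlam⟩ := h.model
  obtain ⟨g, hg, hgl⟩ := hlam.exists_measurable_rate t
  have hle := past_le hlam.measurable (t - 1)
  have hg' : Measurable g := hg.mono hle le_rfl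
  have hgS : ∀ᵐ y ∂π, (g y : ℝ) = statIntensity r θ y t := by
    filter_upwards [hgl, h.ae_rate_eq hθ hlam t] with y h1 h2
    rw [h1, h2.2]
  set B : Set (ℤ → ℕ) := {y | Q (g y)}ᶜ with hB
  have hBm : MeasurableSet[past (fun t (y : ℤ → ℕ) => y t) (t - 1)] B :=
    ((measurable_coe_nnreal_real.comp hg) hQ).compl
  -- The exceptional set belongs to the past and meets the event of count `u` in a null set. Given
  -- the past that event has positive probability, so the exceptional set is null.
  have h0 : π (B ∩ (fun y : ℤ → ℕ => y t) ⁻¹' {u}) = 0 := by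
    rw [measure_eq_zero_iff_ae_notMem]
    filter_upwards [hae, hgS] with y h1 h2 h3
    refine h3.1 ?_
    change Q (g y)
    rw [h2]
    exact h1 h3.2
  rw [hlam.setLIntegral_poisson t u hBm hg' hgl, lintegral_eq_zero_iff (by
    have : Measurable fun q : ℝ≥0 => poissonMeasure q {u} := by
      simp_rw [poissonMeasure_singleton]; fun_prop
    exact this.comp hg'), Filter.EventuallyEq, ae_restrict_iff' (hle _ hBm)] at h0
  filter_upwards [h0, hgS, h.ae_temperedPath hθ] with y h1 h2 h3
  by_contra hne
  have h4 := h1 (show y ∈ B from fun hq => hne (by rw [← h2]; exact hq))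
  have h5 : (0 : ℝ) < g y := by rw [h2]; exact h3.statIntensity_pos hθ r t
  rw [poissonMeasure_singleton, Pi.zero_apply, ENNReal.ofReal_eq_zero] at h4
  exact absurd h4 (not_le.2 (by positivity))

lemma ae_shift (h : IsStationaryLaw r θ π) {p : (ℤ → ℕ) → Prop} (hp : ∀ᵐ y ∂π, p y) :
    ∀ᵐ y ∂π, p fun s => y (s + 1) :=
  h.shiftInvariant.quasiMeasurePreserving.ae hp

/-- If the intensity were constant, the counts `0` and `1` would lead to the same next intensity. As
`r ≥ 1`, both lie in the lower regime, and these intensities differ by `b₁ > 0`. -/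
lemma not_ae_const (h : IsStationaryLaw r θ π) (hθ : θ ∈ paramSpace) (hr : 1 ≤ r) (t : ℤ) (b : ℝ) :
    ¬ ∀ᵐ y ∂π, statIntensity r θ y t = b := by
  intro hb
  have := h.isProbabilityMeasure
  have h1 : ∀ᵐ y ∂π, nextIntensity r θ (y t) b = b := by
    filter_upwards [hb, h.ae_shift hb, h.ae_temperedPath hθ] with y h2 h3 h4
    rw [statIntensity_shift, h4.statIntensity_succ hθ, h2] at h3
    exact h3
  have h2 : ∀ u : ℕ, nextIntensity r θ u b = b := fun u => by
    have h3 := h.ae_of_ae_count_eq hθ t u (Q := fun _ => nextIntensity r θ u b = b)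
      (MeasurableSet.const _) (h1.mono fun y h3 h4 => by rwa [h4] at h3)
    simpa using h3
  have h3 := h2 0
  have h4 := h2 1
  simp only [nextIntensity, dCoef, aCoef, bCoef, hr, Nat.zero_le, if_true] at h3 h4
  push_cast at h3 h4
  linarith [hθ.1 2]

/-- The regressors are linearly independent. -/
lemma eq_zero_of_regressor (h : IsStationaryLaw r θ π) (hθ : θ ∈ paramSpace) (hr : 1 ≤ r) (t : ℤ)
    {v : Fin 6 → ℝ} (hv : ∀ u ∈ testCounts r, ∀ᵐ y ∂π,
      ∑ i, v i * regressor r u (statIntensity r θ y t) i = 0) : v = 0 := by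
  have := h.isProbabilityMeasure
  have key : ∀ p q : ℝ, (∀ᵐ y ∂π, p + q * statIntensity r θ y t = 0) → p = 0 ∧ q = 0 := by
    intro p q hpq
    have hq : q = 0 := by
      by_contra hq
      refine h.not_ae_const hθ hr t (-p / q) (hpq.mono fun y hy => ?_)
      rw [eq_div_iff hq]
      linarith
    subst hq
    simpa using hpq
  have h0 := hv 0 (by simp [testCounts])
  have h1 := hv 1 (by simp [testCounts])
  have h2 := hv (r + 1) (by simp [testCounts])
  have h3 := hv (r + 2) (by simp [testCounts])
  have e1 : ¬ r + 1 ≤ r := by omega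
  have e2 : ¬ r + 2 ≤ r := by omega
  simp only [regressor, hr, Nat.zero_le, if_true, e1, e2, if_false, Fin.sum_univ_six] at h0 h1 h2 h3
  simp at h0 h1 h2 h3
  -- Subtracting the relations for two counts of one regime isolates the coefficient of the count.
  -- The remaining affine relation in the intensity is trivial because the intensity is not almost
  -- surely constant.
  have a2 : v 2 = 0 := by
    obtain ⟨y, h4, h5⟩ := (h0.and h1).exists
    linarith
  have a5 : v 5 = 0 := by
    obtain ⟨y, h4, h5⟩ := (h2.and h3).exists
    linarith
  obtain ⟨a0, a1⟩ := key (v 0) (v 1) (h0.mono fun y hy => by linarith)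
  obtain ⟨a3, a4⟩ := key (v 3) (v 4) (h2.mono fun y hy => by rw [a5] at hy; linarith)
  ext i
  fin_cases i <;> assumption

end IsStationaryLaw

end SETPAR

/-! ### The information matrix under the stationary law -/

namespace SETPAR

lemma infoMatrix_apply (r : ℕ) (θ : Param) (y : ℤ → ℕ) (t : ℤ) (i j : Fin 6) :
    infoMatrix r θ y t i j = (statIntensity r θ y t)⁻¹ *
      (partials (fun ϑ => statIntensity r ϑ y t) θ i
        * partials (fun ϑ => statIntensity r ϑ y t) θ j) := by
  simp [infoMatrix, Matrix.vecMulVec_apply]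

namespace TemperedPath

variable {y : ℤ → ℕ} {r : ℕ} {θ : Param}

lemma infoMatrix_eq (hy : TemperedPath y) (hθ : θ ∈ paramSpace) (x : ℝ) (r : ℕ) (t : ℤ)
    (i j : Fin 6) : infoMatrix r θ y t i j
      = ((scale θ)⁻¹ * (statState r θ y t).2.2 i) * ((scale θ)⁻¹ * (statState r θ y t).2.2 j)
        * (max (statState r θ y t).2.1 (lowerBound x θ))⁻¹ := by
  simp only [infoMatrix_apply, statState, inv_mul_cancel_left₀ (scale_pos hθ).ne',
    max_eq_left (hy.lowerBound_le_statIntensity hθ x r t)]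
  ring

lemma partials_succ (hy : TemperedPath y) (hθ : θ ∈ paramSpace) (r : ℕ) (t : ℤ) (i : Fin 6) :
    partials (fun ϑ => statIntensity r ϑ y (t + 1)) θ i
      = aCoef r θ (y t) * partials (fun ϑ => statIntensity r ϑ y t) θ i
        + regressor r (y t) (statIntensity r θ y t) i := by
  have h1 := congrFun (congrArg (fun s : State => s.2.2) (hy.statState_succ hθ r t)) i
  simp only [statState, stateStep] at h1
  refine mul_left_cancel₀ (scale_pos hθ).ne' (h1.trans ?_)
  ring

end TemperedPath

namespace IsStationaryLaw

variable {r : ℕ} {θ : Param} {π : Measure (ℤ → ℕ)}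

/-- The ergodic law inherits polynomial moments from any bounded sample; one obtained by
conditioning the stationary law serves. -/
lemma integrable_map (h : IsStationaryLaw r θ π) (hθ : θ ∈ paramSpace) {x : ℝ} (hx : 0 < x)
    (t : ℤ) (i j : Fin 6) :
    Integrable (fun s : State => ((scale θ)⁻¹ * s.2.2 i) * ((scale θ)⁻¹ * s.2.2 j)
      * (max s.2.1 (lowerBound x θ))⁻¹) (π.map fun y => statState r θ y t) ∧
    ∀ u, Integrable (regressorWeight r u i j) (π.map fun y => statState r θ y t) := by
  have := h.isProbabilityMeasure
  have := Measure.isProbabilityMeasure_map (h.aemeasurable_statState hθ t)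
  obtain ⟨g, hg, hS⟩ := h.exists_sample hθ
  obtain ⟨K, hK⟩ := ((tendsto_measure_le (ν := π) g).eventually_ne one_ne_zero).exists
  have hprob : IsProbabilityMeasure (π[|{y | g y ≤ K}]) := cond_isProbabilityMeasure hK
  obtain ⟨lam, hs, -⟩ := hS K hK
  have hμ := h.isErgodicMeasure hθ t
  exact ⟨(hs.negligible_average_info hθ hx hμ i j).1,
    fun u => (hs.negligible_average_regressor hθ x hμ u i j).1⟩

lemma integrable_infoMatrix (h : IsStationaryLaw r θ π) (hθ : θ ∈ paramSpace) (t : ℤ)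
    (i j : Fin 6) : Integrable (fun y => infoMatrix r θ y t i j) π := by
  refine ((h.integrable_map hθ one_pos t i j).1.comp_aemeasurable
    (h.aemeasurable_statState hθ t)).congr ?_
  filter_upwards [h.ae_temperedPath hθ] with y hy
  exact (hy.infoMatrix_eq hθ 1 r t i j).symm

/-- The lower bound, and with it the initial value `x`, disappears: the stationary intensity lies
above it almost surely. -/
lemma limitInfo_eq (h : IsStationaryLaw r θ π) (hθ : θ ∈ paramSpace) {x : ℝ} (hx : 0 < x) (t : ℤ) :
    Matrix.of (limitInfo (π.map fun y => statState r θ y t) θ (lowerBound x θ))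
      = fisherMatrix π r θ t := by
  ext i j
  rw [Matrix.of_apply, limitInfo, integral_map (h.aemeasurable_statState hθ t)
    (h.integrable_map hθ hx t i j).1.aestronglyMeasurable, fisherMatrix, Matrix.of_apply]
  refine integral_congr_ae ?_
  filter_upwards [h.ae_temperedPath hθ] with y hy
  exact (hy.infoMatrix_eq hθ x r t i j).symm

/-- The information matrix is positive definite. -/
lemma posDef_fisherMatrix (h : IsStationaryLaw r θ π) (hθ : θ ∈ paramSpace) (hr : 1 ≤ r) (t : ℤ) :
    (fisherMatrix π r θ t).PosDef := by
  refine posDef_of_quadratic (fun i j => ?_) fun v hv => ?_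
  · simp only [fisherMatrix, Matrix.of_apply, infoMatrix_apply]
    exact integral_congr_ae (.of_forall fun y => by ring)
  · have h0 := ae_eq_zero_of_quadratic_nonpos (ν := π) (s := {()})
      (w := fun _ y => (statIntensity r θ y t)⁻¹)
      (Z := fun _ y => partials (fun ϑ => statIntensity r ϑ y t) θ)
      (fun _ _ y => inv_nonneg.2 (statIntensity_nonneg hθ r y t))
      (fun _ _ i j => by simpa only [infoMatrix_apply] using h.integrable_infoMatrix hθ t i j)
      (v := v) (by simpa only [Finset.sum_singleton, fisherMatrix, Matrix.of_apply,
        infoMatrix_apply] using hv) () (by simp)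
    have h1 : ∀ᵐ y ∂π, ∑ i, v i * partials (fun ϑ => statIntensity r ϑ y t) θ i = 0 := by
      filter_upwards [h0, h.ae_temperedPath hθ] with y h2 h3
      exact pow_eq_zero_iff two_ne_zero |>.1
        ((mul_eq_zero.1 h2).resolve_left (inv_ne_zero (h3.statIntensity_pos hθ r t).ne'))
    refine h.eq_zero_of_regressor hθ hr t fun u _ => h.ae_of_ae_count_eq hθ t u
      (Q := fun l => ∑ i, v i * regressor r u l i = 0) (measurableSet_eq_fun
        (Finset.measurable_fun_sum _ fun i _ => (measurable_regressor r u i).const_mul _)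
        measurable_const) ?_
    -- By stationarity the derivatives at times `t` and `t + 1` are both orthogonal to `v`, so their
    -- recursion leaves `v` orthogonal to the regressor.
    filter_upwards [h1, h.ae_shift h1, h.ae_temperedPath hθ] with y h2 h3 h4 h5
    simp only [statIntensity_shift, h4.partials_succ hθ r t, h5] at h3
    rw [← h3]
    simp only [mul_add, Finset.sum_add_distrib, mul_left_comm _ (aCoef r θ u), ← Finset.mul_sum, h2,
      mul_zero, zero_add]

/-- Quantitative identifiability: the least value of this form on the unit sphere is the constant in
the consistency bound. -/
lemma posDef_regressorWeight (h : IsStationaryLaw r θ π) (hθ : θ ∈ paramSpace) (hr : 1 ≤ r)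
    (t : ℤ) : (Matrix.of fun i j => ∑ u ∈ testCounts r, ∫ s, regressorWeight r u i j s
      ∂π.map fun y => statState r θ y t).PosDef := by
  refine posDef_of_quadratic (fun i j => ?_) fun v hv => ?_
  · simp only [Matrix.of_apply, regressorWeight]
    exact Finset.sum_congr rfl fun u _ => integral_congr_ae (.of_forall fun s => by ring)
  · have h0 := ae_eq_zero_of_quadratic_nonpos (ν := π.map fun y => statState r θ y t)
      (s := testCounts r)
      (w := fun u s => Real.exp (-max s.1 0) * max s.1 0 ^ u / (u.factorial : ℝ))
      (Z := fun u s => regressor r u s.2.1)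
      (fun u _ s => by have := le_max_right s.1 0; positivity)
      (fun u _ i j => (h.integrable_map hθ one_pos t i j).2 u) (v := v) hv
    refine h.eq_zero_of_regressor hθ hr t fun u hu => ?_
    filter_upwards [ae_of_ae_map (h.aemeasurable_statState hθ t) (h0 u hu),
      h.ae_temperedPath hθ] with y h2 h3
    have h4 := h3.statIntensity_pos hθ r t
    simp only [statState, max_eq_left h4.le] at h2
    exact pow_eq_zero_iff two_ne_zero |>.1
      ((mul_eq_zero.1 h2).resolve_left (by positivity))

end IsStationaryLaw

end SETPAR

/-! ### Removal of the conditioning on a bounded initial intensity -/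

section

variable {Ω : Type*} [MeasurableSpace Ω] {P : Measure Ω} [IsProbabilityMeasure P] {g : Ω → ℝ≥0}

lemma measure_le_cond_add {A : Set Ω} (hA : MeasurableSet A) (B : Set Ω) :
    P B ≤ P[|A] B + P Aᶜ := by
  rw [← measure_inter_add_sdiff B hA]
  refine add_le_add ?_ (measure_mono fun ω hω => hω.2)
  rw [Set.inter_comm, ← cond_mul_eq_inter hA]
  exact mul_le_of_le_one_right' prob_le_one

/-- Negligibility may be checked conditionally on events of probability close to one. -/
lemma NegligibleInProb.of_cond (hg : Measurable g) {U : ℕ → Ω → ℝ}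
    (h : ∀ K : ℕ, P {ω | g ω ≤ K} ≠ 0 → NegligibleInProb (P[|{ω | g ω ≤ K}]) U) :
    NegligibleInProb P U := by
  intro ε hε
  rw [ENNReal.tendsto_nhds_zero]
  intro δ hδ
  have h1 : Tendsto (fun K : ℕ => P {ω | g ω ≤ K}ᶜ) atTop (𝓝 0) := by
    have h2 := ENNReal.Tendsto.sub tendsto_const_nhds (SETPAR.tendsto_measure_le (ν := P) g)
      (Or.inl ENNReal.one_ne_top)
    rw [tsub_self] at h2
    exact h2.congr fun K => (prob_compl_eq_one_sub (hg measurableSet_Iic)).symm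
  obtain ⟨K, hK0, hK⟩ := (((SETPAR.tendsto_measure_le (ν := P) g).eventually_ne one_ne_zero).and
    (ENNReal.tendsto_nhds_zero.1 h1 _ (ENNReal.half_pos hδ.ne'))).exists
  filter_upwards [ENNReal.tendsto_nhds_zero.1 (h K hK0 ε hε) _ (ENNReal.half_pos hδ.ne')] with n hn
  calc _ ≤ _ := measure_le_cond_add (hg (measurableSet_Iic (a := (K : ℝ≥0)))) _
    _ ≤ δ / 2 + δ / 2 := add_le_add hn hK
    _ = δ := ENNReal.add_halves δ

/-- The integral is a mixture of the conditional one and a part bounded by the probability of the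
complement. Its distance from `l` exceeds the conditional distance by at most that probability times
`1 + ‖l‖`. -/
lemma tendsto_integral_of_cond (hg : Measurable g) {F : ℕ → Ω → ℂ}
    (hF : ∀ n, AEStronglyMeasurable (F n) P) (hF1 : ∀ n ω, ‖F n ω‖ ≤ 1) {l : ℂ}
    (h : ∀ K : ℕ, P {ω | g ω ≤ K} ≠ 0 →
      Tendsto (fun n => ∫ ω, F n ω ∂P[|{ω | g ω ≤ K}]) atTop (𝓝 l)) :
    Tendsto (fun n => ∫ ω, F n ω ∂P) atTop (𝓝 l) := by
  rw [Metric.tendsto_atTop]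
  intro ε hε
  have h1 := SETPAR.tendsto_measureReal_le (ν := P) g
  have h2 : Tendsto (fun K : ℕ => (1 - P.real {ω | g ω ≤ K}) * (1 + ‖l‖)) atTop (𝓝 0) := by
    simpa using (h1.const_sub 1).mul_const (1 + ‖l‖)
  obtain ⟨K, hK0, hK⟩ := ((h1.eventually_ne one_ne_zero).and
    (h2.eventually_lt_const (half_pos hε))).exists
  set A := {ω | g ω ≤ K} with hA
  have hAm : MeasurableSet A := hg measurableSet_Iic
  obtain ⟨N, hN⟩ := Metric.tendsto_atTop.1 (h K fun h0 => hK0 (by rw [measureReal_def, h0]; rfl))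
    (ε / 2) (half_pos hε)
  refine ⟨N, fun n hn => ?_⟩
  have hi : Integrable (F n) P := Integrable.of_bound (hF n) 1 (.of_forall (hF1 n))
  have h4 : ∫ ω in A, F n ω ∂P = (P.real A : ℂ) * ∫ ω, F n ω ∂P[|A] := by
    rw [ProbabilityTheory.cond, integral_smul_measure, ENNReal.toReal_inv, ← measureReal_def,
      Complex.real_smul, Complex.ofReal_inv, mul_inv_cancel_left₀ (by exact_mod_cast hK0)]
  have h5 : ‖∫ ω in Aᶜ, F n ω ∂P‖ ≤ 1 * P.real Aᶜ :=
    norm_setIntegral_le_of_norm_le_const (measure_lt_top _ _) fun ω _ => hF1 n ω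
  rw [probReal_compl_eq_one_sub hAm, one_mul] at h5
  have h6 := hN n hn
  rw [dist_eq_norm] at h6 ⊢
  have hP0 : 0 ≤ P.real A := measureReal_nonneg
  have hP1 : P.real A ≤ 1 := measureReal_le_one
  have e : ∫ ω, F n ω ∂P - l = (P.real A : ℂ) * (∫ ω, F n ω ∂P[|A] - l)
      + ∫ ω in Aᶜ, F n ω ∂P - ((1 - P.real A : ℝ) : ℂ) * l := by
    rw [← integral_add_compl hAm hi, h4]
    push_cast
    ring
  rw [e]
  calc _ ≤ ‖(P.real A : ℂ) * (∫ ω, F n ω ∂P[|A] - l)‖ + ‖∫ ω in Aᶜ, F n ω ∂P‖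
        + ‖((1 - P.real A : ℝ) : ℂ) * l‖ :=
        (norm_sub_le _ _).trans (add_le_add (norm_add_le _ _) le_rfl)
    _ ≤ 1 * ‖∫ ω, F n ω ∂P[|A] - l‖ + (1 - P.real A) + (1 - P.real A) * ‖l‖ := by
        rw [norm_mul, norm_mul, Complex.norm_real, Complex.norm_real, Real.norm_of_nonneg hP0,
          Real.norm_of_nonneg (sub_nonneg.2 hP1)]
        gcongr
    _ < ε := by linarith

end

/-! ### Assembly of the theorem -/

namespace SETPAR

lemma approxIntensity_eq (r : ℕ) (x : ℝ) (θ : Param) (y : ℤ → ℕ) (k : ℕ) :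
    approxIntensity r x θ y k = pathIntensity r x θ (fun j => y (j + 1)) k := by
  induction k with
  | zero => rfl
  | succ k ih => rw [approxIntensity, pathIntensity, ih]

lemma logLik_eq (r : ℕ) (x : ℝ) (y : ℤ → ℕ) (n : ℕ) :
    logLik r x y n = pathLik r x (fun j => y (j + 1)) n := by
  funext θ
  simp only [logLik, pathLik, approxIntensity_eq]

lemma empiricalMatrix_eq {θ : Param} (hθ : θ ∈ paramSpace) {x : ℝ} (hx : 0 < x) (r : ℕ)
    (y : ℤ → ℕ) (n : ℕ) (i j : Fin 6) :
    empiricalMatrix r x y n θ i j = pathInfo r x (fun j => y (j + 1)) n θ i j := by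
  have h : ∀ k, partials (fun ϑ => pathIntensity r x ϑ (fun j => y (j + 1)) k) θ
      = pathDeriv r x θ (fun j => y (j + 1)) k := fun k =>
     partials_eq_of_hasFDerivAt (hasFDerivAt_pathIntensity hθ hx r _ k)
  simp only [empiricalMatrix, pathInfo, approxIntensity_eq, h, Matrix.smul_apply, Matrix.sum_apply,
    Matrix.vecMulVec_apply, smul_eq_mul]
  congr 1
  exact Finset.sum_congr rfl fun k _ => mul_comm _ _

end SETPAR

theorem theorem3 {Ω : Type*} [MeasurableSpace Ω] (P : Measure Ω) [IsProbabilityMeasure P]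
    (r : ℕ) (hr : 1 ≤ r)
    (D : Set SETPAR.Param) (hDcompact : IsCompact D) (hD : D ⊆ SETPAR.paramSpace)
    (θ₀ : SETPAR.Param) (hθ₀ : θ₀ ∈ interior D)
    -- the process that generates the observations `Y_1, …, Y_n`
    (Y : ℤ → Ω → ℕ) (lam : ℤ → Ω → ℝ≥0) (hY : SETPAR.IsSETPAR P r θ₀ Y lam)
    -- the stationary law, under which `G` is computed (at an arbitrary time `t`)
    (π : Measure (ℤ → ℕ)) (hπ : SETPAR.IsStationaryLaw r θ₀ π) (t : ℤ)
    -- the fixed initial value of the intensity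
    (x : ℝ) (hx : 0 < x)
    -- the maximum likelihood estimators
    (θhat : ℕ → Ω → SETPAR.Param) (hθhat : ∀ n, AEMeasurable (θhat n) P)
    (hMLE : ∀ n, ∀ᵐ ω ∂P, θhat n ω ∈ D ∧
      IsMaxOn (SETPAR.logLik r x (fun s => Y s ω) n) D (θhat n ω)) :
    -- `G` is well defined and invertible
    (∀ᵐ y ∂π, (∀ θ ∈ SETPAR.paramSpace, Summable (SETPAR.statTerm r θ y t)) ∧
      DifferentiableAt ℝ (fun θ => SETPAR.statIntensity r θ y t) θ₀) ∧
    (∀ i j, Integrable (fun y => SETPAR.infoMatrix r θ₀ y t i j) π) ∧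
    (SETPAR.fisherMatrix π r θ₀ t).PosDef ∧
    -- asymptotic normality
    TendstoInDistribution (fun (n : ℕ) ω => √(n : ℝ) • (θhat n ω - θ₀)) atTop id
      (fun _ => P) (multivariateGaussian 0 (SETPAR.fisherMatrix π r θ₀ t)⁻¹) ∧
    -- consistency of the empirical matrix, computed at the estimator and at the true parameter
    (∀ i j, TendstoInMeasure P
      (fun (n : ℕ) ω => SETPAR.empiricalMatrix r x (fun s => Y s ω) n (θhat n ω) i j) atTop
      (fun _ => SETPAR.fisherMatrix π r θ₀ t i j)) ∧
    (∀ i j, TendstoInMeasure P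
      (fun (n : ℕ) ω => SETPAR.empiricalMatrix r x (fun s => Y s ω) n θ₀ i j) atTop
      (fun _ => SETPAR.fisherMatrix π r θ₀ t i j)) := by
  have hθD : θ₀ ∈ D := interior_subset hθ₀
  have hθ : θ₀ ∈ SETPAR.paramSpace := hD hθD
  have hπ1 := hπ.isProbabilityMeasure
  have hG := hπ.posDef_fisherMatrix hθ hr t
  obtain ⟨a, c, m, hE⟩ := SETPAR.exists_uniformBounds hDcompact ⟨θ₀, hθD⟩ hD hx
  have hμ1 := Measure.isProbabilityMeasure_map (hπ.aemeasurable_statState hθ t)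
  set μ := π.map fun y => SETPAR.statState r θ₀ y t with hμ
  have herg : (SETPAR.stateChain r θ₀ hθ).IsErgodicMeasure μ := hπ.isErgodicMeasure hθ t
  have hGeq := hπ.limitInfo_eq hθ hx t
  rw [← hμ] at hGeq
  have hGij : ∀ i j, SETPAR.limitInfo μ θ₀ (SETPAR.lowerBound x θ₀) i j
      = SETPAR.fisherMatrix π r θ₀ t i j := fun i j => congrFun (congrFun hGeq i) j
  have hGμ : (Matrix.of (SETPAR.limitInfo μ θ₀ (SETPAR.lowerBound x θ₀))).PosDef := by rwa [hGeq]
  -- The identifiability constant, taken from the stationary law but used for the observed process: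
  -- both follow the same chain and have the same ergodic limits.
  obtain ⟨γ, hγ, hγ'⟩ := SETPAR.exists_le_quadratic (hπ.posDef_regressorWeight hθ hr t)
  simp only [← SETPAR.sum_sum_eq_dotProduct, Matrix.of_apply] at hγ'
  obtain ⟨g, hg, -, hS⟩ := hY.exists_boundedSample hθ
  simp only [SETPAR.logLik_eq] at hMLE
  have hprob : ∀ K : ℕ, P {ω | g ω ≤ K} ≠ 0 → IsProbabilityMeasure (P[|{ω | g ω ≤ K}]) :=
    fun K hK => cond_isProbabilityMeasure hK
  have hMLE' : ∀ K : ℕ, ∀ n, ∀ᵐ ω ∂P[|{ω | g ω ≤ K}], θhat n ω ∈ D ∧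
      IsMaxOn (SETPAR.pathLik r x (fun k => Y (k + 1) ω) n) D (θhat n ω) := fun K n =>
    cond_absolutelyContinuous.ae_le (hMLE n)
  have hcons : ∀ K : ℕ, P {ω | g ω ≤ K} ≠ 0 →
      NegligibleInProb (P[|{ω | g ω ≤ K}]) fun n ω => ‖θhat n ω - θ₀‖ := fun K hK => by
    have := hprob K hK
    exact (hS K hK).negligible_norm_sub hE hDcompact hθD herg hγ hγ' (hMLE' K)
  have hmeas : ∀ n : ℕ, AEMeasurable (fun ω => √(n : ℝ) • (θhat n ω - θ₀)) P := fun n =>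
    ((hθhat n).sub_const θ₀).const_smul (√(n : ℝ))
  refine ⟨?_, hπ.integrable_infoMatrix hθ t, hG, ⟨hmeas, aemeasurable_id, ?_⟩, fun i j => ?_,
    fun i j => ?_⟩
  · filter_upwards [hπ.ae_temperedPath hθ] with y hy
    exact ⟨fun θ hθ' => hy.summable_statTerm hθ' r t, hy.differentiableAt_statIntensity hθ r t⟩
  -- By Lévy's continuity theorem characteristic functions suffice; being bounded by one, they can
  -- be treated conditionally on a bounded initial intensity.
  · refine ProbabilityMeasure.tendsto_of_tendsto_charFun fun u => ?_
    simp only [ProbabilityMeasure.coe_mk, Measure.map_id]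
    rw [charFun_multivariateGaussian hG.inv.posSemidef]
    have h1 : ∀ n : ℕ, charFun (P.map fun ω => √(n : ℝ) • (θhat n ω - θ₀)) u
        = ∫ ω, Complex.exp ((inner ℝ (√(n : ℝ) • (θhat n ω - θ₀)) u : ℝ) * Complex.I) ∂P :=
      fun n => by
        rw [charFun_apply, integral_map (hmeas n)
          (by fun_prop : Continuous fun z : SETPAR.Param =>
            Complex.exp ((inner ℝ z u : ℝ) * Complex.I)).aestronglyMeasurable]
    simp_rw [h1]
    refine tendsto_integral_of_cond hg (fun n => ?_)
      (fun n ω => (Complex.norm_exp_ofReal_mul_I _).le) fun K hK => ?_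
    · exact ((by fun_prop : Continuous fun z : SETPAR.Param =>
        Complex.exp ((inner ℝ z u : ℝ) * Complex.I)).measurable.comp_aemeasurable
          (hmeas n)).aestronglyMeasurable
    · have := hprob K hK
      have h2 := (hS K hK).tendsto_integral_exp_estimator hE hθ₀ herg hGμ (hcons K hK) (hMLE' K)
        (fun n => (hθhat n).mono_ac cond_absolutelyContinuous) u
      rw [hGeq] at h2
      convert h2 using 3
      simp
      ring
  · rw [tendstoInMeasure_iff_norm]
    have h1 : NegligibleInProb P fun n ω =>
        SETPAR.pathInfo r x (fun k => Y (k + 1) ω) n (θhat n ω) i j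
          - SETPAR.fisherMatrix π r θ₀ t i j := by
      refine NegligibleInProb.of_cond hg fun K hK => ?_
      have := hprob K hK
      rw [← hGij]
      exact (hS K hK).negligible_pathInfo_sub hE hθD herg (hcons K hK)
        (fun n => (hMLE' K n).mono fun ω h => h.1) i j
    refine h1.mono_ae (.of_forall fun n => ?_)
    filter_upwards [hMLE n] with ω hω
    rw [SETPAR.empiricalMatrix_eq (hD hω.1) hx]
  · rw [tendstoInMeasure_iff_norm]
    have h1 : NegligibleInProb P fun n ω =>
        SETPAR.pathInfo r x (fun k => Y (k + 1) ω) n θ₀ i j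
          - SETPAR.fisherMatrix π r θ₀ t i j := by
      refine NegligibleInProb.of_cond hg fun K hK => ?_
      have := hprob K hK
      rw [← hGij]
      exact ((hS K hK).negligible_average_info hθ hx herg i j).2
    refine h1.mono fun n ω => ?_
    rw [SETPAR.empiricalMatrix_eq hθ hx]
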